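/- **Setting.** For every sample size $T$ let $(x_t)_{t\in\mathbb Z}$, $x_t=(x_{t,1},\dots,x_{t,p})^\top\in\mathbb R^p$, $p=p_T\ge 2$, be regressors and let $y_t=m_t+u_t$ with $\mathbb E[u_tx_{t,j}]=0$ for all $j\in[p]$, where $m_t$ is approximated by $x_t^\top\beta$, $\beta\in\mathbb R^p$ (for instance $m_t=\sum_{j\ge1}\beta_jx_{t,j}$ and $\beta$ collects the first $p$ coefficients). The law of the data may depend on $T$; constants, $O(1)$ and "universal" are uniform in $T$. Put $\|z\|_T^2=T^{-1}\sum_{t=1}^Tz_t^2$, and write $\mathbf y,\mathbf m,\mathbf X$ for the data over $t=1,\dots,T$, and $\mathbf X_j$, $\mathbf X_{-j}$ for the $j$-th and the remaining columns of $\mathbf X$. The sg-LASSO estimator $\hat\beta$ is any minimizer over $b\in\mathbb R^p$ of $\|\mathbf y-\mathbf Xb\|_T^2+2\lambda\{\alpha|b|_1+(1-\alpha)\sum_{A\in\mathcal G}|b_A|_2\}$, where $\alpha\in[0,1]$ is fixed and $\mathcal G$ is a partition of $[p]$ into groups of bounded size. Let $\hat u_t=y_t-x_t^\top\hat\beta$.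 Let $\Sigma=\mathbb E[x_tx_t^\top]$, $\Theta=\Sigma^{-1}$, and let $G\subset[p]$ have fixed size. For $j\in G$ let $\gamma_j=\Sigma_{-j,-j}^{-1}\Sigma_{-j,j}$, $v_{t,j}=x_{t,j}-x_{t,-j}^\top\gamma_j$, $\sigma_j^2=\mathbb E[v_{t,j}^2]$; let $\hat\gamma_j$ be any minimizer of $\|\mathbf X_j-\mathbf X_{-j}\gamma\|_T^2+2\lambda_j|\gamma|_1$, $\hat\sigma_j^2=\|\mathbf X_j-\mathbf X_{-j}\hat\gamma_j\|_T^2+\lambda_j|\hat\gamma_j|_1$, and let $\hat\Theta_G$ have the rows $\hat\Theta_j=\hat\sigma_j^{-2}(1,-\hat\gamma_j^\top)$, $j\in G$ (entry $1$ in position $j$). With a kernel $K$ and a bandwidth $M_T\to\infty$ put $$\hat\Xi_G=\sum_{|k|<T}K\Big(\frac k{M_T}\Big)\hat\Gamma_k,\quad \hat\Gamma_k=\hat\Theta_G\Big(\frac1T\sum_{t=1}^{T-k}\hat u_t\hat u_{t+k}x_tx_{t+k}^\top\Big)\hat\Theta_G^\top\ (k\ge0),\quad\hat\Gamma_{-k}=\hat\Gamma_k^\top,$$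 $$\Xi_G=\sum_{k\in\mathbb Z}\Gamma_k,\qquad \Gamma_k=\Theta_G\mathbb E[u_tx_tu_{t+k}x_{t+k}^\top]\Theta_G^\top .$$ Let $\sqrt{s_\alpha}=\alpha\sqrt{|S_0|}+(1-\alpha)\sqrt{|\mathcal G_0|}$, where $S_0$ is the support of $\beta$ and $\mathcal G_0$ is the set of groups that meet it; let $S_j$ be the number of non-zero entries of the $j$-th row of $\Theta$ and $s=s_\alpha\vee\max_{j\in G}S_j$. For a $\sigma$-algebra $\mathcal M$ and a random vector $\xi\in\mathbb R^l$ let $\tau(\mathcal M,\xi)=\big\|\sup_f|\mathbb E(f(\xi)|\mathcal M)-\mathbb E f(\xi)|\big\|_1$, the supremum being over the functions $f:\mathbb R^l\to\mathbb R$ that are $1$-Lipschitz for $|\cdot|_1$; the $\tau$-mixing coefficients of a process $(\xi_t)$ with $\mathcal M_t=\sigma(\xi_t,\xi_{t-1},\dots)$ are $\tau_k=\sup_{l\ge1}\frac1l\sup_{t+k\le t_1<\dots<t_l}\tau(\mathcal M_t,(\xi_{t_1},\dots,\xi_{t_l}))$. Fix $r>4$, $q>2r/(r-2)$, $\nu=qr/(q+r)$,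 $a>(\nu-1)/(\nu-2)$, $b>(r-2)/(r-4)$, and put $$\kappa=\frac{(a+1)\nu-1}{a+\nu-1},\qquad \mu=\frac{(b+1)r-2}{r+2(b-1)} .$$ **Theorem.** There is a constant $C_0>0$, depending only on $q,r,a,b$ and on the universal bounds in condition 1 below and on the group size, such that the following holds. Suppose that conditions 1–5 hold for the regression $(y_t,x_t,u_t,m_t,\beta,\lambda,\alpha,\mathcal G)$ and also for each nodewise regression $j\in G$, that is with $(y_t,x_t,u_t,m_t,\beta,\lambda)$ replaced by $(x_{t,j},x_{t,-j},v_{t,j},x_{t,-j}^\top\gamma_j,\gamma_j,\lambda_j)$ and with $\alpha=1$: 1. $(u_tx_t)$ and $(x_tx_t^\top)$ are strictly stationary, $\|u_t\|_q$ and $\max_j\|x_{t,j}\|_r$ are bounded by a universal constant, and for all $j,l$ the $\tau$-mixing coefficients of $(u_tx_{t,j})_t$ and $(x_{t,j}x_{t,l})_t$ are at most $ck^{-a}$ and $ck^{-b}$ for all $k\ge1$, with a universal constant $c>0$; 2. the smallest eigenvalue of $\mathbb E[x_tx_t^\top]$ is bounded away from zero; 3. for some $\delta\in(0,1)$ and some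 $C_1<\infty$, $C_0\rho_T\le\lambda\le C_1\rho_T$ for all large $T$, where $\rho_T=\big(\frac p{\delta T^{\kappa-1}}\big)^{1/\kappa}\vee\sqrt{\log(8p/\delta)/T}$; 4. with $s'=s_\alpha\vee1$ ($s_\alpha$ being computed for the regression in question), $\|\mathbf m-\mathbf X\beta\|_T^2=O_P(s'\lambda^2)$, $s'^{\mu}p^2T^{1-\mu}\to0$, and $p^2\exp(-c_0T/s'^2)\to0$ for some $c_0>0$; 5. $\mathbb E[u_t^2|x_t]$ is bounded by a universal constant; $(u_t^2)_t$ has a long-run variance $\lim_n\mathrm{Var}(n^{-1/2}\sum_{t=1}^nu_t^2)$, the variances of these normalized partial sums being bounded uniformly in $n$ and $T$; $\|\mathbf m-\mathbf X\beta\|_T=o_P(T^{-1/2})$; and for every $k\ge0$ there are $c_k>0$, $d_k>1$ such that for all $j,l$ the $\tau$-mixing coefficients of $(u_tu_{t+k}x_{t,j}x_{t+k,l})_t$ are at most $c_kn^{-d_k}$, $n\ge1$. Suppose further that: 6. $\max_{j\in G}|\Theta_j|_1=O(1)$, $s^2\log^2p/T\to0$, $p/\sqrt{T^{\kappa-2}\log^\kappa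 p}\to0$ and $s^\kappa pT^{1-4\kappa/5}\to0$; 7. uniformly over $t,k\in\mathbb Z$ and $j,h\in G$, the quantities $\mathbb E|u_tu_{t+k}v_{t,j}v_{t+k,h}|$, $\mathbb E|v_{t,j}u_{t+k}v_{t+k,h}|^2$, $\mathbb E|u_tu_{t+k}v_{t+k,h}|^2$, $\mathbb E|u_tv_{t,j}u_{t+k}|^2$, $\mathbb E|u_tv_{t,j}v_{t+k,h}|^2$, $\mathbb E|u_t|^{2\tilde q}$ and $\mathbb E|v_{t,j}|^{2\tilde q}$ are bounded, for some $\tilde q\ge\kappa$; 8. $K:\mathbb R\to[-1,1]$ satisfies $K(0)=1$, is Riemann integrable on $\mathbb R$ (the Riemann sums $\sum_{k\in\mathbb Z}hK(\xi_k)$, with any tags $\xi_k\in[kh,(k+1)h]$, converge absolutely and tend to a limit as $h\to0$, uniformly in the tags), and for some $\varepsilon,\varsigma>0$ and $L<\infty$, $|K(0)-K(x)|\le L|x|^\varsigma$ for $|x|<\varepsilon$; 9. $V_t=(u_tv_{t,j}/\sigma_j^2)_{j\in G}$ is fourth-order stationary and, for some universal constants $D_1,D_2$, $\sum_{k\in\mathbb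 Z}|k|^\varsigma\|\mathbb E[V_0V_k^\top]\|\le D_1$ and $\sup_{k\in\mathbb Z}\sum_{l\in\mathbb Z}\sum_{t\in\mathbb Z}\sum_{j,h\in G}|\mathrm{Cov}(V_{0,j}V_{k,h},V_{t,j}V_{t+l,h})|\le D_2$. Then the series defining $\Xi_G$ converges and, in the Frobenius norm, as $T\to\infty$ and $M_T\to\infty$, $$\|\hat\Xi_G-\Xi_G\|=O_P\left(M_T\left(\frac{sp^{1/\kappa}}{T^{1-1/\kappa}}\vee s\sqrt{\frac{\log p}T}+\frac{s^2p^{2/\kappa}}{T^{2-3/\kappa}}+\frac{s^3p^{5/\kappa}}{T^{4-5/\kappa}}\right)+M_T^{-\varsigma}+T^{-(\varsigma\wedge1)}\right).$$ -/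

import Mathlib

open MeasureTheory ProbabilityTheory Filter Topology
open scoped ENNReal Matrix Matrix.Norms.Frobenius

namespace HAC

noncomputable section

/-! ### Stochastic orders of magnitude -/

/-- `Z_T = O_P(ρ_T)` as `T → ∞`, for random variables on possibly different probability spaces. -/
def IsBigOP {Ω : ℕ → Type*} [∀ T, MeasurableSpace (Ω T)] (P : ∀ T, Measure (Ω T))
    (Z : ∀ T, Ω T → ℝ) (ρ : ℕ → ℝ) : Prop :=
  ∀ ε : ℝ, 0 < ε → ∃ C : ℝ, 0 < C ∧
    ∀ᶠ T in atTop, P T {ω | C * ρ T < |Z T ω|} ≤ ENNReal.ofReal ε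

/-- `Z_T = o_P(ρ_T)` as `T → ∞`. -/
def IsLittleOP {Ω : ℕ → Type*} [∀ T, MeasurableSpace (Ω T)] (P : ∀ T, Measure (Ω T))
    (Z : ∀ T, Ω T → ℝ) (ρ : ℕ → ℝ) : Prop :=
  ∀ ε : ℝ, 0 < ε → Tendsto (fun T => P T {ω | ε * ρ T < |Z T ω|}) atTop (𝓝 0)

/-! ### Stationarity, long-run variances and `τ`-mixing -/

section Processes

variable {Ω : Type*} [mΩ : MeasurableSpace Ω]

/-- Strict stationarity: the law of the whole path is invariant under time shifts. -/
def StrictlyStationary {E : Type*} [MeasurableSpace E] (μ : Measure Ω) (ξ : ℤ → Ω → E) : Prop :=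
  ∀ h : ℤ, Measure.map (fun ω (t : ℤ) => ξ (t + h) ω) μ = Measure.map (fun ω (t : ℤ) => ξ t ω) μ

/-- Stationarity up to order four: fourth moments are finite and all joint moments of order at
most four are invariant under time shifts. -/
def FourthOrderStationary {J : Type*} (μ : Measure Ω) (V : ℤ → Ω → J → ℝ) : Prop :=
  (∀ t j, MemLp (fun ω => V t ω j) 4 μ) ∧
    ∀ n : ℕ, n ≤ 4 → ∀ (t : Fin n → ℤ) (j : Fin n → J) (h : ℤ),
      ∫ ω, ∏ i, V (t i + h) ω (j i) ∂μ = ∫ ω, ∏ i, V (t i) ω (j i) ∂μ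

/-- `Var(n^{-1/2} ∑_{t=1}^n ξ_t)`. -/
def partialSumVar (μ : Measure Ω) (ξ : ℤ → Ω → ℝ) (n : ℕ) : ℝ :=
  Var[fun ω => (√(n : ℝ))⁻¹ * ∑ t ∈ Finset.Icc (1 : ℤ) n, ξ t ω; μ]

/-- The square-integrable process `ξ` has a long-run variance
`lim_n Var(n^{-1/2} ∑_{t=1}^n ξ_t)`; the variances on the way to the limit are at most `D`. -/
def HasLongRunVariance (μ : Measure Ω) (ξ : ℤ → Ω → ℝ) (D : ℝ) : Prop :=
  (∀ t, MemLp (ξ t) 2 μ) ∧ (∃ L : ℝ, Tendsto (partialSumVar μ ξ) atTop (𝓝 L)) ∧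
    ∀ n, partialSumVar μ ξ n ≤ D

/-- `1`-Lipschitz functions on `ℝ^l` with respect to the `ℓ₁` norm. -/
def lipOne (l : ℕ) : Set ((Fin l → ℝ) → ℝ) :=
  {f | ∀ x y, |f x - f y| ≤ ∑ i, |x i - y i|}

/-- `τ(𝓜, ξ) = ‖ sup_{f ∈ Lip₁} |E(f(ξ) | 𝓜) - E f(ξ)| ‖₁`, where all the conditional expectations
are computed from one regular conditional distribution of `ξ` given `𝓜`, so that the supremum is
taken pointwise. -/
def tauCoef (μ : Measure Ω) [IsFiniteMeasure μ] (𝓜 : MeasurableSpace Ω) {l : ℕ}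
    (ξ : Ω → Fin l → ℝ) : ℝ≥0∞ :=
  let κ : @Kernel Ω (Fin l → ℝ) 𝓜 _ := @condDistrib Ω Ω (Fin l → ℝ) _ _ _ mΩ 𝓜 ξ id μ _
  ∫⁻ ω, ⨆ f ∈ lipOne l, ‖(∫ x, f x ∂(κ ω)) - ∫ ω', f (ξ ω') ∂μ‖ₑ ∂μ

/-- The natural filtration `𝓜_t = σ(ξ_t, ξ_{t-1}, …)`. -/
@[reducible] def past {E : Type*} [MeasurableSpace E] (ξ : ℤ → Ω → E) (t : ℤ) : MeasurableSpace Ω :=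
  ⨆ s : ℤ, ⨆ _ : s ≤ t, MeasurableSpace.comap (ξ s) inferInstance

/-- The `τ`-mixing coefficient
`τ_k = sup_{l ≥ 1} l⁻¹ sup_{t + k ≤ t₁ < ⋯ < t_l} τ(𝓜_t, (ξ_{t₁}, …, ξ_{t_l}))`. -/
def tauMixing (μ : Measure Ω) [IsFiniteMeasure μ] (ξ : ℤ → Ω → ℝ) (k : ℕ) : ℝ≥0∞ :=
  ⨆ (l : ℕ) (_ : 1 ≤ l) (t : ℤ) (i : Fin l → ℤ) (_ : StrictMono i) (_ : ∀ n, t + k ≤ i n),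
    (l : ℝ≥0∞)⁻¹ * tauCoef μ (past ξ t) (fun ω n => ξ (i n) ω)

end Processes

/-! ### Linear regressions and the sparse-group LASSO -/

/-- A regression `y_t = m_t + u_t` with regressors `x_t ∈ ℝ^ι`, in which the regression function
`m_t` is approximated by the linear function `x_tᵀ β`. -/
structure LinReg (Ω ι : Type*) where
  /-- regressors -/
  x : ℤ → Ω → ι → ℝ
  /-- regression error -/
  u : ℤ → Ω → ℝ
  /-- regression function -/
  m : ℤ → Ω → ℝ
  /-- projection parameter -/
  β : ι → ℝ

/-- The square `‖z‖_T² = T⁻¹ ∑_{t=1}^T z_t²` of the empirical norm. -/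
def empNormSq (T : ℕ) (z : ℤ → ℝ) : ℝ := (T : ℝ)⁻¹ * ∑ t ∈ Finset.Icc (1 : ℤ) T, z t ^ 2

section Penalty

variable {ι : Type*} [Fintype ι] [DecidableEq ι]

/-- `Ω(b) = α |b|₁ + (1 - α) ‖b‖_{2,1}` for the group structure `𝒢`. -/
def sgPenalty (α : ℝ) (𝒢 : Finpartition (Finset.univ : Finset ι)) (b : ι → ℝ) : ℝ :=
  α * ∑ j, |b j| + (1 - α) * ∑ A ∈ 𝒢.parts, √(∑ j ∈ A, b j ^ 2)

/-- `b` solves `min_b ‖y - X b‖_T² + 2 λ Ω(b)`. -/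
def IsSGLasso (T : ℕ) (y : ℤ → ℝ) (x : ℤ → ι → ℝ) (α : ℝ)
    (𝒢 : Finpartition (Finset.univ : Finset ι)) (lam : ℝ) (b : ι → ℝ) : Prop :=
  IsMinOn (fun b' => empNormSq T (fun t => y t - x t ⬝ᵥ b') + 2 * lam * sgPenalty α 𝒢 b')
    Set.univ b

open Classical in
/-- The effective sparsity `s_α`, `√s_α = α √|S₀| + (1 - α) √|𝒢₀|`, where `S₀` is the support of
`β` and `𝒢₀` is the set of groups that meet `S₀`. -/
def effSparsity (α : ℝ) (𝒢 : Finpartition (Finset.univ : Finset ι)) (β : ι → ℝ) : ℝ :=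
  (α * √((Finset.univ.filter fun j => β j ≠ 0).card : ℝ)
    + (1 - α) * √((𝒢.parts.filter fun A => ∃ j ∈ A, β j ≠ 0).card : ℝ)) ^ 2

end Penalty

namespace LinReg

variable {Ω : Type*} [MeasurableSpace Ω] {ι : Type*}

/-- The response `y_t = m_t + u_t`. -/
def y (R : LinReg Ω ι) (t : ℤ) (ω : Ω) : ℝ := R.m t ω + R.u t ω

/-- The approximation error `m_t - x_tᵀ β`. -/
def approxError [Fintype ι] (R : LinReg Ω ι) (t : ℤ) (ω : Ω) : ℝ := R.m t ω - R.x t ω ⬝ᵥ R.β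

/-- `Σ = E[x_t x_tᵀ]`. -/
def secondMoment (R : LinReg Ω ι) (μ : Measure Ω) : Matrix ι ι ℝ :=
  Matrix.of fun k l => ∫ ω, R.x 0 ω k * R.x 0 ω l ∂μ

/-- The precision matrix `Θ = Σ⁻¹`. -/
def precision [Fintype ι] [DecidableEq ι] (R : LinReg Ω ι) (μ : Measure Ω) : Matrix ι ι ℝ :=
  (R.secondMoment μ)⁻¹

/-- The number `S_j` of non-zero coefficients in the `j`-th row of `Θ`. -/
def rowSparsity [Fintype ι] [DecidableEq ι] (R : LinReg Ω ι) (μ : Measure Ω) (j : ι) : ℕ :=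
  (Function.support (R.precision μ j)).ncard

/-- The coefficient `γ_j = Σ_{-j,-j}⁻¹ Σ_{-j,j}` of the projection of `x_j` on `x_{-j}`. -/
def nodeCoef [Fintype ι] [DecidableEq ι] (R : LinReg Ω ι) (μ : Measure Ω) (j : ι) :
    {k : ι // k ≠ j} → ℝ :=
  let A : Matrix {k : ι // k ≠ j} {k : ι // k ≠ j} ℝ :=
    (R.secondMoment μ).submatrix Subtype.val Subtype.val
  A⁻¹ *ᵥ fun k => R.secondMoment μ k.1 j

/-- The `j`-th nodewise regression `x_j = x_{-j}ᵀ γ_j + v_j`. -/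
def nodewise [Fintype ι] [DecidableEq ι] (R : LinReg Ω ι) (μ : Measure Ω) (j : ι) :
    LinReg Ω {k : ι // k ≠ j} where
  x t ω k := R.x t ω k.1
  u t ω := R.x t ω j - (fun k : {k : ι // k ≠ j} => R.x t ω k.1) ⬝ᵥ R.nodeCoef μ j
  m t ω := (fun k : {k : ι // k ≠ j} => R.x t ω k.1) ⬝ᵥ R.nodeCoef μ j
  β := R.nodeCoef μ j

/-- The error `v_{t,j}` of the `j`-th nodewise regression. -/
def nodeError [Fintype ι] [DecidableEq ι] (R : LinReg Ω ι) (μ : Measure Ω) (j : ι)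
    (t : ℤ) (ω : Ω) : ℝ := (R.nodewise μ j).u t ω

/-- `σ_j² = E[v_{t,j}²]`. -/
def nodeVar [Fintype ι] [DecidableEq ι] (R : LinReg Ω ι) (μ : Measure Ω) (j : ι) : ℝ :=
  ∫ ω, R.nodeError μ j 0 ω ^ 2 ∂μ

/-- Conditions on the data: stationarity of `(u_t x_t)` and `(x_t x_tᵀ)`, exogeneity, moments of
order `q` and `r` bounded by `B`, and polynomial decay of the `τ`-mixing coefficients of
`(u_t x_{t,j})` and `(x_{t,j} x_{t,l})`. -/
structure DataCond (R : LinReg Ω ι) (μ : Measure Ω) [IsProbabilityMeasure μ]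
    (q r a b c B : ℝ) : Prop where
  measurable_x : ∀ t, Measurable (R.x t)
  measurable_u : ∀ t, Measurable (R.u t)
  stationary_ux : StrictlyStationary μ fun t ω (j : ι) => R.u t ω * R.x t ω j
  stationary_xx : StrictlyStationary μ fun t ω (j : ι × ι) => R.x t ω j.1 * R.x t ω j.2
  exogenous : ∀ t j, ∫ ω, R.u t ω * R.x t ω j ∂μ = 0
  moment_u : ∀ t, eLpNorm (R.u t) (ENNReal.ofReal q) μ ≤ ENNReal.ofReal B
  moment_x : ∀ t j, eLpNorm (fun ω => R.x t ω j) (ENNReal.ofReal r) μ ≤ ENNReal.ofReal B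
  mixing_ux : ∀ j, ∀ k : ℕ, 1 ≤ k →
    tauMixing μ (fun t ω => R.u t ω * R.x t ω j) k ≤ ENNReal.ofReal (c * (k : ℝ) ^ (-a))
  mixing_xx : ∀ j l, ∀ k : ℕ, 1 ≤ k →
    tauMixing μ (fun t ω => R.x t ω j * R.x t ω l) k ≤ ENNReal.ofReal (c * (k : ℝ) ^ (-b))

end LinReg

/-! ### Exponents, tuning and the conditions on a sequence of regressions -/

/-- `ν = q r / (q + r)`. -/
def prodExponent (q r : ℝ) : ℝ := q * r / (q + r)

/-- The dependence-tails exponent `κ = ((a + 1) ν - 1) / (a + ν - 1)`. -/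
def kappa (q r a : ℝ) : ℝ :=
  ((a + 1) * prodExponent q r - 1) / (a + prodExponent q r - 1)

/-- The exponent `μ = ((b + 1) r - 2) / (r + 2 (b - 1))`. -/
def muExponent (r b : ℝ) : ℝ := ((b + 1) * r - 2) / (r + 2 * (b - 1))

/-- `(p / (δ T^{κ - 1}))^{1/κ} ∨ √(log(8 p / δ) / T)`. -/
def tuningRate (κ δ : ℝ) (p T : ℕ) : ℝ :=
  max (((p : ℝ) / (δ * (T : ℝ) ^ (κ - 1))) ^ (1 / κ)) √(Real.log (8 * p / δ) / T)

/-- The conditions on a sequence of regressions, indexed by the sample size `T`, that are imposed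
both on the main regression and on the nodewise regressions. All the constants are uniform in `T`;
`p T` is the dimension that enters the rates. -/
structure RegressionCond {Ω : ℕ → Type*} [∀ T, MeasurableSpace (Ω T)] (P : ∀ T, Measure (Ω T))
    [∀ T, IsProbabilityMeasure (P T)] {ι : ℕ → Type} [∀ T, Fintype (ι T)]
    [∀ T, DecidableEq (ι T)] (R : ∀ T, LinReg (Ω T) (ι T)) (α : ℝ)
    (𝒢 : ∀ T, Finpartition (Finset.univ : Finset (ι T))) (p : ℕ → ℕ) (lam : ℕ → ℝ)
    (q r a b c B C₀ : ℝ) : Prop where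
  data : ∀ T, (R T).DataCond (P T) q r a b c B
  /-- the smallest eigenvalue of `Σ` is bounded away from zero -/
  covariance : ∃ γ : ℝ, 0 < γ ∧
    ∀ T, ((R T).secondMoment (P T) - γ • (1 : Matrix (ι T) (ι T) ℝ)).PosSemidef
  /-- `λ` is of the order of `tuningRate`, with a constant of at least `C₀` -/
  tuning : ∃ δ : ℝ, 0 < δ ∧ δ < 1 ∧ ∃ C₁ : ℝ, ∀ᶠ T in atTop,
    C₀ * tuningRate (kappa q r a) δ (p T) T ≤ lam T ∧
      lam T ≤ C₁ * tuningRate (kappa q r a) δ (p T) T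
  approx_rate : IsBigOP P (fun T ω => empNormSq T fun t => (R T).approxError t ω)
    (fun T => max (effSparsity α (𝒢 T) (R T).β) 1 * lam T ^ 2)
  dim_rate : Tendsto (fun T : ℕ => max (effSparsity α (𝒢 T) (R T).β) 1 ^ muExponent r b *
    (p T : ℝ) ^ 2 * (T : ℝ) ^ (1 - muExponent r b)) atTop (𝓝 0)
  dim_exp_rate : ∃ c₀ : ℝ, 0 < c₀ ∧ Tendsto (fun T : ℕ => (p T : ℝ) ^ 2 *
    Real.exp (-(c₀ * T / max (effSparsity α (𝒢 T) (R T).β) 1 ^ 2))) atTop (𝓝 0)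
  /-- bounded conditional variance of the error given the regressors -/
  cond_var : ∃ D : ℝ, ∀ T t, ∀ᵐ ω ∂(P T),
    ((P T)[fun ω' => (R T).u t ω' ^ 2 | MeasurableSpace.comap ((R T).x t) inferInstance]) ω ≤ D
  long_run : ∃ D : ℝ, ∀ T, HasLongRunVariance (P T) (fun t ω => (R T).u t ω ^ 2) D
  approx_small : IsLittleOP P (fun T ω => √(empNormSq T fun t => (R T).approxError t ω))
    (fun T => (T : ℝ) ^ (-(1 / 2) : ℝ))
  mixing_prod : ∀ k : ℕ, ∃ c₁ d : ℝ, 0 < c₁ ∧ 1 < d ∧ ∀ T j l, ∀ n : ℕ, 1 ≤ n →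
    tauMixing (P T) (fun t ω =>
      (R T).u t ω * (R T).u (t + k) ω * (R T).x t ω j * (R T).x (t + k) ω l) n
      ≤ ENNReal.ofReal (c₁ * (n : ℝ) ^ (-d))

section Group

variable {Ω : Type*} [MeasurableSpace Ω] {ι : Type*} [Fintype ι] [DecidableEq ι] {g : ℕ}

/-- The sparsity `s = s_α ∨ max_{j ∈ G} S_j`. The group `G ⊂ ι` of size `g` is given by an
enumeration of its elements. -/
def sparsity (R : LinReg Ω ι) (μ : Measure Ω) (α : ℝ)
    (𝒢 : Finpartition (Finset.univ : Finset ι)) (G : Fin g ↪ ι) : ℝ :=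
  max (effSparsity α 𝒢 R.β) ((Finset.univ.sup fun i => R.rowSparsity μ (G i) : ℕ) : ℝ)

/-- The process `V_t = (u_t v_{t,j} / σ_j²)_{j ∈ G}`. -/
def scoreProcess (R : LinReg Ω ι) (μ : Measure Ω) (G : Fin g ↪ ι) (t : ℤ) (ω : Ω) (i : Fin g) : ℝ :=
  R.u t ω * R.nodeError μ (G i) t ω / R.nodeVar μ (G i)

/-- Moments of products of the regression errors `u` and `v_j`, `j ∈ G`, of order `Q` for the
errors themselves, bounded by `D` uniformly over the time points and over `G`. -/
structure MomentCond (R : LinReg Ω ι) (μ : Measure Ω) (G : Fin g ↪ ι) (Q D : ℝ) : Prop where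
  uuvv : ∀ (t k : ℤ) (i h : Fin g),
    ∫⁻ ω, ‖R.u t ω * R.u (t + k) ω * R.nodeError μ (G i) t ω * R.nodeError μ (G h) (t + k) ω‖ₑ ∂μ
      ≤ ENNReal.ofReal D
  vuv_sq : ∀ (t k : ℤ) (i h : Fin g),
    ∫⁻ ω, ‖R.nodeError μ (G i) t ω * R.u (t + k) ω * R.nodeError μ (G h) (t + k) ω‖ₑ ^ 2 ∂μ
      ≤ ENNReal.ofReal D
  uuv_sq : ∀ (t k : ℤ) (h : Fin g),
    ∫⁻ ω, ‖R.u t ω * R.u (t + k) ω * R.nodeError μ (G h) (t + k) ω‖ₑ ^ 2 ∂μ ≤ ENNReal.ofReal D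
  uvu_sq : ∀ (t k : ℤ) (i : Fin g),
    ∫⁻ ω, ‖R.u t ω * R.nodeError μ (G i) t ω * R.u (t + k) ω‖ₑ ^ 2 ∂μ ≤ ENNReal.ofReal D
  uvv_sq : ∀ (t k : ℤ) (i h : Fin g),
    ∫⁻ ω, ‖R.u t ω * R.nodeError μ (G i) t ω * R.nodeError μ (G h) (t + k) ω‖ₑ ^ 2 ∂μ
      ≤ ENNReal.ofReal D
  u_pow : ∀ t, ∫⁻ ω, ‖R.u t ω‖ₑ ^ (2 * Q) ∂μ ≤ ENNReal.ofReal D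
  v_pow : ∀ t (i : Fin g), ∫⁻ ω, ‖R.nodeError μ (G i) t ω‖ₑ ^ (2 * Q) ∂μ ≤ ENNReal.ofReal D

/-! ### Kernels and the class of autocovariances -/

/-- Riemann integrability on the whole line: the Riemann sums over the partitions of `ℝ` into
intervals of length `h`, with arbitrary tags, converge as `h → 0`. -/
def RiemannIntegrable (K : ℝ → ℝ) : Prop :=
  ∃ I : ℝ, ∀ ε : ℝ, 0 < ε → ∃ δ : ℝ, 0 < δ ∧ ∀ h : ℝ, 0 < h → h < δ →
    ∀ x : ℤ → ℝ, (∀ k : ℤ, x k ∈ Set.Icc (k * h) ((k + 1) * h)) →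
      Summable (fun k => h * K (x k)) ∧ |(∑' k, h * K (x k)) - I| ≤ ε

/-- A kernel `K : ℝ → [-1, 1]`, Riemann integrable, with `K(0) = 1` and of order `ς` at zero. -/
structure KernelCond (K : ℝ → ℝ) (ς : ℝ) : Prop where
  abs_le_one : ∀ x, |K x| ≤ 1
  zero : K 0 = 1
  riemann : RiemannIntegrable K
  smooth : ∃ ε L : ℝ, 0 < ε ∧ ∀ x, |x| < ε → |K 0 - K x| ≤ L * |x| ^ ς

/-- The process `V` is fourth-order stationary, its autocovariances `Γ_k = E[V_0 V_kᵀ]` satisfy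
`∑_k |k|^ς ‖Γ_k‖ ≤ D₁`, and
`sup_k ∑_l ∑_t ∑_{j,h} |Cov(V_{0,j} V_{k,h}, V_{t,j} V_{t+l,h})| ≤ D₂`. -/
structure AutocovCond (μ : Measure Ω) (V : ℤ → Ω → Fin g → ℝ) (ς D₁ D₂ : ℝ) : Prop where
  stationary : FourthOrderStationary μ V
  second : ∑' k : ℤ, ENNReal.ofReal (|(k : ℝ)| ^ ς) *
    ‖(Matrix.of fun i h => ∫ ω, V 0 ω i * V k ω h ∂μ : Matrix (Fin g) (Fin g) ℝ)‖ₑ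
      ≤ ENNReal.ofReal D₁
  fourth : ∀ k : ℤ, ∑' l : ℤ, ∑' t : ℤ, ∑ i, ∑ h,
    ‖cov[fun ω => V 0 ω i * V k ω h, fun ω => V t ω i * V (t + l) ω h; μ]‖ₑ ≤ ENNReal.ofReal D₂

/-! ### The long-run variance and the HAC estimator -/

/-- The rows `Θ_G` of the precision matrix. -/
def precisionRows (R : LinReg Ω ι) (μ : Measure Ω) (G : Fin g ↪ ι) : Matrix (Fin g) ι ℝ :=
  Matrix.of fun i => R.precision μ (G i)

/-- `Γ_k = Θ_G E[u_t x_t u_{t+k} x_{t+k}ᵀ] Θ_Gᵀ`. -/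
def autocov (R : LinReg Ω ι) (μ : Measure Ω) (G : Fin g ↪ ι) (k : ℤ) : Matrix (Fin g) (Fin g) ℝ :=
  precisionRows R μ G *
    Matrix.of (fun j l => ∫ ω, R.u 0 ω * R.x 0 ω j * R.u k ω * R.x k ω l ∂μ) *
    (precisionRows R μ G)ᵀ

/-- The long-run variance `Ξ_G = ∑_{k ∈ ℤ} Γ_k`. -/
def longRunVar (R : LinReg Ω ι) (μ : Measure Ω) (G : Fin g ↪ ι) : Matrix (Fin g) (Fin g) ℝ :=
  ∑' k : ℤ, autocov R μ G k

/-- `σ̂_j² = ‖X_j - X_{-j} γ̂_j‖_T² + λ_j |γ̂_j|₁`. -/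
def nodeVarEst (T : ℕ) (x : ℤ → ι → ℝ) (j : ι) (lam : ℝ) (γ : {k : ι // k ≠ j} → ℝ) : ℝ :=
  empNormSq T (fun t => x t j - (fun k : {k : ι // k ≠ j} => x t k.1) ⬝ᵥ γ) + lam * ∑ k, |γ k|

/-- The rows `Θ̂_j = σ̂_j⁻² (1, -γ̂_jᵀ)`, `j ∈ G`, of the nodewise LASSO estimator of `Θ`. -/
def precisionRowsEst (T : ℕ) (x : ℤ → ι → ℝ) (G : Fin g ↪ ι) (lam : Fin g → ℝ)
    (γ : ∀ i, {k : ι // k ≠ G i} → ℝ) : Matrix (Fin g) ι ℝ :=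
  Matrix.of fun i k => (nodeVarEst T x (G i) (lam i) (γ i))⁻¹ *
    if hk : k = G i then 1 else -γ i ⟨k, hk⟩

/-- `Θ̂_G (T⁻¹ ∑_{t=1}^{T-k} û_t û_{t+k} x_t x_{t+k}ᵀ) Θ̂_Gᵀ` for `k ≥ 0`, as a function of the
residuals `û` and of `Θ̂_G`. -/
def autocovEst (T : ℕ) (x : ℤ → ι → ℝ) (res : ℤ → ℝ) (Th : Matrix (Fin g) ι ℝ) (k : ℕ) :
    Matrix (Fin g) (Fin g) ℝ :=
  Th * ((T : ℝ)⁻¹ • ∑ t ∈ Finset.Icc (1 : ℤ) ((T : ℤ) - k),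
    (res t * res (t + k)) • Matrix.vecMulVec (x t) (x (t + k))) * Thᵀ

/-- The HAC estimator `∑_{|k| < T} K(k / M) Γ̂_k` with `Γ̂_{-k} = Γ̂_kᵀ`. -/
def hacEst (K : ℝ → ℝ) (M : ℝ) (T : ℕ) (x : ℤ → ι → ℝ) (res : ℤ → ℝ) (Th : Matrix (Fin g) ι ℝ) :
    Matrix (Fin g) (Fin g) ℝ :=
  ∑ k ∈ Finset.Ioo (-(T : ℤ)) T, K ((k : ℝ) / M) •
    if 0 ≤ k then autocovEst T x res Th k.natAbs else (autocovEst T x res Th k.natAbs)ᵀ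

/-- `Ξ̂_G`: the HAC estimator built from the residuals `û_t = y_t - x_tᵀ β̂` and from the nodewise
LASSO coefficients `γ̂_j`, `j ∈ G`, with tuning parameters `λ_j`. -/
def hacResiduals (K : ℝ → ℝ) (M : ℝ) (T : ℕ) (R : LinReg Ω ι) (G : Fin g ↪ ι) (lam : Fin g → ℝ)
    (β : ι → ℝ) (γ : ∀ i, {k : ι // k ≠ G i} → ℝ) (ω : Ω) : Matrix (Fin g) (Fin g) ℝ :=
  hacEst K M T (fun t => R.x t ω) (fun t => R.y t ω - R.x t ω ⬝ᵥ β)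
    (precisionRowsEst T (fun t => R.x t ω) G lam γ)

end Group

/-- The convergence rate of the HAC estimator. -/
def hacRate (κ ς s M : ℝ) (p T : ℕ) : ℝ :=
  M * (max (s * (p : ℝ) ^ (1 / κ) / (T : ℝ) ^ (1 - 1 / κ)) (s * √(Real.log p / T))
      + s ^ 2 * (p : ℝ) ^ (2 / κ) / (T : ℝ) ^ (2 - 3 / κ)
      + s ^ 3 * (p : ℝ) ^ (5 / κ) / (T : ℝ) ^ (4 - 5 / κ))
    + M ^ (-ς) + (T : ℝ) ^ (-(min ς 1))

end

end HAC

/-! Write L = √(log p / T) and A = sL. The estimator turns out to have error of order M·A + M^{-ς} +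
T^{-(ς∧1)} in every entry, and the stated rate dominates this (`le_hacRate`).

Reduction to scalar products. The normal equations say that Σ maps (1, -γ_j) to σ_j² e_j, so Θ_j =
σ_j⁻²(1, -γ_j) and Θ_G u_t x_t = V_t (`precision_eq`, `scoreProcess_eq`). Hence Γ_k = E[V_0 V_kᵀ],
while the entries of Γ̂_k are σ̂_i⁻² σ̂_l⁻² times lagged means of û û v̂ v̂ (`hacResiduals_apply`).
The error of an entry has three parts. (1) Bias: the weights K(k/M)(1 - |k|/T) are compared with 1
at the price of |k|^ς, which is summable against Γ_k (`KernelCond.exists_bias_le`). (2) Fluctuation: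
by the fourth-order condition, the lagged means of products of true scores have variance at most
D₂/T; as ∑|K(k/M)| = O(M), this contributes M/√T (`tight_autocov`). (3) Estimation: the fourfold
product of perturbed errors is expanded. Terms linear in an estimation error are split by Young's
inequality with weight A; in the remaining terms two errors are paired, and the other two factors
are bounded by their maxima over t ≤ T (`abs_perturb_mul_four_le`, `abs_hacResiduals_sub_le`). The
mean squares of the errors are O(sL²), so each lag contributes O(A) and the sum over lags O(M·A).
The size of the maxima is controlled by moments, and `exists_min_mul_le` shows that the fitted
nodewise errors do no harm.

LASSO rates. Deterministically, if λ dominates the noise and the Gram matrix is entrywise within a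
constant over s of Σ, the error lies in a cone on which the Gram form is bounded below
(`IsSGLasso.oracle`). These events are likely by a union bound and a Fuk–Nagaev inequality for
τ-mixing sequences (`exists_concentration`). With λ only a fixed multiple of the tuning rate, the
noise event fails with a probability of order 1/p, which need not be small if p stays bounded; a
second oracle inequality without a cone covers that case (`IsSGLasso.oracle_lowDim`,
`exists_lasso_rate`).

Fuk–Nagaev. The definition of τ bounds the cost of replacing a block, in the expectation of a
Lipschitz function, by a copy independent of the past. Blocks of one parity are therefore replaced
one at a time, with no coupling, inside a Lipschitz ramp that is dominated by an exponential; the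
truncated Laplace transforms multiply (`integral_le_of_replacement`, `fuk_nagaev`). Block variances
are linear in the block length by a covariance inequality.

All probabilistic statements are combined as `TightEvents`; on their intersection `hacEvent` the
argument is deterministic. -/

namespace HAC

/-! ### Replacing a block by an independent copy at the cost of a τ-coefficient. -/

section Replacement

variable {Ω : Type*} [mΩ : MeasurableSpace Ω]

/-- The conditional law of `ξ` given `X` may be replaced by its marginal law in the expectation of
a function that is Lipschitz in `ξ`. -/
lemma enorm_integral_sub_le_lintegral_condDistrib {β : Type*} [MeasurableSpace β] (μ : Measure Ω)
    [IsProbabilityMeasure μ] {l : ℕ} {X : Ω → β} (hX : Measurable X) {ξ : Ω → Fin l → ℝ}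
    (hξ : Measurable ξ) {Ψ : β → (Fin l → ℝ) → ℝ} (hΨ : Measurable (Function.uncurry Ψ)) {L : ℝ}
    (hL : 0 < L) (hlip : ∀ z x y, |Ψ z x - Ψ z y| ≤ L * ∑ i, |x i - y i|)
    (hint : Integrable (fun ω => Ψ (X ω) (ξ ω)) μ)
    (hint' : Integrable (fun w : Ω × Ω => Ψ (X w.1) (ξ w.2)) (μ.prod μ)) :
    ‖(∫ ω, Ψ (X ω) (ξ ω) ∂μ) - ∫ ω, ∫ ω', Ψ (X ω) (ξ ω') ∂μ ∂μ‖ₑ ≤ ENNReal.ofReal L *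
      ∫⁻ ω, ⨆ f ∈ lipOne l, ‖(∫ x, f x ∂(condDistrib ξ X μ (X ω))) - ∫ ω', f (ξ ω') ∂μ‖ₑ ∂μ := by
  have hcomp : ∫ ω, Ψ (X ω) (ξ ω) ∂μ
      = ∫ ω, ∫ x, Ψ (X ω) x ∂(condDistrib ξ X μ (X ω)) ∂μ := by
    have h1 : ∫ ω, Ψ (X ω) (ξ ω) ∂μ
        = ∫ w, Function.uncurry Ψ w ∂(μ.map fun ω => (X ω, ξ ω)) := by
      rw [integral_map (by fun_prop) hΨ.aestronglyMeasurable]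
      rfl
    have h2 : Integrable (Function.uncurry Ψ) (μ.map fun ω => (X ω, ξ ω)) := by
      rw [integrable_map_measure hΨ.aestronglyMeasurable (by fun_prop)]
      exact hint
    rw [h1]
    rw [← compProd_map_condDistrib hξ.aemeasurable] at h2 ⊢
    rw [Measure.integral_compProd h2, integral_map hX.aemeasurable]
    · rfl
    · exact (hΨ.stronglyMeasurable.integral_kernel_prod_right').aestronglyMeasurable
  have hi1 : Integrable (fun ω => ∫ x, Ψ (X ω) x ∂(condDistrib ξ X μ (X ω))) μ := by
    have h2 : Integrable (Function.uncurry Ψ) (μ.map fun ω => (X ω, ξ ω)) := by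
      rw [integrable_map_measure hΨ.aestronglyMeasurable (by fun_prop)]
      exact hint
    exact h2.integral_condDistrib hX.aemeasurable hξ.aemeasurable
  have hi2 := hint'.integral_prod_left
  rw [hcomp, ← integral_sub hi1 hi2]
  refine (enorm_integral_le_lintegral_enorm _).trans ?_
  rw [← lintegral_const_mul' _ _ ENNReal.ofReal_ne_top]
  refine lintegral_mono fun ω => ?_
  -- For fixed ω the rescaled section competes in the supremum, so the difference of its two
  -- integrals is controlled pointwise in ω.
  have hmem : (fun x => L⁻¹ * Ψ (X ω) x) ∈ lipOne l := by
    intro x y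
    rw [← mul_sub, abs_mul, abs_of_pos (inv_pos.2 hL), inv_mul_le_iff₀ hL]
    exact hlip _ _ _
  refine le_trans ?_ (mul_le_mul_right (le_iSup₂_of_le _ hmem le_rfl) _)
  rw [integral_const_mul, integral_const_mul, ← mul_sub, enorm_mul, ← mul_assoc,
    Real.enorm_of_nonneg (inv_pos.2 hL).le, ← ENNReal.ofReal_mul hL.le, mul_inv_cancel₀ hL.ne',
    ENNReal.ofReal_one, one_mul]

lemma past_le {E : Type*} [MeasurableSpace E] {ξ : ℤ → Ω → E} (hξ : ∀ t, Measurable (ξ t))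
    (t : ℤ) : past ξ t ≤ mΩ :=
  iSup₂_le fun s _ => (hξ s).comap_le

lemma measurable_past {Ω : Type*} {E : Type*} [MeasurableSpace E] {ξ : ℤ → Ω → E} {s t : ℤ} (hst : s ≤ t) :
    Measurable[past ξ t] (ξ s) := by
  refine Measurable.of_comap_le ?_
  exact le_iSup₂_of_le (f := fun s (_ : s ≤ t) => MeasurableSpace.comap (ξ s) inferInstance) s hst
    le_rfl

/-- Replacement of a block of the process by an independent copy of it. -/
lemma enorm_integral_sub_le_tauMixing (μ : Measure Ω) [IsProbabilityMeasure μ] {ξ : ℤ → Ω → ℝ}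
    (hξ : ∀ t, Measurable (ξ t)) {t : ℤ} {k : ℕ} {s : Finset ℤ} (hs : ∀ i ∈ s, t + k ≤ i)
    {Z : Ω → ℝ} (hZ : Measurable[past ξ t] Z) {ψ : ℝ → ℝ → ℝ}
    (hψ : Measurable (Function.uncurry ψ)) {L : ℝ} (hL : 0 < L)
    (hlip : ∀ z x y, |ψ z x - ψ z y| ≤ L * |x - y|)
    (hint : Integrable (fun ω => ψ (Z ω) (∑ i ∈ s, ξ i ω)) μ)
    (hint' : Integrable (fun w : Ω × Ω => ψ (Z w.1) (∑ i ∈ s, ξ i w.2)) (μ.prod μ)) :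
    ‖(∫ ω, ψ (Z ω) (∑ i ∈ s, ξ i ω) ∂μ) - ∫ ω, ∫ ω', ψ (Z ω) (∑ i ∈ s, ξ i ω') ∂μ ∂μ‖ₑ
      ≤ ENNReal.ofReal L * (s.card * tauMixing μ ξ k) := by
  rcases Nat.eq_zero_or_pos s.card with h0 | hpos
  · rw [Finset.card_eq_zero] at h0
    subst h0
    simp
  set l := s.card with hl
  let i : Fin l → ℤ := s.orderEmbOfFin rfl
  have hi : StrictMono i := (s.orderEmbOfFin rfl).strictMono
  have hsum : ∀ ω, ∑ n, ξ (i n) ω = ∑ j ∈ s, ξ j ω := by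
    intro ω
    have : s = Finset.univ.map (s.orderEmbOfFin rfl).toEmbedding := by
      simp
    conv_rhs => rw [this, Finset.sum_map]
    rfl
  have hle := past_le hξ t
  let Ψ : Ω → (Fin l → ℝ) → ℝ := fun ω x => ψ (Z ω) (∑ n, x n)
  have key : ‖(∫ ω, ψ (Z ω) (∑ i ∈ s, ξ i ω) ∂μ) - ∫ ω, ∫ ω', ψ (Z ω) (∑ i ∈ s, ξ i ω') ∂μ ∂μ‖ₑ
      ≤ ENNReal.ofReal L * tauCoef μ (past ξ t) (fun ω n => ξ (i n) ω) := by
    -- Conditioning on a σ-algebra is conditioning on the identity map into Ω equipped with that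
    -- σ-algebra; this is the kernel that defines `tauCoef`. The sum of coordinates is 1-Lipschitz
    -- for the ℓ₁ norm.
    have := @enorm_integral_sub_le_lintegral_condDistrib Ω mΩ Ω (past ξ t) μ _ l id
      (measurable_id'' hle) (fun ω n => ξ (i n) ω) (by fun_prop) Ψ ?_ L hL ?_ ?_ ?_
    · simp only [Ψ, id, hsum] at this
      exact this
    · have h1 : @Measurable (Ω × (Fin l → ℝ)) ℝ (@Prod.instMeasurableSpace _ _ (past ξ t) _) _
          (fun w => Z w.1) := hZ.comp (@measurable_fst _ _ (past ξ t) _)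
      have h2 : @Measurable (Ω × (Fin l → ℝ)) ℝ (@Prod.instMeasurableSpace _ _ (past ξ t) _) _
          (fun w => ∑ n, w.2 n) := by
        have : Measurable (fun x : Fin l → ℝ => ∑ n, x n) := by fun_prop
        exact this.comp (@measurable_snd _ _ (past ξ t) _)
      exact hψ.comp (h1.prodMk h2)
    · intro z x y
      refine (hlip _ _ _).trans (mul_le_mul_of_nonneg_left ?_ hL.le)
      rw [← Finset.sum_sub_distrib]
      exact Finset.abs_sum_le_sum_abs _ _
    · simpa only [Ψ, id, hsum] using hint
    · simpa only [Ψ, id, hsum] using hint'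
  refine key.trans (mul_le_mul_right ?_ _)
  have hin : ∀ n, t + k ≤ i n := fun n => hs _ (Finset.orderEmbOfFin_mem s rfl n)
  -- The normalization 1/l in the mixing coefficient is the source of the factor `s.card`.
  have : (l : ℝ≥0∞)⁻¹ * tauCoef μ (past ξ t) (fun ω n => ξ (i n) ω) ≤ tauMixing μ ξ k := by
    unfold tauMixing
    refine le_iSup₂_of_le l hpos (le_iSup₂_of_le t i (le_iSup₂_of_le hi hin le_rfl))
  rwa [ENNReal.inv_mul_le_iff (by exact_mod_cast hpos.ne') (ENNReal.natCast_ne_top _)] at this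

end Replacement

/-! ### Truncated Laplace transforms and a Fuk–Nagaev bound under replacement. -/

section Laplace

lemma exp_le_one_add_add_sq {x : ℝ} (hx : x ≤ 1) : Real.exp x ≤ 1 + x + x ^ 2 := by
  rcases le_total (-1) x with h | h
  · have := Real.abs_exp_sub_one_sub_id_le (abs_le.2 ⟨h, hx⟩)
    linarith [(abs_le.1 this).2]
  · have : Real.exp x ≤ 1 := Real.exp_le_one_iff.2 (by linarith)
    nlinarith

/-- For hw ≤ 1 the quadratic bound on the exponential suffices. On [1, hz] the function e^t t^{-ν}
is the exponential of the convex function t - ν log t, hence at most the sum of its values at the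
two ends; multiplying by t^ν at t = hw gives the two power terms. -/
lemma exp_mul_le_of_le {ν h z w : ℝ} (hν : 0 < ν) (hh : 0 < h) (hz : 0 < z) (hw : w ≤ z) :
    Real.exp (h * w) ≤ 1 + h * w + h ^ 2 * w ^ 2
      + (Real.exp 1 * h ^ ν + Real.exp (h * z) * z ^ (-ν)) * |w| ^ ν := by
  rcases le_or_gt (h * w) 1 with hx | hx
  · have h1 := exp_le_one_add_add_sq hx
    have h2 : 0 ≤ (Real.exp 1 * h ^ ν + Real.exp (h * z) * z ^ (-ν)) * |w| ^ ν := by positivity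
    nlinarith
  · have hw0 : 0 < w := by
      by_contra hneg
      have : h * w ≤ 0 := mul_nonpos_of_nonneg_of_nonpos hh.le (not_lt.1 hneg)
      linarith
    have hx0 : 0 < h * w := by positivity
    have hX0 : 0 < h * z := by positivity
    have hconv : ConvexOn ℝ (Set.Ioi (0 : ℝ)) fun t => t - ν * Real.log t := by
      have h1 : ConvexOn ℝ (Set.Ioi (0 : ℝ)) fun t : ℝ => -(ν * Real.log t) :=
        (strictConcaveOn_log_Ioi.concaveOn.smul hν.le).neg
      have := (convexOn_id (𝕜 := ℝ) (convex_Ioi (0 : ℝ))).add h1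
      exact this.congr fun x _ => by simp [sub_eq_add_neg]
    have hmax := hconv.le_max_of_mem_Icc (x := 1) (y := h * z) (z := h * w)
      (Set.mem_Ioi.2 one_pos) (Set.mem_Ioi.2 hX0)
      ⟨hx.le, mul_le_mul_of_nonneg_left hw hh.le⟩
    simp only [Real.log_one, mul_zero, sub_zero] at hmax
    have hexp : ∀ t : ℝ, 0 < t → Real.exp (t - ν * Real.log t) = Real.exp t * t ^ (-ν) := by
      intro t ht
      rw [sub_eq_add_neg, Real.exp_add, Real.rpow_def_of_pos ht]
      ring_nf
    have h1 : Real.exp (h * w) * (h * w) ^ (-ν)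
        ≤ Real.exp 1 + Real.exp (h * z) * (h * z) ^ (-ν) := by
      rw [← hexp _ hx0, ← hexp _ hX0]
      rcases le_max_iff.1 hmax with h2 | h2
      · have := Real.exp_le_exp.2 h2
        have := Real.exp_pos (h * z - ν * Real.log (h * z))
        linarith
      · have := Real.exp_le_exp.2 h2
        have := Real.exp_pos 1
        linarith
    have h2 : Real.exp (h * w)
        ≤ (Real.exp 1 + Real.exp (h * z) * (h * z) ^ (-ν)) * (h * w) ^ ν := by
      have h3 := mul_le_mul_of_nonneg_right h1 (Real.rpow_nonneg hx0.le ν)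
      rwa [mul_assoc, ← Real.rpow_add hx0, neg_add_cancel, Real.rpow_zero, mul_one] at h3
    have h3 : (Real.exp 1 + Real.exp (h * z) * (h * z) ^ (-ν)) * (h * w) ^ ν
        = (Real.exp 1 * h ^ ν + Real.exp (h * z) * z ^ (-ν)) * |w| ^ ν := by
      rw [abs_of_pos hw0, Real.mul_rpow hh.le hw0.le, Real.mul_rpow hh.le hz.le]
      have : h ^ (-ν) * h ^ ν = 1 := by rw [← Real.rpow_add hh, neg_add_cancel, Real.rpow_zero]
      linear_combination Real.exp (h * z) * z ^ (-ν) * w ^ ν * this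
    nlinarith [sq_nonneg (h * w)]

variable {Ω : Type*} [MeasurableSpace Ω]

/-- Truncation is from above only. Where the variable exceeds z, the pointwise bound at z is smaller
than the same expression at the variable itself, so the bound may be integrated with the
untruncated, centred variable, and the linear term vanishes. -/
lemma integral_exp_mul_min_le (μ : Measure Ω) [IsProbabilityMeasure μ] {V : Ω → ℝ} {ν h z : ℝ}
    (hν : 0 < ν) (hh : 0 < h) (hz : 0 < z) (hV1 : Integrable V μ)
    (hV2 : Integrable (fun ω => V ω ^ 2) μ) (hVν : Integrable (fun ω => |V ω| ^ ν) μ)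
    (hV0 : ∫ ω, V ω ∂μ = 0) :
    ∫ ω, Real.exp (h * min (V ω) z) ∂μ ≤ Real.exp (h ^ 2 * ∫ ω, V ω ^ 2 ∂μ
      + (Real.exp 1 * h ^ ν + Real.exp (h * z) * z ^ (-ν)) * ∫ ω, |V ω| ^ ν ∂μ) := by
  set κ := Real.exp 1 * h ^ ν + Real.exp (h * z) * z ^ (-ν) with hκ
  have hκ0 : 0 ≤ κ := by positivity
  have hle : ∀ v : ℝ, Real.exp (h * min v z) ≤ 1 + h * v + h ^ 2 * v ^ 2 + κ * |v| ^ ν := by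
    intro v
    rcases le_total v z with hv | hv
    · rw [min_eq_left hv]
      exact exp_mul_le_of_le hν hh hz hv
    · rw [min_eq_right hv]
      have h1 := exp_mul_le_of_le hν hh hz (le_refl z)
      have h2 : |z| ^ ν ≤ |v| ^ ν :=
        Real.rpow_le_rpow (abs_nonneg _) (by rw [abs_of_pos hz, abs_of_pos (hz.trans_le hv)]; exact hv)
          hν.le
      have h3 : z ^ 2 ≤ v ^ 2 := pow_le_pow_left₀ hz.le hv 2
      have h4 := mul_le_mul_of_nonneg_left h2 hκ0
      have h5 := mul_le_mul_of_nonneg_left h3 (sq_nonneg h)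
      have h6 := mul_le_mul_of_nonneg_left hv hh.le
      linarith
  have hint : Integrable (fun ω => 1 + h * V ω + h ^ 2 * V ω ^ 2 + κ * |V ω| ^ ν) μ :=
    (((integrable_const _).add (hV1.const_mul _)).add (hV2.const_mul _)).add (hVν.const_mul _)
  have h1 : ∫ ω, Real.exp (h * min (V ω) z) ∂μ
      ≤ ∫ ω, (1 + h * V ω + h ^ 2 * V ω ^ 2 + κ * |V ω| ^ ν) ∂μ :=
    integral_mono_of_nonneg (Eventually.of_forall fun ω => (Real.exp_pos _).le) hint
      (Eventually.of_forall fun ω => hle _)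
  refine h1.trans ?_
  have hA : Integrable (fun ω => 1 + h * V ω) μ := (integrable_const _).add (hV1.const_mul _)
  have hB : Integrable (fun ω => 1 + h * V ω + h ^ 2 * V ω ^ 2) μ := hA.add (hV2.const_mul _)
  rw [integral_add hB (hVν.const_mul _), integral_add hA (hV2.const_mul _),
    integral_add (integrable_const _) (hV1.const_mul _), integral_const_mul, integral_const_mul,
    integral_const_mul, hV0]
  simp only [integral_const, probReal_univ, one_smul, mul_zero, add_zero]
  rw [add_assoc]
  have := Real.add_one_le_exp (h ^ 2 * ∫ ω, V ω ^ 2 ∂μ + κ * ∫ ω, |V ω| ^ ν ∂μ)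
  linarith

lemma integrable_of_mem_Icc {μ : Measure Ω} [IsFiniteMeasure μ] {f : Ω → ℝ} (hf : Measurable f)
    {C : ℝ} (h0 : ∀ ω, 0 ≤ f ω) (h1 : ∀ ω, f ω ≤ C) : Integrable f μ :=
  Integrable.of_bound hf.aestronglyMeasurable C
    (Eventually.of_forall fun ω => by rw [Real.norm_of_nonneg (h0 ω)]; exact h1 ω)

lemma measurable_of_lipschitz_abs {F : ℝ → ℝ} {L : ℝ} (hF : ∀ x y, |F x - F y| ≤ L * |x - y|) :
    Measurable F := by
  have : LipschitzWith (Real.toNNReal L) F := LipschitzWith.of_dist_le_mul fun x y => by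
    rw [Real.dist_eq, Real.dist_eq]
    exact (hF x y).trans (mul_le_mul_of_nonneg_right (Real.le_coe_toNNReal L) (abs_nonneg _))
  exact this.continuous.measurable

/-- If the increments of a random walk may be replaced one by one by independent copies, up to
errors, then bounded Lipschitz functions dominated by an exponential function have expectations
bounded by truncated Laplace transforms. -/
lemma integral_le_of_replacement (μ : Measure Ω) [IsProbabilityMeasure μ] {V : ℕ → Ω → ℝ}
    (hV : ∀ i, Measurable (V i)) {err : ℕ → ℝ} {L h z : ℝ} (hh : 0 ≤ h)
    (hrep : ∀ n, ∀ F : ℝ → ℝ, (∀ x, 0 ≤ F x) → (∀ x, F x ≤ 1) →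
      (∀ x y, |F x - F y| ≤ L * |x - y|) →
      ∫ ω, F (∑ i ∈ Finset.range n, V i ω + V n ω) ∂μ
        ≤ (∫ ω, ∫ ω', F (∑ i ∈ Finset.range n, V i ω + V n ω') ∂μ ∂μ) + err n) (n : ℕ) :
    ∀ (F : ℝ → ℝ) (c D : ℝ), 0 ≤ c → 0 ≤ D → (∀ x, 0 ≤ F x) → (∀ x, F x ≤ 1) →
      (∀ x y, |F x - F y| ≤ L * |x - y|) → (∀ s, F s ≤ c + D * Real.exp (h * s)) →
      ∫ ω, F (∑ i ∈ Finset.range n, V i ω) ∂μ ≤ c + (∑ i ∈ Finset.range n, μ.real {ω | z < V i ω})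
        + D * (∏ i ∈ Finset.range n, ∫ ω, Real.exp (h * min (V i ω) z) ∂μ)
        + ∑ i ∈ Finset.range n, err i := by
  -- Integrating out the last increment turns F into a function of the same class, with c increased
  -- by the probability of exceeding z (where F ≤ 1 is used) and D multiplied by the truncated
  -- Laplace transform. This is why F, c and D are universally quantified in the induction.
  induction n with
  | zero =>
    intro F c D hc hD h0 h1 hlip hF
    simpa using hF 0
  | succ n ih =>
    intro F c D hc hD h0 h1 hlip hF
    have hFm := measurable_of_lipschitz_abs hlip
    have hiF : ∀ s, Integrable (fun ω => F (s + V n ω)) μ := fun s =>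
      integrable_of_mem_Icc (hFm.comp ((hV n).const_add s)) (fun _ => h0 _) (fun _ => h1 _)
    have hiE : Integrable (fun ω => Real.exp (h * min (V n ω) z)) μ :=
      integrable_of_mem_Icc (C := Real.exp (h * z)) (by have := hV n; fun_prop)
        (fun _ => (Real.exp_pos _).le)
        (fun _ => Real.exp_le_exp.2 (mul_le_mul_of_nonneg_left (min_le_right _ _) hh))
    set m := ∫ ω, Real.exp (h * min (V n ω) z) ∂μ with hm
    have hm0 : 0 ≤ m := integral_nonneg fun _ => (Real.exp_pos _).le
    have hset : MeasurableSet {ω | z < V n ω} := measurableSet_lt measurable_const (hV n)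
    have hbound : ∀ s, ∫ ω, F (s + V n ω) ∂μ
        ≤ (c + μ.real {ω | z < V n ω}) + D * m * Real.exp (h * s) := by
      intro s
      have hpt : ∀ ω, F (s + V n ω) ≤ c + Set.indicator {ω | z < V n ω} (fun _ => (1 : ℝ)) ω
          + D * Real.exp (h * s) * Real.exp (h * min (V n ω) z) := by
        intro ω
        by_cases hω : z < V n ω
        · have : Set.indicator {ω | z < V n ω} (fun _ => (1 : ℝ)) ω = 1 :=
            Set.indicator_of_mem (by exact hω) _
          rw [this]
          have h2 : 0 ≤ D * Real.exp (h * s) * Real.exp (h * min (V n ω) z) := by positivity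
          linarith [h1 (s + V n ω)]
        · have : Set.indicator {ω | z < V n ω} (fun _ => (1 : ℝ)) ω = 0 :=
            Set.indicator_of_notMem (by exact hω) _
          rw [this, min_eq_left (not_lt.1 hω), mul_assoc, ← Real.exp_add, ← mul_add]
          linarith [hF (s + V n ω)]
      have hi1 : Integrable (fun ω => c + Set.indicator {ω | z < V n ω} (fun _ => (1 : ℝ)) ω) μ :=
        (integrable_const _).add ((integrable_const _).indicator hset)
      refine (integral_mono (hiF s) (hi1.add (hiE.const_mul _)) hpt).trans (le_of_eq ?_)
      rw [integral_add' hi1 (hiE.const_mul _), integral_add (integrable_const _)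
        ((integrable_const _).indicator hset), integral_const_mul, integral_indicator_const _ hset,
        ← hm]
      simp
      ring
    have hG := ih (fun s => ∫ ω, F (s + V n ω) ∂μ) (c + μ.real {ω | z < V n ω}) (D * m)
      (by positivity) (by positivity) (fun s => integral_nonneg fun _ => h0 _)
      (fun s => by
        have := integral_mono (hiF s) (integrable_const (1 : ℝ)) (fun _ => h1 _)
        simpa using this)
      (fun x y => by
        rw [← integral_sub (hiF x) (hiF y)]
        refine (abs_integral_le_integral_abs).trans ?_
        have h2 : ∀ ω, |F (x + V n ω) - F (y + V n ω)| ≤ L * |x - y| := fun ω => by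
          have := hlip (x + V n ω) (y + V n ω)
          rwa [add_sub_add_right_eq_sub] at this
        have := integral_mono ((hiF x).sub (hiF y)).abs (integrable_const (L * |x - y|)) h2
        simpa using this)
      hbound
    have h3 := hrep n F h0 h1 hlip
    simp only [Finset.sum_range_succ, Finset.prod_range_succ]
    calc ∫ ω, F (∑ i ∈ Finset.range n, V i ω + V n ω) ∂μ
        ≤ (∫ ω, ∫ ω', F (∑ i ∈ Finset.range n, V i ω + V n ω') ∂μ ∂μ) + err n := h3
      _ ≤ _ := by
        rw [← hm]
        linarith [hG]

/-- The Fuk–Nagaev inequality for a random walk whose increments may be replaced one by one by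
independent copies, up to errors. -/
lemma measureReal_le_of_replacement (μ : Measure Ω) [IsProbabilityMeasure μ] {V : ℕ → Ω → ℝ}
    (hV : ∀ i, Measurable (V i)) {err : ℕ → ℝ} {ν y A B : ℝ} (hν : 0 < ν) (hy : 0 < y)
    (hA : 0 < A) (hB : 0 < B) (n : ℕ) (herr : ∀ i, 0 ≤ err i)
    (hrep : ∀ n, ∀ F : ℝ → ℝ, (∀ x, 0 ≤ F x) → (∀ x, F x ≤ 1) →
      (∀ x y', |F x - F y'| ≤ y⁻¹ * |x - y'|) →
      ∫ ω, F (∑ i ∈ Finset.range n, V i ω + V n ω) ∂μ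
        ≤ (∫ ω, ∫ ω', F (∑ i ∈ Finset.range n, V i ω + V n ω') ∂μ ∂μ) + err n)
    (hV1 : ∀ i, Integrable (V i) μ) (hV2 : ∀ i, Integrable (fun ω => V i ω ^ 2) μ)
    (hVν : ∀ i, Integrable (fun ω => |V i ω| ^ ν) μ) (hV0 : ∀ i, ∫ ω, V i ω ∂μ = 0)
    (hsumA : ∑ i ∈ Finset.range n, ∫ ω, |V i ω| ^ ν ∂μ ≤ A)
    (hsumB : ∑ i ∈ Finset.range n, ∫ ω, V i ω ^ 2 ∂μ ≤ B) :
    μ.real {ω | 2 * y ≤ ∑ i ∈ Finset.range n, V i ω} ≤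
      2 ^ ν * (1 + Real.exp (1 + Real.exp 1 * ν ^ ν)) *
        (A * y ^ (-ν) + Real.exp (-(y ^ 2 / (4 * B)))) + ∑ i ∈ Finset.range n, err i := by
  set E₀ := Real.exp (1 + Real.exp 1 * ν ^ ν) with hE₀
  have hE₀pos : 0 < E₀ := Real.exp_pos _
  -- With truncation at y/2 and h = ℓ/z one has hy = 2ℓ, so that e^{-hy} pays for the quadratic term
  -- and still leaves e^{-ℓ} = A z^{-ν}.
  set z := y / 2 with hz_def
  have hz : 0 < z := by positivity
  have herrs : 0 ≤ ∑ i ∈ Finset.range n, err i := Finset.sum_nonneg fun i _ => herr i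
  have h2ν : (1 : ℝ) ≤ 2 ^ ν := Real.one_le_rpow (by norm_num) hν.le
  have hzν : z ^ (-ν) = 2 ^ ν * y ^ (-ν) := by
    rw [hz_def, Real.div_rpow hy.le (by norm_num), Real.rpow_neg (by norm_num : (0:ℝ) ≤ 2)]
    field_simp
  -- If z^ν ≤ A the right-hand side exceeds 1.
  rcases le_or_gt (z ^ ν) A with hcase | hcase
  · have h1 : 1 ≤ A * z ^ (-ν) := by
      rw [Real.rpow_neg hz.le, ← div_eq_mul_inv, one_le_div (by positivity)]
      exact hcase
    rw [hzν] at h1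
    have h2 : μ.real {ω | 2 * y ≤ ∑ i ∈ Finset.range n, V i ω} ≤ 1 := measureReal_le_one
    have h3 : 0 ≤ 2 ^ ν * (1 + E₀) * Real.exp (-(y ^ 2 / (4 * B))) := by positivity
    have h4 : 0 ≤ 2 ^ ν * E₀ * (A * y ^ (-ν)) := by positivity
    nlinarith
  set ℓ := Real.log (z ^ ν / A) with hℓ_def
  have hratio : 1 < z ^ ν / A := (one_lt_div hA).2 hcase
  have hℓ : 0 < ℓ := Real.log_pos hratio
  have hexpℓ : Real.exp ℓ = z ^ ν / A := Real.exp_log (by positivity)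
  have hexpℓ' : Real.exp (-ℓ) = A * z ^ (-ν) := by
    rw [Real.exp_neg, hexpℓ, Real.rpow_neg hz.le]
    field_simp
  -- The value y/(2B) minimizes the Gaussian exponent h²B - hy; the cap ℓ/z keeps e^{hz} z^{-ν} A
  -- below 1.
  set h := min (ℓ / z) (y / (2 * B)) with hh_def
  have hh : 0 < h := lt_min (by positivity) (by positivity)
  have hhz : h * z ≤ ℓ := by
    have := min_le_left (ℓ / z) (y / (2 * B))
    rw [← hh_def, le_div_iff₀ hz] at this
    exact this
  -- A ramp from 0 at y to 1 at 2y: it dominates the indicator of the tail event, has slope 1/y, and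
  -- lies below e^{h(s - y)}.
  set F : ℝ → ℝ := fun s => max 0 (min 1 ((s - y) * y⁻¹)) with hF_def
  have hF0 : ∀ x, 0 ≤ F x := fun x => le_max_left _ _
  have hF1 : ∀ x, F x ≤ 1 := fun x => max_le zero_le_one (min_le_left _ _)
  have hFl : ∀ x x', |F x - F x'| ≤ y⁻¹ * |x - x'| := by
    intro x x'
    have h1 : |F x - F x'| ≤ |min 1 ((x - y) * y⁻¹) - min 1 ((x' - y) * y⁻¹)| := by
      have := abs_max_sub_max_le_abs (min 1 ((x - y) * y⁻¹)) (min 1 ((x' - y) * y⁻¹)) 0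
      simpa only [hF_def, max_comm (0 : ℝ)] using this
    have h2 := abs_min_sub_min_le_max 1 ((x - y) * y⁻¹) 1 ((x' - y) * y⁻¹)
    rw [sub_self, abs_zero, max_eq_right (abs_nonneg _), ← sub_mul, abs_mul,
      abs_of_pos (inv_pos.2 hy), sub_sub_sub_cancel_right] at h2
    exact h1.trans (h2.trans_eq (mul_comm _ _))
  have hFe : ∀ s, F s ≤ 0 + Real.exp (-(h * y)) * Real.exp (h * s) := by
    intro s
    rw [zero_add, ← Real.exp_add]
    rcases le_or_gt s y with hs | hs
    · have : F s = 0 := by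
        apply max_eq_left
        exact (min_le_right _ _).trans
          (mul_nonpos_of_nonpos_of_nonneg (by linarith) (inv_pos.2 hy).le)
      rw [this]
      positivity
    · refine (hF1 s).trans (Real.one_le_exp ?_)
      nlinarith
  have hmain := integral_le_of_replacement μ hV (z := z) hh.le hrep n F 0 (Real.exp (-(h * y)))
    le_rfl (Real.exp_pos _).le hF0 hF1 hFl hFe
  have hFm := measurable_of_lipschitz_abs hFl
  have hSm : Measurable fun ω => ∑ i ∈ Finset.range n, V i ω := by fun_prop
  have hP : μ.real {ω | 2 * y ≤ ∑ i ∈ Finset.range n, V i ω}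
      ≤ ∫ ω, F (∑ i ∈ Finset.range n, V i ω) ∂μ := by
    have hset : MeasurableSet {ω | 2 * y ≤ ∑ i ∈ Finset.range n, V i ω} :=
      measurableSet_le measurable_const hSm
    have h1 : μ.real {ω | 2 * y ≤ ∑ i ∈ Finset.range n, V i ω}
        = ∫ ω, Set.indicator {ω | 2 * y ≤ ∑ i ∈ Finset.range n, V i ω} (fun _ => (1 : ℝ)) ω ∂μ := by
      rw [integral_indicator_const _ hset]
      simp
    rw [h1]
    refine integral_mono ((integrable_const _).indicator hset)
      (integrable_of_mem_Icc (hFm.comp hSm) (fun _ => hF0 _) (fun _ => hF1 _)) fun ω => ?_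
    by_cases hω : 2 * y ≤ ∑ i ∈ Finset.range n, V i ω
    · rw [Set.indicator_of_mem (by exact hω)]
      refine le_max_of_le_right (le_min le_rfl ?_)
      rw [← div_eq_mul_inv, one_le_div hy]
      linarith
    · rw [Set.indicator_of_notMem (by exact hω)]
      exact hF0 _
  have htail : ∑ i ∈ Finset.range n, μ.real {ω | z < V i ω} ≤ A * z ^ (-ν) := by
    have h1 : ∀ i, μ.real {ω | z < V i ω} ≤ (∫ ω, |V i ω| ^ ν ∂μ) * z ^ (-ν) := by
      intro i
      have h2 := mul_meas_ge_le_integral_of_nonneg (μ := μ)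
        (Eventually.of_forall fun ω => Real.rpow_nonneg (abs_nonneg (V i ω)) ν) (hVν i) (z ^ ν)
      have h3 : μ.real {ω | z < V i ω} ≤ μ.real {ω | z ^ ν ≤ |V i ω| ^ ν} := by
        refine measureReal_mono fun ω hω => ?_
        have hω' : z < V i ω := hω
        exact Real.rpow_le_rpow hz.le (hω'.le.trans (le_abs_self _)) hν.le
      rw [Real.rpow_neg hz.le, ← div_eq_mul_inv, le_div_iff₀ (by positivity)]
      calc _ ≤ μ.real {ω | z ^ ν ≤ |V i ω| ^ ν} * z ^ ν :=
            mul_le_mul_of_nonneg_right h3 (by positivity)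
        _ ≤ _ := by rw [mul_comm]; exact h2
    refine (Finset.sum_le_sum fun i _ => h1 i).trans ?_
    rw [← Finset.sum_mul]
    exact mul_le_mul_of_nonneg_right hsumA (by positivity)
  have hprod : ∏ i ∈ Finset.range n, ∫ ω, Real.exp (h * min (V i ω) z) ∂μ
      ≤ Real.exp (h ^ 2 * B + (Real.exp 1 * h ^ ν + Real.exp (h * z) * z ^ (-ν)) * A) := by
    refine (Finset.prod_le_prod (fun i _ => integral_nonneg fun _ => (Real.exp_pos _).le)
      fun i _ => integral_exp_mul_min_le μ hν hh hz (hV1 i) (hV2 i) (hVν i) (hV0 i)).trans ?_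
    rw [← Real.exp_sum, Finset.sum_add_distrib, ← Finset.mul_sum, ← Finset.mul_sum]
    gcongr
  have hc1 : Real.exp (h * z) * z ^ (-ν) * A ≤ 1 := by
    calc _ ≤ Real.exp ℓ * z ^ (-ν) * A := by gcongr
      _ = 1 := by
        rw [mul_assoc, mul_comm (z ^ (-ν)) A, ← hexpℓ', ← Real.exp_add, add_neg_cancel,
          Real.exp_zero]
  -- Since h ≤ ℓ/z, the left side is at most ℓ^ν e^{-ℓ}, which is bounded in ℓ.
  have hc2 : h ^ ν * A ≤ ν ^ ν := by
    have h1 : h ≤ ℓ / z := min_le_left _ _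
    have h2 : h ^ ν * A ≤ ℓ ^ ν * Real.exp (-ℓ) := by
      calc h ^ ν * A ≤ (ℓ / z) ^ ν * A := by gcongr
        _ = ℓ ^ ν * (A * z ^ (-ν)) := by
          rw [Real.div_rpow hℓ.le hz.le, Real.rpow_neg hz.le]
          field_simp
        _ = _ := by rw [hexpℓ']
    have h3 : ℓ ^ ν ≤ ν ^ ν * Real.exp ℓ := by
      have h4 : ℓ / ν ≤ Real.exp (ℓ / ν) := by linarith [Real.add_one_le_exp (ℓ / ν)]
      have h5 : (ℓ / ν) ^ ν ≤ Real.exp (ℓ / ν) ^ ν :=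
        Real.rpow_le_rpow (by positivity) h4 hν.le
      rw [Real.div_rpow hℓ.le hν.le, ← Real.exp_mul, div_mul_cancel₀ _ hν.ne',
        div_le_iff₀ (by positivity), mul_comm] at h5
      exact h5
    calc _ ≤ ℓ ^ ν * Real.exp (-ℓ) := h2
      _ ≤ ν ^ ν * Real.exp ℓ * Real.exp (-ℓ) := by gcongr
      _ = ν ^ ν := by rw [mul_assoc, ← Real.exp_add, add_neg_cancel, Real.exp_zero, mul_one]
  have hexpo : Real.exp (-(h * y)) * Real.exp (h ^ 2 * B
      + (Real.exp 1 * h ^ ν + Real.exp (h * z) * z ^ (-ν)) * A)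
      ≤ E₀ * (A * z ^ (-ν) + Real.exp (-(y ^ 2 / (4 * B)))) := by
    have h1 : Real.exp (-(h * y)) * Real.exp (h ^ 2 * B
        + (Real.exp 1 * h ^ ν + Real.exp (h * z) * z ^ (-ν)) * A)
        ≤ E₀ * Real.exp (-(h * y) + h ^ 2 * B) := by
      rw [hE₀, ← Real.exp_add, ← Real.exp_add]
      apply Real.exp_le_exp.2
      have := mul_le_mul_of_nonneg_left hc2 (Real.exp_pos 1).le
      linarith
    refine h1.trans (mul_le_mul_of_nonneg_left ?_ hE₀pos.le)
    rcases le_total (ℓ / z) (y / (2 * B)) with hc | hc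
    · have he : h = ℓ / z := min_eq_left hc
      have h2 : h * B ≤ y / 2 := by
        rw [he]
        calc ℓ / z * B ≤ y / (2 * B) * B := by gcongr
          _ = y / 2 := by field_simp
      have h3 : h * y = 2 * ℓ := by
        rw [he, hz_def]
        field_simp
      have h4 : -(h * y) + h ^ 2 * B ≤ -ℓ := by nlinarith
      have := Real.exp_le_exp.2 h4
      rw [hexpℓ'] at this
      linarith [Real.exp_pos (-(y ^ 2 / (4 * B)))]
    · have he : h = y / (2 * B) := min_eq_right hc
      have h2 : -(h * y) + h ^ 2 * B = -(y ^ 2 / (4 * B)) := by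
        rw [he]
        field_simp
        ring
      rw [h2]
      have : 0 ≤ A * z ^ (-ν) := by positivity
      linarith
  have hfin := (mul_le_mul_of_nonneg_left hprod (Real.exp_pos (-(h * y))).le).trans hexpo
  set e := Real.exp (-(y ^ 2 / (4 * B)))
  have he0 : 0 < e := Real.exp_pos _
  rw [hzν] at hfin htail
  have hx0 : 0 ≤ A * y ^ (-ν) := by positivity
  have : A * (2 ^ ν * y ^ (-ν)) + E₀ * (A * (2 ^ ν * y ^ (-ν)) + e)
      ≤ 2 ^ ν * (1 + E₀) * (A * y ^ (-ν) + e) := by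
    have h1 : E₀ * e ≤ 2 ^ ν * (E₀ * e) := le_mul_of_one_le_left (by positivity) h2ν
    have h2 : 0 ≤ 2 ^ ν * e := by positivity
    nlinarith
  linarith

end Laplace

/-! ### Covariance inequality for τ-mixing sequences, and blocks of time points. -/

section FukNagaev

variable {Ω : Type*} [MeasurableSpace Ω]

lemma abs_integral_sub_le_tauMixing (μ : Measure Ω) [IsProbabilityMeasure μ] {ξ : ℤ → Ω → ℝ}
    (hξ : ∀ t, Measurable (ξ t)) {t : ℤ} {k : ℕ} {s : Finset ℤ} (hs : ∀ i ∈ s, t + k ≤ i)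
    {δ : ℝ} (hδ : 0 ≤ δ) (hτ : tauMixing μ ξ k ≤ ENNReal.ofReal δ)
    {Z : Ω → ℝ} (hZ : Measurable[past ξ t] Z) {ψ : ℝ → ℝ → ℝ}
    (hψ : Measurable (Function.uncurry ψ)) {L : ℝ} (hL : 0 < L)
    (hlip : ∀ z x y, |ψ z x - ψ z y| ≤ L * |x - y|)
    (hint : Integrable (fun ω => ψ (Z ω) (∑ i ∈ s, ξ i ω)) μ)
    (hint' : Integrable (fun w : Ω × Ω => ψ (Z w.1) (∑ i ∈ s, ξ i w.2)) (μ.prod μ)) :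
    |(∫ ω, ψ (Z ω) (∑ i ∈ s, ξ i ω) ∂μ) - ∫ ω, ∫ ω', ψ (Z ω) (∑ i ∈ s, ξ i ω') ∂μ ∂μ|
      ≤ L * (s.card * δ) := by
  have h := enorm_integral_sub_le_tauMixing μ hξ hs hZ hψ hL hlip hint hint'
  have h2 : ENNReal.ofReal L * (s.card * tauMixing μ ξ k) ≤ ENNReal.ofReal (L * (s.card * δ)) := by
    rw [ENNReal.ofReal_mul hL.le, ENNReal.ofReal_mul (Nat.cast_nonneg _), ENNReal.ofReal_natCast]
    gcongr
  have h3 := h.trans h2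
  rw [Real.enorm_eq_ofReal_abs] at h3
  exact (ENNReal.ofReal_le_ofReal_iff (by positivity)).1 h3

lemma memLp_of_eLpNorm_le {μ : Measure Ω} {X : Ω → ℝ} {p : ℝ≥0∞} {C : ℝ} (hX : Measurable X)
    (h : eLpNorm X p μ ≤ ENNReal.ofReal C) : MemLp X p μ :=
  ⟨hX.aestronglyMeasurable, h.trans_lt ENNReal.ofReal_lt_top⟩

lemma integral_abs_rpow_le {μ : Measure Ω} {X : Ω → ℝ} {ν C : ℝ} (hν : 0 < ν) (hC : 0 ≤ C)
    (hX : Measurable X) (h : eLpNorm X (ENNReal.ofReal ν) μ ≤ ENNReal.ofReal C) :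
    Integrable (fun ω => |X ω| ^ ν) μ ∧ ∫ ω, |X ω| ^ ν ∂μ ≤ C ^ ν := by
  have hm := memLp_of_eLpNorm_le hX h
  have h0 : ENNReal.ofReal ν ≠ 0 := by simpa using hν
  have hi := hm.integrable_norm_rpow h0 ENNReal.ofReal_ne_top
  rw [ENNReal.toReal_ofReal hν.le] at hi
  refine ⟨hi, ?_⟩
  rw [hm.eLpNorm_eq_integral_rpow_norm h0 ENNReal.ofReal_ne_top, ENNReal.toReal_ofReal hν.le,
    ENNReal.ofReal_le_ofReal_iff hC] at h
  have hnn : 0 ≤ ∫ ω, ‖X ω‖ ^ ν ∂μ := integral_nonneg fun _ => by positivity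
  have := Real.rpow_le_rpow (by positivity) h hν.le
  rwa [← Real.rpow_mul hnn, inv_mul_cancel₀ hν.ne', Real.rpow_one] at this

lemma eLpNorm_sub_integral_le {μ : Measure Ω} [IsProbabilityMeasure μ] {X : Ω → ℝ} {ν C : ℝ}
    (hν : 1 ≤ ν) (hC : 0 ≤ C) (hX : Measurable X)
    (h : eLpNorm X (ENNReal.ofReal ν) μ ≤ ENNReal.ofReal C) :
    eLpNorm (fun ω => X ω - ∫ ω', X ω' ∂μ) (ENNReal.ofReal ν) μ ≤ ENNReal.ofReal (2 * C) := by
  have h1 : (1 : ℝ≥0∞) ≤ ENNReal.ofReal ν := by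
    rw [← ENNReal.ofReal_one]; exact ENNReal.ofReal_le_ofReal hν
  have h2 : ‖∫ ω', X ω' ∂μ‖ₑ ≤ ENNReal.ofReal C := by
    refine (enorm_integral_le_lintegral_enorm _).trans ?_
    rw [← eLpNorm_one_eq_lintegral_enorm]
    exact (eLpNorm_le_eLpNorm_of_exponent_le h1 hX.aestronglyMeasurable).trans h
  have h3 : eLpNorm (fun _ : Ω => ∫ ω', X ω' ∂μ) (ENNReal.ofReal ν) μ ≤ ENNReal.ofReal C := by
    rw [eLpNorm_const _ (by positivity) (IsProbabilityMeasure.ne_zero μ)]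
    simpa using h2
  refine (eLpNorm_sub_le hX.aestronglyMeasurable aestronglyMeasurable_const h1).trans ?_
  rw [two_mul, ENNReal.ofReal_add hC hC]
  exact add_le_add h h3

lemma mul_abs_le_of_lt {ν N x y : ℝ} (hν : 2 ≤ ν) (hN : 0 < N) (hx : N < |x|) :
    |x| * |y| ≤ N ^ (2 - ν) * (|x| ^ ν + |y| ^ ν) := by
  have key : ∀ u : ℝ, N < u → u ^ 2 ≤ N ^ (2 - ν) * u ^ ν := by
    intro u hu
    have hu0 : 0 < u := hN.trans hu
    have h1 : u ^ (2 - ν) ≤ N ^ (2 - ν) :=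
      Real.rpow_le_rpow_of_nonpos hN hu.le (by linarith)
    calc u ^ 2 = u ^ (2 - ν) * u ^ ν := by
          rw [← Real.rpow_add hu0, sub_add_cancel, Real.rpow_two]
      _ ≤ _ := by gcongr
  have hN2 : 0 ≤ N ^ (2 - ν) := by positivity
  rcases le_total |y| |x| with h | h
  · have h2 : 0 ≤ N ^ (2 - ν) * |y| ^ ν := by positivity
    nlinarith [key _ hx, abs_nonneg x]
  · have h2 : 0 ≤ N ^ (2 - ν) * |x| ^ ν := by positivity
    nlinarith [key _ (hx.trans_le h), abs_nonneg y]

/-- The covariance inequality for `τ`-mixing processes with moments of order `ν > 2`. -/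
lemma abs_integral_mul_le_of_tauMixing (μ : Measure Ω) [IsProbabilityMeasure μ] {ξ : ℤ → Ω → ℝ}
    (hξ : ∀ t, Measurable (ξ t)) {ν a c D : ℝ} (hν : 2 < ν) (hc : 0 ≤ c) {m : ℤ → ℝ}
    (hi : ∀ t, Integrable (ξ t) μ) (hm : ∀ t, m t = ∫ ω, ξ t ω ∂μ)
    (hν1 : ∀ t, Integrable (fun ω => |ξ t ω - m t| ^ ν) μ)
    (h2 : ∀ s t, Integrable (fun ω => (ξ s ω - m s) * (ξ t ω - m t)) μ)
    (hD : ∀ t, ∫ ω, |ξ t ω - m t| ^ ν ∂μ ≤ D) {k : ℕ} (hk : 1 ≤ k)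
    (hτ : tauMixing μ ξ k ≤ ENNReal.ofReal (c * (k : ℝ) ^ (-a))) {s t : ℤ} (hst : s + k ≤ t) :
    |∫ ω, (ξ s ω - m s) * (ξ t ω - m t) ∂μ|
      ≤ (c + 2 * D) * (k : ℝ) ^ (-(a * (ν - 2) / (ν - 1))) := by
  have hk0 : (0 : ℝ) < k := by exact_mod_cast hk
  -- One factor is truncated at N so that the product is N-Lipschitz in the later variable.
  -- Replacement costs N k^{-a} and truncation N^{2-ν}; this choice of N makes the two equal.
  set N : ℝ := (k : ℝ) ^ (a / (ν - 1)) with hN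
  have hN0 : 0 < N := by positivity
  set φ : ℝ → ℝ := fun z => max (-N) (min (z - m s) N) with hφ
  have hφm : Measurable φ := by fun_prop
  have hφb : ∀ z, |φ z| ≤ N := fun z =>
    abs_le.2 ⟨le_max_left _ _, max_le (by linarith) (min_le_right _ _)⟩
  have hit : Integrable (fun ω => ξ t ω - m t) μ := (hi t).sub (integrable_const _)
  have hi1 : Integrable (fun ω => φ (ξ s ω) * (ξ t ω - m t)) μ :=
    hit.bdd_mul (c := N) (hφm.comp (hξ s)).aestronglyMeasurable
      (Eventually.of_forall fun ω => hφb _)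
  have hfirst : |∫ ω, φ (ξ s ω) * (ξ t ω - m t) ∂μ| ≤ N * (c * (k : ℝ) ^ (-a)) := by
    have h := abs_integral_sub_le_tauMixing μ hξ (t := s) (k := k) (s := {t})
      (by simpa using hst) (δ := c * (k : ℝ) ^ (-a)) (by positivity) hτ (Z := ξ s)
      (measurable_past le_rfl) (ψ := fun z x => φ z * (x - m t))
      (by
        have : Measurable fun w : ℝ × ℝ => φ w.1 * (w.2 - m t) := by fun_prop
        exact this) hN0
      (fun z x y => by
        rw [← mul_sub, abs_mul, sub_sub_sub_cancel_right]
        exact mul_le_mul_of_nonneg_right (hφb z) (abs_nonneg _))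
      (by simpa using hi1)
      (by
        simp only [Finset.sum_singleton]
        refine Integrable.mul_prod (f := fun ω => φ (ξ s ω)) ?_ hit
        exact Integrable.of_bound (hφm.comp (hξ s)).aestronglyMeasurable N
          (Eventually.of_forall fun ω => hφb _))
    have h0 : ∫ ω', (ξ t ω' - m t) ∂μ = 0 := by
      rw [integral_sub (hi t) (integrable_const _), hm t]
      simp
    simpa [integral_const_mul, h0] using h
  have hsecond : |∫ ω, (ξ s ω - m s - φ (ξ s ω)) * (ξ t ω - m t) ∂μ| ≤ N ^ (2 - ν) * (2 * D) := by
    refine abs_integral_le_integral_abs.trans ?_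
    have hpt : ∀ ω, |(ξ s ω - m s - φ (ξ s ω)) * (ξ t ω - m t)|
        ≤ N ^ (2 - ν) * (|ξ s ω - m s| ^ ν + |ξ t ω - m t| ^ ν) := by
      intro ω
      rw [abs_mul]
      by_cases hω : N < |ξ s ω - m s|
      · refine le_trans ?_ (mul_abs_le_of_lt hν.le hN0 hω)
        refine mul_le_mul_of_nonneg_right ?_ (abs_nonneg _)
        simp only [hφ]
        rcases le_total 0 (ξ s ω - m s) with h | h
        · rw [abs_of_nonneg h] at hω ⊢
          rw [min_eq_right hω.le, max_eq_right (by linarith), abs_of_pos (by linarith)]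
          linarith
        · rw [abs_of_nonpos h] at hω ⊢
          rw [min_eq_left (by linarith), max_eq_left (by linarith), abs_of_neg (by linarith)]
          linarith
      · have h1 := abs_le.1 (not_lt.1 hω)
        have : φ (ξ s ω) = ξ s ω - m s := by
          simp only [hφ]
          rw [min_eq_left h1.2, max_eq_right h1.1]
        rw [this, sub_self, abs_zero, zero_mul]
        positivity
    have hib : Integrable (fun ω => N ^ (2 - ν) * (|ξ s ω - m s| ^ ν + |ξ t ω - m t| ^ ν)) μ :=
      ((hν1 s).add (hν1 t)).const_mul _
    refine (integral_mono_of_nonneg (Eventually.of_forall fun _ => abs_nonneg _) hib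
      (Eventually.of_forall hpt)).trans ?_
    rw [integral_const_mul, integral_add (hν1 s) (hν1 t)]
    have := hD s
    have := hD t
    gcongr
    linarith
  have hsplit : ∫ ω, (ξ s ω - m s) * (ξ t ω - m t) ∂μ = ∫ ω, φ (ξ s ω) * (ξ t ω - m t) ∂μ
      + ∫ ω, (ξ s ω - m s - φ (ξ s ω)) * (ξ t ω - m t) ∂μ := by
    have hi2 : Integrable (fun ω => (ξ s ω - m s - φ (ξ s ω)) * (ξ t ω - m t)) μ := by
      have := (h2 s t).sub hi1
      refine this.congr (Eventually.of_forall fun ω => ?_)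
      simp only [Pi.sub_apply]
      ring
    rw [← integral_add hi1 hi2]
    congr 1 with ω
    ring
  have hν1' : ν - 1 ≠ 0 := by linarith
  have e1 : N * (k : ℝ) ^ (-a) = (k : ℝ) ^ (-(a * (ν - 2) / (ν - 1))) := by
    rw [hN, ← Real.rpow_add hk0]
    congr 1
    field_simp
    ring
  have e2 : N ^ (2 - ν) = (k : ℝ) ^ (-(a * (ν - 2) / (ν - 1))) := by
    rw [hN, ← Real.rpow_mul hk0.le]
    congr 1
    field_simp
    ring
  rw [hsplit]
  refine (abs_add_le _ _).trans ((add_le_add hfirst hsecond).trans (le_of_eq ?_))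
  rw [e2, ← e1]
  ring

lemma sum_range_two_mul {M : Type*} [AddCommMonoid M] (f : ℕ → M) (n : ℕ) :
    ∑ m ∈ Finset.range (2 * n), f m = ∑ i ∈ Finset.range n, (f (2 * i) + f (2 * i + 1)) := by
  induction n with
  | zero => simp
  | succ n ih =>
    rw [Nat.mul_succ, Finset.sum_range_succ, Finset.sum_range_succ, ih, Finset.sum_range_succ,
      add_assoc]

/-- The `m`-th block of length `J` in `{1, …, T}`. -/
noncomputable def timeBlock (T J m : ℕ) : Finset ℤ :=
  (Finset.Icc (1 : ℤ) T).filter fun t => ((t - 1) / (J : ℤ)).toNat = m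

lemma mem_timeBlock {T J m : ℕ} (hJ : 0 < J) {t : ℤ} (ht : t ∈ timeBlock T J m) :
    (m : ℤ) * J + 1 ≤ t ∧ t ≤ ((m : ℤ) + 1) * J := by
  simp only [timeBlock, Finset.mem_filter, Finset.mem_Icc] at ht
  obtain ⟨⟨h1, -⟩, h2⟩ := ht
  have hJ' : (0 : ℤ) < J := by exact_mod_cast hJ
  have h0 : 0 ≤ (t - 1) / (J : ℤ) := Int.ediv_nonneg (by linarith) hJ'.le
  have h3 : (t - 1) / (J : ℤ) = m := by omega
  have h4 := Int.ediv_mul_le (t - 1) hJ'.ne'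
  have h5 := Int.lt_ediv_add_one_mul_self (t - 1) hJ'
  rw [h3] at h4 h5
  constructor <;> linarith

lemma card_timeBlock_le {T J m : ℕ} (hJ : 0 < J) : (timeBlock T J m).card ≤ J := by
  have : timeBlock T J m ⊆ Finset.Icc ((m : ℤ) * J + 1) (((m : ℤ) + 1) * J) := fun t ht =>
    Finset.mem_Icc.2 (mem_timeBlock hJ ht)
  refine (Finset.card_le_card this).trans ?_
  rw [Int.card_Icc]
  have : ((m : ℤ) + 1) * J + 1 - (m * J + 1) = J := by ring
  rw [this, Int.toNat_natCast]

/-- There are more blocks in the range than can be non-empty. Their number is even so that they can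
be split by parity. -/
lemma sum_timeBlock {M : Type*} [AddCommMonoid M] (f : ℤ → M) {T J : ℕ} :
    ∑ t ∈ Finset.Icc (1 : ℤ) T, f t = ∑ m ∈ Finset.range (2 * T), ∑ t ∈ timeBlock T J m, f t := by
  refine (Finset.sum_fiberwise_of_maps_to ?_ _).symm
  intro t ht
  rw [Finset.mem_Icc] at ht
  rw [Finset.mem_range]
  have : (t - 1) / (J : ℤ) ≤ t - 1 := Int.ediv_le_self _ (by linarith)
  omega

end FukNagaev

/-! ### Block variances and the Fuk–Nagaev inequality. -/

section FukNagaev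

variable {Ω : Type*} [MeasurableSpace Ω]

/-- Block sums of a `τ`-mixing process have variances of the order of the block length. -/
lemma exists_integral_sq_sum_le {ν a c D : ℝ} (hν : 2 < ν) (ha : (ν - 1) / (ν - 2) < a)
    (hc : 0 ≤ c) (hD0 : 0 ≤ D) : ∃ B : ℝ, 0 < B ∧
    ∀ {Ω : Type*} [MeasurableSpace Ω] (μ : Measure Ω) [IsProbabilityMeasure μ] (ξ : ℤ → Ω → ℝ)
      (m : ℤ → ℝ), (∀ t, Measurable (ξ t)) → (∀ t, Integrable (ξ t) μ) →
      (∀ t, m t = ∫ ω, ξ t ω ∂μ) → (∀ t, Integrable (fun ω => |ξ t ω - m t| ^ ν) μ) →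
      (∀ s t, Integrable (fun ω => (ξ s ω - m s) * (ξ t ω - m t)) μ) →
      (∀ t, ∫ ω, |ξ t ω - m t| ^ ν ∂μ ≤ D) →
      (∀ k : ℕ, 1 ≤ k → tauMixing μ ξ k ≤ ENNReal.ofReal (c * (k : ℝ) ^ (-a))) →
      ∀ s : Finset ℤ, ∫ ω, (∑ t ∈ s, (ξ t ω - m t)) ^ 2 ∂μ ≤ B * s.card := by
  have hν2 : 0 < ν - 2 := by linarith
  have hν1 : 0 < ν - 1 := by linarith
  -- The decay exponent of the covariances; the lower bound on a says precisely that ρ > 1, so that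
  -- the covariances are summable over lags.
  set ρ := a * (ν - 2) / (ν - 1) with hρ_def
  have hρ : 1 < ρ := by
    rw [div_lt_iff₀ hν2] at ha
    rw [hρ_def, lt_div_iff₀ hν1]
    linarith
  -- A summable majorant of the covariance at lag j. At lag 0 it uses x² ≤ 1 + |x|^ν.
  let H : ℤ → ℝ := fun j => (if j = 0 then 1 + D else 0) + (c + 2 * D) * |(j : ℝ)| ^ (-ρ)
  have hH0 : ∀ j, 0 ≤ H j := fun j => by
    have : 0 ≤ (if j = 0 then 1 + D else 0) := by split_ifs <;> positivity
    positivity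
  have hHs : Summable H := by
    refine Summable.add ?_ ((Real.summable_abs_int_rpow hρ).mul_left _)
    exact summable_of_ne_finset_zero (s := {0}) fun j hj => by
      simp only [Finset.mem_singleton] at hj
      simp [hj]
  refine ⟨∑' j, H j + 1, add_pos_of_nonneg_of_pos (tsum_nonneg hH0) one_pos, ?_⟩
  intro Ω _ μ _ ξ m hξ hi hm hi1 h2 hD hτ s
  have hpair : ∀ u v : ℤ, ∫ ω, (ξ u ω - m u) * (ξ v ω - m v) ∂μ ≤ H (v - u) := by
    intro u v
    rcases lt_trichotomy u v with huv | huv | huv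
    · have h := abs_integral_mul_le_of_tauMixing μ hξ hν hc hi hm hi1 h2 hD
        (k := (v - u).toNat) (by omega) (hτ _ (by omega)) (s := u) (t := v) (by omega)
      have h3 : (((v - u).toNat : ℕ) : ℝ) = |((v - u : ℤ) : ℝ)| := by
        rw [abs_of_pos (by exact_mod_cast sub_pos.2 huv)]
        exact_mod_cast Int.toNat_of_nonneg (by omega)
      rw [h3] at h
      refine (le_abs_self _).trans (h.trans ?_)
      simp only [H]
      have : 0 ≤ (if v - u = 0 then 1 + D else 0) := by split_ifs <;> positivity
      linarith
    · subst huv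
      simp only [H, sub_self]
      have h4 : ∫ ω, (ξ u ω - m u) * (ξ u ω - m u) ∂μ ≤ 1 + D := by
        have h5 : ∀ x : ℝ, x * x ≤ 1 + |x| ^ ν := by
          intro x
          rcases le_total |x| 1 with hx | hx
          · have : 0 ≤ |x| ^ ν := by positivity
            nlinarith [abs_mul_abs_self x, abs_nonneg x]
          · have : |x| ^ (2 : ℝ) ≤ |x| ^ ν := Real.rpow_le_rpow_of_exponent_le hx hν.le
            rw [Real.rpow_two, sq_abs] at this
            nlinarith
        have h6 := integral_mono (h2 u u) ((integrable_const (1 : ℝ)).add (hi1 u))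
          (fun ω => h5 _)
        rw [integral_add' (integrable_const _) (hi1 u)] at h6
        simp only [integral_const, probReal_univ, one_smul] at h6
        linarith [hD u]
      have : 0 ≤ (c + 2 * D) * |((0 : ℤ) : ℝ)| ^ (-ρ) := by positivity
      simpa using h4.trans (le_add_of_nonneg_right this)
    · have h := abs_integral_mul_le_of_tauMixing μ hξ hν hc hi hm hi1 h2 hD
        (k := (u - v).toNat) (by omega) (hτ _ (by omega)) (s := v) (t := u) (by omega)
      have h3 : (((u - v).toNat : ℕ) : ℝ) = |((v - u : ℤ) : ℝ)| := by
        rw [abs_of_neg (by exact_mod_cast sub_neg.2 huv)]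
        have : (((u - v).toNat : ℤ) : ℝ) = ((u - v : ℤ) : ℝ) := by
          rw [Int.toNat_of_nonneg (by omega)]
        push_cast at this ⊢
        linarith
      rw [h3] at h
      have h7 : ∫ ω, (ξ u ω - m u) * (ξ v ω - m v) ∂μ
          = ∫ ω, (ξ v ω - m v) * (ξ u ω - m u) ∂μ := by
        congr 1 with ω; ring
      rw [h7]
      refine (le_abs_self _).trans (h.trans ?_)
      simp only [H]
      have : 0 ≤ (if v - u = 0 then 1 + D else 0) := by split_ifs <;> positivity
      linarith
  have hexp : ∫ ω, (∑ t ∈ s, (ξ t ω - m t)) ^ 2 ∂μ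
      = ∑ u ∈ s, ∑ v ∈ s, ∫ ω, (ξ u ω - m u) * (ξ v ω - m v) ∂μ := by
    simp_rw [sq, Finset.sum_mul_sum]
    rw [integral_finsetSum _ fun u _ => integrable_finsetSum _ fun v _ => h2 u v]
    refine Finset.sum_congr rfl fun u _ => ?_
    rw [integral_finsetSum _ fun v _ => h2 u v]
  rw [hexp]
  have hrow : ∀ u ∈ s, ∑ v ∈ s, ∫ ω, (ξ u ω - m u) * (ξ v ω - m v) ∂μ ≤ ∑' j, H j + 1 := by
    intro u _
    have h8 : ∑ v ∈ s, H (v - u) ≤ ∑' j, H j := by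
      have : ∑ v ∈ s, H (v - u) = ∑ j ∈ s.map (Equiv.subRight u).toEmbedding, H j := by
        rw [Finset.sum_map]
        rfl
      rw [this]
      exact hHs.sum_le_tsum _ fun j _ => hH0 j
    linarith [Finset.sum_le_sum fun v (_ : v ∈ s) => hpair u v]
  refine (Finset.sum_le_sum hrow).trans (le_of_eq ?_)
  rw [Finset.sum_const, nsmul_eq_mul, mul_comm]

lemma measurable_block_sum {ξ : ℤ → Ω → ℝ} (hξ : ∀ t, Measurable (ξ t)) (s : Finset ℤ)
    (m : ℤ → ℝ) (e : ℝ) : Measurable fun ω => e * ∑ t ∈ s, (ξ t ω - m t) := by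
  fun_prop

/-- The tail bound for the sum over the blocks of one parity. -/
lemma measureReal_parity_le {ν a c D B y : ℝ} (hν : 2 < ν) (hc : 0 ≤ c) (hD : 0 < D) (hB : 0 < B)
    (hy : 0 < y) (μ : Measure Ω) [IsProbabilityMeasure μ] {ξ : ℤ → Ω → ℝ} {m : ℤ → ℝ}
    (hξ : ∀ t, Measurable (ξ t)) (hmom : ∀ t, eLpNorm (fun ω => ξ t ω - m t) (ENNReal.ofReal ν) μ
      ≤ ENNReal.ofReal D) (hcent : ∀ t, ∫ ω, (ξ t ω - m t) ∂μ = 0)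
    (hvar : ∀ s : Finset ℤ, ∫ ω, (∑ t ∈ s, (ξ t ω - m t)) ^ 2 ∂μ ≤ B * s.card)
    {J T : ℕ} (hJ : 0 < J) (hT : 0 < T)
    (hτ : tauMixing μ ξ J ≤ ENNReal.ofReal (c * (J : ℝ) ^ (-a))) {π : ℕ} (hπ : π < 2) {e : ℝ}
    (he : |e| = 1) :
    μ.real {ω | 2 * y ≤ ∑ i ∈ Finset.range T, e * ∑ t ∈ timeBlock T J (2 * i + π), (ξ t ω - m t)}
      ≤ 2 ^ ν * (1 + Real.exp (1 + Real.exp 1 * ν ^ ν)) *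
        (D ^ ν * (J : ℝ) ^ (ν - 1) * T * y ^ (-ν) + Real.exp (-(y ^ 2 / (4 * (B * T)))))
        + y⁻¹ * (T * (c * (J : ℝ) ^ (-a))) := by
  have hν0 : 0 < ν := by linarith
  have hJr : (0 : ℝ) < J := by exact_mod_cast hJ
  have hTr : (0 : ℝ) < T := by exact_mod_cast hT
  set b : ℕ → Finset ℤ := fun i => timeBlock T J (2 * i + π) with hb
  set V : ℕ → Ω → ℝ := fun i ω => e * ∑ t ∈ b i, (ξ t ω - m t) with hV_def
  have hVm : ∀ i, Measurable (V i) := fun i => measurable_block_sum hξ _ _ _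
  have hmem : ∀ t, MemLp (fun ω => ξ t ω - m t) (ENNReal.ofReal ν) μ := fun t =>
    memLp_of_eLpNorm_le (by have := hξ t; fun_prop) (hmom t)
  have h1ν : (1 : ℝ≥0∞) ≤ ENNReal.ofReal ν := by
    rw [← ENNReal.ofReal_one]; exact ENNReal.ofReal_le_ofReal (by linarith)
  have h2ν : (2 : ℝ≥0∞) ≤ ENNReal.ofReal ν := by
    rw [← ENNReal.ofReal_ofNat]; exact ENNReal.ofReal_le_ofReal (by linarith)
  have hVmem : ∀ i, MemLp (V i) (ENNReal.ofReal ν) μ := fun i =>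
    (memLp_finsetSum _ fun t _ => hmem t).const_mul _
  have hVnorm : ∀ i, eLpNorm (V i) (ENNReal.ofReal ν) μ
      ≤ ENNReal.ofReal ((b i).card * D) := by
    intro i
    have h3 : V i = e • ∑ t ∈ b i, fun ω => ξ t ω - m t := by
      ext ω
      simp [hV_def, Finset.sum_apply]
    have h4 : ‖e‖ₑ = 1 := by rw [Real.enorm_eq_ofReal_abs, he, ENNReal.ofReal_one]
    rw [h3, eLpNorm_const_smul, h4, one_mul]
    refine (eLpNorm_sum_le (fun t _ => (hmem t).1) h1ν).trans ?_
    refine (Finset.sum_le_sum fun t _ => hmom t).trans (le_of_eq ?_)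
    rw [Finset.sum_const, nsmul_eq_mul, ENNReal.ofReal_mul (Nat.cast_nonneg _),
      ENNReal.ofReal_natCast]
  have hVint := fun i => integral_abs_rpow_le hν0 (by positivity) (hVm i) (hVnorm i)
  have hcard : ∑ i ∈ Finset.range T, ((b i).card : ℝ) ≤ T := by
    have h5 : ∑ t ∈ Finset.Icc (1 : ℤ) T, (1 : ℕ)
        = ∑ m ∈ Finset.range (2 * T), (timeBlock T J m).card := by
      rw [sum_timeBlock (J := J)]
      simp
    rw [sum_range_two_mul] at h5
    have h6 : ∑ i ∈ Finset.range T, (b i).card ≤ T := by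
      calc ∑ i ∈ Finset.range T, (b i).card
          ≤ ∑ i ∈ Finset.range T, ((timeBlock T J (2 * i)).card
              + (timeBlock T J (2 * i + 1)).card) := by
            refine Finset.sum_le_sum fun i _ => ?_
            have : π = 0 ∨ π = 1 := by omega
            rcases this with h | h <;> simp [hb, h]
        _ = T := by rw [← h5]; simp
    exact_mod_cast h6
  -- Minkowski bounds each block by its cardinality; as cardinalities are at most J and add up to at
  -- most T, the sum of their ν-th powers is at most J^{ν-1} T.
  have hsumA : ∑ i ∈ Finset.range T, ∫ ω, |V i ω| ^ ν ∂μ ≤ D ^ ν * (J : ℝ) ^ (ν - 1) * T := by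
    have h7 : ∀ i, ∫ ω, |V i ω| ^ ν ∂μ ≤ D ^ ν * (J : ℝ) ^ (ν - 1) * (b i).card := by
      intro i
      refine (hVint i).2.trans ?_
      rcases Nat.eq_zero_or_pos (b i).card with h0 | h0
      · rw [h0]
        simp [Real.zero_rpow hν0.ne']
      have h8 : (0 : ℝ) < (b i).card := by exact_mod_cast h0
      have h9 : ((b i).card : ℝ) ≤ J := by exact_mod_cast card_timeBlock_le hJ
      rw [Real.mul_rpow h8.le hD.le, mul_comm, mul_assoc]
      refine mul_le_mul_of_nonneg_left ?_ (by positivity)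
      calc ((b i).card : ℝ) ^ ν = ((b i).card : ℝ) ^ (ν - 1) * (b i).card := by
            rw [← Real.rpow_add_one h8.ne', sub_add_cancel]
        _ ≤ _ := by
          refine mul_le_mul_of_nonneg_right ?_ h8.le
          exact Real.rpow_le_rpow h8.le h9 (by linarith)
    refine (Finset.sum_le_sum fun i _ => h7 i).trans ?_
    rw [← Finset.mul_sum]
    exact mul_le_mul_of_nonneg_left hcard (by positivity)
  have he2 : e ^ 2 = 1 := by rw [← sq_abs, he, one_pow]
  have hsumB : ∑ i ∈ Finset.range T, ∫ ω, V i ω ^ 2 ∂μ ≤ B * T := by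
    have h7 : ∀ i, ∫ ω, V i ω ^ 2 ∂μ ≤ B * (b i).card := by
      intro i
      simp only [hV_def, mul_pow, he2, one_mul]
      exact hvar _
    refine (Finset.sum_le_sum fun i _ => h7 i).trans ?_
    rw [← Finset.mul_sum]
    exact mul_le_mul_of_nonneg_left hcard hB.le
  have hy' : 0 < y⁻¹ := inv_pos.2 hy
  have hrep : ∀ n, ∀ F : ℝ → ℝ, (∀ x, 0 ≤ F x) → (∀ x, F x ≤ 1) →
      (∀ x y', |F x - F y'| ≤ y⁻¹ * |x - y'|) →
      ∫ ω, F (∑ i ∈ Finset.range n, V i ω + V n ω) ∂μ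
        ≤ (∫ ω, ∫ ω', F (∑ i ∈ Finset.range n, V i ω + V n ω') ∂μ ∂μ)
          + y⁻¹ * ((b n).card * (c * (J : ℝ) ^ (-a))) := by
    intro n F hF0 hF1 hFl
    have hFm := measurable_of_lipschitz_abs hFl
    -- The end of the preceding block of the same parity. The skipped block of the other parity
    -- leaves a gap of J before the current one.
    set t₀ : ℤ := (2 * n + π - 1) * J with ht₀
    have hZ : Measurable[past ξ t₀] fun ω => ∑ i ∈ Finset.range n, V i ω := by
      refine Finset.measurable_fun_sum _ fun i hi => ?_
      refine Measurable.const_mul (Finset.measurable_fun_sum _ fun t ht => ?_) _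
      refine Measurable.sub_const (measurable_past ?_) _
      have h10 := (mem_timeBlock hJ ht).2
      have h11 : (i : ℤ) + 1 ≤ n := by exact_mod_cast Finset.mem_range.1 hi
      rw [ht₀]
      refine h10.trans ?_
      push_cast
      exact mul_le_mul_of_nonneg_right (by linarith) (by positivity)
    have hs : ∀ t ∈ b n, t₀ + J ≤ t := by
      intro t ht
      have h10 := (mem_timeBlock hJ ht).1
      rw [ht₀]
      push_cast at h10
      linarith
    set M := ∑ t ∈ b n, m t with hM
    have hV' : ∀ ω, V n ω = e * (∑ t ∈ b n, ξ t ω - M) := fun ω => by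
      simp only [hV_def, hM, Finset.sum_sub_distrib]
    have hSm : Measurable fun ω => ∑ i ∈ Finset.range n, V i ω := by fun_prop
    have hbs : Measurable fun ω => ∑ t ∈ b n, ξ t ω := by fun_prop
    have h := abs_integral_sub_le_tauMixing μ hξ hs (by positivity) hτ hZ
      (ψ := fun z x => F (z + e * (x - M)))
      (by
        have : Measurable fun w : ℝ × ℝ => F (w.1 + e * (w.2 - M)) := by fun_prop
        exact this) hy'
      (fun z x x' => by
        refine (hFl _ _).trans (le_of_eq ?_)
        rw [add_sub_add_left_eq_sub, ← mul_sub, sub_sub_sub_cancel_right, abs_mul, he, one_mul])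
      (integrable_of_mem_Icc (by fun_prop) (fun _ => hF0 _) (fun _ => hF1 _))
      (integrable_of_mem_Icc (by fun_prop) (fun _ => hF0 _) (fun _ => hF1 _))
    simp only [← hV'] at h
    linarith [(abs_le.1 h).2]
  have hmain := measureReal_le_of_replacement μ hVm (A := D ^ ν * (J : ℝ) ^ (ν - 1) * T)
    (B := B * T) (err := fun i => y⁻¹ * ((b i).card * (c * (J : ℝ) ^ (-a)))) hν0 hy (by positivity)
    (by positivity) T (fun i => by positivity) hrep
    (fun i => (hVmem i).integrable h1ν) (fun i => ((hVmem i).mono_exponent h2ν).integrable_sq)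
    (fun i => (hVint i).1)
    (fun i => by
      simp only [hV_def]
      rw [integral_const_mul, integral_finsetSum _ fun t _ => (hmem t).integrable h1ν]
      simp [hcent]) hsumA hsumB
  refine hmain.trans ?_
  rw [← Finset.mul_sum, ← Finset.sum_mul]
  gcongr

set_option maxHeartbeats 1000000 in
/-- The Fuk–Nagaev inequality for `τ`-mixing processes. -/
theorem fuk_nagaev {ν a c C : ℝ} (hν : 2 < ν) (ha : (ν - 1) / (ν - 2) < a) (hc : 0 < c)
    (hC : 0 ≤ C) : ∃ c₁ c₂ : ℝ, 0 < c₁ ∧ 0 < c₂ ∧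
    ∀ {Ω : Type*} [MeasurableSpace Ω] (μ : Measure Ω) [IsProbabilityMeasure μ] (ξ : ℤ → Ω → ℝ),
      (∀ t, Measurable (ξ t)) → (∀ t, eLpNorm (ξ t) (ENNReal.ofReal ν) μ ≤ ENNReal.ofReal C) →
      (∀ k : ℕ, 1 ≤ k → tauMixing μ ξ k ≤ ENNReal.ofReal (c * (k : ℝ) ^ (-a))) →
      ∀ (T : ℕ) (y : ℝ), 0 < y →
        μ.real {ω | y ≤ |∑ t ∈ Finset.Icc (1 : ℤ) T, (ξ t ω - ∫ ω', ξ t ω' ∂μ)|}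
          ≤ c₁ * (T * y ^ (-(((a + 1) * ν - 1) / (a + ν - 1))) + Real.exp (-(c₂ * y ^ 2 / T))) := by
  have hν0 : 0 < ν := by linarith
  have hν2 : 0 < ν - 2 := by linarith
  have ha1 : 1 < a := by
    refine lt_trans ?_ ha
    rw [one_lt_div hν2]; linarith
  -- Centring at most doubles the norm; the added 1 makes the constant positive.
  set D := 2 * C + 1 with hD_def
  have hD : 0 < D := by positivity
  obtain ⟨B, hB, hvar⟩ := exists_integral_sq_sum_le (D := D ^ ν) hν ha hc.le (by positivity)
  set κ := ((a + 1) * ν - 1) / (a + ν - 1) with hκ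
  have hden : 0 < a + ν - 1 := by linarith
  have hκ0 : 0 < κ := div_pos (by nlinarith) hden
  -- Block length J ≈ y^θ balances the moment term J^{ν-1} y^{-ν} against the mixing term y⁻¹
  -- J^{-a}: both become y^{-κ}.
  set θ := (ν - 1) / (a + ν - 1) with hθ
  have hθ0 : 0 < θ := div_pos (by linarith) hden
  set Cν := 2 ^ ν * (1 + Real.exp (1 + Real.exp 1 * ν ^ ν)) with hCν
  have hCν0 : 0 < Cν := by positivity
  set E := Cν * (D ^ ν * 2 ^ (ν - 1) * 4 ^ ν) + 4 * c with hE
  have hE0 : 0 < E := by positivity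
  refine ⟨4 * (E + Cν) + 1, 1 / (64 * B), by positivity, by positivity, ?_⟩
  intro Ω _ μ _ ξ hξ hmom hτ T y hy
  have hexp0 : 0 < Real.exp (-(1 / (64 * B) * y ^ 2 / T)) := Real.exp_pos _
  rcases Nat.eq_zero_or_pos T with hT | hT
  · subst hT
    have : {ω | y ≤ |∑ t ∈ Finset.Icc (1 : ℤ) (0 : ℕ), (ξ t ω - ∫ ω', ξ t ω' ∂μ)|} = ∅ := by
      ext ω
      simp [hy]
    rw [this]
    simp only [measureReal_empty]
    positivity
  have hTr : (1 : ℝ) ≤ T := by exact_mod_cast hT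
  -- Below 1 the polynomial term alone exceeds 1.
  rcases lt_or_ge y 1 with hy1 | hy1
  · have h1 : 1 ≤ y ^ (-κ) := Real.one_le_rpow_of_pos_of_le_one_of_nonpos hy hy1.le (by linarith)
    have h2 : 1 ≤ T * y ^ (-κ) := by nlinarith
    refine measureReal_le_one.trans ?_
    have : 0 ≤ 4 * (E + Cν) := by positivity
    nlinarith
  set m : ℤ → ℝ := fun t => ∫ ω', ξ t ω' ∂μ with hm
  have h1ν : (1 : ℝ≥0∞) ≤ ENNReal.ofReal ν := by
    rw [← ENNReal.ofReal_one]; exact ENNReal.ofReal_le_ofReal (by linarith)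
  have h2ν : (2 : ℝ≥0∞) ≤ ENNReal.ofReal ν := by
    rw [← ENNReal.ofReal_ofNat]; exact ENNReal.ofReal_le_ofReal (by linarith)
  have hint : ∀ t, Integrable (ξ t) μ := fun t =>
    (memLp_of_eLpNorm_le (hξ t) (hmom t)).integrable h1ν
  have hmomD : ∀ t, eLpNorm (fun ω => ξ t ω - m t) (ENNReal.ofReal ν) μ ≤ ENNReal.ofReal D :=
    fun t => (eLpNorm_sub_integral_le (by linarith) hC (hξ t) (hmom t)).trans
      (ENNReal.ofReal_le_ofReal (by linarith))
  have hmeas : ∀ t, Measurable fun ω => ξ t ω - m t := fun t => (hξ t).sub_const _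
  have hmem2 : ∀ t, MemLp (fun ω => ξ t ω - m t) 2 μ := fun t =>
    (memLp_of_eLpNorm_le (hmeas t) (hmomD t)).mono_exponent h2ν
  have hint' := fun t => integral_abs_rpow_le hν0 hD.le (hmeas t) (hmomD t)
  have hcent : ∀ t, ∫ ω, (ξ t ω - m t) ∂μ = 0 := fun t => by
    rw [integral_sub (hint t) (integrable_const _)]
    simp [hm]
  have hV := hvar μ ξ m hξ hint (fun _ => rfl) (fun t => (hint' t).1)
    (fun s t => (hmem2 s).integrable_mul (hmem2 t)) (fun t => (hint' t).2) hτ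
  set J := ⌈y ^ θ⌉₊ with hJ_def
  have hyθ : 1 ≤ y ^ θ := Real.one_le_rpow hy1 hθ0.le
  have hJ : 0 < J := Nat.ceil_pos.2 (by linarith)
  have hJ1 : y ^ θ ≤ J := Nat.le_ceil _
  have hJ2 : (J : ℝ) ≤ 2 * y ^ θ := by
    have := Nat.ceil_lt_add_one (show 0 ≤ y ^ θ by linarith)
    linarith
  have hJr : (0 : ℝ) < J := by exact_mod_cast hJ
  have hY : 0 < y / 4 := by positivity
  have hpar := fun (π : ℕ) (hπ : π < 2) (e : ℝ) (he : |e| = 1) =>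
    measureReal_parity_le hν hc.le hD hB hY μ hξ hmomD hcent hV hJ hT (hτ J hJ) hπ he
  set R := T * y ^ (-κ) with hR
  set X := Real.exp (-(1 / (64 * B) * y ^ 2 / T)) with hX
  have hbound : 2 ^ ν * (1 + Real.exp (1 + Real.exp 1 * ν ^ ν)) *
        (D ^ ν * (J : ℝ) ^ (ν - 1) * T * (y / 4) ^ (-ν)
          + Real.exp (-((y / 4) ^ 2 / (4 * (B * T)))))
        + (y / 4)⁻¹ * (T * (c * (J : ℝ) ^ (-a))) ≤ (E + Cν) * (R + X) := by
    have e1 : Real.exp (-((y / 4) ^ 2 / (4 * (B * T)))) = X := by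
      rw [hX]
      congr 1
      field_simp
      ring
    have e2 : (J : ℝ) ^ (ν - 1) * (y / 4) ^ (-ν) ≤ 2 ^ (ν - 1) * 4 ^ ν * y ^ (-κ) := by
      have h3 : (J : ℝ) ^ (ν - 1) ≤ (2 * y ^ θ) ^ (ν - 1) :=
        Real.rpow_le_rpow hJr.le hJ2 (by linarith)
      rw [Real.mul_rpow (by norm_num) (by positivity), ← Real.rpow_mul hy.le] at h3
      have h4 : (y / 4) ^ (-ν) = 4 ^ ν * y ^ (-ν) := by
        rw [Real.div_rpow hy.le (by norm_num), Real.rpow_neg (by norm_num : (0:ℝ) ≤ 4)]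
        field_simp
      have h5 : y ^ (θ * (ν - 1)) * y ^ (-ν) = y ^ (-κ) := by
        rw [← Real.rpow_add hy]
        congr 1
        rw [hθ, hκ]
        field_simp
        ring
      rw [h4]
      calc (J : ℝ) ^ (ν - 1) * (4 ^ ν * y ^ (-ν))
          ≤ 2 ^ (ν - 1) * y ^ (θ * (ν - 1)) * (4 ^ ν * y ^ (-ν)) := by gcongr
        _ = 2 ^ (ν - 1) * 4 ^ ν * (y ^ (θ * (ν - 1)) * y ^ (-ν)) := by ring
        _ = _ := by rw [h5]
    have e3 : (y / 4)⁻¹ * (J : ℝ) ^ (-a) ≤ 4 * y ^ (-κ) := by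
      have h3 : (J : ℝ) ^ (-a) ≤ (y ^ θ) ^ (-a) :=
        Real.rpow_le_rpow_of_nonpos (by linarith) hJ1 (by linarith)
      rw [← Real.rpow_mul hy.le] at h3
      have h5 : y⁻¹ * y ^ (θ * -a) = y ^ (-κ) := by
        rw [← Real.rpow_neg_one, ← Real.rpow_add hy]
        congr 1
        rw [hθ, hκ]
        field_simp
        ring
      calc (y / 4)⁻¹ * (J : ℝ) ^ (-a) ≤ (y / 4)⁻¹ * y ^ (θ * -a) := by gcongr
        _ = 4 * (y⁻¹ * y ^ (θ * -a)) := by rw [inv_div]; ring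
        _ = _ := by rw [h5]
    rw [e1, ← hCν]
    have hX0 : 0 < X := hexp0
    have hR0 : 0 ≤ R := by positivity
    have h6 : D ^ ν * (J : ℝ) ^ (ν - 1) * T * (y / 4) ^ (-ν)
        ≤ D ^ ν * 2 ^ (ν - 1) * 4 ^ ν * R := by
      calc _ = D ^ ν * T * ((J : ℝ) ^ (ν - 1) * (y / 4) ^ (-ν)) := by ring
        _ ≤ D ^ ν * T * (2 ^ (ν - 1) * 4 ^ ν * y ^ (-κ)) := by gcongr
        _ = _ := by rw [hR]; ring
    have h7 : (y / 4)⁻¹ * (T * (c * (J : ℝ) ^ (-a))) ≤ 4 * c * R := by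
      calc _ = c * T * ((y / 4)⁻¹ * (J : ℝ) ^ (-a)) := by ring
        _ ≤ c * T * (4 * y ^ (-κ)) := by gcongr
        _ = _ := by rw [hR]; ring
    have h8 := mul_le_mul_of_nonneg_left h6 hCν0.le
    have h9 : 0 ≤ E * X := by positivity
    have h10 : 0 ≤ Cν * R := by positivity
    have h11 : E * R = Cν * (D ^ ν * 2 ^ (ν - 1) * 4 ^ ν * R) + 4 * c * R := by rw [hE]; ring
    nlinarith
  -- If the absolute value of the sum is at least y, then for one of the two signs one of the two
  -- parity sums is at least y/2 = 2(y/4).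
  have hincl : {ω | y ≤ |∑ t ∈ Finset.Icc (1 : ℤ) T, (ξ t ω - m t)|} ⊆
      ({ω | 2 * (y / 4) ≤ ∑ i ∈ Finset.range T, 1 * ∑ t ∈ timeBlock T J (2 * i + 0), (ξ t ω - m t)}
        ∪ {ω | 2 * (y / 4) ≤ ∑ i ∈ Finset.range T,
          1 * ∑ t ∈ timeBlock T J (2 * i + 1), (ξ t ω - m t)})
        ∪ ({ω | 2 * (y / 4) ≤ ∑ i ∈ Finset.range T,
          (-1) * ∑ t ∈ timeBlock T J (2 * i + 0), (ξ t ω - m t)}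
        ∪ {ω | 2 * (y / 4) ≤ ∑ i ∈ Finset.range T,
          (-1) * ∑ t ∈ timeBlock T J (2 * i + 1), (ξ t ω - m t)}) := by
    intro ω hω
    simp only [Set.mem_ofPred_eq] at hω
    rw [sum_timeBlock (J := J), sum_range_two_mul, Finset.sum_add_distrib] at hω
    simp only [Set.mem_union, Set.mem_ofPred_eq, ← Finset.mul_sum, add_zero]
    rcases le_abs.1 hω with h | h
    · left
      by_contra hcon
      push Not at hcon
      linarith [hcon.1, hcon.2]
    · right
      by_contra hcon
      push Not at hcon
      linarith [hcon.1, hcon.2]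
  refine (measureReal_mono hincl).trans ?_
  refine (measureReal_union_le _ _).trans ?_
  have g1 := (measureReal_union_le _ _).trans
    (add_le_add (hpar 0 (by norm_num) 1 (by norm_num)) (hpar 1 (by norm_num) 1 (by norm_num)))
  have g2 := (measureReal_union_le _ _).trans
    (add_le_add (hpar 0 (by norm_num) (-1) (by norm_num)) (hpar 1 (by norm_num) (-1) (by norm_num)))
  have hRX : 0 ≤ R + X := by positivity
  refine (add_le_add g1 g2).trans ?_
  rw [add_one_mul, mul_assoc]
  linarith

end FukNagaev

/-! ### Elementary inequalities for the empirical norm. -/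

section EmpiricalNorm

lemma empNormSq_nonneg (T : ℕ) (z : ℤ → ℝ) : 0 ≤ empNormSq T z :=
  mul_nonneg (by positivity) (Finset.sum_nonneg fun _ _ => sq_nonneg _)

lemma empNormSq_congr {T : ℕ} {z z' : ℤ → ℝ} (h : ∀ t, z t = z' t) :
    empNormSq T z = empNormSq T z' := by
  rw [show z = z' from funext h]

lemma abs_inner_le_sqrt_empNormSq (T : ℕ) (z w : ℤ → ℝ) :
    |(T : ℝ)⁻¹ * ∑ t ∈ Finset.Icc (1 : ℤ) T, z t * w t| ≤ √(empNormSq T z) * √(empNormSq T w) := by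
  have h1 : |∑ t ∈ Finset.Icc (1 : ℤ) T, z t * w t|
      ≤ √(∑ t ∈ Finset.Icc (1 : ℤ) T, z t ^ 2) * √(∑ t ∈ Finset.Icc (1 : ℤ) T, w t ^ 2) := by
    rw [← Real.sqrt_mul (Finset.sum_nonneg fun _ _ => sq_nonneg _)]
    exact Real.abs_le_sqrt (Finset.sum_mul_sq_le_sq_mul_sq _ _ _)
  have hT : (0 : ℝ) ≤ (T : ℝ)⁻¹ := by positivity
  rw [abs_mul, abs_of_nonneg hT, empNormSq, empNormSq, Real.sqrt_mul hT, Real.sqrt_mul hT]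
  calc _ ≤ (T : ℝ)⁻¹ * (√(∑ t ∈ Finset.Icc (1 : ℤ) T, z t ^ 2)
        * √(∑ t ∈ Finset.Icc (1 : ℤ) T, w t ^ 2)) := mul_le_mul_of_nonneg_left h1 hT
    _ = (√(T : ℝ)⁻¹ * √(T : ℝ)⁻¹) * (√(∑ t ∈ Finset.Icc (1 : ℤ) T, z t ^ 2)
        * √(∑ t ∈ Finset.Icc (1 : ℤ) T, w t ^ 2)) := by rw [Real.mul_self_sqrt hT]
    _ = _ := by ring

lemma empNormSq_add (T : ℕ) (z w : ℤ → ℝ) : empNormSq T (fun t => z t + w t)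
    = empNormSq T z + 2 * ((T : ℝ)⁻¹ * ∑ t ∈ Finset.Icc (1 : ℤ) T, z t * w t) + empNormSq T w := by
  simp only [empNormSq, add_sq, Finset.sum_add_distrib, mul_assoc, ← Finset.mul_sum]
  ring

lemma empNormSq_neg (T : ℕ) (z : ℤ → ℝ) : empNormSq T (fun t => -z t) = empNormSq T z := by
  simp [empNormSq]

lemma empNormSq_add_le (T : ℕ) (z w : ℤ → ℝ) :
    empNormSq T (fun t => z t + w t) ≤ 2 * empNormSq T z + 2 * empNormSq T w := by
  have : 0 ≤ empNormSq T (fun t => z t - w t) := empNormSq_nonneg _ _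
  simp only [empNormSq, Finset.mul_sum, ← Finset.sum_add_distrib] at this ⊢
  refine Finset.sum_le_sum fun t _ => ?_
  have hT : (0 : ℝ) ≤ (T : ℝ)⁻¹ := by positivity
  nlinarith [sq_nonneg (z t - w t), mul_nonneg hT (sq_nonneg (z t - w t))]

lemma abs_sum_mul_dotProduct_le {ι : Type*} [Fintype ι] {T : ℕ} {u : ℤ → ℝ} {x : ℤ → ι → ℝ}
    {W : ℝ} (hW : ∀ j, |(T : ℝ)⁻¹ * ∑ t ∈ Finset.Icc (1 : ℤ) T,
    u t * x t j| ≤ W) (d : ι → ℝ) :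
    |(T : ℝ)⁻¹ * ∑ t ∈ Finset.Icc (1 : ℤ) T, u t * (x t ⬝ᵥ d)| ≤ W * ∑ j, |d j| := by
  have h : (T : ℝ)⁻¹ * ∑ t ∈ Finset.Icc (1 : ℤ) T, u t * (x t ⬝ᵥ d)
      = ∑ j, ((T : ℝ)⁻¹ * ∑ t ∈ Finset.Icc (1 : ℤ) T, u t * x t j) * d j := by
    simp only [dotProduct, Finset.mul_sum, Finset.sum_mul]
    rw [Finset.sum_comm]
    refine Finset.sum_congr rfl fun j _ => Finset.sum_congr rfl fun t _ => ?_
    ring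
  rw [h, Finset.mul_sum]
  refine (Finset.abs_sum_le_sum_abs _ _).trans (Finset.sum_le_sum fun j _ => ?_)
  rw [abs_mul]
  exact mul_le_mul_of_nonneg_right (hW j) (abs_nonneg _)

end EmpiricalNorm

/-! ### The sparse-group penalty: comparison with the ℓ₁ norm and decomposability. -/

section Penalty

variable {ι : Type*}

/-- The Euclidean norm of the coordinates in `A`. -/
noncomputable def groupNorm (A : Finset ι) (b : ι → ℝ) : ℝ := √(∑ j ∈ A, b j ^ 2)

lemma groupNorm_nonneg (A : Finset ι) (b : ι → ℝ) : 0 ≤ groupNorm A b := Real.sqrt_nonneg _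

lemma groupNorm_add_le (A : Finset ι) (b d : ι → ℝ) :
    groupNorm A (b + d) ≤ groupNorm A b + groupNorm A d := by
  refine Real.sqrt_le_iff.2 ⟨add_nonneg (groupNorm_nonneg _ _) (groupNorm_nonneg _ _), ?_⟩
  have h1 := Real.sum_mul_le_sqrt_mul_sqrt A b d
  have h2 : groupNorm A b ^ 2 = ∑ j ∈ A, b j ^ 2 :=
    Real.sq_sqrt (Finset.sum_nonneg fun _ _ => sq_nonneg _)
  have h3 : groupNorm A d ^ 2 = ∑ j ∈ A, d j ^ 2 :=
    Real.sq_sqrt (Finset.sum_nonneg fun _ _ => sq_nonneg _)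
  have h4 : ∑ j ∈ A, (b + d) j ^ 2
      = ∑ j ∈ A, b j ^ 2 + 2 * ∑ j ∈ A, b j * d j + ∑ j ∈ A, d j ^ 2 := by
    rw [Finset.mul_sum, ← Finset.sum_add_distrib, ← Finset.sum_add_distrib]
    refine Finset.sum_congr rfl fun j _ => ?_
    simp only [Pi.add_apply]
    ring
  rw [h4, add_sq, h2, h3]
  have h5 : ∑ j ∈ A, b j * d j ≤ groupNorm A b * groupNorm A d := h1
  linarith

lemma groupNorm_le_sum_abs (A : Finset ι) (b : ι → ℝ) : groupNorm A b ≤ ∑ j ∈ A, |b j| := by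
  refine Real.sqrt_le_iff.2 ⟨Finset.sum_nonneg fun _ _ => abs_nonneg _, ?_⟩
  have := Finset.sum_sq_le_sq_sum_of_nonneg (s := A) (f := fun j => |b j|) fun _ _ => abs_nonneg _
  simpa only [sq_abs] using this

lemma sum_abs_le_sqrt_card_mul_groupNorm (A : Finset ι) (b : ι → ℝ) :
    ∑ j ∈ A, |b j| ≤ √(A.card : ℝ) * groupNorm A b := by
  have := Real.sum_mul_le_sqrt_mul_sqrt A (fun _ => 1) fun j => |b j|
  simpa [groupNorm] using this

variable [Fintype ι] [DecidableEq ι] {α : ℝ} {𝒢 : Finpartition (Finset.univ : Finset ι)}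

lemma sgPenalty_eq (α : ℝ) (𝒢 : Finpartition (Finset.univ : Finset ι)) (b : ι → ℝ) :
    sgPenalty α 𝒢 b = α * ∑ j, |b j| + (1 - α) * ∑ A ∈ 𝒢.parts, groupNorm A b := rfl

lemma sum_parts (𝒢 : Finpartition (Finset.univ : Finset ι)) (f : ι → ℝ) :
    ∑ A ∈ 𝒢.parts, ∑ j ∈ A, f j = ∑ j, f j := by
  exact (Finset.sum_biUnion (t := id) (f := f) 𝒢.disjoint).symm.trans
    (congrArg (fun s => ∑ j ∈ s, f j) 𝒢.biUnion_parts)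

lemma sgPenalty_le_sum_abs (hα1 : α ≤ 1) (d : ι → ℝ) : sgPenalty α 𝒢 d ≤ ∑ j, |d j| := by
  have h1 : ∑ A ∈ 𝒢.parts, groupNorm A d ≤ ∑ j, |d j| := by
    rw [← sum_parts 𝒢]
    exact Finset.sum_le_sum fun A _ => groupNorm_le_sum_abs A d
  rw [sgPenalty_eq]
  nlinarith [mul_le_mul_of_nonneg_left h1 (sub_nonneg.2 hα1)]

/-- Cauchy–Schwarz inside each group, of size at most gm. It lets an ℓ∞ bound on the noise be paid
for by the penalty, whatever α is. -/
lemma sum_abs_le_sgPenalty (hα0 : 0 ≤ α) (hα1 : α ≤ 1) {gm : ℕ} (hgm : 1 ≤ gm)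
    (hcard : ∀ A ∈ 𝒢.parts, A.card ≤ gm) (d : ι → ℝ) :
    ∑ j, |d j| ≤ √(gm : ℝ) * sgPenalty α 𝒢 d := by
  have h1 : ∑ j, |d j| ≤ √(gm : ℝ) * ∑ A ∈ 𝒢.parts, groupNorm A d := by
    rw [← sum_parts 𝒢, Finset.mul_sum]
    refine Finset.sum_le_sum fun A hA => (sum_abs_le_sqrt_card_mul_groupNorm A d).trans ?_
    exact mul_le_mul_of_nonneg_right (Real.sqrt_le_sqrt (by exact_mod_cast hcard A hA))
      (groupNorm_nonneg _ _)
  have h2 : (1 : ℝ) ≤ √(gm : ℝ) := Real.one_le_sqrt.2 (by exact_mod_cast hgm)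
  have h3 : 0 ≤ ∑ j, |d j| := Finset.sum_nonneg fun _ _ => abs_nonneg _
  rw [sgPenalty_eq]
  nlinarith [mul_le_mul_of_nonneg_left h1 (sub_nonneg.2 hα1),
    mul_le_mul_of_nonneg_left (le_mul_of_one_le_left h3 h2) hα0]

open Classical in
/-- The part of the penalty of `d` that is carried by the support of `β`. -/
noncomputable def activePenalty (α : ℝ) (𝒢 : Finpartition (Finset.univ : Finset ι))
    (β d : ι → ℝ) : ℝ :=
  α * ∑ j ∈ Finset.univ.filter fun j => β j ≠ 0, |d j|
    + (1 - α) * ∑ A ∈ 𝒢.parts.filter fun A => ∃ j ∈ A, β j ≠ 0, groupNorm A d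

/-- Decomposability: on coordinates and groups where β vanishes the penalty of β + d is that of d,
and elsewhere the triangle inequality loses at most the penalty of d. The difference is thus at most
the active minus the inactive part of the penalty of d. -/
lemma sgPenalty_sub_le (hα0 : 0 ≤ α) (hα1 : α ≤ 1) (β d : ι → ℝ) :
    sgPenalty α 𝒢 β - sgPenalty α 𝒢 (β + d) ≤ 2 * activePenalty α 𝒢 β d - sgPenalty α 𝒢 d := by
  classical
  have h1 : ∑ j, |β j| - ∑ j, |(β + d) j|
      ≤ 2 * ∑ j ∈ Finset.univ.filter (fun j => β j ≠ 0), |d j| - ∑ j, |d j| := by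
    rw [Finset.sum_filter, Finset.mul_sum, ← Finset.sum_sub_distrib, ← Finset.sum_sub_distrib]
    refine Finset.sum_le_sum fun j _ => ?_
    by_cases hj : β j = 0
    · simp [hj]
    · simp only [hj, ne_eq, not_false_eq_true, if_true, Pi.add_apply]
      have := abs_sub_abs_le_abs_sub (β j) (-d j)
      rw [abs_neg, sub_neg_eq_add] at this
      linarith
  have h2 : ∑ A ∈ 𝒢.parts, groupNorm A β - ∑ A ∈ 𝒢.parts, groupNorm A (β + d)
      ≤ 2 * ∑ A ∈ 𝒢.parts.filter (fun A => ∃ j ∈ A, β j ≠ 0), groupNorm A d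
        - ∑ A ∈ 𝒢.parts, groupNorm A d := by
    rw [Finset.sum_filter, Finset.mul_sum, ← Finset.sum_sub_distrib, ← Finset.sum_sub_distrib]
    refine Finset.sum_le_sum fun A _ => ?_
    by_cases hA : ∃ j ∈ A, β j ≠ 0
    · rw [if_pos hA]
      have := groupNorm_add_le A (β + d) (-d)
      have h3 : groupNorm A (-d) = groupNorm A d := by simp [groupNorm]
      rw [h3, add_neg_cancel_right] at this
      linarith
    · rw [if_neg hA]
      push Not at hA
      have h4 : groupNorm A β = 0 := by
        rw [groupNorm, Finset.sum_eq_zero fun j hj => by rw [hA j hj]; norm_num, Real.sqrt_zero]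
      have h5 : groupNorm A (β + d) = groupNorm A d := by
        unfold groupNorm
        congr 1
        exact Finset.sum_congr rfl fun j hj => by rw [Pi.add_apply, hA j hj, zero_add]
      rw [h4, h5]
      linarith
  rw [sgPenalty_eq, sgPenalty_eq, sgPenalty_eq, activePenalty]
  have h6 := mul_le_mul_of_nonneg_left h1 hα0
  have h7 := mul_le_mul_of_nonneg_left h2 (sub_nonneg.2 hα1)
  linarith

/-- Cauchy–Schwarz over the support and over the active groups; the effective sparsity is defined so
that its square root is the resulting constant. -/
lemma activePenalty_le (hα0 : 0 ≤ α) (hα1 : α ≤ 1) (β d : ι → ℝ) :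
    activePenalty α 𝒢 β d ≤ √(effSparsity α 𝒢 β) * groupNorm Finset.univ d := by
  classical
  have hα1' := sub_nonneg.2 hα1
  set S := Finset.univ.filter fun j => β j ≠ 0 with hS
  set 𝒢₀ := 𝒢.parts.filter fun A => ∃ j ∈ A, β j ≠ 0 with h𝒢₀
  have h0 : √(effSparsity α 𝒢 β) = α * √(S.card : ℝ) + (1 - α) * √(𝒢₀.card : ℝ) := by
    have : effSparsity α 𝒢 β = (α * √(S.card : ℝ) + (1 - α) * √(𝒢₀.card : ℝ)) ^ 2 := by
      unfold effSparsity
      congr!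
    rw [this, Real.sqrt_sq (by positivity)]
  have h1 : ∑ j ∈ S, |d j| ≤ √(S.card : ℝ) * groupNorm Finset.univ d := by
    refine (sum_abs_le_sqrt_card_mul_groupNorm S d).trans ?_
    refine mul_le_mul_of_nonneg_left (Real.sqrt_le_sqrt ?_) (Real.sqrt_nonneg _)
    exact Finset.sum_le_sum_of_subset_of_nonneg (Finset.subset_univ _) fun _ _ _ => sq_nonneg _
  have h2 : ∑ A ∈ 𝒢₀, groupNorm A d ≤ √(𝒢₀.card : ℝ) * groupNorm Finset.univ d := by
    have h3 := Real.sum_mul_le_sqrt_mul_sqrt 𝒢₀ (fun _ => 1) fun A => groupNorm A d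
    simp only [one_mul, one_pow, Finset.sum_const, nsmul_eq_mul, mul_one] at h3
    refine h3.trans (mul_le_mul_of_nonneg_left (Real.sqrt_le_sqrt ?_) (Real.sqrt_nonneg _))
    rw [← sum_parts 𝒢]
    have h4 : ∀ A, groupNorm A d ^ 2 = ∑ j ∈ A, d j ^ 2 := fun A =>
      Real.sq_sqrt (Finset.sum_nonneg fun _ _ => sq_nonneg _)
    simp only [h4]
    exact Finset.sum_le_sum_of_subset_of_nonneg (Finset.filter_subset _ _)
      fun _ _ _ => Finset.sum_nonneg fun _ _ => sq_nonneg _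
  have h5 : activePenalty α 𝒢 β d = α * ∑ j ∈ S, |d j| + (1 - α) * ∑ A ∈ 𝒢₀, groupNorm A d := by
    unfold activePenalty
    congr!
  rw [h0, h5]
  have h6 := mul_le_mul_of_nonneg_left h1 hα0
  have h7 := mul_le_mul_of_nonneg_left h2 hα1'
  linarith

end Penalty

/-! ### Deterministic oracle inequalities for the sg-LASSO. -/

section Oracle

variable {ι : Type*} [Fintype ι] [DecidableEq ι] {α : ℝ}
  {𝒢 : Finpartition (Finset.univ : Finset ι)} {T : ℕ} {y u e : ℤ → ℝ} {x : ℤ → ι → ℝ}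
  {β b : ι → ℝ} {lam : ℝ}

/-- The basic inequality for the sg-LASSO. -/
lemma IsSGLasso.basic (h : IsSGLasso T y x α 𝒢 lam b) (hy : ∀ t, y t = u t + e t + x t ⬝ᵥ β)
    {W : ℝ} (hW : ∀ j, |(T : ℝ)⁻¹ * ∑ t ∈ Finset.Icc (1 : ℤ) T, u t * x t j| ≤ W) :
    empNormSq T (fun t => x t ⬝ᵥ (b - β)) ≤ 2 * W * ∑ j, |(b - β) j|
      + 2 * √(empNormSq T e) * √(empNormSq T fun t => x t ⬝ᵥ (b - β))
      + 2 * lam * (sgPenalty α 𝒢 β - sgPenalty α 𝒢 b) := by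
  have h0 := h (Set.mem_univ β)
  simp only [Set.mem_ofPred_eq] at h0
  set d := b - β with hd
  have h1 : empNormSq T (fun t => y t - x t ⬝ᵥ β) = empNormSq T (fun t => u t + e t) :=
    empNormSq_congr fun t => by rw [hy]; ring
  have h2 : empNormSq T (fun t => y t - x t ⬝ᵥ b)
      = empNormSq T (fun t => (u t + e t) + -(x t ⬝ᵥ d)) :=
    empNormSq_congr fun t => by rw [hy, hd, dotProduct_sub]; ring
  rw [h1, h2, empNormSq_add, empNormSq_neg] at h0
  have h3 : (T : ℝ)⁻¹ * ∑ t ∈ Finset.Icc (1 : ℤ) T, (u t + e t) * -(x t ⬝ᵥ d)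
      = -((T : ℝ)⁻¹ * ∑ t ∈ Finset.Icc (1 : ℤ) T, u t * (x t ⬝ᵥ d))
        - (T : ℝ)⁻¹ * ∑ t ∈ Finset.Icc (1 : ℤ) T, e t * (x t ⬝ᵥ d) := by
    simp only [mul_neg, Finset.sum_neg_distrib, add_mul, Finset.sum_add_distrib]
    ring
  have h4 := (abs_le.1 (abs_sum_mul_dotProduct_le hW d)).2
  have h5 := (abs_le.1 (abs_inner_le_sqrt_empNormSq T e fun t => x t ⬝ᵥ d)).2
  rw [h3] at h0
  linarith

variable {γ D : ℝ}

set_option maxHeartbeats 1000000 in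
/-- Prediction and estimation errors of the sg-LASSO when the tuning parameter dominates the noise
and the Gram matrix is close to a well-conditioned matrix, relative to the sparsity. -/
lemma IsSGLasso.oracle (h : IsSGLasso T y x α 𝒢 lam b) (hy : ∀ t, y t = u t + e t + x t ⬝ᵥ β)
    (hα0 : 0 ≤ α) (hα1 : α ≤ 1) {gm : ℕ} (hgm : 1 ≤ gm) (hcard : ∀ A ∈ 𝒢.parts, A.card ≤ gm)
    (hlam : 0 < lam)
    (hW : ∀ j, |(T : ℝ)⁻¹ * ∑ t ∈ Finset.Icc (1 : ℤ) T, u t * x t j| ≤ lam / (2 * √(gm : ℝ)))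
    (hγ : 0 < γ) (hD0 : 0 ≤ D) (hD : 32 * gm * max (effSparsity α 𝒢 β) 1 * D ≤ γ)
    (hquad : ∀ d : ι → ℝ, γ * groupNorm Finset.univ d ^ 2 - D * (∑ j, |d j|) ^ 2
      ≤ empNormSq T fun t => x t ⬝ᵥ d) :
    √(empNormSq T fun t => x t ⬝ᵥ (b - β))
        ≤ 6 * √(2 / γ) * lam * √(max (effSparsity α 𝒢 β) 1) + 4 * √(empNormSq T e) ∧
      (√(empNormSq T e) = 0 → ∑ j, |(b - β) j| ≤ 4 * √(gm : ℝ) * √(2 / γ)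
        * √(max (effSparsity α 𝒢 β) 1) * √(empNormSq T fun t => x t ⬝ᵥ (b - β))) := by
  have hbasic := h.basic hy hW
  set d := b - β with hd
  set n := √(empNormSq T fun t => x t ⬝ᵥ d) with hn
  set E := √(empNormSq T e) with hE
  set s := max (effSparsity α 𝒢 β) 1 with hs
  have hs1 : 1 ≤ s := le_max_right _ _
  have hn0 : 0 ≤ n := Real.sqrt_nonneg _
  have hE0 : 0 ≤ E := Real.sqrt_nonneg _
  have hn2 : n ^ 2 = empNormSq T fun t => x t ⬝ᵥ d := Real.sq_sqrt (empNormSq_nonneg _ _)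
  have hg0 : 0 < √(gm : ℝ) := Real.sqrt_pos.2 (by exact_mod_cast hgm)
  set Ω := sgPenalty α 𝒢 d with hΩ
  set Ω₀ := activePenalty α 𝒢 β d with hΩ₀
  have hl1 := sum_abs_le_sgPenalty hα0 hα1 hgm hcard d
  have hpen := sgPenalty_sub_le (𝒢 := 𝒢) hα0 hα1 β d
  rw [show β + d = b by rw [hd]; abel] at hpen
  -- The noise uses up λΩ, half of the penalty term 2λΩ; decomposability leaves 4λΩ₀ on the active
  -- part.
  have hmain : n ^ 2 ≤ 4 * lam * Ω₀ - lam * Ω + 2 * E * n := by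
    rw [hn2]
    have h1 : 2 * (lam / (2 * √(gm : ℝ))) * ∑ j, |d j| ≤ lam * Ω := by
      calc _ ≤ 2 * (lam / (2 * √(gm : ℝ))) * (√(gm : ℝ) * Ω) := by gcongr
        _ = lam * Ω := by field_simp
    have h2 := mul_le_mul_of_nonneg_left hpen hlam.le
    linarith
  set r := √(2 / γ) with hr
  have hr0 : 0 < r := Real.sqrt_pos.2 (by positivity)
  have hr2 : r ^ 2 = 2 / γ := Real.sq_sqrt (by positivity)
  set w := groupNorm Finset.univ d with hw
  have hw0 : 0 ≤ w := groupNorm_nonneg _ _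
  have hΩ₀le : Ω₀ ≤ √s * w := (activePenalty_le hα0 hα1 β d).trans
    (mul_le_mul_of_nonneg_right (Real.sqrt_le_sqrt (le_max_left _ _)) hw0)
  have hss : √s ^ 2 = s := Real.sq_sqrt (by linarith)
  have hgg : √(gm : ℝ) ^ 2 = gm := Real.sq_sqrt (by positivity)
  -- On the cone the ℓ₁ norm is at most 4√(gm·s) times the ℓ₂ norm, so by `hD` the deviation of the
  -- Gram matrix costs no more than half of γ.
  have hcone : Ω ≤ 4 * Ω₀ → ∑ j, |d j| ≤ 4 * √(gm : ℝ) * √s * w ∧ w ≤ r * n := by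
    intro hc
    have h1 : ∑ j, |d j| ≤ 4 * √(gm : ℝ) * √s * w := by
      calc ∑ j, |d j| ≤ √(gm : ℝ) * Ω := hl1
        _ ≤ √(gm : ℝ) * (4 * (√s * w)) := by gcongr; linarith
        _ = _ := by ring
    refine ⟨h1, ?_⟩
    have h2 : (∑ j, |d j|) ^ 2 ≤ 16 * gm * s * w ^ 2 := by
      calc (∑ j, |d j|) ^ 2 ≤ (4 * √(gm : ℝ) * √s * w) ^ 2 :=
            pow_le_pow_left₀ (Finset.sum_nonneg fun _ _ => abs_nonneg _) h1 2
        _ = 16 * √(gm : ℝ) ^ 2 * √s ^ 2 * w ^ 2 := by ring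
        _ = _ := by rw [hgg, hss]
    have h3 : D * (∑ j, |d j|) ^ 2 ≤ γ / 2 * w ^ 2 := by
      calc D * (∑ j, |d j|) ^ 2 ≤ D * (16 * gm * s * w ^ 2) := by gcongr
        _ = (32 * gm * s * D) / 2 * w ^ 2 := by ring
        _ ≤ γ / 2 * w ^ 2 := by gcongr
    have h4 : w ^ 2 ≤ (r * n) ^ 2 := by
      rw [mul_pow, hr2, hn2, div_mul_eq_mul_div, le_div_iff₀ hγ]
      linarith [hquad d]
    exact le_of_sq_le_sq h4 (by positivity)
  refine ⟨?_, fun hEz => ?_⟩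
  -- Either the approximation error dominates and there is nothing to prove, or the cross term 2En
  -- is absorbed by n²/2 and the error lies in the cone.
  · rcases le_or_gt n (4 * E) with hc | hc
    · have : 0 ≤ 6 * r * lam * √s := by positivity
      linarith
    · have h1 : 2 * E * n ≤ n ^ 2 / 2 := by nlinarith
      have h2 : Ω ≤ 4 * Ω₀ := by
        have : lam * Ω ≤ lam * (4 * Ω₀) := by nlinarith [sq_nonneg n]
        exact le_of_mul_le_mul_left this hlam
      obtain ⟨h3, h4⟩ := hcone h2
      have h5 : 0 ≤ lam * Ω := by
        have : 0 ≤ √(gm : ℝ) * Ω := (Finset.sum_nonneg fun _ _ => abs_nonneg _).trans hl1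
        exact mul_nonneg hlam.le (nonneg_of_mul_nonneg_right this hg0)
      have hn2' : n ^ 2 / 2 ≤ 3 * lam * (√s * (r * n)) := by
        have h6 : √(gm : ℝ) * Ω₀ ≤ √(gm : ℝ) * Ω := by
          refine mul_le_mul_of_nonneg_left ?_ hg0.le
          have := sgPenalty_sub_le (𝒢 := 𝒢) hα0 hα1 β d
          rw [hΩ₀, hΩ, activePenalty, sgPenalty_eq]
          refine add_le_add (mul_le_mul_of_nonneg_left ?_ hα0)
            (mul_le_mul_of_nonneg_left ?_ (sub_nonneg.2 hα1))
          · exact Finset.sum_le_sum_of_subset_of_nonneg (Finset.subset_univ _)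
              fun _ _ _ => abs_nonneg _
          · exact Finset.sum_le_sum_of_subset_of_nonneg (Finset.filter_subset _ _)
              fun _ _ _ => groupNorm_nonneg _ _
        have h7 : Ω₀ ≤ Ω := le_of_mul_le_mul_left h6 hg0
        have h8 : n ^ 2 / 2 ≤ 3 * lam * Ω₀ := by nlinarith
        have h9 : Ω₀ ≤ √s * (r * n) :=
          hΩ₀le.trans (mul_le_mul_of_nonneg_left h4 (Real.sqrt_nonneg _))
        exact h8.trans (mul_le_mul_of_nonneg_left h9 (by positivity))
      have hnpos : 0 < n := lt_of_le_of_lt (by positivity) hc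
      have : n ≤ 6 * r * lam * √s := by
        have : n * n ≤ (6 * r * lam * √s) * n := by nlinarith
        exact le_of_mul_le_mul_right this hnpos
      linarith
  -- Without approximation error the cone condition holds unconditionally; this is what the exactly
  -- linear nodewise regressions need for their ℓ₁ rate.
  · rw [hEz] at hmain
    have h2 : Ω ≤ 4 * Ω₀ := by
      have : lam * Ω ≤ lam * (4 * Ω₀) := by nlinarith [sq_nonneg n]
      exact le_of_mul_le_mul_left this hlam
    obtain ⟨h3, h4⟩ := hcone h2
    calc ∑ j, |d j| ≤ 4 * √(gm : ℝ) * √s * w := h3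
      _ ≤ 4 * √(gm : ℝ) * √s * (r * n) := by gcongr
      _ = _ := by ring

/-- Prediction and estimation errors of the sg-LASSO in low dimensions, for noise of the order of
the tuning parameter. -/
lemma IsSGLasso.oracle_lowDim (h : IsSGLasso T y x α 𝒢 lam b)
    (hy : ∀ t, y t = u t + e t + x t ⬝ᵥ β) (hα0 : 0 ≤ α) (hα1 : α ≤ 1) (hlam : 0 < lam) {A : ℝ}
    (hA : 0 ≤ A) (hW : ∀ j, |(T : ℝ)⁻¹ * ∑ t ∈ Finset.Icc (1 : ℤ) T, u t * x t j| ≤ A * lam)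
    (hγ : 0 < γ) (hD0 : 0 ≤ D) {N : ℕ} (hN : Fintype.card ι ≤ N) (hD : 2 * N * D ≤ γ)
    (hquad : ∀ d : ι → ℝ, γ * groupNorm Finset.univ d ^ 2 - D * (∑ j, |d j|) ^ 2
      ≤ empNormSq T fun t => x t ⬝ᵥ d) :
    √(empNormSq T fun t => x t ⬝ᵥ (b - β))
        ≤ 2 * (A + 1) * √(N : ℝ) * √(2 / γ) * lam + 2 * √(empNormSq T e) ∧
      ∑ j, |(b - β) j| ≤ √(N : ℝ) * √(2 / γ) * √(empNormSq T fun t => x t ⬝ᵥ (b - β)) := by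
  have hbasic := h.basic hy hW
  set d := b - β with hd
  set n := √(empNormSq T fun t => x t ⬝ᵥ d) with hn
  set E := √(empNormSq T e) with hE
  have hn0 : 0 ≤ n := Real.sqrt_nonneg _
  have hE0 : 0 ≤ E := Real.sqrt_nonneg _
  have hn2 : n ^ 2 = empNormSq T fun t => x t ⬝ᵥ d := Real.sq_sqrt (empNormSq_nonneg _ _)
  -- No cone is used here: the change in penalty is at most the ℓ₁ norm of d, which in dimension at
  -- most N is bounded by √N times its ℓ₂ norm. The noise may therefore be any multiple of λ.
  have hpen : sgPenalty α 𝒢 β - sgPenalty α 𝒢 b ≤ ∑ j, |d j| := by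
    have h1 := sgPenalty_sub_le (𝒢 := 𝒢) hα0 hα1 b (-d)
    have h2 := sgPenalty_sub_le (𝒢 := 𝒢) hα0 hα1 β d
    rw [show β + d = b by rw [hd]; abel] at h2
    have h3 : activePenalty α 𝒢 β d ≤ sgPenalty α 𝒢 d := by
      rw [activePenalty, sgPenalty_eq]
      refine add_le_add (mul_le_mul_of_nonneg_left ?_ hα0)
        (mul_le_mul_of_nonneg_left ?_ (sub_nonneg.2 hα1))
      · exact Finset.sum_le_sum_of_subset_of_nonneg (Finset.subset_univ _)
          fun _ _ _ => abs_nonneg _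
      · exact Finset.sum_le_sum_of_subset_of_nonneg (Finset.filter_subset _ _)
          fun _ _ _ => groupNorm_nonneg _ _
    linarith [sgPenalty_le_sum_abs (𝒢 := 𝒢) hα1 d]
  set r := √(2 / γ) with hr
  have hr0 : 0 < r := Real.sqrt_pos.2 (by positivity)
  have hr2 : r ^ 2 = 2 / γ := Real.sq_sqrt (by positivity)
  set w := groupNorm Finset.univ d with hw
  have hw0 : 0 ≤ w := groupNorm_nonneg _ _
  have hl1 : ∑ j, |d j| ≤ √(N : ℝ) * w := by
    refine (sum_abs_le_sqrt_card_mul_groupNorm _ d).trans ?_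
    refine mul_le_mul_of_nonneg_right (Real.sqrt_le_sqrt ?_) hw0
    rw [Finset.card_univ]
    exact_mod_cast hN
  have hNN : √(N : ℝ) ^ 2 = N := Real.sq_sqrt (by positivity)
  have hwn : w ≤ r * n := by
    have h2 : (∑ j, |d j|) ^ 2 ≤ N * w ^ 2 := by
      calc (∑ j, |d j|) ^ 2 ≤ (√(N : ℝ) * w) ^ 2 :=
            pow_le_pow_left₀ (Finset.sum_nonneg fun _ _ => abs_nonneg _) hl1 2
        _ = _ := by rw [mul_pow, hNN]
    have h3 : D * (∑ j, |d j|) ^ 2 ≤ γ / 2 * w ^ 2 := by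
      calc D * (∑ j, |d j|) ^ 2 ≤ D * (N * w ^ 2) := by gcongr
        _ = (2 * N * D) / 2 * w ^ 2 := by ring
        _ ≤ γ / 2 * w ^ 2 := by gcongr
    have h4 : w ^ 2 ≤ (r * n) ^ 2 := by
      rw [mul_pow, hr2, hn2, div_mul_eq_mul_div, le_div_iff₀ hγ]
      linarith [hquad d]
    exact le_of_sq_le_sq h4 (by positivity)
  have hl1' : ∑ j, |d j| ≤ √(N : ℝ) * r * n := by
    calc _ ≤ √(N : ℝ) * w := hl1
      _ ≤ √(N : ℝ) * (r * n) := by gcongr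
      _ = _ := by ring
  refine ⟨?_, hl1'⟩
  rcases hn0.eq_or_lt with h0 | hnpos
  · rw [← h0]
    positivity
  have h5 : n * n ≤ (2 * (A + 1) * √(N : ℝ) * r * lam + 2 * E) * n := by
    have h6 : n ^ 2 ≤ 2 * (A + 1) * lam * ∑ j, |d j| + 2 * E * n := by
      rw [hn2]
      have := mul_le_mul_of_nonneg_left hpen (by positivity : 0 ≤ 2 * lam)
      linarith
    have h7 := mul_le_mul_of_nonneg_left hl1' (by positivity : 0 ≤ 2 * (A + 1) * lam)
    nlinarith
  exact le_of_mul_le_mul_right h5 hnpos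

/-- The empirical quadratic form is bounded below when the Gram matrix is close to a matrix with
eigenvalues bounded away from zero. -/
lemma le_empNormSq_dotProduct {S : Matrix ι ι ℝ} (hS : (S - γ • (1 : Matrix ι ι ℝ)).PosSemidef)
    (hD : ∀ j k, |(T : ℝ)⁻¹ * ∑ t ∈ Finset.Icc (1 : ℤ) T, x t j * x t k - S j k| ≤ D)
    (d : ι → ℝ) : γ * groupNorm Finset.univ d ^ 2 - D * (∑ j, |d j|) ^ 2
      ≤ empNormSq T fun t => x t ⬝ᵥ d := by
  have h1 : (empNormSq T fun t => x t ⬝ᵥ d)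
      = ∑ j, ∑ k, d j * d k * ((T : ℝ)⁻¹ * ∑ t ∈ Finset.Icc (1 : ℤ) T, x t j * x t k) := by
    simp only [empNormSq, dotProduct, sq, Finset.sum_mul_sum]
    simp only [Finset.mul_sum]
    rw [Finset.sum_comm]
    refine Finset.sum_congr rfl fun j _ => ?_
    rw [Finset.sum_comm]
    refine Finset.sum_congr rfl fun k _ => Finset.sum_congr rfl fun t _ => ?_
    ring
  have h2 : γ * groupNorm Finset.univ d ^ 2 ≤ ∑ j, ∑ k, d j * d k * S j k := by
    have h3 := hS.dotProduct_mulVec_nonneg d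
    rw [Matrix.sub_mulVec, dotProduct_sub, Matrix.smul_mulVec, Matrix.one_mulVec,
      dotProduct_smul] at h3
    have h4 : star d ⬝ᵥ d = groupNorm Finset.univ d ^ 2 := by
      rw [groupNorm, Real.sq_sqrt (Finset.sum_nonneg fun _ _ => sq_nonneg _)]
      simp [dotProduct, sq]
    have h5 : star d ⬝ᵥ (S *ᵥ d) = ∑ j, ∑ k, d j * d k * S j k := by
      simp only [dotProduct, Matrix.mulVec, star_trivial, Finset.mul_sum]
      exact Finset.sum_congr rfl fun j _ => Finset.sum_congr rfl fun k _ => by ring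
    rw [h4, h5, smul_eq_mul] at h3
    linarith
  have h6 : |(empNormSq T fun t => x t ⬝ᵥ d) - ∑ j, ∑ k, d j * d k * S j k|
      ≤ D * (∑ j, |d j|) ^ 2 := by
    rw [h1, ← Finset.sum_sub_distrib, sq, Finset.sum_mul_sum, Finset.mul_sum]
    refine (Finset.abs_sum_le_sum_abs _ _).trans (Finset.sum_le_sum fun j _ => ?_)
    rw [← Finset.sum_sub_distrib, Finset.mul_sum]
    refine (Finset.abs_sum_le_sum_abs _ _).trans (Finset.sum_le_sum fun k _ => ?_)
    rw [← mul_sub, abs_mul, abs_mul, mul_comm]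
    exact mul_le_mul_of_nonneg_right (hD j k) (by positivity)
  linarith [(abs_le.1 h6).1]

end Oracle

/-! ### Inequalities between the exponents ν, κ, μ and r. -/

section Exponents

lemma prodExponent_pos_iff {q r : ℝ} (hr : 4 < r) (hq : 2 * r / (r - 2) < q) :
    2 < q ∧ 2 < prodExponent q r := by
  have h1 : 0 < r - 2 := by linarith
  rw [div_lt_iff₀ h1] at hq
  have hq2 : 2 < q := by nlinarith
  refine ⟨hq2, ?_⟩
  rw [prodExponent, lt_div_iff₀ (by linarith)]
  linarith

/-- The denominator of κ is positive and κ - 2 has the sign of a(ν - 2) - (ν - 1), so this is the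
hypothesis on a. The bound μ > 2 follows from the hypothesis on b in the same way. -/
lemma two_lt_kappa {q r a : ℝ} (hr : 4 < r) (hq : 2 * r / (r - 2) < q)
    (ha : (prodExponent q r - 1) / (prodExponent q r - 2) < a) : 2 < kappa q r a := by
  obtain ⟨-, hν⟩ := prodExponent_pos_iff hr hq
  set ν := prodExponent q r
  have h1 : 0 < ν - 2 := by linarith
  rw [div_lt_iff₀ h1] at ha
  have ha0 : 0 < a := by
    by_contra h
    have := mul_nonpos_of_nonpos_of_nonneg (not_lt.1 h) h1.le
    linarith
  rw [kappa, lt_div_iff₀ (by linarith)]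
  linarith

lemma two_lt_muExponent {r b : ℝ} (hr : 4 < r) (hb : (r - 2) / (r - 4) < b) :
    2 < muExponent r b := by
  have h1 : 0 < r - 4 := by linarith
  rw [div_lt_iff₀ h1] at hb
  have hb0 : 0 < b := by
    by_contra h
    have := mul_nonpos_of_nonpos_of_nonneg (not_lt.1 h) h1.le
    linarith
  rw [muExponent, lt_div_iff₀ (by linarith)]
  linarith

/-- The difference r/2 - μ is a positive multiple of (r - 2)². It provides the slack in
`exists_min_mul_le`. -/
lemma muExponent_lt {r b : ℝ} (hr : 4 < r) (hb : (r - 2) / (r - 4) < b) :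
    muExponent r b < r / 2 := by
  have h1 : 0 < r - 4 := by linarith
  rw [div_lt_iff₀ h1] at hb
  have hb0 : 0 < b := by
    by_contra h
    have := mul_nonpos_of_nonpos_of_nonneg (not_lt.1 h) h1.le
    linarith
  rw [muExponent, div_lt_iff₀ (by linarith)]
  nlinarith [sq_pos_of_pos (show 0 < r - 2 by linarith)]

end Exponents

/-! ### Calculus of events of probability close to one. -/

section Tight

variable {Ω : ℕ → Type*} [∀ T, MeasurableSpace (Ω T)] {P : ∀ T, Measure (Ω T)}

/-- Events `E C T`, indexed by a constant `C`, whose probabilities are eventually as close to one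
as desired if `C` is large. -/
def TightEvents (P : ∀ T, Measure (Ω T)) (E : ℝ → ∀ T, Set (Ω T)) : Prop :=
  ∀ ε : ℝ, 0 < ε → ∃ C₀ : ℝ, 0 < C₀ ∧ ∀ C, C₀ ≤ C →
    ∀ᶠ T in atTop, P T (E C T)ᶜ ≤ ENNReal.ofReal ε

lemma TightEvents.inter {E F : ℝ → ∀ T, Set (Ω T)} (hE : TightEvents P E)
    (hF : TightEvents P F) : TightEvents P fun C T => E C T ∩ F C T := by
  intro ε hε
  obtain ⟨C₁, h1, hE'⟩ := hE (ε / 2) (by positivity)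
  obtain ⟨C₂, h2, hF'⟩ := hF (ε / 2) (by positivity)
  refine ⟨max C₁ C₂, lt_max_of_lt_left h1, fun C hC => ?_⟩
  filter_upwards [hE' C ((le_max_left _ _).trans hC), hF' C ((le_max_right _ _).trans hC)]
    with T h3 h4
  rw [Set.compl_inter]
  refine (measure_union_le _ _).trans ((add_le_add h3 h4).trans (le_of_eq ?_))
  rw [← ENNReal.ofReal_add (by positivity) (by positivity), add_halves]

lemma TightEvents.mono {E F : ℝ → ∀ T, Set (Ω T)} (hE : TightEvents P E)
    (h : ∀ C, ∀ᶠ T in atTop, E C T ⊆ F C T) : TightEvents P F := by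
  intro ε hε
  obtain ⟨C₁, h1, hE'⟩ := hE ε hε
  refine ⟨C₁, h1, fun C hC => ?_⟩
  filter_upwards [hE' C hC, h C] with T h3 h4
  exact (measure_mono (Set.compl_subset_compl.2 h4)).trans h3

/-- Replacing the constant by a function of it. -/
lemma TightEvents.mono_const {E F : ℝ → ∀ T, Set (Ω T)} (hE : TightEvents P E)
    (h : ∀ C, 0 < C → ∃ C', ∀ D, C' ≤ D → ∀ᶠ T in atTop, E C T ⊆ F D T) : TightEvents P F := by
  intro ε hε
  obtain ⟨C₁, h1, hE'⟩ := hE ε hε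
  obtain ⟨C', h2⟩ := h C₁ h1
  refine ⟨max C' 1, by positivity, fun D hD => ?_⟩
  filter_upwards [hE' C₁ le_rfl, h2 D ((le_max_left _ _).trans hD)] with T h3 h4
  exact (measure_mono (Set.compl_subset_compl.2 h4)).trans h3

lemma TightEvents.of_ae {F : ∀ T, Set (Ω T)} (h : ∀ᶠ T in atTop, ∀ᵐ ω ∂(P T), ω ∈ F T) :
    TightEvents P fun _ T => F T := by
  intro ε _
  refine ⟨1, one_pos, fun C _ => ?_⟩
  filter_upwards [h] with T hT
  have : P T (F T)ᶜ = 0 := hT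
  rw [this]
  exact bot_le

lemma TightEvents.iInter {κ : Type*} [Finite κ] {E : κ → ℝ → ∀ T, Set (Ω T)}
    (hE : ∀ i, TightEvents P (E i)) : TightEvents P fun C T => ⋂ i, E i C T := by
  classical
  cases nonempty_fintype κ
  have key : ∀ s : Finset κ, TightEvents P fun C T => ⋂ i ∈ s, E i C T := by
    intro s
    induction s using Finset.induction_on with
    | empty =>
      refine (TightEvents.of_ae (F := fun _ => Set.univ) ?_).mono fun C => ?_
      · exact Eventually.of_forall fun T => Eventually.of_forall fun ω => Set.mem_univ _
      · exact Eventually.of_forall fun T => by simp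
    | insert i s _ ih =>
      refine ((hE i).inter ih).mono fun C => Eventually.of_forall fun T => ?_
      simp
  refine (key Finset.univ).mono fun C => Eventually.of_forall fun T => ?_
  simp

lemma TightEvents.isBigOP {E : ℝ → ∀ T, Set (Ω T)} (hE : TightEvents P E)
    {Z : ∀ T, Ω T → ℝ} {ρ : ℕ → ℝ}
    (h : ∀ C, 0 < C → ∃ C' : ℝ, 0 < C' ∧ ∀ᶠ T in atTop, ∀ ω ∈ E C T, |Z T ω| ≤ C' * ρ T) :
    IsBigOP P Z ρ := by
  intro ε hε
  obtain ⟨C₁, h1, hE'⟩ := hE ε hε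
  obtain ⟨C', h2, h3⟩ := h C₁ h1
  refine ⟨C', h2, ?_⟩
  filter_upwards [hE' C₁ le_rfl, h3] with T h4 h5
  refine (measure_mono fun ω hω => ?_).trans h4
  intro hmem
  exact absurd (h5 ω hmem) (not_le.2 hω)

/-- Markov's inequality as a tightness statement. -/
lemma TightEvents.of_lintegral {Z : ∀ T, Ω T → ℝ≥0∞} {ρ : ℕ → ℝ} {D : ℝ}
    (hρ : ∀ᶠ T in atTop, 0 < ρ T)
    (h : ∀ᶠ T in atTop, ∫⁻ ω, Z T ω ∂(P T) ≤ ENNReal.ofReal (D * ρ T))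
    (hm : ∀ T, AEMeasurable (Z T) (P T)) :
    TightEvents P fun C T => {ω | Z T ω ≤ ENNReal.ofReal (C * ρ T)} := by
  intro ε hε
  refine ⟨(|D| + 1) / ε, by positivity, fun C hC => ?_⟩
  filter_upwards [hρ, h] with T h1 h2
  have hC0 : 0 < C := lt_of_lt_of_le (by positivity) hC
  have h4 : P T {ω | Z T ω ≤ ENNReal.ofReal (C * ρ T)}ᶜ
      ≤ P T {ω | ENNReal.ofReal (C * ρ T) ≤ Z T ω} := by
    refine measure_mono fun ω hω => ?_
    have hω' : ¬ Z T ω ≤ ENNReal.ofReal (C * ρ T) := hω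
    exact (not_le.1 hω').le
  have hpos : 0 < C * ρ T := by positivity
  refine h4.trans ((meas_ge_le_lintegral_div (hm T) (by simpa using hpos)
    ENNReal.ofReal_ne_top).trans ?_)
  rw [ENNReal.div_le_iff (by simpa using hpos) ENNReal.ofReal_ne_top,
    ← ENNReal.ofReal_mul hε.le]
  refine h2.trans (ENNReal.ofReal_le_ofReal ?_)
  rw [div_le_iff₀ hε] at hC
  have : D ≤ C * ε := (le_abs_self D).trans (by linarith)
  nlinarith

lemma TightEvents.of_integral {Z : ∀ T, Ω T → ℝ} {ρ : ℕ → ℝ} {D : ℝ}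
    (hρ : ∀ᶠ T in atTop, 0 < ρ T) (h0 : ∀ T ω, 0 ≤ Z T ω) (hi : ∀ T, Integrable (Z T) (P T))
    (h : ∀ᶠ T in atTop, ∫ ω, Z T ω ∂(P T) ≤ D * ρ T) :
    TightEvents P fun C T => {ω | Z T ω ≤ C * ρ T} := by
  have h1 := TightEvents.of_lintegral (P := P) (Z := fun T ω => ENNReal.ofReal (Z T ω)) (D := D) hρ
    (by
      filter_upwards [h] with T hT
      rw [← ofReal_integral_eq_lintegral_ofReal (hi T) (Eventually.of_forall (h0 T))]
      exact ENNReal.ofReal_le_ofReal hT)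
    (fun T => (hi T).aemeasurable.ennreal_ofReal)
  refine h1.mono_const fun C hC => ⟨C, fun D hD => ?_⟩
  filter_upwards [hρ] with T hT
  intro ω hω
  have h2 := (ENNReal.ofReal_le_ofReal_iff (by positivity)).1 hω
  exact h2.trans (mul_le_mul_of_nonneg_right hD hT.le)

end Tight

/-! ### Concentration of the noise and of the Gram matrix. -/

section Concentration

variable {Ω : Type*} [MeasurableSpace Ω] {ι : Type*}

lemma eLpNorm_mul_le_ofReal {μ : Measure Ω} {X Y : Ω → ℝ} {q r ν C : ℝ} (hq : 0 < q) (hr : 0 < r)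
    (hν : ν = q * r / (q + r)) (hC : 0 ≤ C) (hX : Measurable X) (hY : Measurable Y)
    (hXq : eLpNorm X (ENNReal.ofReal q) μ ≤ ENNReal.ofReal C)
    (hYr : eLpNorm Y (ENNReal.ofReal r) μ ≤ ENNReal.ofReal C) :
    eLpNorm (fun ω => X ω * Y ω) (ENNReal.ofReal ν) μ ≤ ENNReal.ofReal (C * C) := by
  have hν0 : 0 < ν := by rw [hν]; positivity
  have : ENNReal.HolderTriple (ENNReal.ofReal q) (ENNReal.ofReal r) (ENNReal.ofReal ν) := by
    constructor
    rw [← ENNReal.ofReal_inv_of_pos hq, ← ENNReal.ofReal_inv_of_pos hr,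
      ← ENNReal.ofReal_inv_of_pos hν0, ← ENNReal.ofReal_add (by positivity) (by positivity)]
    congr 1
    rw [hν]
    field_simp
    ring
  have h := eLpNorm_smul_le_mul_eLpNorm (p := ENNReal.ofReal q) (q := ENNReal.ofReal r)
    (r := ENNReal.ofReal ν) hY.aestronglyMeasurable hX.aestronglyMeasurable (μ := μ)
  refine le_trans h ?_
  rw [ENNReal.ofReal_mul hC]
  gcongr

lemma measureReal_exists_le {κ : Type*} [Fintype κ] (μ : Measure Ω) [IsFiniteMeasure μ]
    {s : κ → Set Ω} {δ : ℝ} (h : ∀ i, μ.real (s i) ≤ δ) :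
    μ.real {ω | ∃ i, ω ∈ s i} ≤ Fintype.card κ * δ := by
  have h1 : {ω | ∃ i, ω ∈ s i} = ⋃ i, s i := by ext; simp
  rw [h1]
  refine (measureReal_iUnion_fintype_le _).trans ((Finset.sum_le_sum fun i _ => h i).trans ?_)
  simp

lemma StrictlyStationary.integral_eq {E : Type*} [MeasurableSpace E] {μ : Measure Ω}
    {ξ : ℤ → Ω → E} (h : StrictlyStationary μ ξ) (hξ : ∀ t, Measurable (ξ t)) {f : E → ℝ}
    (hf : Measurable f) (t : ℤ) : ∫ ω, f (ξ t ω) ∂μ = ∫ ω, f (ξ 0 ω) ∂μ := by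
  have h1 := h t
  have hm : Measurable fun z : ℤ → E => f (z 0) := hf.comp (measurable_pi_apply 0)
  have h2 : ∫ z, f (z 0) ∂(μ.map fun ω s => ξ (s + t) ω) = ∫ ω, f (ξ t ω) ∂μ := by
    rw [integral_map (by fun_prop) hm.aestronglyMeasurable]
    simp
  have h3 : ∫ z, f (z 0) ∂(μ.map fun ω s => ξ s ω) = ∫ ω, f (ξ 0 ω) ∂μ := by
    rw [integral_map (by fun_prop) hm.aestronglyMeasurable]
  rw [← h2, ← h3, h1]

/-- Concentration of the noise and of the Gram matrix of a regression. -/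
theorem exists_concentration {q r a b c B : ℝ} (hr : 4 < r) (hq : 2 * r / (r - 2) < q)
    (ha : (prodExponent q r - 1) / (prodExponent q r - 2) < a) (hb : (r - 2) / (r - 4) < b)
    (hc : 0 < c) : ∃ c₁ c₂ : ℝ, 0 < c₁ ∧ 0 < c₂ ∧
    ∀ {Ω : Type*} [MeasurableSpace Ω] (μ : Measure Ω) [IsProbabilityMeasure μ] {ι : Type}
      [Fintype ι] (R : LinReg Ω ι), R.DataCond μ q r a b c B → ∀ (T : ℕ) (y : ℝ), 0 < y →
      μ.real {ω | ∃ j, y ≤ |∑ t ∈ Finset.Icc (1 : ℤ) T, R.u t ω * R.x t ω j|} ≤ Fintype.card ι *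
          (c₁ * (T * y ^ (-kappa q r a) + Real.exp (-(c₂ * y ^ 2 / T)))) ∧
      μ.real {ω | ∃ jk : ι × ι, y ≤ |∑ t ∈ Finset.Icc (1 : ℤ) T,
          (R.x t ω jk.1 * R.x t ω jk.2 - R.secondMoment μ jk.1 jk.2)|} ≤ (Fintype.card ι) ^ 2 *
          (c₁ * (T * y ^ (-muExponent r b) + Real.exp (-(c₂ * y ^ 2 / T)))) := by
  obtain ⟨hq2, hν⟩ := prodExponent_pos_iff hr hq
  set C := max B 0 with hC
  have hC0 : 0 ≤ C := le_max_right _ _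
  -- Products of two regressors have moments of order r/2 and mixing rate b. With ν = r/2 and a = b,
  -- the condition of the Fuk–Nagaev inequality is the one on b, and the exponent κ becomes μ.
  have hb' : (r / 2 - 1) / (r / 2 - 2) < b := by
    refine lt_of_le_of_lt (le_of_eq ?_) hb
    have h1 : r - 4 ≠ 0 := by linarith
    have h2 : r / 2 - 2 ≠ 0 := by
      intro h; apply h1; linarith
    rw [div_eq_div_iff h2 h1]
    ring
  obtain ⟨d₁, d₂, hd₁, hd₂, hF⟩ := fuk_nagaev hν ha hc (mul_nonneg hC0 hC0)
  obtain ⟨e₁, e₂, he₁, he₂, hG⟩ := fuk_nagaev (ν := r / 2) (by linarith) hb' hc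
    (mul_nonneg hC0 hC0)
  refine ⟨max d₁ e₁, min d₂ e₂, lt_max_of_lt_left hd₁, lt_min hd₂ he₂, ?_⟩
  intro Ω _ μ _ ι _ R hR T y hy
  have hBC : ENNReal.ofReal B ≤ ENNReal.ofReal C := ENNReal.ofReal_le_ofReal (le_max_left _ _)
  have hxm : ∀ t j, Measurable fun ω => R.x t ω j := fun t j =>
    (measurable_pi_apply j).comp (hR.measurable_x t)
  have hκ : ((a + 1) * prodExponent q r - 1) / (a + prodExponent q r - 1) = kappa q r a := rfl
  have hμ : ((b + 1) * (r / 2) - 1) / (b + r / 2 - 1) = muExponent r b := by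
    have hr4 : 0 < r - 4 := by linarith
    have hb0 : 0 < b := lt_trans (div_pos (by linarith) hr4) hb
    have h1 : b + r / 2 - 1 ≠ 0 := by
      have : 0 < b + r / 2 - 1 := by linarith
      exact this.ne'
    have h2 : r + 2 * (b - 1) ≠ 0 := by
      have : 0 < r + 2 * (b - 1) := by linarith
      exact this.ne'
    rw [muExponent, div_eq_div_iff h1 h2]
    ring
  have hexp : ∀ d, min d₂ e₂ ≤ d →
      Real.exp (-(d * y ^ 2 / T)) ≤ Real.exp (-(min d₂ e₂ * y ^ 2 / T)) := fun d hd =>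
    Real.exp_le_exp.2 (neg_le_neg (by gcongr))
  constructor
  · refine measureReal_exists_le μ (s := fun j => {ω | y ≤ |∑ t ∈ Finset.Icc (1 : ℤ) T,
      R.u t ω * R.x t ω j|}) fun j => ?_
    have h := hF μ (fun t ω => R.u t ω * R.x t ω j)
      (fun t => (hR.measurable_u t).mul (hxm t j))
      (fun t => eLpNorm_mul_le_ofReal (by linarith) (by linarith) rfl hC0 (hR.measurable_u t)
        (hxm t j) ((hR.moment_u t).trans hBC) ((hR.moment_x t j).trans hBC))
      (fun k hk => hR.mixing_ux j k hk) T y hy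
    simp only [hR.exogenous, sub_zero] at h
    rw [hκ] at h
    refine h.trans ?_
    have := hexp d₂ (min_le_left _ _)
    have h0 : 0 < Real.exp (-(d₂ * y ^ 2 / T)) := Real.exp_pos _
    gcongr
    exact le_max_left _ _
  · have hsm : ∀ t j k, ∫ ω, R.x t ω j * R.x t ω k ∂μ = R.secondMoment μ j k := by
      intro t j k
      have := hR.stationary_xx.integral_eq
        (fun t => measurable_pi_lambda _ fun jk => (hxm t jk.1).mul (hxm t jk.2))
        (measurable_pi_apply (j, k)) t
      exact this
    have hcard : ((Fintype.card ι : ℝ)) ^ 2 = (Fintype.card (ι × ι) : ℝ) := by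
      rw [Fintype.card_prod]; push_cast; ring
    rw [hcard]
    refine measureReal_exists_le μ (s := fun jk : ι × ι => {ω | y ≤ |∑ t ∈ Finset.Icc (1 : ℤ) T,
      (R.x t ω jk.1 * R.x t ω jk.2 - R.secondMoment μ jk.1 jk.2)|}) fun jk => ?_
    have h := hG μ (fun t ω => R.x t ω jk.1 * R.x t ω jk.2)
      (fun t => (hxm t jk.1).mul (hxm t jk.2))
      (fun t => eLpNorm_mul_le_ofReal (by linarith) (by linarith)
        (by
          have : r + r ≠ 0 := by
            have : 0 < r + r := by linarith
            exact this.ne'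
          field_simp
          ring) hC0 (hxm t jk.1)
        (hxm t jk.2) ((hR.moment_x t _).trans hBC) ((hR.moment_x t _).trans hBC))
      (fun k hk => hR.mixing_xx jk.1 jk.2 k hk) T y hy
    simp only [hsm] at h
    rw [hμ] at h
    refine h.trans ?_
    have := hexp e₂ (min_le_right _ _)
    have h0 : 0 < Real.exp (-(e₂ * y ^ 2 / T)) := Real.exp_pos _
    gcongr
    exact le_max_right _ _

end Concentration

/-! ### Dimension conditions translated into the rate √(log p / T). -/

section Rates

lemma log_two_le_log_natCast {n : ℕ} (hn : 2 ≤ n) : Real.log 2 ≤ Real.log n :=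
  Real.log_le_log (by norm_num) (by exact_mod_cast hn)

lemma log_natCast_pos {n : ℕ} (hn : 2 ≤ n) : 0 < Real.log n :=
  (Real.log_pos (by norm_num)).trans_le (log_two_le_log_natCast hn)

/-- With L = √(ℓ/t), the denominator in the dimension condition is t^{κ-1} L^κ, the form in which it
meets the tuning rate and the tail bound. -/
lemma sqrt_rpow_mul_rpow {κ t ℓ : ℝ} (ht : 0 < t) (hℓ : 0 < ℓ) :
    √(t ^ (κ - 2) * ℓ ^ κ) = t ^ (κ - 1) * √(ℓ / t) ^ κ := by
  have h1 : √(ℓ / t) ^ κ = ℓ ^ (κ / 2) * t ^ (-(κ / 2)) := by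
    rw [Real.sqrt_eq_rpow, ← Real.rpow_mul (by positivity), Real.div_rpow hℓ.le ht.le,
      Real.rpow_neg ht.le, div_eq_mul_inv, one_div_mul_eq_div]
  rw [h1, Real.sqrt_eq_rpow, Real.mul_rpow (by positivity) (by positivity), ← Real.rpow_mul ht.le,
    ← Real.rpow_mul hℓ.le, mul_comm (ℓ ^ (κ / 2)), ← mul_assoc, ← Real.rpow_add ht]
  congr 2 <;> ring

lemma mul_rpow_sqrt_mul {κ t ℓ C : ℝ} (ht : 0 < t) (hℓ : 0 < ℓ) (hC : 0 < C) :
    t * (C * √(t * ℓ)) ^ (-κ) = C ^ (-κ) * (√(t ^ (κ - 2) * ℓ ^ κ))⁻¹ := by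
  have h1 : √(t * ℓ) = t * √(ℓ / t) := by
    rw [show t * ℓ = t ^ 2 * (ℓ / t) by field_simp, Real.sqrt_mul (by positivity),
      Real.sqrt_sq ht.le]
  have hL : 0 < √(ℓ / t) := Real.sqrt_pos.2 (by positivity)
  rw [sqrt_rpow_mul_rpow ht hℓ, h1, Real.mul_rpow hC.le (by positivity),
    Real.mul_rpow ht.le hL.le, mul_inv, Real.rpow_neg hL.le, ← Real.rpow_neg ht.le]
  have h2 : t * t ^ (-κ) = t ^ (-(κ - 1)) := by
    nth_rewrite 1 [← Real.rpow_one t]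
    rw [← Real.rpow_add ht]
    congr 1
    ring
  rw [← h2]
  ring

lemma tuningRate_nonneg (κ δ : ℝ) (p T : ℕ) : 0 ≤ tuningRate κ δ p T :=
  le_max_of_le_right (Real.sqrt_nonneg _)

/-- The dimension condition says that p / (T^{κ-1} L^κ) tends to 0, so the polynomial part of the
tuning rate is eventually below L. In the logarithmic part log(8/δ) is absorbed by log p ≥ log 2. -/
lemma eventually_tuningRate_le {κ δ : ℝ} {p : ℕ → ℕ} (hp : ∀ T, 2 ≤ p T) (hκ : 0 < κ) (hδ : 0 < δ)
    (hδ1 : δ < 1) (h : Tendsto (fun T : ℕ => (p T : ℝ) /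
      √((T : ℝ) ^ (κ - 2) * Real.log (p T) ^ κ)) atTop (𝓝 0)) :
    ∀ᶠ T : ℕ in atTop, tuningRate κ δ (p T) T
      ≤ (1 + √(1 + Real.log (8 / δ) / Real.log 2)) * √(Real.log (p T) / T) := by
  filter_upwards [h.eventually (gt_mem_nhds hδ), eventually_gt_atTop 0] with T hT hT0
  have hTr : (0 : ℝ) < T := by exact_mod_cast hT0
  have hℓ := log_natCast_pos (hp T)
  have hp0 : (0 : ℝ) < p T := by exact_mod_cast (by have := hp T; omega : 0 < p T)
  have hl2 : 0 < Real.log 2 := Real.log_pos (by norm_num)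
  have hl8 : 0 < Real.log (8 / δ) := Real.log_pos (by rw [lt_div_iff₀ hδ]; linarith)
  set L := √(Real.log (p T) / T) with hL
  have hL0 : 0 < L := Real.sqrt_pos.2 (by positivity)
  rw [sqrt_rpow_mul_rpow hTr hℓ, div_lt_iff₀ (by positivity)] at hT
  have h1 : ((p T : ℝ) / (δ * (T : ℝ) ^ (κ - 1))) ^ (1 / κ) ≤ L := by
    have h2 : (p T : ℝ) / (δ * (T : ℝ) ^ (κ - 1)) ≤ L ^ κ := by
      rw [div_le_iff₀ (by positivity)]
      linarith
    calc _ ≤ (L ^ κ) ^ (1 / κ) := Real.rpow_le_rpow (by positivity) h2 (by positivity)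
      _ = L := by rw [← Real.rpow_mul hL0.le, mul_one_div_cancel hκ.ne', Real.rpow_one]
  have h3 : √(Real.log (8 * p T / δ) / T) ≤ √(1 + Real.log (8 / δ) / Real.log 2) * L := by
    rw [hL, ← Real.sqrt_mul (by positivity)]
    apply Real.sqrt_le_sqrt
    rw [mul_div_assoc']
    refine div_le_div_of_nonneg_right ?_ hTr.le
    have h4 : Real.log (8 * p T / δ) = Real.log (8 / δ) + Real.log (p T) := by
      rw [← Real.log_mul (by positivity) (by positivity)]
      congr 1
      ring
    rw [h4, add_mul, one_mul, div_mul_eq_mul_div, add_comm]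
    gcongr
    rw [le_div_iff₀ hl2]
    exact mul_le_mul_of_nonneg_left (log_two_le_log_natCast (hp T)) hl8.le
  refine max_le ?_ ?_
  · have : 0 ≤ √(1 + Real.log (8 / δ) / Real.log 2) * L := by positivity
    linarith
  · linarith

/-- The polynomial part of the union bound for the noise at level C√(T log p) is a constant times
the quantity in the dimension condition. -/
lemma tendsto_noise_rate {κ C : ℝ} {p : ℕ → ℕ} (hp : ∀ T, 2 ≤ p T) (hC : 0 < C)
    (h : Tendsto (fun T : ℕ => (p T : ℝ) /
      √((T : ℝ) ^ (κ - 2) * Real.log (p T) ^ κ)) atTop (𝓝 0)) :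
    Tendsto (fun T : ℕ => (p T : ℝ) * (T * (C * √(T * Real.log (p T))) ^ (-κ))) atTop (𝓝 0) := by
  have h1 := h.const_mul (C ^ (-κ))
  rw [mul_zero] at h1
  refine h1.congr' ?_
  filter_upwards [eventually_gt_atTop 0] with T hT
  rw [mul_rpow_sqrt_mul (by exact_mod_cast hT) (log_natCast_pos (hp T)) hC]
  ring

/-- The union bound over p² entries of the Gram matrix at deviation x₀/s. Its polynomial part is a
multiple of s^μ p² T^{1-μ}; its exponential part vanishes because T/s² grows faster than log² p. -/
lemma tendsto_gram_rate {μ x₀ c₁ c₂ : ℝ} {p : ℕ → ℕ} {s : ℕ → ℝ} (hp : ∀ T, 2 ≤ p T)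
    (hs : ∀ T, 1 ≤ s T) (hx₀ : 0 < x₀) (hc₁ : 0 < c₁) (hc₂ : 0 < c₂)
    (h1 : Tendsto (fun T : ℕ => s T ^ μ * (p T : ℝ) ^ 2 * (T : ℝ) ^ (1 - μ)) atTop (𝓝 0))
    (h2 : Tendsto (fun T : ℕ => s T ^ 2 * Real.log (p T) ^ 2 / T) atTop (𝓝 0)) :
    Tendsto (fun T : ℕ => (p T : ℝ) ^ 2 * (c₁ * (T * (T * (x₀ / s T)) ^ (-μ)
      + Real.exp (-(c₂ * (T * (x₀ / s T)) ^ 2 / T))))) atTop (𝓝 0) := by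
  have hl2 : 0 < Real.log 2 := Real.log_pos (by norm_num)
  set k := c₂ * x₀ ^ 2 with hk
  have hk0 : 0 < k := by positivity
  have h3 : Tendsto (fun T : ℕ => c₁ * x₀ ^ (-μ) *
      (s T ^ μ * (p T : ℝ) ^ 2 * (T : ℝ) ^ (1 - μ))
      + c₁ * (2 / k / Real.log 2 ^ 2) * (s T ^ 2 * Real.log (p T) ^ 2 / T)) atTop (𝓝 0) := by
    simpa using (h1.const_mul (c₁ * x₀ ^ (-μ))).add (h2.const_mul (c₁ * (2 / k / Real.log 2 ^ 2)))
  refine squeeze_zero' (Eventually.of_forall fun T => ?_) ?_ h3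
  · have := hs T
    positivity
  · filter_upwards [h2.eventually (gt_mem_nhds (show 0 < k * Real.log 2 / 4 by positivity)),
      eventually_gt_atTop 0] with T hT hT0
    have hTr : (0 : ℝ) < T := by exact_mod_cast hT0
    have hsT : 0 < s T := lt_of_lt_of_le one_pos (hs T)
    have hℓ := log_natCast_pos (hp T)
    have hℓ2 := log_two_le_log_natCast (hp T)
    have hp0 : (0 : ℝ) < p T := by exact_mod_cast (by have := hp T; omega : 0 < p T)
    set ℓ := Real.log (p T) with hℓ_def
    have e1 : (T : ℝ) * (T * (x₀ / s T)) ^ (-μ)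
        = x₀ ^ (-μ) * (s T ^ μ * (T : ℝ) ^ (1 - μ)) := by
      rw [Real.mul_rpow hTr.le (by positivity), Real.div_rpow hx₀.le hsT.le,
        Real.rpow_neg hsT.le, sub_eq_add_neg, Real.rpow_add hTr, Real.rpow_one]
      field_simp
    set z := T / s T ^ 2 with hz
    have hz0 : 0 < z := by positivity
    have e2 : c₂ * (T * (x₀ / s T)) ^ 2 / T = k * z := by
      rw [hz, hk]
      field_simp
    have e3 : s T ^ 2 * ℓ ^ 2 / T = ℓ ^ 2 / z := by
      rw [hz]
      field_simp
    rw [e3] at hT ⊢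
    rw [div_lt_iff₀ hz0] at hT
    have e4 : (p T : ℝ) ^ 2 * Real.exp (-(k * z)) ≤ 2 / k / Real.log 2 ^ 2 * (ℓ ^ 2 / z) := by
      have e5 : (p T : ℝ) ^ 2 = Real.exp (2 * ℓ) := by
        rw [mul_comm, Real.exp_mul, hℓ_def, Real.exp_log hp0, Real.rpow_two]
      rw [e5, ← Real.exp_add]
      -- From ℓ² < (k log 2 / 4) z and log 2 ≤ ℓ it follows that kz ≥ 4ℓ, so half of the exponent
      -- absorbs the factor p².
      have e6 : 2 * ℓ + -(k * z) ≤ -(k * z / 2) := by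
        have : 2 * ℓ * Real.log 2 ≤ (k * z / 2) * Real.log 2 := by nlinarith
        have := le_of_mul_le_mul_right this hl2
        linarith
      have e7 : Real.exp (-(k * z / 2)) ≤ 2 / (k * z) := by
        rw [Real.exp_neg, ← inv_div (k * z) 2]
        refine inv_anti₀ (by positivity) ?_
        linarith [Real.add_one_le_exp (k * z / 2)]
      refine (Real.exp_le_exp.2 e6).trans (e7.trans ?_)
      rw [show 2 / k / Real.log 2 ^ 2 * (ℓ ^ 2 / z) = 2 / (k * z) * (ℓ ^ 2 / Real.log 2 ^ 2) by
        field_simp]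
      refine le_mul_of_one_le_right (by positivity) ?_
      rw [one_le_div (by positivity)]
      gcongr
    rw [e1, e2]
    have := mul_le_mul_of_nonneg_left e4 hc₁.le
    nlinarith

end Rates

/-! ### Rates of convergence of the sg-LASSO. -/

section LassoRate

lemma LinReg.y_eq {Ω ι : Type*} [MeasurableSpace Ω] [Fintype ι] (R : LinReg Ω ι) (t : ℤ) (ω : Ω) :
    R.y t ω = R.u t ω + R.approxError t ω + R.x t ω ⬝ᵥ R.β := by
  rw [LinReg.y, LinReg.approxError]
  ring

/-- The event on which the sg-LASSO attains its rates of convergence. -/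
def lassoEvent {Ω : ℕ → Type*} [∀ T, MeasurableSpace (Ω T)] {ι : ℕ → Type}
    [∀ T, Fintype (ι T)] [∀ T, DecidableEq (ι T)] (R : ∀ T, LinReg (Ω T) (ι T)) (s L : ℕ → ℝ)
    (βhat : ∀ T, Ω T → ι T → ℝ) (C : ℝ) (T : ℕ) : Set (Ω T) :=
  {ω | √(empNormSq T fun t => (R T).x t ω ⬝ᵥ (βhat T ω - (R T).β))
      ≤ C * (√(s T) * L T) + 4 * √(empNormSq T fun t => (R T).approxError t ω) ∧
    (√(empNormSq T fun t => (R T).approxError t ω) = 0 →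
      ∑ j, |(βhat T ω - (R T).β) j| ≤ C * (s T * L T))}

set_option maxHeartbeats 4000000 in
/-- Rates of convergence of the sg-LASSO. -/
theorem exists_lasso_rate {q r a b c B : ℝ} {gm : ℕ} (hgm : 1 ≤ gm) (hr : 4 < r)
    (hq : 2 * r / (r - 2) < q) (ha : (prodExponent q r - 1) / (prodExponent q r - 2) < a)
    (hb : (r - 2) / (r - 4) < b) (hc : 0 < c) : ∃ C₀ : ℝ, 0 < C₀ ∧
    ∀ (Ω : ℕ → Type*) [∀ T, MeasurableSpace (Ω T)] (P : ∀ T, Measure (Ω T))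
      [∀ T, IsProbabilityMeasure (P T)] (ι : ℕ → Type) [∀ T, Fintype (ι T)]
      [∀ T, DecidableEq (ι T)] (p : ℕ → ℕ) (R : ∀ T, LinReg (Ω T) (ι T)) (α : ℝ)
      (𝒢 : ∀ T, Finpartition (Finset.univ : Finset (ι T))) (lam : ℕ → ℝ)
      (βhat : ∀ T, Ω T → ι T → ℝ),
      (∀ T, 2 ≤ p T) → (∀ T, Fintype.card (ι T) ≤ p T) → 0 ≤ α → α ≤ 1 →
      (∀ T, ∀ A ∈ (𝒢 T).parts, A.card ≤ gm) →
      (∀ᶠ T in atTop, ∀ᵐ ω ∂(P T), IsSGLasso T (fun t => (R T).y t ω)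
        (fun t => (R T).x t ω) α (𝒢 T) (lam T) (βhat T ω)) →
      RegressionCond P R α 𝒢 p lam q r a b c B C₀ →
      Tendsto (fun T : ℕ => max (effSparsity α (𝒢 T) (R T).β) 1 ^ 2 *
        Real.log (p T) ^ 2 / T) atTop (𝓝 0) →
      Tendsto (fun T : ℕ => (p T : ℝ) /
        √((T : ℝ) ^ (kappa q r a - 2) * Real.log (p T) ^ kappa q r a)) atTop (𝓝 0) →
      TightEvents P (lassoEvent R (fun T => max (effSparsity α (𝒢 T) (R T).β) 1)
        (fun T => √(Real.log (p T) / T)) βhat) := by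
  obtain ⟨c₁, c₂, hc₁, hc₂, hconc⟩ := exists_concentration (B := B) hr hq ha hb hc
  have hκ2 := two_lt_kappa hr hq ha
  set κ := kappa q r a with hκ
  -- At deviation C'√(TΛ) of the sum the Gaussian exponent is 2Λ ≥ 2 log p, so that the union bound
  -- over p coordinates leaves 1/p.
  set C' := √(2 / c₂) with hC'
  have hC'0 : 0 < C' := Real.sqrt_pos.2 (by positivity)
  have hC'2 : c₂ * C' ^ 2 = 2 := by
    rw [hC', Real.sq_sqrt (by positivity)]
    field_simp
  have hg0 : 0 < √(gm : ℝ) := Real.sqrt_pos.2 (by exact_mod_cast hgm)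
  -- This makes the noise level λ/(2√gm) of the oracle inequality at least C'√(Λ/T).
  refine ⟨2 * √(gm : ℝ) * C', by positivity, ?_⟩
  intro Ω _ P _ ι _ _ p R α 𝒢 lam βhat hp hcard hα0 hα1 h𝒢 hlasso hR hs2 hp6
  set s : ℕ → ℝ := fun T => max (effSparsity α (𝒢 T) (R T).β) 1 with hs
  have hs1 : ∀ T, 1 ≤ s T := fun T => le_max_right _ _
  obtain ⟨γ, hγ, hcov⟩ := hR.covariance
  obtain ⟨δ, hδ, hδ1, C₁, htun⟩ := hR.tuning
  set K := 1 + √(1 + Real.log (8 / δ) / Real.log 2) with hK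
  have hK0 : 0 < K := by positivity
  set C₃ := (max C₁ 0) * K with hC₃
  have hC₃0 : 0 ≤ C₃ := by positivity
  set L : ℕ → ℝ := fun T => √(Real.log (p T) / T) with hL
  set rr := √(2 / γ) with hrr
  have hrr0 : 0 < rr := Real.sqrt_pos.2 (by positivity)
  intro ε hε
  -- The threshold between high and low dimension. For p ≥ N the noise bound c₁/p is at most ε/4;
  -- for p < N the noise is only compared with the larger level A·λ/(2√gm), with A depending on ε.
  -- The two regimes may alternate along the sequence.
  obtain ⟨N, hN⟩ := exists_nat_gt (max 1 (4 * c₁ / ε))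
  have hN1 : (1 : ℝ) < N := (le_max_left _ _).trans_lt hN
  have hNε : 4 * c₁ / ε < N := (le_max_right _ _).trans_lt hN
  set A := max 1 (4 * c₁ * N / ε) with hA
  have hA1 : 1 ≤ A := le_max_left _ _
  -- A Gram deviation of x₀/s meets the requirements of both oracle inequalities.
  set x₀ := min (γ / (32 * gm)) (γ / (2 * N)) with hx₀
  have hgm0 : (0 : ℝ) < gm := by exact_mod_cast hgm
  have hx₀0 : 0 < x₀ := lt_min (by positivity) (by positivity)
  have hA2 : 4 * c₁ * N / ε ≤ A := le_max_right _ _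
  have hx₀a : x₀ ≤ γ / (32 * gm) := min_le_left _ _
  have hx₀b : x₀ ≤ γ / (2 * N) := min_le_right _ _
  set D₁ := 6 * rr * C₃ with hD₁
  set D₂ := 2 * (A + 1) * √(N : ℝ) * rr * C₃ with hD₂
  set C := D₁ + 4 * √(gm : ℝ) * rr * D₁ + D₂ + √(N : ℝ) * rr * D₂ + 1 with hC
  have hD₁0 : 0 ≤ D₁ := by positivity
  have hD₂0 : 0 ≤ D₂ := by positivity
  have hq1 : 0 ≤ 4 * √(gm : ℝ) * rr * D₁ := by positivity
  have hq2 : 0 ≤ √(N : ℝ) * rr * D₂ := by positivity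
  have hCpos : 0 < C := by positivity
  refine ⟨C, hCpos, fun C₄ hC₄ => ?_⟩
  clear_value C D₁ D₂ x₀ A C₃ K rr C'
  have ht1 := (tendsto_noise_rate (κ := κ) hp hC'0 hp6).const_mul c₁
  rw [mul_zero] at ht1
  have ht2 := tendsto_gram_rate (μ := muExponent r b) hp hs1 hx₀0 hc₁ hc₂ hR.dim_rate hs2
  filter_upwards [htun, eventually_tuningRate_le hp (by linarith) hδ hδ1 hp6, hlasso,
    ht1.eventually (gt_mem_nhds (show 0 < ε / 4 by positivity)),
    ht2.eventually (gt_mem_nhds (show 0 < ε / 2 by positivity)),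
    eventually_gt_atTop 0] with T hT1 hT2 hT3 hT4 hT5 hT0
  rw [← hK] at hT2
  have hTr : (0 : ℝ) < T := by exact_mod_cast hT0
  have hℓ := log_natCast_pos (hp T)
  have hp0 : (0 : ℝ) < p T := by exact_mod_cast (by have := hp T; omega : 0 < p T)
  have hp2 : (2 : ℝ) ≤ p T := by exact_mod_cast hp T
  have hL0 : 0 < L T := Real.sqrt_pos.2 (by positivity)
  have hsT := hs1 T
  have hss : 1 ≤ √(s T) := Real.one_le_sqrt.2 hsT
  have hss2 : √(s T) * √(s T) = s T := Real.mul_self_sqrt (by linarith)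
  set Λ := Real.log (8 * p T / δ) with hΛ
  have hpδ : 8 * (p T : ℝ) ≤ 8 * p T / δ := by
    rw [le_div_iff₀ hδ]
    nlinarith
  have hΛp : Real.log (p T) ≤ Λ := Real.log_le_log hp0 (by linarith)
  have hΛ1 : 1 ≤ Λ := by
    rw [hΛ, Real.le_log_iff_exp_le (by positivity)]
    have := Real.exp_one_lt_d9
    linarith
  have hlamlow : 2 * √(gm : ℝ) * C' * √(Λ / T) ≤ lam T := by
    refine le_trans ?_ hT1.1
    exact mul_le_mul_of_nonneg_left (le_max_right _ _) (by positivity)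
  have hlam : 0 < lam T := lt_of_lt_of_le (by positivity) hlamlow
  have hlamup : lam T ≤ C₃ * L T := by
    calc lam T ≤ C₁ * tuningRate κ δ (p T) T := hT1.2
      _ ≤ max C₁ 0 * tuningRate κ δ (p T) T :=
        mul_le_mul_of_nonneg_right (le_max_left _ _) (tuningRate_nonneg _ _ _ _)
      _ ≤ max C₁ 0 * (K * L T) := mul_le_mul_of_nonneg_left hT2 (le_max_right _ _)
      _ = _ := by rw [hC₃]; ring
  have hsqrtT : T * √(Λ / T) = √(T * Λ) := by
    rw [show T * Λ = T ^ 2 * (Λ / T) by field_simp, Real.sqrt_mul (by positivity),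
      Real.sqrt_sq hTr.le]
  -- The factor A' only improves the exponential part; the polynomial part is at most its value for
  -- A' = 1, which is eventually below ε/4.
  have hnoise : ∀ A' : ℝ, 1 ≤ A' → (P T).real {ω | ∃ j, T * (A' * (lam T / (2 * √(gm : ℝ))))
      ≤ |∑ t ∈ Finset.Icc (1 : ℤ) T, (R T).u t ω * (R T).x t ω j|}
      ≤ ε / 4 + c₁ * (p T * Real.exp (-(2 * A' ^ 2 * Λ))) := by
    intro A' hA'
    set y := T * (A' * (lam T / (2 * √(gm : ℝ)))) with hy
    have hylow : A' * (C' * √(T * Λ)) ≤ y := by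
      have h1 : C' * √(Λ / T) ≤ lam T / (2 * √(gm : ℝ)) := by
        rw [le_div_iff₀ (by positivity)]
        linarith
      calc A' * (C' * √(T * Λ)) = T * (A' * (C' * √(Λ / T))) := by rw [← hsqrtT]; ring
        _ ≤ y := by rw [hy]; gcongr
    have hy0 : 0 < y := by positivity
    refine ((hconc (P T) (R T) (hR.data T) T y hy0).1).trans ?_
    have h2 : y ^ (-κ) ≤ (C' * √(T * Real.log (p T))) ^ (-κ) := by
      refine Real.rpow_le_rpow_of_nonpos (by positivity) ?_ (by linarith)
      calc C' * √(T * Real.log (p T)) ≤ C' * √(T * Λ) := by gcongr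
        _ ≤ A' * (C' * √(T * Λ)) := le_mul_of_one_le_left (by positivity) hA'
        _ ≤ y := hylow
    have h3 : Real.exp (-(c₂ * y ^ 2 / T)) ≤ Real.exp (-(2 * A' ^ 2 * Λ)) := by
      apply Real.exp_le_exp.2 (neg_le_neg _)
      have h4 : (A' * (C' * √(T * Λ))) ^ 2 ≤ y ^ 2 := pow_le_pow_left₀ (by positivity) hylow 2
      have h5 : (A' * (C' * √(T * Λ))) ^ 2 = A' ^ 2 * C' ^ 2 * (T * Λ) := by
        rw [mul_pow, mul_pow, Real.sq_sqrt (by positivity : (0 : ℝ) ≤ T * Λ)]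
        ring
      rw [h5] at h4
      rw [le_div_iff₀ hTr]
      calc 2 * A' ^ 2 * Λ * T = c₂ * (A' ^ 2 * C' ^ 2 * (T * Λ)) := by
            rw [← hC'2]; ring
        _ ≤ _ := mul_le_mul_of_nonneg_left h4 hc₂.le
    have hcardT : (Fintype.card (ι T) : ℝ) ≤ p T := by exact_mod_cast hcard T
    calc (Fintype.card (ι T) : ℝ) * (c₁ * (T * y ^ (-κ) + Real.exp (-(c₂ * y ^ 2 / T))))
        ≤ p T * (c₁ * (T * (C' * √(T * Real.log (p T))) ^ (-κ)
            + Real.exp (-(2 * A' ^ 2 * Λ)))) := by gcongr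
      _ = c₁ * (p T * (T * (C' * √(T * Real.log (p T))) ^ (-κ)))
            + c₁ * (p T * Real.exp (-(2 * A' ^ 2 * Λ))) := by ring
      _ ≤ _ := by linarith
  set bad₂ : Set (Ω T) := {ω | ∃ jk : ι T × ι T, T * (x₀ / s T) ≤ |∑ t ∈ Finset.Icc (1 : ℤ) T,
    ((R T).x t ω jk.1 * (R T).x t ω jk.2 - (R T).secondMoment (P T) jk.1 jk.2)|} with hbad₂
  have hP2 : P T bad₂ ≤ ENNReal.ofReal (ε / 2) := by
    rw [← ofReal_measureReal]
    refine ENNReal.ofReal_le_ofReal ?_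
    have hcardT : (Fintype.card (ι T) : ℝ) ≤ p T := by exact_mod_cast hcard T
    refine ((hconc (P T) (R T) (hR.data T) T (T * (x₀ / s T)) (by positivity)).2).trans
      (le_trans ?_ hT5.le)
    gcongr
  have hgram : ∀ ω, ω ∉ bad₂ → ∀ d : ι T → ℝ, γ * groupNorm Finset.univ d ^ 2
      - (x₀ / s T) * (∑ j, |d j|) ^ 2 ≤ empNormSq T fun t => (R T).x t ω ⬝ᵥ d := by
    intro ω hω
    refine le_empNormSq_dotProduct (hcov T) fun j k => ?_
    have h1 : |∑ t ∈ Finset.Icc (1 : ℤ) T,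
        ((R T).x t ω j * (R T).x t ω k - (R T).secondMoment (P T) j k)| < T * (x₀ / s T) := by
      by_contra hcon
      exact hω ⟨(j, k), not_lt.1 hcon⟩
    have h2 : (T : ℝ)⁻¹ * ∑ t ∈ Finset.Icc (1 : ℤ) T, (R T).x t ω j * (R T).x t ω k
        - (R T).secondMoment (P T) j k = (T : ℝ)⁻¹ * ∑ t ∈ Finset.Icc (1 : ℤ) T,
          ((R T).x t ω j * (R T).x t ω k - (R T).secondMoment (P T) j k) := by
      rw [Finset.sum_sub_distrib, Finset.sum_const, Int.card_Icc]
      simp only [add_sub_cancel_right, Int.toNat_natCast, nsmul_eq_mul]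
      field_simp
    rw [h2, abs_mul, abs_of_pos (by positivity), inv_mul_le_iff₀ hTr]
    exact h1.le
  have hnoise' : ∀ (W : ℝ) (ω : Ω T), ¬ (∃ j, T * W ≤ |∑ t ∈ Finset.Icc (1 : ℤ) T,
      (R T).u t ω * (R T).x t ω j|) → ∀ j, |(T : ℝ)⁻¹ * ∑ t ∈ Finset.Icc (1 : ℤ) T,
        (R T).u t ω * (R T).x t ω j| ≤ W := by
    intro W ω hω j
    push Not at hω
    rw [abs_mul, abs_of_pos (by positivity), inv_mul_le_iff₀ hTr]
    exact (hω j).le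
  have hfin : ∀ bad₁ : Set (Ω T), (P T).real bad₁ ≤ ε / 2 →
      (∀ ω, ω ∉ bad₁ → ω ∉ bad₂ → IsSGLasso T (fun t => (R T).y t ω)
        (fun t => (R T).x t ω) α (𝒢 T) (lam T) (βhat T ω) → ω ∈ lassoEvent R s L βhat C₄ T) →
      P T (lassoEvent R s L βhat C₄ T)ᶜ ≤ ENNReal.ofReal ε := by
    intro bad₁ h1 h2
    have h3 : (lassoEvent R s L βhat C₄ T)ᶜ ⊆ (bad₁ ∪ bad₂) ∪ {ω | ¬ IsSGLasso T
        (fun t => (R T).y t ω) (fun t => (R T).x t ω) α (𝒢 T) (lam T) (βhat T ω)} := by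
      intro ω hω
      by_contra hcon
      simp only [Set.mem_union, Set.mem_ofPred_eq, not_or, not_not] at hcon
      exact hω (h2 ω hcon.1.1 hcon.1.2 hcon.2)
    have h4 : P T bad₁ ≤ ENNReal.ofReal (ε / 2) := by
      rw [← ofReal_measureReal]
      exact ENNReal.ofReal_le_ofReal h1
    refine (measure_mono h3).trans ((measure_union_le _ _).trans ?_)
    have h5 : P T {ω | ¬ IsSGLasso T
        (fun t => (R T).y t ω) (fun t => (R T).x t ω) α (𝒢 T) (lam T) (βhat T ω)} = 0 := hT3
    rw [h5, add_zero]
    refine (measure_union_le _ _).trans ((add_le_add h4 hP2).trans (le_of_eq ?_))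
    rw [← ENNReal.ofReal_add (by positivity) (by positivity), add_halves]
  have hdiv : x₀ / s T ≤ x₀ := div_le_self hx₀0.le hsT
  have hLs : L T ≤ √(s T) * L T := le_mul_of_one_le_left hL0.le hss
  have hLs' : √(s T) * L T ≤ s T * L T := by
    refine mul_le_mul_of_nonneg_right ?_ hL0.le
    nlinarith
  rcases le_or_gt N (p T) with hNp | hNp
  · refine hfin {ω | ∃ j, T * (1 * (lam T / (2 * √(gm : ℝ))))
      ≤ |∑ t ∈ Finset.Icc (1 : ℤ) T, (R T).u t ω * (R T).x t ω j|} ?_ ?_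
    · refine (hnoise 1 le_rfl).trans ?_
      have h1 : p T * Real.exp (-(2 * 1 ^ 2 * Λ)) ≤ (N : ℝ)⁻¹ := by
        have h2 : Real.exp (-(2 * 1 ^ 2 * Λ)) ≤ Real.exp (-(2 * Real.log (p T))) :=
          Real.exp_le_exp.2 (by linarith)
        have h3 : Real.exp (-(2 * Real.log (p T))) = ((p T : ℝ) ^ 2)⁻¹ := by
          rw [Real.exp_neg, mul_comm, Real.exp_mul, Real.exp_log hp0, Real.rpow_two]
        rw [h3] at h2
        have h4 : (N : ℝ) ≤ p T := by exact_mod_cast hNp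
        calc _ ≤ (p T : ℝ) * ((p T : ℝ) ^ 2)⁻¹ := by gcongr
          _ = (p T : ℝ)⁻¹ := by field_simp
          _ ≤ _ := inv_anti₀ (by linarith) h4
      have h5 : c₁ * (N : ℝ)⁻¹ ≤ ε / 4 := by
        rw [div_lt_iff₀ hε] at hNε
        rw [← div_eq_mul_inv, div_le_iff₀ (by linarith)]
        linarith
      have := mul_le_mul_of_nonneg_left h1 hc₁.le
      linarith
    · intro ω h1 h2 h3
      have h4 := hnoise' _ ω h1
      rw [one_mul] at h4
      have hx : 32 * gm * s T * (x₀ / s T) ≤ γ := by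
        calc 32 * gm * s T * (x₀ / s T) = 32 * gm * x₀ := by field_simp
          _ ≤ 32 * gm * (γ / (32 * gm)) := mul_le_mul_of_nonneg_left hx₀a (by positivity)
          _ = γ := by field_simp
      have h56 := h3.oracle (fun t => (R T).y_eq t ω) hα0 hα1 hgm (h𝒢 T) hlam h4 hγ
        (by positivity) hx (hgram ω h2)
      rw [← hrr] at h56
      obtain ⟨(h5 : _ ≤ 6 * rr * lam T * √(s T) + _), h6⟩ := h56
      have h7 : 6 * rr * lam T * √(s T) ≤ D₁ * (√(s T) * L T) := by
        calc _ ≤ 6 * rr * (C₃ * L T) * √(s T) := by gcongr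
          _ = _ := by rw [hD₁]; ring
      refine ⟨?_, fun hE => ?_⟩
      · refine h5.trans ?_
        have h8 : D₁ * (√(s T) * L T) ≤ C₄ * (√(s T) * L T) := by
          gcongr
          linarith
        linarith
      · refine (h6 hE).trans ?_
        rw [hE, mul_zero, add_zero] at h5
        calc 4 * √(gm : ℝ) * rr * √(s T) * _
            ≤ 4 * √(gm : ℝ) * rr * √(s T) * (D₁ * (√(s T) * L T)) :=
              mul_le_mul_of_nonneg_left (h5.trans h7) (by positivity)
          _ = 4 * √(gm : ℝ) * rr * D₁ * ((√(s T) * √(s T)) * L T) := by ring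
          _ = 4 * √(gm : ℝ) * rr * D₁ * (s T * L T) := by rw [hss2]
          _ ≤ C₄ * (s T * L T) := by
            gcongr
            linarith
  · refine hfin {ω | ∃ j, T * (A * (lam T / (2 * √(gm : ℝ))))
      ≤ |∑ t ∈ Finset.Icc (1 : ℤ) T, (R T).u t ω * (R T).x t ω j|} ?_ ?_
    · refine (hnoise A hA1).trans ?_
      have h4 : (p T : ℝ) ≤ N := by exact_mod_cast hNp.le
      -- Here p < N, and Λ ≥ 1 together with A ≥ 1 gives 2A²Λ ≥ A; the choice A ≥ 4c₁N/ε then makes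
      -- c₁N/A at most ε/4.
      have h1 : Real.exp (-(2 * A ^ 2 * Λ)) ≤ A⁻¹ := by
        have h2 : A ≤ 2 * A ^ 2 * Λ := by nlinarith
        rw [Real.exp_neg]
        refine inv_anti₀ (by linarith) ?_
        linarith [Real.add_one_le_exp (2 * A ^ 2 * Λ)]
      have h5 : c₁ * (N * A⁻¹) ≤ ε / 4 := by
        have h6 := hA2
        rw [div_le_iff₀ hε] at h6
        rw [← mul_assoc, ← div_eq_mul_inv, div_le_iff₀ (by linarith)]
        linarith
      have : c₁ * (p T * Real.exp (-(2 * A ^ 2 * Λ))) ≤ c₁ * (N * A⁻¹) := by gcongr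
      linarith
    · intro ω h1 h2 h3
      have h4 := hnoise' _ ω h1
      have h4' : ∀ j, |(T : ℝ)⁻¹ * ∑ t ∈ Finset.Icc (1 : ℤ) T,
          (R T).u t ω * (R T).x t ω j| ≤ A * lam T := by
        intro j
        refine (h4 j).trans (mul_le_mul_of_nonneg_left ?_ (by linarith))
        refine div_le_self hlam.le ?_
        have : (1 : ℝ) ≤ √(gm : ℝ) := Real.one_le_sqrt.2 (by exact_mod_cast hgm)
        linarith
      have hx : 2 * N * (x₀ / s T) ≤ γ := by
        calc 2 * N * (x₀ / s T) ≤ 2 * N * (γ / (2 * N)) := by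
              exact mul_le_mul_of_nonneg_left (hdiv.trans hx₀b) (by positivity)
          _ = γ := by field_simp
      have h56 := h3.oracle_lowDim (fun t => (R T).y_eq t ω) hα0 hα1 hlam (by linarith) h4' hγ
        (by positivity) ((hcard T).trans hNp.le) hx (hgram ω h2)
      rw [← hrr] at h56
      obtain ⟨h5, h6⟩ := h56
      have h7 : 2 * (A + 1) * √(N : ℝ) * rr * lam T ≤ D₂ * (√(s T) * L T) := by
        calc _ ≤ 2 * (A + 1) * √(N : ℝ) * rr * (C₃ * L T) := by gcongr
          _ = D₂ * L T := by rw [hD₂]; ring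
          _ ≤ _ := by gcongr
      have hE0 : 0 ≤ √(empNormSq T fun t => (R T).approxError t ω) := Real.sqrt_nonneg _
      refine ⟨?_, fun hE => ?_⟩
      · refine h5.trans ?_
        have h8 : D₂ * (√(s T) * L T) ≤ C₄ * (√(s T) * L T) := by
          gcongr
          linarith
        linarith
      · refine h6.trans ?_
        rw [hE, mul_zero, add_zero] at h5
        calc √(N : ℝ) * rr * _
            ≤ √(N : ℝ) * rr * (D₂ * (√(s T) * L T)) :=
              mul_le_mul_of_nonneg_left (h5.trans h7) (by positivity)
          _ ≤ √(N : ℝ) * rr * (D₂ * (s T * L T)) := by gcongr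
          _ = √(N : ℝ) * rr * D₂ * (s T * L T) := by ring
          _ ≤ C₄ * (s T * L T) := by
            gcongr
            linarith

end LassoRate

/-! ### Nodewise regressions and the rows of the precision matrix. -/

section NodeWeights

variable {ι : Type*} [Fintype ι] [DecidableEq ι]

/-- The vector with entry `1` in position `j` and entries `-γ` elsewhere. -/
noncomputable def nodeWeights (j : ι) (γ : {k : ι // k ≠ j} → ℝ) : ι → ℝ :=
  fun k => if hk : k = j then 1 else -γ ⟨k, hk⟩

lemma nodeWeights_self (j : ι) (γ : {k : ι // k ≠ j} → ℝ) : nodeWeights j γ j = 1 := by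
  simp [nodeWeights]

lemma nodeWeights_ne {j : ι} (γ : {k : ι // k ≠ j} → ℝ) (k : {k : ι // k ≠ j}) :
    nodeWeights j γ k.1 = -γ k := by
  simp [nodeWeights, k.2]

lemma sum_mul_nodeWeights (j : ι) (γ : {k : ι // k ≠ j} → ℝ) (f : ι → ℝ) :
    ∑ k, f k * nodeWeights j γ k = f j - (fun k : {k : ι // k ≠ j} => f k.1) ⬝ᵥ γ := by
  rw [Fintype.sum_eq_add_sum_subtype_ne _ j, nodeWeights_self, mul_one, dotProduct, sub_eq_add_neg,
    ← Finset.sum_neg_distrib]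
  simp [nodeWeights_ne]

lemma sum_abs_nodeWeights (j : ι) (γ : {k : ι // k ≠ j} → ℝ) :
    ∑ k, |nodeWeights j γ k| = 1 + ∑ k, |γ k| := by
  rw [Fintype.sum_eq_add_sum_subtype_ne _ j, nodeWeights_self, abs_one]
  simp [nodeWeights_ne]

lemma ncard_support_nodeWeights (j : ι) (γ : {k : ι // k ≠ j} → ℝ) :
    (Function.support (nodeWeights j γ)).ncard
      = 1 + (Finset.univ.filter fun k => γ k ≠ 0).card := by
  classical
  have : Function.support (nodeWeights j γ)
      = ↑(insert j ((Finset.univ.filter fun k => γ k ≠ 0).map (Function.Embedding.subtype _))) := by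
    ext k
    by_cases hk : k = j
    · simp [hk, nodeWeights_self]
    · simp [nodeWeights, hk]
  rw [this, Set.ncard_coe_finset, Finset.card_insert_of_notMem (by simp), Finset.card_map, add_comm]

end NodeWeights

namespace LinReg

variable {Ω : Type*} [MeasurableSpace Ω] {ι : Type*} [Fintype ι] [DecidableEq ι]
  {R : LinReg Ω ι} {μ : Measure Ω}

lemma nodeError_eq (R : LinReg Ω ι) (μ : Measure Ω) (j : ι) (t : ℤ) (ω : Ω) :
    R.nodeError μ j t ω = ∑ k, R.x t ω k * nodeWeights j (R.nodeCoef μ j) k := by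
  rw [sum_mul_nodeWeights]; rfl

section

variable {q r a b c B γ : ℝ} [IsProbabilityMeasure μ]

lemma DataCond.measurable_x_apply (h : R.DataCond μ q r a b c B) (t : ℤ) (j : ι) :
    Measurable fun ω => R.x t ω j := (measurable_pi_apply j).comp (h.measurable_x t)

lemma DataCond.measurable_nodeError (h : R.DataCond μ q r a b c B) (j : ι) (t : ℤ) :
    Measurable (R.nodeError μ j t) := by
  have : R.nodeError μ j t = fun ω => ∑ k, R.x t ω k * nodeWeights j (R.nodeCoef μ j) k :=
    funext fun ω => nodeError_eq R μ j t ω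
  rw [this]
  exact Finset.measurable_sum _ fun k _ => (h.measurable_x_apply t k).mul_const _

lemma DataCond.memLp_x (h : R.DataCond μ q r a b c B) (hr : 4 < r) (t : ℤ) (j : ι) :
    MemLp (fun ω => R.x t ω j) 2 μ := by
  refine (memLp_of_eLpNorm_le (h.measurable_x_apply t j) (h.moment_x t j)).mono_exponent ?_
  rw [← ENNReal.ofReal_ofNat]
  exact ENNReal.ofReal_le_ofReal (by linarith)

lemma DataCond.integrable_xx (h : R.DataCond μ q r a b c B) (hr : 4 < r) (t : ℤ) (j l : ι) :
    Integrable (fun ω => R.x t ω j * R.x t ω l) μ :=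
  (h.memLp_x hr t j).integrable_mul (h.memLp_x hr t l)

lemma DataCond.integral_xx (h : R.DataCond μ q r a b c B) (t : ℤ) (j l : ι) :
    ∫ ω, R.x t ω j * R.x t ω l ∂μ = R.secondMoment μ j l :=
  h.stationary_xx.integral_eq
    (fun t => measurable_pi_lambda _ fun i =>
      (h.measurable_x_apply t i.1).mul (h.measurable_x_apply t i.2))
    (measurable_pi_apply (j, l)) t

lemma DataCond.integral_dotProduct_mul (h : R.DataCond μ q r a b c B) (hr : 4 < r) (t : ℤ)
    (w z : ι → ℝ) : ∫ ω, (∑ k, R.x t ω k * w k) * (∑ k, R.x t ω k * z k) ∂μ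
      = w ⬝ᵥ (R.secondMoment μ *ᵥ z) := by
  have : ∀ ω, (∑ k, R.x t ω k * w k) * (∑ k, R.x t ω k * z k)
      = ∑ k, ∑ l, (w k * z l) * (R.x t ω k * R.x t ω l) := by
    intro ω
    rw [Finset.sum_mul_sum]
    exact Finset.sum_congr rfl fun k _ => Finset.sum_congr rfl fun l _ => by ring
  simp only [this]
  rw [integral_finsetSum _ fun k _ => integrable_finsetSum _ fun l _ =>
    (h.integrable_xx hr t k l).const_mul _]
  simp only [dotProduct, Matrix.mulVec, Finset.mul_sum]
  refine Finset.sum_congr rfl fun k _ => ?_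
  rw [integral_finsetSum _ fun l _ => (h.integrable_xx hr t k l).const_mul _]
  refine Finset.sum_congr rfl fun l _ => ?_
  rw [integral_const_mul, h.integral_xx]
  ring

lemma secondMoment_isSymm (R : LinReg Ω ι) (μ : Measure Ω) : (R.secondMoment μ).IsSymm := by
  ext k l
  simp only [Matrix.transpose_apply, secondMoment, Matrix.of_apply, mul_comm]

lemma posDef_of_sub_smul {S : Matrix ι ι ℝ} (hγ : 0 < γ)
    (hS : (S - γ • (1 : Matrix ι ι ℝ)).PosSemidef) : S.PosDef := by
  have h1 : (γ • (1 : Matrix ι ι ℝ)).PosDef := Matrix.PosDef.one.smul hγ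
  simpa using Matrix.PosDef.posSemidef_add hS h1

variable (hr : 4 < r) (h : R.DataCond μ q r a b c B) (hγ : 0 < γ)
  (hS : (R.secondMoment μ - γ • (1 : Matrix ι ι ℝ)).PosSemidef)

include hr h in
lemma integral_nodeError_sq (j : ι) (t : ℤ) : ∫ ω, R.nodeError μ j t ω ^ 2 ∂μ
    = nodeWeights j (R.nodeCoef μ j) ⬝ᵥ (R.secondMoment μ *ᵥ nodeWeights j (R.nodeCoef μ j)) := by
  simp only [nodeError_eq, sq]
  exact h.integral_dotProduct_mul hr t _ _

include hr h in
lemma integral_nodeError_sq_eq_nodeVar (j : ι) (t : ℤ) :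
    ∫ ω, R.nodeError μ j t ω ^ 2 ∂μ = R.nodeVar μ j := by
  rw [nodeVar, integral_nodeError_sq hr h, integral_nodeError_sq hr h]

include hγ hS in
lemma secondMoment_mulVec_ne (j : ι) (k : ι) (hk : k ≠ j) :
    (R.secondMoment μ *ᵥ nodeWeights j (R.nodeCoef μ j)) k = 0 := by
  have hP := posDef_of_sub_smul hγ hS
  set A : Matrix {k : ι // k ≠ j} {k : ι // k ≠ j} ℝ :=
    (R.secondMoment μ).submatrix Subtype.val Subtype.val with hA
  have hAP : A.PosDef := hP.submatrix Subtype.val_injective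
  have h1 : A *ᵥ R.nodeCoef μ j = fun k => R.secondMoment μ k.1 j := by
    rw [nodeCoef, Matrix.mulVec_mulVec, Matrix.mul_nonsing_inv _ ((Matrix.isUnit_iff_isUnit_det _).1 hAP.isUnit),
      Matrix.one_mulVec]
  have h2 := congrFun h1 ⟨k, hk⟩
  simp only [Matrix.mulVec, dotProduct] at h2 ⊢
  rw [sum_mul_nodeWeights, sub_eq_zero, ← h2]
  rfl

include hr h hγ hS in
-- Off position j these are the normal equations of the projection. In position j, the quadratic
-- form of Σ at the weights w equals σ_j²; it reduces to the single term (Σw)_j, because w_j = 1 and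
-- the other coordinates of Σw vanish.
lemma secondMoment_mulVec (j : ι) :
    R.secondMoment μ *ᵥ nodeWeights j (R.nodeCoef μ j) = Pi.single j (R.nodeVar μ j) := by
  set w := nodeWeights j (R.nodeCoef μ j)
  have h1 : R.nodeVar μ j = (R.secondMoment μ *ᵥ w) j := by
    rw [nodeVar, integral_nodeError_sq hr h, dotProduct,
      Finset.sum_eq_single j (fun k _ hk => by rw [secondMoment_mulVec_ne hγ hS j k hk, mul_zero])
        (by simp), nodeWeights_self, one_mul]
  ext k
  by_cases hk : k = j
  · subst hk; rw [h1, Pi.single_eq_same]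
  · rw [secondMoment_mulVec_ne hγ hS j k hk, Pi.single_eq_of_ne hk]

include hr h hγ hS in
-- σ_j² is the quadratic form of Σ at a vector with a coordinate equal to 1.
lemma le_nodeVar (j : ι) : γ ≤ R.nodeVar μ j := by
  rw [nodeVar, integral_nodeError_sq hr h]
  set w := nodeWeights j (R.nodeCoef μ j) with hw
  have h1 := hS.dotProduct_mulVec_nonneg w
  rw [Matrix.sub_mulVec, dotProduct_sub, Matrix.smul_mulVec, Matrix.one_mulVec, dotProduct_smul] at h1
  simp only [star_trivial, smul_eq_mul, sub_nonneg] at h1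
  refine le_trans ?_ h1
  have h2 : w j * w j ≤ w ⬝ᵥ w :=
    Finset.single_le_sum (f := fun k => w k * w k) (fun k _ => mul_self_nonneg _) (Finset.mem_univ j)
  rw [hw, nodeWeights_self] at h2
  nlinarith

include hr h hγ hS in
-- Applying Θ to Σw = σ_j² e_j gives w = σ_j² Θe_j, a column of Θ, and Θ is symmetric.
lemma precision_eq (j k : ι) :
    R.precision μ j k = (R.nodeVar μ j)⁻¹ * nodeWeights j (R.nodeCoef μ j) k := by
  have hP := posDef_of_sub_smul hγ hS
  have hσ := hγ.trans_le (le_nodeVar hr h hγ hS j)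
  have h1 := congrArg (R.precision μ *ᵥ ·) (secondMoment_mulVec hr h hγ hS j)
  simp only [precision, Matrix.mulVec_mulVec] at h1
  rw [Matrix.nonsing_inv_mul _ ((Matrix.isUnit_iff_isUnit_det _).1 hP.isUnit), Matrix.one_mulVec] at h1
  have h2 := congrFun h1 k
  rw [Matrix.mulVec_single] at h2
  have h3 : (R.precision μ).IsSymm := (secondMoment_isSymm R μ).inv
  rw [← h3.apply, h2]
  simp [precision]
  field_simp

include hr h hγ hS in
-- The row of Θ has ℓ₁ norm (1 + |γ_j|₁)/σ_j². Bounded rows thus bound the penalty term λ_j|γ_j|₁ in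
-- the variance estimator.
lemma sum_abs_nodeCoef_le (j : ι) :
    ∑ k, |R.nodeCoef μ j k| ≤ R.nodeVar μ j * ∑ k, |R.precision μ j k| := by
  have hσ := hγ.trans_le (le_nodeVar hr h hγ hS j)
  simp only [precision_eq hr h hγ hS, abs_mul, abs_inv, abs_of_pos hσ]
  rw [← Finset.mul_sum, mul_inv_cancel_left₀ hσ.ne', sum_abs_nodeWeights]
  linarith

include hr h hγ hS in
-- For α = 1 the effective sparsity is the size of the support of γ_j; the diagonal entry of Θ
-- accounts for the extra 1.
lemma rowSparsity_eq (j : ι) : (R.rowSparsity μ j : ℝ)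
    = 1 + effSparsity 1 (⊥ : Finpartition (Finset.univ : Finset {k : ι // k ≠ j})) (R.nodeCoef μ j) := by
  classical
  have hσ := hγ.trans_le (le_nodeVar hr h hγ hS j)
  have : R.rowSparsity μ j = (Function.support (nodeWeights j (R.nodeCoef μ j))).ncard := by
    rw [rowSparsity]
    congr 1
    ext k
    simp [precision_eq hr h hγ hS, hσ.ne']
  rw [this, ncard_support_nodeWeights, effSparsity]
  simp only [one_mul, sub_self, zero_mul, add_zero]
  rw [Real.sq_sqrt (by positivity)]
  push_cast
  congr!

include hr h hγ hS in
lemma sum_precision_mul (j : ι) (t : ℤ) (ω : Ω) :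
    ∑ k, R.precision μ j k * R.x t ω k = R.nodeError μ j t ω / R.nodeVar μ j := by
  simp only [precision_eq hr h hγ hS, nodeError_eq, div_eq_inv_mul, Finset.mul_sum]
  exact Finset.sum_congr rfl fun k _ => by ring

end

end LinReg

/-! ### The score process and entrywise formulas for the autocovariances. -/

section Score

variable {Ω : Type*} [MeasurableSpace Ω] {ι : Type*} [Fintype ι] [DecidableEq ι] {g : ℕ}
  {R : LinReg Ω ι} {μ : Measure Ω} [IsProbabilityMeasure μ] {q r a b c B γ : ℝ} {G : Fin g ↪ ι}

lemma LinReg.DataCond.memLp_ux (h : R.DataCond μ q r a b c B) (hr : 4 < r)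
    (hq : 2 * r / (r - 2) < q) (t : ℤ) (j : ι) : MemLp (fun ω => R.u t ω * R.x t ω j) 2 μ := by
  obtain ⟨hq2, hν⟩ := prodExponent_pos_iff hr hq
  have h1 : eLpNorm (fun ω => R.u t ω * R.x t ω j) (ENNReal.ofReal (prodExponent q r)) μ
      ≤ ENNReal.ofReal (max B 0 * max B 0) :=
    eLpNorm_mul_le_ofReal (by linarith) (by linarith) rfl (le_max_right _ _) (h.measurable_u t)
      (h.measurable_x_apply t j)
      ((h.moment_u t).trans (ENNReal.ofReal_le_ofReal (le_max_left _ _)))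
      ((h.moment_x t j).trans (ENNReal.ofReal_le_ofReal (le_max_left _ _)))
  refine (memLp_of_eLpNorm_le ((h.measurable_u t).mul (h.measurable_x_apply t j))
    h1).mono_exponent ?_
  rw [← ENNReal.ofReal_ofNat]
  exact ENNReal.ofReal_le_ofReal hν.le

lemma scoreProcess_eq (hr : 4 < r) (h : R.DataCond μ q r a b c B) (hγ : 0 < γ)
    (hS : (R.secondMoment μ - γ • (1 : Matrix ι ι ℝ)).PosSemidef) (t : ℤ) (ω : Ω) (i : Fin g) :
    scoreProcess R μ G t ω i = ∑ k, R.precision μ (G i) k * (R.u t ω * R.x t ω k) := by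
  rw [scoreProcess, mul_div_assoc, ← LinReg.sum_precision_mul hr h hγ hS, Finset.mul_sum]
  exact Finset.sum_congr rfl fun k _ => by ring

/-- Θ_G u_t x_t is the score V_t, and the expectation passes through the finite sums because the u_t
x_{t,j} are square integrable. -/
lemma autocov_apply (hr : 4 < r) (hq : 2 * r / (r - 2) < q) (h : R.DataCond μ q r a b c B)
    (hγ : 0 < γ) (hS : (R.secondMoment μ - γ • (1 : Matrix ι ι ℝ)).PosSemidef) (k : ℤ)
    (i l : Fin g) : autocov R μ G k i l
      = ∫ ω, scoreProcess R μ G 0 ω i * scoreProcess R μ G k ω l ∂μ := by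
  have hint : ∀ m n : ι, Integrable (fun ω => R.u 0 ω * R.x 0 ω m * (R.u k ω * R.x k ω n)) μ :=
    fun m n => (h.memLp_ux hr hq 0 m).integrable_mul (h.memLp_ux hr hq k n)
  have h1 : ∀ ω, scoreProcess R μ G 0 ω i * scoreProcess R μ G k ω l
      = ∑ n, ∑ m, (R.precision μ (G i) m * R.precision μ (G l) n) *
        (R.u 0 ω * R.x 0 ω m * (R.u k ω * R.x k ω n)) := by
    intro ω
    rw [scoreProcess_eq hr h hγ hS, scoreProcess_eq hr h hγ hS, Finset.sum_mul_sum,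
      Finset.sum_comm]
    exact Finset.sum_congr rfl fun n _ => Finset.sum_congr rfl fun m _ => by ring
  simp only [h1]
  rw [integral_finsetSum _ fun n _ => integrable_finsetSum _ fun m _ => (hint m n).const_mul _]
  rw [autocov, Matrix.mul_apply]
  refine Finset.sum_congr rfl fun n _ => ?_
  rw [integral_finsetSum _ fun m _ => (hint m n).const_mul _, Matrix.mul_apply, Finset.sum_mul]
  refine Finset.sum_congr rfl fun m _ => ?_
  rw [integral_const_mul]
  simp only [precisionRows, Matrix.of_apply, Matrix.transpose_apply]
  rw [show (fun ω => R.u 0 ω * R.x 0 ω m * R.u k ω * R.x k ω n)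
    = fun ω => R.u 0 ω * R.x 0 ω m * (R.u k ω * R.x k ω n) from funext fun ω => by ring]
  ring

lemma FourthOrderStationary.integral_mul {J : Type*} {V : ℤ → Ω → J → ℝ}
    (h : FourthOrderStationary μ V) (s t m : ℤ) (i l : J) :
    ∫ ω, V (s + m) ω i * V (t + m) ω l ∂μ = ∫ ω, V s ω i * V t ω l ∂μ := by
  have := h.2 2 (by norm_num) ![s, t] ![i, l] m
  simpa [Fin.prod_univ_two] using this

lemma FourthOrderStationary.integral_mul₄ {J : Type*} {V : ℤ → Ω → J → ℝ}
    (h : FourthOrderStationary μ V) (s₁ s₂ s₃ s₄ m : ℤ) (i₁ i₂ i₃ i₄ : J) :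
    ∫ ω, V (s₁ + m) ω i₁ * V (s₂ + m) ω i₂ * V (s₃ + m) ω i₃ * V (s₄ + m) ω i₄ ∂μ
      = ∫ ω, V s₁ ω i₁ * V s₂ ω i₂ * V s₃ ω i₃ * V s₄ ω i₄ ∂μ := by
  have := h.2 4 le_rfl ![s₁, s₂, s₃, s₄] ![i₁, i₂, i₃, i₄] m
  simpa [Fin.prod_univ_four] using this

lemma autocovEst_apply {T : ℕ} (x : ℤ → ι → ℝ) (res : ℤ → ℝ)
    (Th : Matrix (Fin g) ι ℝ) (k : ℕ) (i l : Fin g) :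
    autocovEst T x res Th k i l = (T : ℝ)⁻¹ * ∑ t ∈ Finset.Icc (1 : ℤ) ((T : ℤ) - k),
      res t * res (t + k) * (∑ m, x t m * Th i m) * (∑ m, x (t + k) m * Th l m) := by
  rw [autocovEst, Matrix.mul_smul, Matrix.smul_mul, Matrix.smul_apply, smul_eq_mul,
    Matrix.mul_sum, Matrix.sum_mul, Matrix.sum_apply]
  congr 1
  refine Finset.sum_congr rfl fun t _ => ?_
  rw [Matrix.mul_smul, Matrix.smul_mul, Matrix.smul_apply, smul_eq_mul, Matrix.mul_vecMulVec,
    Matrix.vecMulVec_mul, Matrix.vecMulVec_apply, Matrix.vecMul_transpose]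
  simp only [Matrix.mulVec, dotProduct]
  simp only [mul_comm (Th _ _)]
  ring

lemma sum_mul_precisionRowsEst (T : ℕ) (x : ℤ → ι → ℝ) (lam : Fin g → ℝ)
    (γ : ∀ i, {k : ι // k ≠ G i} → ℝ) (i : Fin g) (z : ι → ℝ) :
    ∑ m, z m * precisionRowsEst T x G lam γ i m = (nodeVarEst T x (G i) (lam i) (γ i))⁻¹ *
      (z (G i) - (fun k : {k : ι // k ≠ G i} => z k.1) ⬝ᵥ γ i) := by
  rw [← sum_mul_nodeWeights, Finset.mul_sum]
  refine Finset.sum_congr rfl fun m _ => ?_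
  simp only [precisionRowsEst, Matrix.of_apply, nodeWeights]
  ring

end Score

/-! ### Sums over the kernel and the smoothing bias. -/

section KernelSums

variable {K : ℝ → ℝ} {ς : ℝ}

lemma card_filter_floor_div_le (F : Finset ℤ) {w : ℝ} (hw : 0 < w) (j : ℤ) :
    ((F.filter fun k : ℤ => ⌊(k : ℝ) / w⌋ = j).card : ℝ) ≤ w + 1 := by
  have hsub : (F.filter fun k : ℤ => ⌊(k : ℝ) / w⌋ = j) ⊆ Finset.Ico ⌈j * w⌉ ⌈j * w + w⌉ := by
    intro k hk
    rw [Finset.mem_filter, Int.floor_eq_iff, le_div_iff₀ hw, div_lt_iff₀ hw] at hk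
    rw [Finset.mem_Ico, Int.ceil_le, Int.lt_ceil]
    exact ⟨hk.2.1, by linarith [hk.2.2]⟩
  have h1 : ⌈j * w⌉ ≤ ⌈j * w + w⌉ := Int.ceil_mono (by linarith)
  have h2 : (((⌈j * w + w⌉ - ⌈j * w⌉).toNat : ℤ) : ℝ) = ⌈j * w + w⌉ - ⌈j * w⌉ := by
    rw [Int.toNat_of_nonneg (by linarith)]; push_cast; rfl
  calc ((F.filter fun k : ℤ => ⌊(k : ℝ) / w⌋ = j).card : ℝ)
      ≤ ((Finset.Ico ⌈j * w⌉ ⌈j * w + w⌉).card : ℝ) := by exact_mod_cast Finset.card_le_card hsub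
    _ = ⌈j * w + w⌉ - ⌈j * w⌉ := by rw [Int.card_Ico, ← h2]; push_cast; rfl
    _ ≤ w + 1 := by
      have := Int.ceil_lt_add_one (j * w + w)
      have := Int.le_ceil (j * w)
      linarith

/-- The supremum of |K| on a cell need not be attained; a factor 2 makes room for a near-maximizer
that can serve as a tag. -/
lemma exists_forall_abs_le_two_mul (hK : ∀ x, |K x| ≤ 1) {s : Set ℝ} (hs : s.Nonempty) :
    ∃ x ∈ s, ∀ y ∈ s, |K y| ≤ 2 * |K x| := by
  set A : Set ℝ := (fun x => |K x|) '' s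
  have hbdd : BddAbove A := ⟨1, by rintro _ ⟨x, -, rfl⟩; exact hK x⟩
  have hle : ∀ y ∈ s, |K y| ≤ sSup A := fun y hy => le_csSup hbdd ⟨y, hy, rfl⟩
  obtain ⟨x₀, hx₀⟩ := hs
  rcases (abs_nonneg _ |>.trans (hle x₀ hx₀)).eq_or_lt with h0 | h0
  · exact ⟨x₀, hx₀, fun y hy => (hle y hy).trans (by rw [← h0]; positivity)⟩
  · obtain ⟨_, ⟨x, hx, rfl⟩, hlt⟩ := exists_lt_of_lt_csSup (s := A) ⟨_, x₀, hx₀, rfl⟩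
      (show sSup A / 2 < sSup A by linarith)
    exact ⟨x, hx, fun y hy => (hle y hy).trans (by simp only at hlt; linarith)⟩

/-- Riemann sums converge absolutely for arbitrary tags. Tagging each cell of one fixed width h by a
near-maximizer of |K| makes the cellwise suprema summable, and each cell contains at most hM + 1 of
the points k/M. -/
lemma KernelCond.exists_sum_abs_le (hK : KernelCond K ς) :
    ∃ C : ℝ, 0 < C ∧ ∀ M : ℝ, 1 ≤ M → ∀ F : Finset ℤ, ∑ k ∈ F, |K ((k : ℝ) / M)| ≤ C * M := by
  obtain ⟨I, hI⟩ := hK.riemann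
  obtain ⟨δ, hδ, hI⟩ := hI 1 one_pos
  set h : ℝ := δ / 2 with hh
  have hh0 : 0 < h := by positivity
  have hcell : ∀ j : ℤ, ∃ x ∈ Set.Icc ((j : ℝ) * h) ((j + 1) * h),
      ∀ y ∈ Set.Icc ((j : ℝ) * h) ((j + 1) * h), |K y| ≤ 2 * |K x| := fun j =>
    exists_forall_abs_le_two_mul hK.abs_le_one ⟨j * h, by constructor <;> nlinarith⟩
  choose x hx hxy using hcell
  have hsum : Summable fun j => |K (x j)| := by
    have := ((hI h hh0 (by linarith) x hx).1.mul_left h⁻¹).abs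
    simpa [inv_mul_cancel_left₀ hh0.ne'] using this
  set S := ∑' j, |K (x j)|
  have hS0 : 0 ≤ S := tsum_nonneg fun _ => abs_nonneg _
  refine ⟨2 * (h + 1) * (S + 1), by positivity, fun M hM F => ?_⟩
  have hM0 : 0 < M := by linarith
  have h1 : ∀ k ∈ F, |K ((k : ℝ) / M)| ≤ 2 * |K (x ⌊(k : ℝ) / (h * M)⌋)| := by
    intro k _
    refine hxy _ _ ?_
    have h2 := Int.floor_le ((k : ℝ) / (h * M))
    have h3 := (Int.lt_floor_add_one ((k : ℝ) / (h * M))).le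
    rw [le_div_iff₀ (by positivity)] at h2
    rw [div_le_iff₀ (by positivity)] at h3
    constructor
    · rw [le_div_iff₀ hM0]; linarith
    · rw [div_le_iff₀ hM0]; linarith
  calc ∑ k ∈ F, |K ((k : ℝ) / M)| ≤ ∑ k ∈ F, 2 * |K (x ⌊(k : ℝ) / (h * M)⌋)| := Finset.sum_le_sum h1
    _ = ∑ j ∈ F.image fun k : ℤ => ⌊(k : ℝ) / (h * M)⌋,
        (F.filter fun k : ℤ => ⌊(k : ℝ) / (h * M)⌋ = j).card • (2 * |K (x j)|) :=
      Finset.sum_comp (fun j => 2 * |K (x j)|) fun k : ℤ => ⌊(k : ℝ) / (h * M)⌋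
    _ ≤ ∑ j ∈ F.image fun k : ℤ => ⌊(k : ℝ) / (h * M)⌋, (h * M + 1) * (2 * |K (x j)|) := by
      refine Finset.sum_le_sum fun j _ => ?_
      rw [nsmul_eq_mul]
      exact mul_le_mul_of_nonneg_right (card_filter_floor_div_le F (by positivity) j) (by positivity)
    _ ≤ (h * M + 1) * (2 * S) := by
      rw [← Finset.mul_sum, ← Finset.mul_sum]
      gcongr
      exact hsum.sum_le_tsum _ fun _ _ => abs_nonneg _
    _ ≤ 2 * (h + 1) * (S + 1) * M := by nlinarith [mul_nonneg hS0 hM0.le, mul_pos hh0 hM0]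

/-- Near 0 this is the order of the kernel; for |x| ≥ ε the left side is at most 2 ≤ 2(|x|/ε)^ς. -/
lemma KernelCond.exists_abs_sub_one_le (hς : 0 < ς) (hK : KernelCond K ς) :
    ∃ A : ℝ, 0 < A ∧ ∀ x, |K x - 1| ≤ A * |x| ^ ς := by
  obtain ⟨ε, L, hε, h⟩ := hK.smooth
  refine ⟨max L 0 + 2 * ε ^ (-ς), by positivity, fun x => ?_⟩
  rcases lt_or_ge |x| ε with hx | hx
  · have := h x hx
    rw [hK.zero, abs_sub_comm] at this
    refine this.trans ?_
    have h2 : 0 ≤ |x| ^ ς := by positivity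
    have h3 : 0 < ε ^ (-ς) := by positivity
    gcongr
    linarith [le_max_left L 0]
  · have h1 : |K x - 1| ≤ 2 := by
      have := abs_sub (K x) 1
      have := hK.abs_le_one x
      rw [abs_one] at *
      linarith
    have h2 : ε ^ ς ≤ |x| ^ ς := Real.rpow_le_rpow hε.le hx hς.le
    have h3 : 1 ≤ ε ^ (-ς) * |x| ^ ς := by
      rw [Real.rpow_neg hε.le, inv_mul_eq_div, le_div_iff₀ (by positivity), one_mul]
      exact h2
    have h4 : 0 ≤ max L 0 * |x| ^ ς := by positivity
    nlinarith

/-- Each weight differs from 1 by at most a multiple of |k|^ς (M^{-ς} + T^{-(ς∧1)}). For |k| < T the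
kernel costs (|k|/M)^ς and the taper |k|/T ≤ (|k|/T)^{ς∧1}; for |k| ≥ T the weight is 0 and 1 ≤
(|k|/T)^{ς∧1}. Finally |k|^{ς∧1} ≤ |k|^ς for non-zero integers. -/
lemma KernelCond.exists_bias_le (hς : 0 < ς) (hK : KernelCond K ς) :
    ∃ A : ℝ, 0 < A ∧ ∀ (M : ℝ) (T : ℕ) (c : ℤ → ℝ) (D : ℝ), 0 < M → 1 ≤ T → Summable c →
      Summable (fun k : ℤ => |(k : ℝ)| ^ ς * |c k|) → ∑' k : ℤ, |(k : ℝ)| ^ ς * |c k| ≤ D →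
      |∑ k ∈ Finset.Ioo (-(T : ℤ)) T, K ((k : ℝ) / M) * ((1 - |(k : ℝ)| / T) * c k) - ∑' k, c k|
        ≤ A * (M ^ (-ς) + (T : ℝ) ^ (-(min ς 1))) * D := by
  obtain ⟨A, hA, hA1⟩ := hK.exists_abs_sub_one_le hς
  refine ⟨A + 1, by positivity, fun M T c D hM hT hc hs hD => ?_⟩
  have hT0 : (0 : ℝ) < T := by exact_mod_cast hT
  have hT1 : (1 : ℝ) ≤ T := by exact_mod_cast hT
  set w : ℤ → ℝ := fun k => if k ∈ Finset.Ioo (-(T : ℤ)) T then K ((k : ℝ) / M) * (1 - |(k : ℝ)| / T)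
    else 0 with hw
  have hsupp : ∀ k ∉ Finset.Ioo (-(T : ℤ)) T, w k * c k = 0 := fun k hk => by simp only [hw, if_neg hk, zero_mul]
  have h1 : ∑ k ∈ Finset.Ioo (-(T : ℤ)) T, K ((k : ℝ) / M) * ((1 - |(k : ℝ)| / T) * c k)
      = ∑' k, w k * c k := by
    rw [tsum_eq_sum hsupp]
    refine Finset.sum_congr rfl fun k hk => ?_
    simp only [hw, if_pos hk, mul_assoc]
  have hws : Summable fun k => w k * c k := summable_of_ne_finset_zero hsupp
  set B := (A + 1) * (M ^ (-ς) + (T : ℝ) ^ (-(min ς 1))) with hB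
  have hpt : ∀ k, |w k * c k - c k| ≤ B * (|(k : ℝ)| ^ ς * |c k|) := by
    intro k
    rw [show w k * c k - c k = (w k - 1) * c k by ring, abs_mul, ← mul_assoc]
    refine mul_le_mul_of_nonneg_right ?_ (abs_nonneg _)
    have hMς : 0 < M ^ (-ς) := by positivity
    have hTς : 0 < (T : ℝ) ^ (-(min ς 1)) := by positivity
    by_cases hk0 : k = 0
    · have : (0 : ℤ) ∈ Finset.Ioo (-(T : ℤ)) T := by
        rw [Finset.mem_Ioo]; omega
      simp only [hk0, hw, if_pos this]
      simp [hK.zero, Real.zero_rpow hς.ne']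
    have hk1 : (1 : ℝ) ≤ |(k : ℝ)| := by
      rw [← Int.cast_abs]; exact_mod_cast Int.one_le_abs hk0
    have hkς : 0 < |(k : ℝ)| ^ ς := by positivity
    have hkm : |(k : ℝ)| ^ (min ς 1) ≤ |(k : ℝ)| ^ ς :=
      Real.rpow_le_rpow_of_exponent_le hk1 (min_le_left _ _)
    have hdiv : (|(k : ℝ)| / T) ^ (min ς 1) ≤ (T : ℝ) ^ (-(min ς 1)) * |(k : ℝ)| ^ ς := by
      rw [Real.div_rpow (abs_nonneg _) hT0.le, Real.rpow_neg hT0.le, div_eq_inv_mul]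
      gcongr
    by_cases hk : k ∈ Finset.Ioo (-(T : ℤ)) T
    · have hkT : |(k : ℝ)| ≤ T := by
        rw [Finset.mem_Ioo, ← abs_lt] at hk
        rw [← Int.cast_abs]; exact_mod_cast hk.le
      have h2 : |(k : ℝ)| / T ≤ (|(k : ℝ)| / T) ^ (min ς 1) := by
        have h3 : |(k : ℝ)| / T ≤ 1 := (div_le_one hT0).2 hkT
        have h4 : 0 < |(k : ℝ)| / T := by positivity
        conv_lhs => rw [← Real.rpow_one (|(k : ℝ)| / T)]
        exact Real.rpow_le_rpow_of_exponent_ge h4 h3 (min_le_right _ _)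
      have h3 := hA1 ((k : ℝ) / M)
      rw [abs_div, abs_of_pos hM, Real.div_rpow (abs_nonneg _) hM.le] at h3
      have h4 : |K ((k : ℝ) / M) * (|(k : ℝ)| / T)| ≤ |(k : ℝ)| / T := by
        rw [abs_mul, abs_of_nonneg (a := |(k : ℝ)| / T) (by positivity)]
        exact mul_le_of_le_one_left (by positivity) (hK.abs_le_one _)
      simp only [hw, if_pos hk]
      rw [show K ((k : ℝ) / M) * (1 - |(k : ℝ)| / T) - 1
        = (K ((k : ℝ) / M) - 1) - K ((k : ℝ) / M) * (|(k : ℝ)| / T) by ring]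
      have h5 := abs_sub (K ((k : ℝ) / M) - 1) (K ((k : ℝ) / M) * (|(k : ℝ)| / T))
      have h6 : A * (|(k : ℝ)| ^ ς / M ^ ς) = A * M ^ (-ς) * |(k : ℝ)| ^ ς := by
        rw [Real.rpow_neg hM.le]; ring
      have h7 : 0 ≤ M ^ (-ς) * |(k : ℝ)| ^ ς := by positivity
      have h8 : 0 ≤ A * ((T : ℝ) ^ (-(min ς 1)) * |(k : ℝ)| ^ ς) := by positivity
      rw [hB]
      nlinarith
    · have hkT : (T : ℝ) ≤ |(k : ℝ)| := by
        rw [Finset.mem_Ioo, ← abs_lt, not_lt] at hk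
        rw [← Int.cast_abs]; exact_mod_cast hk
      have h2 : 1 ≤ (|(k : ℝ)| / T) ^ (min ς 1) :=
        Real.one_le_rpow ((one_le_div hT0).2 hkT) (by positivity)
      simp only [hw, if_neg hk, zero_sub, abs_neg, abs_one]
      have h7 : 0 ≤ M ^ (-ς) * |(k : ℝ)| ^ ς := by positivity
      have h8 : 0 ≤ A * ((T : ℝ) ^ (-(min ς 1)) * |(k : ℝ)| ^ ς) := by positivity
      have h9 : 0 ≤ A * (M ^ (-ς) * |(k : ℝ)| ^ ς) := by positivity
      rw [hB]
      nlinarith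
  rw [h1, ← hws.tsum_sub hc]
  have hsa : Summable fun k : ℤ => |w k * c k - c k| := (hws.sub hc).abs
  calc |∑' k, (w k * c k - c k)| ≤ ∑' k, |w k * c k - c k| := by
        simpa [Real.norm_eq_abs] using norm_tsum_le_tsum_norm (f := fun k => w k * c k - c k) hsa
    _ ≤ ∑' k : ℤ, B * (|(k : ℝ)| ^ ς * |c k|) := hsa.tsum_le_tsum hpt (hs.mul_left _)
    _ = B * ∑' k : ℤ, |(k : ℝ)| ^ ς * |c k| := tsum_mul_left
    _ ≤ B * D := by gcongr

end KernelSums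

section FrobeniusEntries

variable {m n : Type*} [Fintype m] [Fintype n]

lemma abs_apply_le_frobenius_norm (A : Matrix m n ℝ) (i : m) (j : n) : |A i j| ≤ ‖A‖ := by
  rw [Matrix.frobenius_norm_def, ← Real.sqrt_eq_rpow]
  refine Real.le_sqrt_of_sq_le ?_
  have h1 := Finset.single_le_sum (f := fun j => ‖A i j‖ ^ (2 : ℝ)) (fun j _ => by positivity)
    (Finset.mem_univ j)
  have h2 := Finset.single_le_sum (f := fun i => ∑ j, ‖A i j‖ ^ (2 : ℝ)) (fun i _ => by positivity)
    (Finset.mem_univ i)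
  refine le_trans (le_of_eq ?_) (h1.trans h2)
  rw [Real.rpow_two, Real.norm_eq_abs]

lemma frobenius_norm_le_sum_abs (A : Matrix m n ℝ) : ‖A‖ ≤ ∑ i, ∑ j, |A i j| := by
  rw [Matrix.frobenius_norm_def, ← Real.sqrt_eq_rpow]
  refine Real.sqrt_le_iff.2 ⟨by positivity, ?_⟩
  have h1 : ∀ i, ∑ j, ‖A i j‖ ^ (2 : ℝ) ≤ (∑ j, |A i j|) ^ 2 := fun i => by
    simp only [Real.rpow_two, Real.norm_eq_abs]
    exact Finset.sum_sq_le_sq_sum_of_nonneg fun _ _ => abs_nonneg _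
  exact (Finset.sum_le_sum fun i _ => h1 i).trans
    (Finset.sum_sq_le_sq_sum_of_nonneg fun _ _ => by positivity)

end FrobeniusEntries

/-! ### Lagged means: mean, variance and summability of the autocovariances. -/

section LagMeans

variable {Ω : Type*} [MeasurableSpace Ω] {μ : Measure Ω} [IsProbabilityMeasure μ]

lemma integral_abs_le_sqrt_integral_sq {f : Ω → ℝ} (hf : MemLp f 2 μ) :
    ∫ ω, |f ω| ∂μ ≤ √(∫ ω, f ω ^ 2 ∂μ) := by
  have h1 := variance_nonneg |f| μ
  rw [variance_eq_sub hf.abs] at h1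
  refine Real.le_sqrt_of_sq_le ?_
  have h2 : ∫ ω, (|f| ^ 2) ω ∂μ = ∫ ω, f ω ^ 2 ∂μ :=
    integral_congr_ae (Eventually.of_forall fun ω => by simp)
  have h3 : ∫ ω, |f| ω ∂μ = ∫ ω, |f ω| ∂μ := rfl
  rw [h2, h3] at h1
  linarith

lemma integral_abs_sub_integral_le_sqrt_variance {f : Ω → ℝ} (hf : MemLp f 2 μ) :
    ∫ ω, |f ω - ∫ ω', f ω' ∂μ| ∂μ ≤ √(Var[f; μ]) := by
  rw [variance_eq_integral hf.aemeasurable]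
  exact integral_abs_le_sqrt_integral_sq (hf.sub (memLp_const _))

/-- The mean of `F t (t + k)` over the pairs of time points in `{1, …, T}` with lag `k`, normalized
by `T`. -/
noncomputable def lagMean (T k : ℕ) (F : ℤ → ℤ → ℝ) : ℝ :=
  (T : ℝ)⁻¹ * ∑ t ∈ Finset.Icc (1 : ℤ) ((T : ℤ) - k), F t (t + k)

lemma lagMean_mono {T k : ℕ} {F H : ℤ → ℤ → ℝ}
    (h : ∀ t ∈ Finset.Icc (1 : ℤ) ((T : ℤ) - k), F t (t + k) ≤ H t (t + k)) :
    lagMean T k F ≤ lagMean T k H :=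
  mul_le_mul_of_nonneg_left (Finset.sum_le_sum h) (by positivity)

lemma lagMean_sub (T k : ℕ) (F H : ℤ → ℤ → ℝ) :
    lagMean T k (fun t t' => F t t' - H t t') = lagMean T k F - lagMean T k H := by
  simp only [lagMean, Finset.sum_sub_distrib, mul_sub]

lemma lagMean_add (T k : ℕ) (F H : ℤ → ℤ → ℝ) :
    lagMean T k (fun t t' => F t t' + H t t') = lagMean T k F + lagMean T k H := by
  simp only [lagMean, Finset.sum_add_distrib, mul_add]

lemma lagMean_const_mul (T k : ℕ) (c : ℝ) (F : ℤ → ℤ → ℝ) :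
    lagMean T k (fun t t' => c * F t t') = c * lagMean T k F := by
  simp only [lagMean, ← Finset.mul_sum, mul_left_comm]

lemma abs_lagMean_le (T k : ℕ) (F : ℤ → ℤ → ℝ) :
    |lagMean T k F| ≤ lagMean T k fun t t' => |F t t'| := by
  rw [lagMean, abs_mul, abs_of_nonneg (by positivity : (0 : ℝ) ≤ (T : ℝ)⁻¹)]
  exact mul_le_mul_of_nonneg_left (Finset.abs_sum_le_sum_abs _ _) (by positivity)

lemma lagMean_fst_sq_le (T k : ℕ) (z : ℤ → ℝ) :
    lagMean T k (fun t _ => z t ^ 2) ≤ empNormSq T z := by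
  refine mul_le_mul_of_nonneg_left ?_ (by positivity)
  exact Finset.sum_le_sum_of_subset_of_nonneg (Finset.Icc_subset_Icc le_rfl (by omega))
    fun _ _ _ => sq_nonneg _

lemma lagMean_snd_sq_le (T k : ℕ) (z : ℤ → ℝ) :
    lagMean T k (fun _ t' => z t' ^ 2) ≤ empNormSq T z := by
  refine mul_le_mul_of_nonneg_left ?_ (by positivity)
  have h1 : ∑ t ∈ Finset.Icc (1 : ℤ) ((T : ℤ) - k), z (t + k) ^ 2
      = ∑ t ∈ (Finset.Icc (1 : ℤ) ((T : ℤ) - k)).map (addRightEmbedding (k : ℤ)), z t ^ 2 := by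
    rw [Finset.sum_map]; rfl
  refine h1.trans_le ?_
  refine Finset.sum_le_sum_of_subset_of_nonneg (fun t ht => ?_) fun _ _ _ => sq_nonneg _
  rw [Finset.mem_map] at ht
  obtain ⟨t', ht', rfl⟩ := ht
  rw [Finset.mem_Icc] at *
  simp only [addRightEmbedding_apply]
  omega

lemma integral_lagMean_le {T k : ℕ} {F : Ω → ℤ → ℤ → ℝ} {D : ℝ} (hD : 0 ≤ D)
    (hint : ∀ t t', Integrable (fun ω => F ω t t') μ) (h : ∀ t t', ∫ ω, F ω t t' ∂μ ≤ D) :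
    Integrable (fun ω => lagMean T k (F ω)) μ ∧ ∫ ω, lagMean T k (F ω) ∂μ ≤ D := by
  refine ⟨(integrable_finsetSum _ fun t _ => hint _ _).const_mul _, ?_⟩
  simp only [lagMean]
  rcases Nat.eq_zero_or_pos T with rfl | hT
  · simpa using hD
  have hT0 : (0 : ℝ) < T := by exact_mod_cast hT
  rw [integral_const_mul, integral_finsetSum _ fun t _ => hint _ _, inv_mul_le_iff₀ hT0]
  calc _ ≤ ∑ t ∈ Finset.Icc (1 : ℤ) ((T : ℤ) - k), D := Finset.sum_le_sum fun t _ => h _ _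
    _ = ((Finset.Icc (1 : ℤ) ((T : ℤ) - k)).card : ℝ) * D := by rw [Finset.sum_const, nsmul_eq_mul]
    _ ≤ T * D := by
      gcongr
      rw [Int.card_Icc]
      omega

variable {g : ℕ} {V : ℤ → Ω → Fin g → ℝ} {ς D₁ D₂ : ℝ}

lemma FourthOrderStationary.memLp_mul (h : FourthOrderStationary μ V) (s t : ℤ) (i l : Fin g) :
    MemLp (fun ω => V s ω i * V t ω l) 2 μ := by
  have : ENNReal.HolderTriple 4 4 2 := ⟨by
    rw [← two_mul, show (4 : ℝ≥0∞) = 2 * 2 by norm_num, ENNReal.mul_inv (by simp) (by simp),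
      ← mul_assoc, ENNReal.mul_inv_cancel (by simp) (by simp), one_mul]⟩
  exact (h.1 t l).mul (h.1 s i)

lemma FourthOrderStationary.covariance_shift (h : FourthOrderStationary μ V) (s t k : ℤ)
    (i l : Fin g) :
    cov[fun ω => V s ω i * V (s + k) ω l, fun ω => V t ω i * V (t + k) ω l; μ]
      = cov[fun ω => V 0 ω i * V k ω l, fun ω => V (t - s) ω i * V (t - s + k) ω l; μ] := by
  rw [covariance_eq_sub (h.memLp_mul _ _ _ _) (h.memLp_mul _ _ _ _),
    covariance_eq_sub (h.memLp_mul _ _ _ _) (h.memLp_mul _ _ _ _)]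
  have h1 := h.integral_mul₄ 0 k (t - s) (t - s + k) s i l i l
  have h2 := h.integral_mul 0 k s i l
  have h3 := h.integral_mul (t - s) (t - s + k) s i l
  simp only [zero_add, sub_add_cancel, show t - s + k + s = t + k by ring,
    show k + s = s + k by ring] at h1 h2 h3
  rw [h2, h3]
  congr 1
  simpa only [Pi.mul_apply, mul_assoc] using h1

/-- Only the terms with the same lag in both products, and with the given pair of indices, are kept
from the fourth-order sum. -/
lemma AutocovCond.sum_abs_covariance_le (h : AutocovCond μ V ς D₁ D₂) (hD : 0 ≤ D₂) (k : ℤ)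
    (i l : Fin g) (F : Finset ℤ) :
    ∑ t ∈ F, |cov[fun ω => V 0 ω i * V k ω l, fun ω => V t ω i * V (t + k) ω l; μ]| ≤ D₂ := by
  have h1 : ∑ t ∈ F, ‖cov[fun ω => V 0 ω i * V k ω l, fun ω => V t ω i * V (t + k) ω l; μ]‖ₑ
      ≤ ENNReal.ofReal D₂ := by
    refine le_trans ?_ (h.fourth k)
    refine le_trans ?_ (ENNReal.le_tsum k)
    refine le_trans ?_ (ENNReal.sum_le_tsum F)
    refine Finset.sum_le_sum fun t _ => ?_
    refine le_trans ?_ (Finset.single_le_sum (fun _ _ => bot_le) (Finset.mem_univ i))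
    exact Finset.single_le_sum (f := fun l =>
      ‖cov[fun ω => V 0 ω i * V k ω l, fun ω => V t ω i * V (t + k) ω l; μ]‖ₑ)
      (fun _ _ => bot_le) (Finset.mem_univ l)
  have h2 : ∀ t ∈ F, ‖cov[fun ω => V 0 ω i * V k ω l, fun ω => V t ω i * V (t + k) ω l; μ]‖ₑ
      = ENNReal.ofReal |cov[fun ω => V 0 ω i * V k ω l, fun ω => V t ω i * V (t + k) ω l; μ]| :=
    fun t _ => Real.enorm_eq_ofReal_abs _
  rw [Finset.sum_congr rfl h2, ← ENNReal.ofReal_sum_of_nonneg fun _ _ => abs_nonneg _] at h1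
  exact (ENNReal.ofReal_le_ofReal_iff hD).1 h1

/-- There are T - k products, normalized by T, which gives the mean (1 - k/T)Γ_k. By stationarity
every row of their covariance matrix sums to at most D₂, so the variance is at most D₂/T; Jensen's
inequality gives the L¹ bound. -/
lemma AutocovCond.integral_abs_lagMean_sub_le (h : AutocovCond μ V ς D₁ D₂) (hD : 0 ≤ D₂)
    {T k : ℕ} (hk : k < T) (i l : Fin g) :
    Integrable (fun ω => |lagMean T k (fun t t' => V t ω i * V t' ω l)
        - (1 - (k : ℝ) / T) * ∫ ω', V 0 ω' i * V k ω' l ∂μ|) μ ∧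
      ∫ ω, |lagMean T k (fun t t' => V t ω i * V t' ω l)
        - (1 - (k : ℝ) / T) * ∫ ω', V 0 ω' i * V k ω' l ∂μ| ∂μ ≤ √(D₂ / T) := by
  have hT0 : (0 : ℝ) < T := by exact_mod_cast (by omega : 0 < T)
  set S := Finset.Icc (1 : ℤ) ((T : ℤ) - k) with hS
  have hcard : (S.card : ℝ) = T - k := by
    rw [hS, Int.card_Icc]
    have : (((T : ℤ) - k + 1 - 1).toNat : ℤ) = (T : ℤ) - k := by omega
    exact_mod_cast this
  set X : ℤ → Ω → ℝ := fun t ω => V t ω i * V (t + k) ω l with hX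
  have hXm : ∀ t, MemLp (X t) 2 μ := fun t => h.stationary.memLp_mul _ _ _ _
  set Z : Ω → ℝ := fun ω => (T : ℝ)⁻¹ * ∑ t ∈ S, X t ω with hZ
  have hSm : MemLp (fun ω => ∑ t ∈ S, X t ω) 2 μ := memLp_finsetSum _ fun t _ => hXm t
  have hZm : MemLp Z 2 μ := hSm.const_mul _
  have hEX : ∀ t, ∫ ω, X t ω ∂μ = ∫ ω', V 0 ω' i * V k ω' l ∂μ := by
    intro t
    have := h.stationary.integral_mul 0 k t i l
    simp only [zero_add, add_comm (k : ℤ) t] at this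
    exact this
  have hEZ : ∫ ω, Z ω ∂μ = (1 - (k : ℝ) / T) * ∫ ω', V 0 ω' i * V k ω' l ∂μ := by
    rw [hZ, integral_const_mul, integral_finsetSum _ fun t _ => (hXm t).integrable one_le_two]
    simp only [hEX]
    rw [Finset.sum_const, nsmul_eq_mul, hcard]
    field_simp
  have hvar : Var[Z; μ] ≤ D₂ / T := by
    rw [hZ, variance_const_mul, ← covariance_self hSm.aemeasurable,
      covariance_fun_sum_fun_sum' (fun t _ => hXm t) (fun t _ => hXm t)]
    have h1 : ∀ s ∈ S, ∑ t ∈ S, cov[X s, X t; μ] ≤ D₂ := by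
      intro s _
      refine le_trans ?_ (h.sum_abs_covariance_le hD k i l (S.image fun t => t - s))
      rw [Finset.sum_image fun a _ b _ hab => by simpa using hab]
      refine Finset.sum_le_sum fun t _ => ?_
      rw [hX, h.stationary.covariance_shift]
      exact le_abs_self _
    have h2 : ∑ s ∈ S, ∑ t ∈ S, cov[X s, X t; μ] ≤ T * D₂ := by
      refine (Finset.sum_le_sum h1).trans ?_
      rw [Finset.sum_const, nsmul_eq_mul, hcard]
      have : (0 : ℝ) ≤ k := by positivity
      gcongr
      linarith
    calc _ ≤ ((T : ℝ)⁻¹) ^ 2 * (T * D₂) := by gcongr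
      _ = D₂ / T := by field_simp
  have hfun : (fun ω => |lagMean T k (fun t t' => V t ω i * V t' ω l)
        - (1 - (k : ℝ) / T) * ∫ ω', V 0 ω' i * V k ω' l ∂μ|)
      = fun ω => |Z ω - ∫ ω', Z ω' ∂μ| := by
    ext ω; rw [hEZ]; rfl
  rw [hfun]
  exact ⟨((hZm.integrable one_le_two).sub (integrable_const _)).abs,
    (integral_abs_sub_integral_le_sqrt_variance hZm).trans (Real.sqrt_le_sqrt hvar)⟩

/-- Since |k|^ς ≥ 1 for k ≠ 0, the weighted bound gives plain summability; the lag 0, whose weight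
is 0, is added separately. -/
lemma AutocovCond.summable_apply (h : AutocovCond μ V ς D₁ D₂) (hς : 0 < ς) (hD : 0 ≤ D₁)
    (i l : Fin g) {Γ : ℤ → ℝ} (hΓ : ∀ k, Γ k = ∫ ω, V 0 ω i * V k ω l ∂μ) :
    Summable Γ ∧ Summable (fun k : ℤ => |(k : ℝ)| ^ ς * |Γ k|) ∧
      ∑' k : ℤ, |(k : ℝ)| ^ ς * |Γ k| ≤ D₁ := by
  have h1 : ∑' k : ℤ, ENNReal.ofReal (|(k : ℝ)| ^ ς * |Γ k|) ≤ ENNReal.ofReal D₁ := by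
    refine le_trans (ENNReal.tsum_le_tsum fun k => ?_) h.second
    rw [ENNReal.ofReal_mul (by positivity)]
    gcongr
    rw [← ofReal_norm]
    refine ENNReal.ofReal_le_ofReal ?_
    rw [hΓ]
    exact abs_apply_le_frobenius_norm
      (Matrix.of fun i h => ∫ ω, V 0 ω i * V k ω h ∂μ : Matrix (Fin g) (Fin g) ℝ) i l
  have h2 : Summable (fun k : ℤ => |(k : ℝ)| ^ ς * |Γ k|) := by
    have h3 := ENNReal.summable_toReal (h1.trans_lt ENNReal.ofReal_lt_top).ne
    refine h3.congr fun k => ENNReal.toReal_ofReal (by positivity)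
  refine ⟨?_, h2, ?_⟩
  · refine Summable.of_abs ?_
    refine Summable.of_nonneg_of_le (fun _ => abs_nonneg _) (fun k => ?_)
      ((summable_of_ne_finset_zero (s := {0}) (f := fun k : ℤ => if k = 0 then |Γ 0| else 0)
        fun k hk => if_neg (by simpa using hk)).add h2)
    · by_cases hk : k = 0
      · subst hk
        simp [Real.zero_rpow hς.ne']
      · rw [if_neg hk, zero_add]
        refine le_mul_of_one_le_left (abs_nonneg _) (Real.one_le_rpow ?_ hς.le)
        rw [← Int.cast_abs]
        exact_mod_cast Int.one_le_abs hk
  · rw [← ENNReal.ofReal_tsum_of_nonneg (fun k => by positivity) h2] at h1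
    exact (ENNReal.ofReal_le_ofReal_iff hD).1 h1

end LagMeans

lemma summable_matrix_of_apply {m n : Type*} [Fintype m] [Fintype n] {A : ℤ → Matrix m n ℝ}
    (h : ∀ i j, Summable fun k => A k i j) : Summable A :=
  Pi.summable.2 fun i => Pi.summable.2 fun j => h i j

lemma tsum_matrix_apply {m n : Type*} [Fintype m] [Fintype n] {A : ℤ → Matrix m n ℝ}
    (h : Summable A) (i : m) (j : n) : (∑' k, A k) i j = ∑' k, A k i j := by
  have h1 : Summable fun k => A k i := Pi.summable.1 h i
  exact (congrFun (tsum_apply (f := A) h (x := i)) j).trans (tsum_apply h1)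

/-! ### Effect of estimated errors on products and on kernel-weighted sums. -/

section Perturbation

lemma abs_mul_four_le {x y z w H : ℝ} (hz : z ^ 2 ≤ H) (hw : w ^ 2 ≤ H) :
    |x * y * z * w| ≤ H * ((x ^ 2 + y ^ 2) / 2) := by
  have h1 : |x * y| ≤ (x ^ 2 + y ^ 2) / 2 :=
    abs_le.2 ⟨by nlinarith [sq_nonneg (x + y)], by nlinarith [sq_nonneg (x - y)]⟩
  have h2 : |z * w| ≤ H :=
    abs_le.2 ⟨by nlinarith [sq_nonneg (z + w)], by nlinarith [sq_nonneg (z - w)]⟩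
  rw [mul_assoc (x * y), abs_mul, mul_comm H]
  gcongr

lemma abs_mul_le_sq_div {η : ℝ} (hη : 0 < η) (x w : ℝ) :
    |x * w| ≤ (2 * η)⁻¹ * x ^ 2 + η / 2 * w ^ 2 := by
  have h1 : (2 * η)⁻¹ * x ^ 2 + η / 2 * w ^ 2 - |x| * |w| = (2 * η)⁻¹ * (|x| - η * |w|) ^ 2 := by
    rw [← sq_abs x, ← sq_abs w]
    field_simp
    ring
  rw [abs_mul]
  have : 0 ≤ (2 * η)⁻¹ * (|x| - η * |w|) ^ 2 := by positivity
  linarith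

/-- The four terms linear in an error multiply it by three true factors, whose squares have bounded
moments; Young's inequality with the free parameter η separates them. The rest groups into six
terms, one for each pair of errors: the pair is bounded by half the sum of squares, and the two
other factors, perturbed or not, have squares at most 2(N + β). -/
lemma abs_perturb_mul_four_le {u a u' a' v b v' b' N β η : ℝ} (hη : 0 < η) (hu : u ^ 2 ≤ N)
    (hu' : u' ^ 2 ≤ N) (hv : v ^ 2 ≤ N) (hv' : v' ^ 2 ≤ N) (hb : b ^ 2 ≤ β) (hb' : b' ^ 2 ≤ β) :
    |(u + a) * (u' + a') * (v + b) * (v' + b') - u * u' * v * v'|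
      ≤ ((2 * η)⁻¹ + 3 * (N + β)) * (a ^ 2 + a' ^ 2 + b ^ 2 + b' ^ 2)
        + η / 2 * ((v * u' * v') ^ 2 + (u * v * v') ^ 2 + (u * u' * v') ^ 2 + (u * v * u') ^ 2) := by
  have hN : 0 ≤ N := (sq_nonneg u).trans hu
  have hβ : 0 ≤ β := (sq_nonneg b).trans hb
  set H := 2 * (N + β) with hH
  have hV : (v + b) ^ 2 ≤ H := by nlinarith [sq_nonneg (v - b)]
  have hV' : (v' + b') ^ 2 ≤ H := by nlinarith [sq_nonneg (v' - b')]
  have hNH : N ≤ H := by linarith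
  have h1 := abs_mul_le_sq_div hη a (v * u' * v')
  have h2 := abs_mul_le_sq_div hη a' (u * v * v')
  have h3 := abs_mul_le_sq_div hη b (u * u' * v')
  have h4 := abs_mul_le_sq_div hη b' (u * v * u')
  have q1 := abs_mul_four_le (x := a) (y := a') hV hV'
  have q2 := abs_mul_four_le (x := a) (y := b) (hu'.trans hNH) hV'
  have q3 := abs_mul_four_le (x := a) (y := b') (hu'.trans hNH) (hv.trans hNH)
  have q4 := abs_mul_four_le (x := a') (y := b) (hu.trans hNH) hV'
  have q5 := abs_mul_four_le (x := a') (y := b') (hu.trans hNH) (hv.trans hNH)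
  have q6 := abs_mul_four_le (x := b) (y := b') (hu.trans hNH) (hu'.trans hNH)
  have key : (u + a) * (u' + a') * (v + b) * (v' + b') - u * u' * v * v'
      = a * (v * u' * v') + a' * (u * v * v') + b * (u * u' * v') + b' * (u * v * u')
        + a * a' * (v + b) * (v' + b') + a * b * u' * (v' + b') + a * b' * u' * v
        + a' * b * u * (v' + b') + a' * b' * u * v + b * b' * u * u' := by ring
  have hsum : H * ((a ^ 2 + a' ^ 2) / 2) + H * ((a ^ 2 + b ^ 2) / 2) + H * ((a ^ 2 + b' ^ 2) / 2)
      + H * ((a' ^ 2 + b ^ 2) / 2) + H * ((a' ^ 2 + b' ^ 2) / 2) + H * ((b ^ 2 + b' ^ 2) / 2)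
      = 3 * (N + β) * (a ^ 2 + a' ^ 2 + b ^ 2 + b' ^ 2) := by rw [hH]; ring
  rw [key, add_mul]
  rw [abs_le] at *
  constructor <;> linarith [h1.1, h1.2]

variable {g : ℕ}

/-- The product `u_t u_{t'} v_{t,i} v_{t',l}`. -/
def crossProd (u : ℤ → ℝ) (v : Fin g → ℤ → ℝ) (i l : Fin g) (t t' : ℤ) : ℝ :=
  u t * u t' * v i t * v l t'

/-- The sum over `i` and `l` of the products of errors whose moments are controlled. -/
noncomputable def momentSum (u : ℤ → ℝ) (v : Fin g → ℤ → ℝ) (t t' : ℤ) : ℝ :=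
  ∑ i, ∑ l, ((v i t * u t' * v l t') ^ 2 + (u t * v i t * v l t') ^ 2 + (u t * u t' * v l t') ^ 2
    + (u t * v i t * u t') ^ 2 + |u t * u t' * v i t * v l t'|)

lemma le_momentSum (u : ℤ → ℝ) (v : Fin g → ℤ → ℝ) (t t' : ℤ) (i l : Fin g) :
    (v i t * u t' * v l t') ^ 2 + (u t * v i t * v l t') ^ 2 + (u t * u t' * v l t') ^ 2
    + (u t * v i t * u t') ^ 2 + |u t * u t' * v i t * v l t'| ≤ momentSum u v t t' := by
  refine le_trans ?_ (Finset.single_le_sum (f := fun i => ∑ l, ((v i t * u t' * v l t') ^ 2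
    + (u t * v i t * v l t') ^ 2 + (u t * u t' * v l t') ^ 2
    + (u t * v i t * u t') ^ 2 + |u t * u t' * v i t * v l t'|)) (fun i _ => by positivity)
    (Finset.mem_univ i))
  exact Finset.single_le_sum (f := fun l => ((v i t * u t' * v l t') ^ 2
    + (u t * v i t * v l t') ^ 2 + (u t * u t' * v l t') ^ 2
    + (u t * v i t * u t') ^ 2 + |u t * u t' * v i t * v l t'|)) (fun i _ => by positivity)
    (Finset.mem_univ l)

lemma momentSum_nonneg (u : ℤ → ℝ) (v : Fin g → ℤ → ℝ) (t t' : ℤ) : 0 ≤ momentSum u v t t' := by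
  rw [momentSum]; positivity

lemma abs_crossProd_le (u : ℤ → ℝ) (v : Fin g → ℤ → ℝ) (i l : Fin g) (t t' : ℤ) :
    |crossProd u v i l t t'| ≤ momentSum u v t t' := by
  refine le_trans ?_ (le_momentSum u v t t' i l)
  rw [crossProd]
  have : 0 ≤ (v i t * u t' * v l t') ^ 2 + (u t * v i t * v l t') ^ 2 + (u t * u t' * v l t') ^ 2
    + (u t * v i t * u t') ^ 2 := by positivity
  linarith

/-- The sample autocovariance of order `k ∈ ℤ`, up to normalization. -/
noncomputable def signedLagMean (T : ℕ) (u : ℤ → ℝ) (v : Fin g → ℤ → ℝ) (k : ℤ) (i l : Fin g) : ℝ :=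
  if 0 ≤ k then lagMean T k.natAbs (crossProd u v i l) else lagMean T k.natAbs (crossProd u v l i)

lemma abs_signedLagMean_le (T : ℕ) (u : ℤ → ℝ) (v : Fin g → ℤ → ℝ) (k : ℤ) (i l : Fin g) :
    |signedLagMean T u v k i l| ≤ lagMean T k.natAbs (momentSum u v) := by
  rw [signedLagMean]
  split_ifs
  all_goals
    exact (abs_lagMean_le _ _ _).trans (lagMean_mono fun t _ => abs_crossProd_le u v _ _ _ _)

/-- Averaging the pointwise bound over t turns the squared errors into empirical norms, at most X
each, and leaves η times a lagged mean of bounded expectation. -/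
lemma abs_lagMean_perturb_le {T n : ℕ} {u a : ℤ → ℝ} {v b : Fin g → ℤ → ℝ} {N β X η : ℝ}
    (hη : 0 < η) (hN : 0 ≤ N) (hβ : 0 ≤ β) (hu : ∀ t ∈ Finset.Icc (1 : ℤ) T, u t ^ 2 ≤ N)
    (hv : ∀ i, ∀ t ∈ Finset.Icc (1 : ℤ) T, v i t ^ 2 ≤ N)
    (hb : ∀ i, ∀ t ∈ Finset.Icc (1 : ℤ) T, b i t ^ 2 ≤ β)
    (ha : empNormSq T a ≤ X) (hbX : ∀ i, empNormSq T (b i) ≤ X) (i l : Fin g) :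
    |lagMean T n (crossProd (fun t => u t + a t) (fun i t => v i t + b i t) i l)
      - lagMean T n (crossProd u v i l)|
      ≤ ((2 * η)⁻¹ + 3 * (N + β)) * (4 * X) + η * lagMean T n (momentSum u v) := by
  rw [← lagMean_sub]
  refine (abs_lagMean_le _ _ _).trans ?_
  set c := (2 * η)⁻¹ + 3 * (N + β) with hc
  have hc0 : 0 ≤ c := by positivity
  have h1 : lagMean T n (fun t t' => |crossProd (fun t => u t + a t) (fun i t => v i t + b i t) i l t t'
      - crossProd u v i l t t'|)
      ≤ lagMean T n (fun t t' => c * (a t ^ 2 + a t' ^ 2 + b i t ^ 2 + b l t' ^ 2)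
        + η * momentSum u v t t') := by
    refine lagMean_mono fun t ht => ?_
    rw [Finset.mem_Icc] at ht
    have ht1 : t ∈ Finset.Icc (1 : ℤ) T := by rw [Finset.mem_Icc]; omega
    have ht2 : t + n ∈ Finset.Icc (1 : ℤ) T := by rw [Finset.mem_Icc]; omega
    refine (abs_perturb_mul_four_le hη (hu _ ht1) (hu _ ht2) (hv _ _ ht1) (hv _ _ ht2) (hb _ _ ht1)
      (hb _ _ ht2)).trans ?_
    have h2 := le_momentSum u v t (t + n) i l
    have h3 : 0 ≤ |u t * u (t + n) * v i t * v l (t + n)| := abs_nonneg _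
    have h4 := momentSum_nonneg u v t (t + n)
    have h5 : (v i t * u (t + n) * v l (t + n)) ^ 2 + (u t * v i t * v l (t + n)) ^ 2
        + (u t * u (t + n) * v l (t + n)) ^ 2 + (u t * v i t * u (t + n)) ^ 2
        ≤ 2 * momentSum u v t (t + n) := by linarith
    nlinarith
  refine h1.trans ?_
  rw [lagMean_add, lagMean_const_mul, lagMean_const_mul, lagMean_add, lagMean_add, lagMean_add]
  have h2 := (lagMean_fst_sq_le T n a).trans ha
  have h3 := (lagMean_snd_sq_le T n a).trans ha
  have h4 := (lagMean_fst_sq_le T n (b i)).trans (hbX i)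
  have h5 := (lagMean_snd_sq_le T n (b l)).trans (hbX l)
  gcongr
  linarith

lemma abs_signedLagMean_perturb_le {T : ℕ} {u a : ℤ → ℝ} {v b : Fin g → ℤ → ℝ} {N β X η : ℝ}
    (hη : 0 < η) (hN : 0 ≤ N) (hβ : 0 ≤ β) (hu : ∀ t ∈ Finset.Icc (1 : ℤ) T, u t ^ 2 ≤ N)
    (hv : ∀ i, ∀ t ∈ Finset.Icc (1 : ℤ) T, v i t ^ 2 ≤ N)
    (hb : ∀ i, ∀ t ∈ Finset.Icc (1 : ℤ) T, b i t ^ 2 ≤ β)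
    (ha : empNormSq T a ≤ X) (hbX : ∀ i, empNormSq T (b i) ≤ X) (k : ℤ) (i l : Fin g) :
    |signedLagMean T (fun t => u t + a t) (fun i t => v i t + b i t) k i l
      - signedLagMean T u v k i l|
      ≤ ((2 * η)⁻¹ + 3 * (N + β)) * (4 * X) + η * lagMean T k.natAbs (momentSum u v) := by
  rw [signedLagMean, signedLagMean]
  split_ifs
  all_goals exact abs_lagMean_perturb_le hη hN hβ hu hv hb ha hbX _ _

lemma abs_inv_mul_inv_sub_le {x y x' y' γ d : ℝ} (hγ : 0 < γ) (hx : γ ≤ x) (hy : γ ≤ y)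
    (hx' : γ ≤ x') (hy' : γ ≤ y') (hdx : |x - x'| ≤ d) (hdy : |y - y'| ≤ d) :
    |x⁻¹ * y⁻¹ - x'⁻¹ * y'⁻¹| ≤ 2 * d * γ⁻¹ ^ 3 := by
  have hpos : ∀ z, γ ≤ z → 0 < z := fun z hz => hγ.trans_le hz
  have hinv : ∀ z, γ ≤ z → |z⁻¹| ≤ γ⁻¹ := fun z hz => by
    rw [abs_of_pos (inv_pos.2 (hpos z hz))]; exact inv_anti₀ hγ hz
  have hd : ∀ z z', γ ≤ z → γ ≤ z' → |z - z'| ≤ d → |z⁻¹ - z'⁻¹| ≤ d * (γ⁻¹ * γ⁻¹) := by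
    intro z z' hz hz' h
    rw [inv_sub_inv (hpos z hz).ne' (hpos z' hz').ne', div_eq_mul_inv, mul_inv, abs_mul, abs_mul,
      abs_sub_comm]
    have := hinv z hz
    have := hinv z' hz'
    have : 0 ≤ d := (abs_nonneg _).trans h
    gcongr
  have hd0 : 0 ≤ d := (abs_nonneg _).trans hdx
  calc |x⁻¹ * y⁻¹ - x'⁻¹ * y'⁻¹| = |(x⁻¹ - x'⁻¹) * y⁻¹ + x'⁻¹ * (y⁻¹ - y'⁻¹)| := by congr 1; ring
    _ ≤ |x⁻¹ - x'⁻¹| * |y⁻¹| + |x'⁻¹| * |y⁻¹ - y'⁻¹| := by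
      rw [← abs_mul, ← abs_mul]; exact abs_add_le _ _
    _ ≤ d * (γ⁻¹ * γ⁻¹) * γ⁻¹ + γ⁻¹ * (d * (γ⁻¹ * γ⁻¹)) := by
      have := hd x x' hx hx' hdx
      have := hd y y' hy hy' hdy
      have := hinv y hy
      have := hinv x' hx'
      have : 0 < γ⁻¹ := inv_pos.2 hγ
      gcongr
    _ = _ := by ring

/-- Deterministic bound on the effect of estimating the errors `u`, `v` and the variances `σ` on a
kernel-weighted sum of sample autocovariances. -/
lemma abs_sum_kernel_perturb_le {ι : Type*} (F : Finset ι) (w : ι → ℝ) {A B Y : ι → ℝ}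
    {x y x' y' γ d S W c η : ℝ} (hγ : 0 < γ) (hx : γ ≤ x) (hy : γ ≤ y)
    (hx' : γ ≤ x') (hy' : γ ≤ y') (hdx : |x - x'| ≤ d) (hdy : |y - y'| ≤ d) (hc : 0 ≤ c)
    (hη : 0 ≤ η) (hAB : ∀ k, |A k - B k| ≤ c + η * Y k) (hB : ∀ k, |B k| ≤ Y k)
    (hS : ∑ k ∈ F, |w k| ≤ S) (hW : ∑ k ∈ F, |w k| * Y k ≤ W) :
    |∑ k ∈ F, w k * (x⁻¹ * y⁻¹ * A k) - ∑ k ∈ F, w k * (x'⁻¹ * y'⁻¹ * B k)|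
      ≤ γ⁻¹ ^ 2 * (c * S + η * W) + 2 * d * γ⁻¹ ^ 3 * W := by
  have hpos : ∀ z, γ ≤ z → 0 < z := fun z hz => hγ.trans_le hz
  have hinv : ∀ z, γ ≤ z → z⁻¹ ≤ γ⁻¹ := fun z hz => inv_anti₀ hγ hz
  have hxy0 : 0 < x⁻¹ * y⁻¹ := mul_pos (inv_pos.2 (hpos x hx)) (inv_pos.2 (hpos y hy))
  have hxy : x⁻¹ * y⁻¹ ≤ γ⁻¹ ^ 2 := by
    rw [sq]
    exact mul_le_mul (hinv x hx) (hinv y hy) (inv_pos.2 (hpos y hy)).le (inv_pos.2 hγ).le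
  have hdiff := abs_inv_mul_inv_sub_le hγ hx hy hx' hy' hdx hdy
  have hd0 : 0 ≤ d := (abs_nonneg _).trans hdx
  rw [← Finset.sum_sub_distrib]
  calc |∑ k ∈ F, (w k * (x⁻¹ * y⁻¹ * A k) - w k * (x'⁻¹ * y'⁻¹ * B k))|
      ≤ ∑ k ∈ F, |w k * (x⁻¹ * y⁻¹ * A k) - w k * (x'⁻¹ * y'⁻¹ * B k)| :=
        Finset.abs_sum_le_sum_abs _ _
    _ ≤ ∑ k ∈ F, (γ⁻¹ ^ 2 * (c * |w k| + η * (|w k| * Y k))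
          + 2 * d * γ⁻¹ ^ 3 * (|w k| * Y k)) := by
      refine Finset.sum_le_sum fun k _ => ?_
      have h1 : w k * (x⁻¹ * y⁻¹ * A k) - w k * (x'⁻¹ * y'⁻¹ * B k)
          = w k * (x⁻¹ * y⁻¹ * (A k - B k) + (x⁻¹ * y⁻¹ - x'⁻¹ * y'⁻¹) * B k) := by ring
      have h2 : |x⁻¹ * y⁻¹ * (A k - B k) + (x⁻¹ * y⁻¹ - x'⁻¹ * y'⁻¹) * B k|
          ≤ γ⁻¹ ^ 2 * (c + η * Y k) + 2 * d * γ⁻¹ ^ 3 * Y k := by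
        refine (abs_add_le _ _).trans ?_
        rw [abs_mul (x⁻¹ * y⁻¹), abs_mul (x⁻¹ * y⁻¹ - _), abs_of_pos hxy0]
        have := hAB k
        have := hB k
        gcongr
      rw [h1, abs_mul]
      calc _ ≤ |w k| * (γ⁻¹ ^ 2 * (c + η * Y k) + 2 * d * γ⁻¹ ^ 3 * Y k) := by gcongr
        _ = _ := by ring
    _ = γ⁻¹ ^ 2 * (c * ∑ k ∈ F, |w k| + η * ∑ k ∈ F, |w k| * Y k)
          + 2 * d * γ⁻¹ ^ 3 * ∑ k ∈ F, |w k| * Y k := by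
      simp only [Finset.sum_add_distrib, ← Finset.mul_sum]
    _ ≤ _ := by gcongr

end Perturbation

/-! ### Consequences of the dimension conditions for the maxima of errors. -/

section Rates

variable {p : ℕ → ℕ} {s : ℕ → ℝ} {μ D : ℝ}

/-- As s ≥ 1, the condition forces p² ≤ D T^{μ-1}; the dimension grows at most polynomially, and its
logarithm more slowly than any power of T. -/
lemma exists_log_le_rpow (hp : ∀ T, 2 ≤ p T) (hs : ∀ T, 1 ≤ s T) (hμ : 2 < μ) (hD : 0 < D)
    (hdim : ∀ᶠ T : ℕ in atTop, s T ^ μ * (p T : ℝ) ^ 2 * (T : ℝ) ^ (1 - μ) ≤ D) {θ : ℝ} (hθ : 0 < θ) :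
    ∃ c : ℝ, 0 < c ∧ ∀ᶠ T : ℕ in atTop, Real.log (p T) ≤ c * (T : ℝ) ^ θ := by
  set ε := 2 * θ / (μ - 1) with hε
  have hε0 : 0 < ε := div_pos (by linarith) (by linarith)
  refine ⟨D ^ (ε / 2) / ε, by positivity, ?_⟩
  filter_upwards [hdim, eventually_ge_atTop 1] with T hT hT1
  have hT0 : (0 : ℝ) < T := by exact_mod_cast hT1
  have hp0 : (0 : ℝ) < p T := by exact_mod_cast (by linarith [hp T] : 0 < p T)
  have h1 : (p T : ℝ) ^ 2 ≤ D * (T : ℝ) ^ (μ - 1) := by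
    have h2 : 1 ≤ s T ^ μ := Real.one_le_rpow (hs T) (by linarith)
    have h3 : (p T : ℝ) ^ 2 * (T : ℝ) ^ (1 - μ) ≤ D := by
      refine le_trans ?_ hT
      rw [mul_assoc]
      exact le_mul_of_one_le_left (by positivity) h2
    rw [show (1 - μ) = -(μ - 1) by ring, Real.rpow_neg hT0.le, ← div_eq_mul_inv,
      div_le_iff₀ (by positivity)] at h3
    exact h3
  have h4 : (p T : ℝ) ^ ε ≤ D ^ (ε / 2) * (T : ℝ) ^ θ := by
    calc (p T : ℝ) ^ ε = ((p T : ℝ) ^ 2) ^ (ε / 2) := by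
          rw [← Real.rpow_natCast, ← Real.rpow_mul hp0.le]; congr 1; push_cast; ring
      _ ≤ (D * (T : ℝ) ^ (μ - 1)) ^ (ε / 2) := Real.rpow_le_rpow (by positivity) h1 (by positivity)
      _ = D ^ (ε / 2) * (T : ℝ) ^ θ := by
          rw [Real.mul_rpow hD.le (by positivity), ← Real.rpow_mul hT0.le]
          congr 2
          rw [hε]
          have : μ - 1 ≠ 0 := by linarith
          field_simp
  calc Real.log (p T) ≤ (p T : ℝ) ^ ε / ε := Real.log_le_rpow_div hp0.le hε0
    _ ≤ D ^ (ε / 2) * (T : ℝ) ^ θ / ε := by gcongr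
    _ = _ := by ring

lemma sqrt_log_div_pos {n T : ℕ} (hn : 2 ≤ n) (hT : 1 ≤ T) : 0 < √(Real.log n / T) :=
  Real.sqrt_pos.2 (div_pos (log_natCast_pos hn) (by exact_mod_cast hT))

lemma inv_sqrt_le_sqrt_log_div {n T : ℕ} (hn : 2 ≤ n) :
    (√(T : ℝ))⁻¹ ≤ (√(Real.log 2))⁻¹ * √(Real.log n / T) := by
  have h2 : 0 < Real.log 2 := Real.log_pos (by norm_num)
  rw [Real.sqrt_div (log_natCast_pos hn).le, ← mul_div_assoc, inv_mul_eq_div, inv_eq_one_div]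
  gcongr
  rw [one_le_div (Real.sqrt_pos.2 h2)]
  exact Real.sqrt_le_sqrt (log_two_le_log_natCast hn)

lemma tendsto_mul_sqrt_log_div (hp : ∀ T, 2 ≤ p T)
    (hsT : Tendsto (fun T : ℕ => s T ^ 2 * Real.log (p T) ^ 2 / T) atTop (𝓝 0)) :
    Tendsto (fun T : ℕ => s T * √(Real.log (p T) / T)) atTop (𝓝 0) := by
  have h2 : 0 < Real.log 2 := Real.log_pos (by norm_num)
  have h1 : Tendsto (fun T : ℕ => √((Real.log 2)⁻¹ * (s T ^ 2 * Real.log (p T) ^ 2 / T))) atTop (𝓝 0) := by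
    simpa using (hsT.const_mul (Real.log 2)⁻¹).sqrt
  refine squeeze_zero_norm (fun T => ?_) h1
  have hℓ := log_natCast_pos (hp T)
  rw [Real.norm_eq_abs, abs_mul, abs_of_nonneg (Real.sqrt_nonneg (Real.log (p T) / T)),
    ← Real.sqrt_sq_eq_abs, ← Real.sqrt_mul (sq_nonneg _)]
  refine Real.sqrt_le_sqrt ?_
  rw [le_inv_mul_iff₀ h2]
  calc Real.log 2 * (s T ^ 2 * (Real.log (p T) / T))
      ≤ Real.log (p T) * (s T ^ 2 * (Real.log (p T) / T)) := by
        have := log_two_le_log_natCast (hp T)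
        gcongr
    _ = _ := by ring

/-- T^{1/κ} bounds the order of the largest squared error u_t² or v_{t,j}² over t ≤ T. Because κ >
2, it is smaller than √T by a power of T, which beats √(log p). -/
lemma exists_rpow_mul_sqrt_log_div_le (hp : ∀ T, 2 ≤ p T) (hs : ∀ T, 1 ≤ s T) (hμ : 2 < μ)
    (hD : 0 < D)
    (hdim : ∀ᶠ T : ℕ in atTop, s T ^ μ * (p T : ℝ) ^ 2 * (T : ℝ) ^ (1 - μ) ≤ D) {κ : ℝ} (hκ : 2 < κ) :
    ∃ c : ℝ, 0 < c ∧ ∀ᶠ T : ℕ in atTop, (T : ℝ) ^ (1 / κ) * √(Real.log (p T) / T) ≤ c := by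
  have hθ : 0 < 1 - 2 / κ := by
    rw [sub_pos, div_lt_one (by linarith)]; exact hκ
  obtain ⟨c, hc, h⟩ := exists_log_le_rpow hp hs hμ hD hdim hθ
  refine ⟨√c, Real.sqrt_pos.2 hc, ?_⟩
  filter_upwards [h, eventually_ge_atTop 1] with T hT hT1
  have hT0 : (0 : ℝ) < T := by exact_mod_cast hT1
  rw [show (T : ℝ) ^ (1 / κ) = √((T : ℝ) ^ (2 / κ)) by
    rw [Real.sqrt_eq_rpow, ← Real.rpow_mul hT0.le]; congr 1; ring,
    ← Real.sqrt_mul (by positivity)]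
  refine Real.sqrt_le_sqrt ?_
  calc (T : ℝ) ^ (2 / κ) * (Real.log (p T) / T)
      ≤ (T : ℝ) ^ (2 / κ) * (c * (T : ℝ) ^ (1 - 2 / κ) / T) := by gcongr
    _ = c * ((T : ℝ) ^ (2 / κ) * (T : ℝ) ^ (1 - 2 / κ)) / T := by ring
    _ = c := by
      rw [← Real.rpow_add hT0, show 2 / κ + (1 - 2 / κ) = 1 by ring, Real.rpow_one]
      field_simp

/-- The minimum combines two bounds on the largest squared fitted error: T times its mean square,
and the largest squared regressor times the squared ℓ₁ error. If s log^{3/2} p ≤ √T the first is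
good enough. Otherwise s is almost √T, the dimension condition then forces p to be small, and the
second is good enough. -/
lemma exists_min_mul_le {r : ℝ} (hp : ∀ T, 2 ≤ p T) (hs : ∀ T, 1 ≤ s T) (hr : 4 < r) (hμ : 2 < μ)
    (hμr : μ < r / 2) (hD : 0 < D)
    (hdim : ∀ᶠ T : ℕ in atTop, s T ^ μ * (p T : ℝ) ^ 2 * (T : ℝ) ^ (1 - μ) ≤ D)
    (hsT : Tendsto (fun T : ℕ => s T ^ 2 * Real.log (p T) ^ 2 / T) atTop (𝓝 0)) :
    ∃ c : ℝ, 0 < c ∧ ∀ᶠ T : ℕ in atTop,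
      min (T * (s T * √(Real.log (p T) / T) ^ 2))
        (((p T : ℝ) * T) ^ (2 / r) * (s T * √(Real.log (p T) / T)) ^ 2)
        * (s T * √(Real.log (p T) / T) ^ 2) ≤ c * (s T * √(Real.log (p T) / T)) := by
  -- With log p = O(T^θ) for this θ, the bound on p in the second case becomes exactly (pT)^{2/r} =
  -- O(√T). Positivity of θ uses μ < r/2 and r > 4.
  set θ := (r / 2 - 1 - μ / 2) / (3 * μ / 2) with hθ
  have hθ0 : 0 < θ := div_pos (by linarith) (by linarith)
  obtain ⟨c, hc, h⟩ := exists_log_le_rpow hp hs hμ hD hdim hθ0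
  have hl2 : 0 < Real.log 2 := Real.log_pos (by norm_num)
  set c₁ := (D * (c ^ (3 / 2 : ℝ)) ^ μ) ^ (1 / r) with hc₁
  have hc₁0 : 0 < c₁ := by positivity
  refine ⟨1 + c₁ * (√(Real.log 2))⁻¹, by positivity, ?_⟩
  filter_upwards [h, hdim, hsT.eventually (eventually_le_nhds one_pos), eventually_ge_atTop 1]
    with T hℓ hdT hs1 hT1
  have hT0 : (0 : ℝ) < T := by exact_mod_cast hT1
  have hp0 : (0 : ℝ) < p T := by exact_mod_cast (by linarith [hp T] : 0 < p T)
  have hsp : 0 < s T := one_pos.trans_le (hs T)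
  set ℓ := Real.log (p T) with hℓd
  have hℓ0 : 0 < ℓ := log_natCast_pos (hp T)
  set L := √(ℓ / T) with hL
  have hL0 : 0 < L := sqrt_log_div_pos (hp T) hT1
  have hL2 : L ^ 2 = ℓ / T := Real.sq_sqrt (by positivity)
  have hLs : L = √ℓ / √T := Real.sqrt_div hℓ0.le _
  have hqT : √(T : ℝ) ^ 2 = T := Real.sq_sqrt hT0.le
  have hqℓ : √ℓ ^ 2 = ℓ := Real.sq_sqrt hℓ0.le
  have hqT0 : 0 < √(T : ℝ) := Real.sqrt_pos.2 hT0
  have hqℓ0 : 0 < √ℓ := Real.sqrt_pos.2 hℓ0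
  have hsL0 : 0 < s T * L := by positivity
  rw [div_le_one hT0] at hs1
  rcases le_or_gt (s T * (ℓ * √ℓ)) √T with hcase | hcase
  · have h1 : T * (s T * L ^ 2) * (s T * L ^ 2) ≤ s T * L := by
      have h2 : T * (s T * L ^ 2) * (s T * L ^ 2) = (s T * L) * (s T * (T * L ^ 3)) := by ring
      have h3 : T * L ^ 3 = ℓ * √ℓ / √T := by
        rw [pow_succ, hL2, hLs]; field_simp
      rw [h2, h3, ← mul_div_assoc]
      refine mul_le_of_le_one_right hsL0.le ((div_le_one hqT0).2 hcase)
    calc _ ≤ T * (s T * L ^ 2) * (s T * L ^ 2) := by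
          gcongr; exact min_le_left _ _
      _ ≤ s T * L := h1
      _ ≤ _ := le_mul_of_one_le_left hsL0.le (by linarith [show 0 < c₁ * (√(Real.log 2))⁻¹ by positivity])
  · have hpT : ((p T : ℝ) * T) ^ (2 / r) ≤ c₁ * √T := by
      have e1 : (p T : ℝ) ^ 2 ≤ D * (c ^ (3 / 2 : ℝ)) ^ μ * (T : ℝ) ^ (μ / 2 - 1 + 3 * θ * μ / 2) := by
        have a1 : √T / (ℓ * √ℓ) ≤ s T := (div_le_iff₀ (by positivity)).2 hcase.le
        have a2 : ℓ * √ℓ ≤ c ^ (3 / 2 : ℝ) * (T : ℝ) ^ (3 * θ / 2) := by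
          calc ℓ * √ℓ = ℓ ^ (3 / 2 : ℝ) := by
                rw [Real.sqrt_eq_rpow, show (3 / 2 : ℝ) = 1 + 1 / 2 by norm_num,
                  Real.rpow_add hℓ0, Real.rpow_one]
            _ ≤ (c * (T : ℝ) ^ θ) ^ (3 / 2 : ℝ) := Real.rpow_le_rpow hℓ0.le hℓ (by norm_num)
            _ = _ := by
              rw [Real.mul_rpow hc.le (by positivity), ← Real.rpow_mul hT0.le]
              congr 2; ring
        have a3 : (√T / (c ^ (3 / 2 : ℝ) * (T : ℝ) ^ (3 * θ / 2))) ^ μ ≤ s T ^ μ := by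
          refine Real.rpow_le_rpow (by positivity) (le_trans ?_ a1) (by linarith)
          gcongr
        have a4 : (√T / (c ^ (3 / 2 : ℝ) * (T : ℝ) ^ (3 * θ / 2))) ^ μ * (p T : ℝ) ^ 2
            * (T : ℝ) ^ (1 - μ) ≤ D := by
          refine le_trans ?_ hdT
          gcongr
        have a5 : (√T / (c ^ (3 / 2 : ℝ) * (T : ℝ) ^ (3 * θ / 2))) ^ μ * (T : ℝ) ^ (1 - μ)
            = ((c ^ (3 / 2 : ℝ)) ^ μ)⁻¹ * ((T : ℝ) ^ (μ / 2 - 1 + 3 * θ * μ / 2))⁻¹ := by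
          rw [Real.div_rpow (by positivity) (by positivity), Real.mul_rpow (by positivity)
            (by positivity), Real.sqrt_eq_rpow, ← Real.rpow_mul hT0.le, ← Real.rpow_mul hT0.le,
            ← Real.rpow_neg hT0.le, div_eq_mul_inv, mul_inv, ← Real.rpow_neg hT0.le]
          have : (T : ℝ) ^ (-(μ / 2 - 1 + 3 * θ * μ / 2))
            = (T : ℝ) ^ (1 / 2 * μ) * (T : ℝ) ^ (-(3 * θ / 2 * μ)) * (T : ℝ) ^ (1 - μ) := by
            rw [← Real.rpow_add hT0, ← Real.rpow_add hT0]; congr 1; ring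
          rw [this]; ring
        rw [mul_right_comm, a5, ← mul_inv, inv_mul_le_iff₀ (by positivity)] at a4
        linarith
      have e2 : ((p T : ℝ) * T) ^ (2 / r) = ((p T : ℝ) ^ 2 * (T : ℝ) ^ 2) ^ (1 / r) := by
        rw [← mul_pow, ← Real.rpow_natCast, ← Real.rpow_mul (by positivity)]
        congr 1; push_cast; ring
      rw [e2]
      calc ((p T : ℝ) ^ 2 * (T : ℝ) ^ 2) ^ (1 / r)
          ≤ (D * (c ^ (3 / 2 : ℝ)) ^ μ * (T : ℝ) ^ (μ / 2 - 1 + 3 * θ * μ / 2) * (T : ℝ) ^ 2) ^ (1 / r) := by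
            refine Real.rpow_le_rpow (by positivity) ?_ (by positivity)
            gcongr
        _ = c₁ * √T := by
          rw [mul_assoc, Real.mul_rpow (by positivity) (by positivity), ← hc₁, ← Real.rpow_natCast,
            ← Real.rpow_add hT0, ← Real.rpow_mul hT0.le, Real.sqrt_eq_rpow]
          congr 2
          have hμ0 : μ ≠ 0 := by linarith
          have hr0 : r ≠ 0 := by linarith
          have : 3 * θ * μ / 2 = r / 2 - 1 - μ / 2 := by rw [hθ]; field_simp
          rw [this]; push_cast; field_simp; ring
    have h1 : c₁ * √T * (s T * L) ^ 2 * (s T * L ^ 2) ≤ c₁ * (√(Real.log 2))⁻¹ * (s T * L) := by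
      have h2 : c₁ * √T * (s T * L) ^ 2 * (s T * L ^ 2)
          = c₁ * (s T * L) * (s T ^ 2 * (√T * L ^ 3)) := by ring
      have h3 : √T * L ^ 3 = ℓ ^ 2 / T * (√ℓ)⁻¹ := by
        rw [hLs, div_pow, pow_succ √ℓ, hqℓ, pow_succ √(T : ℝ), hqT]
        field_simp
        rw [hqℓ]
      have h4 : (√ℓ)⁻¹ ≤ (√(Real.log 2))⁻¹ := by
        refine inv_anti₀ (Real.sqrt_pos.2 hl2) (Real.sqrt_le_sqrt (log_two_le_log_natCast (hp T)))
      have h5 : s T ^ 2 * (√T * L ^ 3) ≤ (√(Real.log 2))⁻¹ := by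
        rw [h3, ← mul_assoc, ← mul_div_assoc]
        calc _ ≤ 1 * (√ℓ)⁻¹ := by
              gcongr
              exact (div_le_one hT0).2 hs1
          _ ≤ _ := by rw [one_mul]; exact h4
      rw [h2]
      calc _ ≤ c₁ * (s T * L) * (√(Real.log 2))⁻¹ := by gcongr
        _ = _ := by ring
    calc _ ≤ c₁ * √T * (s T * L) ^ 2 * (s T * L ^ 2) := by
          refine mul_le_mul_of_nonneg_right ((min_le_right _ _).trans ?_) (by positivity)
          gcongr
      _ ≤ c₁ * (√(Real.log 2))⁻¹ * (s T * L) := h1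
      _ ≤ _ := by
          gcongr
          linarith

end Rates

/-! ### Maxima, moments and kernel-weighted sums as tight events. -/

section TightMaxima

variable {Ω : ℕ → Type*} [∀ T, MeasurableSpace (Ω T)] {P : ∀ T, Measure (Ω T)}

/-- The maximum of the q-th powers is at most their sum, to which Markov's inequality applies. -/
lemma TightEvents.forall_rpow_le {I : ℕ → Type} [∀ T, Fintype (I T)] {f : ∀ T, I T → Ω T → ℝ}
    {N : ℕ → ℝ} {D q : ℝ} (hD : 0 ≤ D) (hq : 0 < q) (hN : ∀ᶠ T in atTop, 0 < N T)
    (hcard : ∀ T, (Fintype.card (I T) : ℝ) ≤ N T) (hm : ∀ T i, Measurable (f T i))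
    (h : ∀ T i, ∫⁻ ω, ‖f T i ω‖ₑ ^ q ∂(P T) ≤ ENNReal.ofReal D) :
    TightEvents P fun C T => {ω | ∀ i, |f T i ω| ^ q ≤ C * N T} := by
  have hme : ∀ T i, Measurable fun ω => ‖f T i ω‖ₑ ^ q := fun T i =>
    ((hm T i).enorm).pow_const q
  have h1 : TightEvents P fun C T => {ω | ∑ i, ‖f T i ω‖ₑ ^ q ≤ ENNReal.ofReal (C * N T)} := by
    refine TightEvents.of_lintegral (D := D) hN (Eventually.of_forall fun T => ?_)
      fun T => (Finset.measurable_sum _ fun i _ => hme T i).aemeasurable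
    rw [lintegral_finsetSum _ fun i _ => hme T i]
    calc ∑ i, ∫⁻ ω, ‖f T i ω‖ₑ ^ q ∂(P T) ≤ ∑ _i : I T, ENNReal.ofReal D :=
          Finset.sum_le_sum fun i _ => h T i
      _ = ENNReal.ofReal (Fintype.card (I T) * D) := by
        rw [Finset.sum_const, nsmul_eq_mul, ENNReal.ofReal_mul (by positivity),
          ENNReal.ofReal_natCast, Finset.card_univ]
      _ ≤ ENNReal.ofReal (D * N T) := by
        refine ENNReal.ofReal_le_ofReal ?_
        rw [mul_comm]
        exact mul_le_mul_of_nonneg_left (hcard T) hD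
  refine h1.mono_const fun C hC => ⟨C, fun C' hC' => ?_⟩
  filter_upwards [hN] with T hT ω hω i
  have h2 : ‖f T i ω‖ₑ ^ q ≤ ENNReal.ofReal (C * N T) :=
    (Finset.single_le_sum (f := fun i => ‖f T i ω‖ₑ ^ q) (fun _ _ => bot_le)
      (Finset.mem_univ i)).trans hω
  rw [Real.enorm_eq_ofReal_abs, ENNReal.ofReal_rpow_of_nonneg (abs_nonneg _) hq.le] at h2
  exact ((ENNReal.ofReal_le_ofReal_iff (by positivity)).1 h2).trans
    (mul_le_mul_of_nonneg_right hC' hT.le)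

end TightMaxima

section Integrals

variable {Ω : Type*} [MeasurableSpace Ω] {μ : Measure Ω} {f : Ω → ℝ} {D : ℝ}

lemma integral_abs_le_of_lintegral (hf : Measurable f) (hD : 0 ≤ D)
    (h : ∫⁻ ω, ‖f ω‖ₑ ∂μ ≤ ENNReal.ofReal D) :
    Integrable (fun ω => |f ω|) μ ∧ ∫ ω, |f ω| ∂μ ≤ D := by
  have hi : Integrable f μ := ⟨hf.aestronglyMeasurable, h.trans_lt ENNReal.ofReal_lt_top⟩
  refine ⟨hi.abs, ?_⟩
  rw [← ENNReal.ofReal_le_ofReal_iff hD]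
  refine le_trans (le_of_eq ?_) h
  rw [← ofReal_integral_norm_eq_lintegral_enorm hi]
  simp only [Real.norm_eq_abs]

lemma integral_sq_le_of_lintegral (hf : Measurable f) (hD : 0 ≤ D)
    (h : ∫⁻ ω, ‖f ω‖ₑ ^ 2 ∂μ ≤ ENNReal.ofReal D) :
    Integrable (fun ω => f ω ^ 2) μ ∧ ∫ ω, f ω ^ 2 ∂μ ≤ D := by
  have := integral_abs_le_of_lintegral (μ := μ) (hf.pow_const 2) hD (by simpa [enorm_pow] using h)
  simpa [abs_pow, sq_abs] using this

end Integrals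

section MomentSums

variable {Ω : Type*} [MeasurableSpace Ω] {ι : Type*} [Fintype ι] [DecidableEq ι] {g : ℕ}
  {R : LinReg Ω ι} {μ : Measure Ω} [IsProbabilityMeasure μ] {q r a b c B Q D : ℝ} {G : Fin g ↪ ι}

lemma MomentCond.mono (h : MomentCond R μ G Q D) {D' : ℝ} (hD : D ≤ D') :
    MomentCond R μ G Q D' := by
  have hm := ENNReal.ofReal_le_ofReal hD
  exact ⟨fun t k i h' => (h.uuvv t k i h').trans hm, fun t k i h' => (h.vuv_sq t k i h').trans hm,
    fun t k h' => (h.uuv_sq t k h').trans hm, fun t k i => (h.uvu_sq t k i).trans hm,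
    fun t k i h' => (h.uvv_sq t k i h').trans hm, fun t => (h.u_pow t).trans hm,
    fun t i => (h.v_pow t i).trans hm⟩

lemma MomentCond.integral_momentSum_le (h : MomentCond R μ G Q D) (hD : 0 ≤ D)
    (hd : R.DataCond μ q r a b c B) (t t' : ℤ) :
    Integrable (fun ω => momentSum (fun t => R.u t ω) (fun i t => R.nodeError μ (G i) t ω) t t') μ ∧
      ∫ ω, momentSum (fun t => R.u t ω) (fun i t => R.nodeError μ (G i) t ω) t t' ∂μ
        ≤ g * (g * (5 * D)) := by
  have hu := hd.measurable_u
  have hv : ∀ i t, Measurable (R.nodeError μ (G i) t) := fun i t => hd.measurable_nodeError _ _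
  have hk : t + (t' - t) = t' := by ring
  have key : ∀ i l : Fin g,
      Integrable (fun ω => (R.nodeError μ (G i) t ω * R.u t' ω * R.nodeError μ (G l) t' ω) ^ 2
        + (R.u t ω * R.nodeError μ (G i) t ω * R.nodeError μ (G l) t' ω) ^ 2
        + (R.u t ω * R.u t' ω * R.nodeError μ (G l) t' ω) ^ 2
        + (R.u t ω * R.nodeError μ (G i) t ω * R.u t' ω) ^ 2
        + |R.u t ω * R.u t' ω * R.nodeError μ (G i) t ω * R.nodeError μ (G l) t' ω|) μ ∧
      ∫ ω, ((R.nodeError μ (G i) t ω * R.u t' ω * R.nodeError μ (G l) t' ω) ^ 2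
        + (R.u t ω * R.nodeError μ (G i) t ω * R.nodeError μ (G l) t' ω) ^ 2
        + (R.u t ω * R.u t' ω * R.nodeError μ (G l) t' ω) ^ 2
        + (R.u t ω * R.nodeError μ (G i) t ω * R.u t' ω) ^ 2
        + |R.u t ω * R.u t' ω * R.nodeError μ (G i) t ω * R.nodeError μ (G l) t' ω|) ∂μ ≤ 5 * D := by
    intro i l
    have h1 := h.vuv_sq t (t' - t) i l
    have h2 := h.uvv_sq t (t' - t) i l
    have h3 := h.uuv_sq t (t' - t) l
    have h4 := h.uvu_sq t (t' - t) i
    have h5 := h.uuvv t (t' - t) i l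
    rw [hk] at h1 h2 h3 h4 h5
    obtain ⟨i1, b1⟩ := integral_sq_le_of_lintegral (((hv i t).mul (hu t')).mul (hv l t')) hD h1
    obtain ⟨i2, b2⟩ := integral_sq_le_of_lintegral (((hu t).mul (hv i t)).mul (hv l t')) hD h2
    obtain ⟨i3, b3⟩ := integral_sq_le_of_lintegral (((hu t).mul (hu t')).mul (hv l t')) hD h3
    obtain ⟨i4, b4⟩ := integral_sq_le_of_lintegral (((hu t).mul (hv i t)).mul (hu t')) hD h4
    obtain ⟨i5, b5⟩ := integral_abs_le_of_lintegral
      ((((hu t).mul (hu t')).mul (hv i t)).mul (hv l t')) hD h5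
    simp only [Pi.mul_apply] at i1 b1 i2 b2 i3 b3 i4 b4 i5 b5
    have add : ∀ {f h : Ω → ℝ} {a b : ℝ}, (Integrable f μ ∧ ∫ ω, f ω ∂μ ≤ a) →
        (Integrable h μ ∧ ∫ ω, h ω ∂μ ≤ b) →
        Integrable (fun ω => f ω + h ω) μ ∧ ∫ ω, (f ω + h ω) ∂μ ≤ a + b := fun hf hh =>
      ⟨hf.1.add hh.1, by rw [integral_add hf.1 hh.1]; exact add_le_add hf.2 hh.2⟩
    have := add (add (add (add ⟨i1, b1⟩ ⟨i2, b2⟩) ⟨i3, b3⟩) ⟨i4, b4⟩) ⟨i5, b5⟩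
    exact ⟨this.1, this.2.trans (by linarith)⟩
  simp only [momentSum]
  refine ⟨integrable_finsetSum _ fun i _ => integrable_finsetSum _ fun l _ => (key i l).1, ?_⟩
  rw [integral_finsetSum _ fun i _ => integrable_finsetSum _ fun l _ => (key i l).1]
  have h1 : ∀ i : Fin g, ∫ ω, (∑ l, ((R.nodeError μ (G i) t ω * R.u t' ω * R.nodeError μ (G l) t' ω) ^ 2
        + (R.u t ω * R.nodeError μ (G i) t ω * R.nodeError μ (G l) t' ω) ^ 2
        + (R.u t ω * R.u t' ω * R.nodeError μ (G l) t' ω) ^ 2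
        + (R.u t ω * R.nodeError μ (G i) t ω * R.u t' ω) ^ 2
        + |R.u t ω * R.u t' ω * R.nodeError μ (G i) t ω * R.nodeError μ (G l) t' ω|)) ∂μ
        ≤ g * (5 * D) := by
    intro i
    rw [integral_finsetSum _ fun l _ => (key i l).1]
    refine (Finset.sum_le_sum fun l _ => (key i l).2).trans ?_
    rw [Finset.sum_const, nsmul_eq_mul, Finset.card_univ, Fintype.card_fin]
  refine (Finset.sum_le_sum fun i _ => h1 i).trans ?_
  rw [Finset.sum_const, nsmul_eq_mul, Finset.card_univ, Fintype.card_fin]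

end MomentSums

section TightSums

variable {Ω : ℕ → Type*} [∀ T, MeasurableSpace (Ω T)] {P : ∀ T, Measure (Ω T)}
  [∀ T, IsProbabilityMeasure (P T)] {ι : ℕ → Type} [∀ T, Fintype (ι T)] [∀ T, DecidableEq (ι T)]
  {g : ℕ} {R : ∀ T, LinReg (Ω T) (ι T)} {G : ∀ T, Fin g ↪ ι T} {q r a b c B Q D S : ℝ}
  {K : ℝ → ℝ} {M : ℕ → ℝ}

/-- Markov's inequality for the whole weighted sum, so no uniformity over lags is needed; the total
weight of the kernel is O(M). -/
lemma TightEvents.kernel_sum (hS : 0 ≤ S) (hM : ∀ᶠ T in atTop, 1 ≤ M T)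
    (hK : ∀ M : ℝ, 1 ≤ M → ∀ F : Finset ℤ, ∑ k ∈ F, |K ((k : ℝ) / M)| ≤ S * M)
    {Y : ∀ T, ℤ → Ω T → ℝ} {ρ : ℕ → ℝ} (hρ : ∀ᶠ T in atTop, 0 < ρ T)
    (hY0 : ∀ T k ω, 0 ≤ Y T k ω)
    (hY : ∀ T : ℕ, ∀ k ∈ Finset.Ioo (-(T : ℤ)) T, Integrable (Y T k) (P T) ∧
      ∫ ω, Y T k ω ∂(P T) ≤ ρ T) :
    TightEvents P fun C T => {ω | ∑ k ∈ Finset.Ioo (-(T : ℤ)) T, |K ((k : ℝ) / M T)| * Y T k ω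
      ≤ C * (M T * ρ T)} := by
  refine TightEvents.of_integral (D := S) ?_
    (fun T ω => Finset.sum_nonneg fun k _ => mul_nonneg (abs_nonneg _) (hY0 _ _ _))
    (fun T => integrable_finsetSum _ fun k hk => (hY T k hk).1.const_mul _) ?_
  · filter_upwards [hM, hρ] with T h1 h2
    have : 0 < M T := by linarith
    positivity
  · filter_upwards [hM, hρ] with T h1 h2
    rw [integral_finsetSum _ fun k hk => (hY T k hk).1.const_mul _]
    calc ∑ k ∈ Finset.Ioo (-(T : ℤ)) T, ∫ ω, |K ((k : ℝ) / M T)| * Y T k ω ∂(P T)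
        ≤ ∑ k ∈ Finset.Ioo (-(T : ℤ)) T, |K ((k : ℝ) / M T)| * ρ T := by
          refine Finset.sum_le_sum fun k hk => ?_
          rw [integral_const_mul]
          exact mul_le_mul_of_nonneg_left (hY T k hk).2 (abs_nonneg _)
      _ ≤ S * M T * ρ T := by
          rw [← Finset.sum_mul]
          exact mul_le_mul_of_nonneg_right (hK _ h1 _) h2.le
      _ = _ := by ring

lemma tight_momentSum (hS : 0 ≤ S) (hM : ∀ᶠ T in atTop, 1 ≤ M T)
    (hK : ∀ M : ℝ, 1 ≤ M → ∀ F : Finset ℤ, ∑ k ∈ F, |K ((k : ℝ) / M)| ≤ S * M)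
    (hd : ∀ T, (R T).DataCond (P T) q r a b c B) (hD : 0 ≤ D)
    (h : ∀ T, MomentCond (R T) (P T) (G T) Q D) :
    TightEvents P fun C T => {ω | ∑ k ∈ Finset.Ioo (-(T : ℤ)) T, |K ((k : ℝ) / M T)| *
      lagMean T k.natAbs (momentSum (fun t => (R T).u t ω)
        (fun i t => (R T).nodeError (P T) (G T i) t ω)) ≤ C * M T} := by
  have h1 := TightEvents.kernel_sum (P := P) (K := K) (M := M) (ρ := fun _ => g * (g * (5 * D)) + 1)
    (Y := fun T k ω => lagMean T k.natAbs (momentSum (fun t => (R T).u t ω)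
        (fun i t => (R T).nodeError (P T) (G T i) t ω))) hS hM hK
    (Eventually.of_forall fun _ => by positivity)
    (fun T k ω => mul_nonneg (by positivity)
      (Finset.sum_nonneg fun t _ => momentSum_nonneg _ _ _ _))
    (fun T k _ => by
      have := integral_lagMean_le (μ := P T) (T := T) (k := k.natAbs) (D := g * (g * (5 * D)) + 1)
        (F := fun ω => momentSum (fun t => (R T).u t ω)
          (fun i t => (R T).nodeError (P T) (G T i) t ω)) (by positivity)
        (fun t t' => ((h T).integral_momentSum_le hD (hd T) t t').1)
        (fun t t' => ((h T).integral_momentSum_le hD (hd T) t t').2.trans (by linarith))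
      exact this)
  refine h1.mono_const fun C hC => ⟨C * (g * (g * (5 * D)) + 1), fun C' hC' => ?_⟩
  filter_upwards [hM] with T hT ω hω
  have hω' : _ ≤ C * (M T * (g * (g * (5 * D)) + 1)) := hω
  refine hω'.trans ?_
  calc _ = C * (g * (g * (5 * D)) + 1) * M T := by ring
    _ ≤ C' * M T := mul_le_mul_of_nonneg_right hC' (by linarith)

/-- For negative lags the roles of i and l are exchanged, and stationarity identifies the expected
products at lags k and -k. -/
lemma tight_autocov {V : ∀ T, ℤ → Ω T → Fin g → ℝ} {ς D₁ D₂ : ℝ} (hS : 0 ≤ S)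
    (hM : ∀ᶠ T in atTop, 1 ≤ M T)
    (hK : ∀ M : ℝ, 1 ≤ M → ∀ F : Finset ℤ, ∑ k ∈ F, |K ((k : ℝ) / M)| ≤ S * M)
    (hD : 0 < D₂) (h : ∀ T, AutocovCond (P T) (V T) ς D₁ D₂) (i l : Fin g) :
    TightEvents P fun C T => {ω | ∑ k ∈ Finset.Ioo (-(T : ℤ)) T, |K ((k : ℝ) / M T)| *
      |(if 0 ≤ k then lagMean T k.natAbs (fun t t' => V T t ω i * V T t' ω l)
          else lagMean T k.natAbs (fun t t' => V T t ω l * V T t' ω i))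
        - (1 - |(k : ℝ)| / T) * ∫ ω', V T 0 ω' i * V T k ω' l ∂(P T)| ≤ C * (M T * √(D₂ / T))} := by
  refine TightEvents.kernel_sum hS hM hK ?_ (fun _ _ _ => abs_nonneg _) fun T k hk => ?_
  · filter_upwards [eventually_ge_atTop 1] with T hT
    have : (0 : ℝ) < T := by exact_mod_cast hT
    exact Real.sqrt_pos.2 (by positivity)
  · rw [Finset.mem_Ioo] at hk
    have hlt : k.natAbs < T := by omega
    have habs : |(k : ℝ)| = (k.natAbs : ℝ) := by
      rw [← Int.cast_abs, Int.abs_eq_natAbs]; rfl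
    rw [habs]
    split_ifs with h0
    · have := (h T).integral_abs_lagMean_sub_le hD.le hlt i l
      rwa [Int.natAbs_of_nonneg h0] at this
    · have := (h T).integral_abs_lagMean_sub_le hD.le hlt l i
      have h2 := (h T).stationary.integral_mul 0 (-k) k l i
      have h3 : ((k.natAbs : ℕ) : ℤ) = -k := by omega
      rw [h3, ← h2] at this
      simp only [zero_add, neg_add_cancel] at this
      simpa only [mul_comm (V T k _ l)] using this

/-- The variances of the normalized partial sums of v_t² are bounded, so the mean of v_t² deviates
from its expectation by O_P(T^{-1/2}). -/
lemma tight_empNormSq_sub {v : ∀ T, ℤ → Ω T → ℝ} {σ : ℕ → ℝ}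
    (h : ∀ T, HasLongRunVariance (P T) (fun t ω => v T t ω ^ 2) D)
    (hσ : ∀ T t, ∫ ω, v T t ω ^ 2 ∂(P T) = σ T) :
    TightEvents P fun C T => {ω | |empNormSq T (fun t => v T t ω) - σ T| ≤ C * (√(T : ℝ))⁻¹} := by
  have hmem : ∀ T : ℕ, MemLp (fun ω => (√(T : ℝ))⁻¹ * ∑ t ∈ Finset.Icc (1 : ℤ) T, v T t ω ^ 2) 2 (P T) :=
    fun T => (memLp_finsetSum _ fun t _ => (h T).1 t).const_mul _
  have heq : ∀ T ω, empNormSq T (fun t => v T t ω)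
      = (√(T : ℝ))⁻¹ * ((√(T : ℝ))⁻¹ * ∑ t ∈ Finset.Icc (1 : ℤ) T, v T t ω ^ 2) := by
    intro T ω
    rw [empNormSq, ← mul_assoc, ← mul_inv, Real.mul_self_sqrt (by positivity)]
  have hE : ∀ T : ℕ, 1 ≤ T → ∫ ω, empNormSq T (fun t => v T t ω) ∂(P T) = σ T := by
    intro T hT
    have hT0 : (0 : ℝ) < T := by exact_mod_cast hT
    simp only [empNormSq]
    rw [integral_const_mul, integral_finsetSum _ fun t _ => ((h T).1 t).integrable one_le_two]
    simp only [hσ]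
    rw [Finset.sum_const, nsmul_eq_mul, Int.card_Icc, add_sub_cancel_right, Int.toNat_natCast,
      inv_mul_cancel_left₀ hT0.ne']
  refine TightEvents.of_integral (D := √D) ?_ (fun _ _ => abs_nonneg _) (fun T => ?_) ?_
  · filter_upwards [eventually_ge_atTop 1] with T hT
    have : (0 : ℝ) < T := by exact_mod_cast hT
    positivity
  · refine Integrable.abs (Integrable.sub ?_ (integrable_const _))
    simp only [heq]
    exact ((hmem T).const_mul _).integrable one_le_two
  · filter_upwards [eventually_ge_atTop 1] with T hT
    set X := fun ω => (√(T : ℝ))⁻¹ * ∑ t ∈ Finset.Icc (1 : ℤ) T, v T t ω ^ 2 with hX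
    have h1 : ∀ ω, |empNormSq T (fun t => v T t ω) - σ T|
        = (√(T : ℝ))⁻¹ * |X ω - ∫ ω', X ω' ∂(P T)| := by
      intro ω
      rw [← hE T hT]
      simp only [heq]
      rw [integral_const_mul, ← mul_sub, abs_mul, abs_of_nonneg (by positivity : 0 ≤ (√(T : ℝ))⁻¹)]
    simp only [h1]
    rw [integral_const_mul, mul_comm]
    refine mul_le_mul_of_nonneg_right ?_ (by positivity)
    exact (integral_abs_sub_integral_le_sqrt_variance (hmem T)).trans
      (Real.sqrt_le_sqrt ((h T).2.2 T))

end TightSums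

/-! ### Entries of the estimator in terms of residuals. -/

section Entries

variable {Ω : Type*} [MeasurableSpace Ω] {ι : Type*} [Fintype ι] [DecidableEq ι] {g : ℕ}
  {R : LinReg Ω ι} {μ : Measure Ω} {G : Fin g ↪ ι}

/-- A row of Θ̂_G applied to x_t is the nodewise residual divided by σ̂², so each entry becomes a
weighted sum of lagged means of products of four residuals. -/
lemma hacResiduals_apply (K : ℝ → ℝ) (M : ℝ) (T : ℕ) (R : LinReg Ω ι) (G : Fin g ↪ ι)
    (lam : Fin g → ℝ) (β : ι → ℝ) (γ : ∀ i, {k : ι // k ≠ G i} → ℝ) (ω : Ω) (i l : Fin g) :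
    hacResiduals K M T R G lam β γ ω i l = ∑ k ∈ Finset.Ioo (-(T : ℤ)) T, K ((k : ℝ) / M) *
      ((nodeVarEst T (fun t => R.x t ω) (G i) (lam i) (γ i))⁻¹ *
        (nodeVarEst T (fun t => R.x t ω) (G l) (lam l) (γ l))⁻¹ *
        signedLagMean T (fun t => R.y t ω - R.x t ω ⬝ᵥ β)
          (fun i t => R.x t ω (G i) - (fun k : {k : ι // k ≠ G i} => R.x t ω k.1) ⬝ᵥ γ i) k i l) := by
  have key : ∀ (n : ℕ) (i l : Fin g), autocovEst T (fun t => R.x t ω)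
      (fun t => R.y t ω - R.x t ω ⬝ᵥ β) (precisionRowsEst T (fun t => R.x t ω) G lam γ) n i l
      = (nodeVarEst T (fun t => R.x t ω) (G i) (lam i) (γ i))⁻¹ *
        (nodeVarEst T (fun t => R.x t ω) (G l) (lam l) (γ l))⁻¹ *
        lagMean T n (crossProd (fun t => R.y t ω - R.x t ω ⬝ᵥ β)
          (fun i t => R.x t ω (G i) - (fun k : {k : ι // k ≠ G i} => R.x t ω k.1) ⬝ᵥ γ i) i l) := by
    intro n i l
    rw [autocovEst_apply, lagMean, mul_left_comm]
    congr 1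
    rw [Finset.mul_sum]
    refine Finset.sum_congr rfl fun t _ => ?_
    rw [sum_mul_precisionRowsEst, sum_mul_precisionRowsEst, crossProd]
    ring
  rw [hacResiduals, hacEst, Matrix.sum_apply]
  refine Finset.sum_congr rfl fun k _ => ?_
  rw [Matrix.smul_apply, smul_eq_mul, signedLagMean]
  split_ifs with h
  · rw [key]
  · rw [Matrix.transpose_apply, key]
    ring

lemma lagMean_scoreProcess (R : LinReg Ω ι) (μ : Measure Ω) (G : Fin g ↪ ι) (T n : ℕ) (ω : Ω)
    (i l : Fin g) : lagMean T n (fun t t' => scoreProcess R μ G t ω i * scoreProcess R μ G t' ω l)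
      = (R.nodeVar μ (G i))⁻¹ * (R.nodeVar μ (G l))⁻¹ * lagMean T n
        (crossProd (fun t => R.u t ω) (fun i t => R.nodeError μ (G i) t ω) i l) := by
  rw [← lagMean_const_mul]
  congr 1
  ext t t'
  simp only [scoreProcess, crossProd, div_eq_mul_inv]
  ring

lemma signedLagMean_scoreProcess (R : LinReg Ω ι) (μ : Measure Ω) (G : Fin g ↪ ι) (T : ℕ) (k : ℤ)
    (ω : Ω) (i l : Fin g) :
    (if 0 ≤ k then lagMean T k.natAbs
        (fun t t' => scoreProcess R μ G t ω i * scoreProcess R μ G t' ω l)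
      else lagMean T k.natAbs (fun t t' => scoreProcess R μ G t ω l * scoreProcess R μ G t' ω i))
      = (R.nodeVar μ (G i))⁻¹ * (R.nodeVar μ (G l))⁻¹ * signedLagMean T (fun t => R.u t ω)
        (fun i t => R.nodeError μ (G i) t ω) k i l := by
  rw [signedLagMean]
  split_ifs
  · rw [lagMean_scoreProcess]
  · rw [lagMean_scoreProcess]
    ring

lemma abs_empNormSq_add_sub_le (T : ℕ) (v b : ℤ → ℝ) (σ : ℝ) :
    |empNormSq T (fun t => v t + b t) - σ|
      ≤ |empNormSq T v - σ| + 2 * (√(empNormSq T v) * √(empNormSq T b)) + empNormSq T b := by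
  rw [empNormSq_add]
  have h1 := abs_inner_le_sqrt_empNormSq T v b
  have h2 := empNormSq_nonneg T b
  rw [abs_le] at h1 ⊢
  have h3 := le_abs_self (empNormSq T v - σ)
  have h4 := neg_abs_le (empNormSq T v - σ)
  constructor <;> linarith [h1.1, h1.2]

lemma sq_le_mul_empNormSq {T : ℕ} (z : ℤ → ℝ) {t : ℤ} (ht : t ∈ Finset.Icc (1 : ℤ) T) :
    z t ^ 2 ≤ T * empNormSq T z := by
  have hT : (T : ℝ) ≠ 0 := by
    rw [Finset.mem_Icc] at ht
    exact_mod_cast (by omega : T ≠ 0)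
  rw [empNormSq, mul_inv_cancel_left₀ hT]
  exact Finset.single_le_sum (f := fun t => z t ^ 2) (fun _ _ => sq_nonneg _) ht

lemma abs_dotProduct_le {κ : Type*} [Fintype κ] {x d : κ → ℝ} {m : ℝ} (hx : ∀ k, |x k| ≤ m) :
    |x ⬝ᵥ d| ≤ m * ∑ k, |d k| := by
  rw [dotProduct, Finset.mul_sum]
  refine (Finset.abs_sum_le_sum_abs _ _).trans (Finset.sum_le_sum fun k _ => ?_)
  rw [abs_mul]
  exact mul_le_mul_of_nonneg_right (hx k) (abs_nonneg _)

lemma sq_le_of_rpow_le {x A r : ℝ} (hx : 0 ≤ x) (hr : 0 < r) (h : x ^ r ≤ A) :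
    x ^ 2 ≤ A ^ (2 / r) := by
  have h1 := Real.rpow_le_rpow (by positivity) h (by positivity : 0 ≤ 2 / r)
  rw [← Real.rpow_mul hx, mul_div_cancel₀ _ hr.ne', Real.rpow_two] at h1
  exact h1

end Entries

section Moments

variable {Ω : Type*} [MeasurableSpace Ω] {μ : Measure Ω} [IsProbabilityMeasure μ]

lemma lintegral_rpow_le_of_eLpNorm_le {X : Ω → ℝ} {ν C : ℝ} (hν : 0 < ν) (hC : 0 ≤ C)
    (hX : Measurable X) (h : eLpNorm X (ENNReal.ofReal ν) μ ≤ ENNReal.ofReal C) :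
    ∫⁻ ω, ‖X ω‖ₑ ^ ν ∂μ ≤ ENNReal.ofReal (C ^ ν) := by
  obtain ⟨hi, hle⟩ := integral_abs_rpow_le hν hC hX h
  have h1 : ∀ ω, ‖X ω‖ₑ ^ ν = ENNReal.ofReal (|X ω| ^ ν) := fun ω => by
    rw [Real.enorm_eq_ofReal_abs, ENNReal.ofReal_rpow_of_nonneg (abs_nonneg _) hν.le]
  simp only [h1]
  rw [← ofReal_integral_eq_lintegral_ofReal hi (Eventually.of_forall fun _ => by positivity)]
  exact ENNReal.ofReal_le_ofReal hle

lemma integral_sq_le_one_add {X : Ω → ℝ} {Q D : ℝ} (hQ : 1 ≤ Q) (hD : 0 ≤ D)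
    (h : ∫⁻ ω, ‖X ω‖ₑ ^ (2 * Q) ∂μ ≤ ENNReal.ofReal D) : ∫ ω, X ω ^ 2 ∂μ ≤ 1 + D := by
  have h1 : ENNReal.ofReal (∫ ω, X ω ^ 2 ∂μ) ≤ ENNReal.ofReal (1 + D) := by
    calc ENNReal.ofReal (∫ ω, X ω ^ 2 ∂μ) ≤ ‖∫ ω, X ω ^ 2 ∂μ‖ₑ := by
          rw [Real.enorm_eq_ofReal_abs]; exact ENNReal.ofReal_le_ofReal (le_abs_self _)
      _ ≤ ∫⁻ ω, ‖X ω ^ 2‖ₑ ∂μ := enorm_integral_le_lintegral_enorm _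
      _ ≤ ∫⁻ ω, (1 + ‖X ω‖ₑ ^ (2 * Q)) ∂μ := by
        refine lintegral_mono fun ω => ?_
        simp only [enorm_pow]
        rw [← ENNReal.rpow_natCast]
        rcases le_total ‖X ω‖ₑ 1 with hx | hx
        · exact (ENNReal.rpow_le_one hx (by positivity)).trans le_self_add
        · refine (ENNReal.rpow_le_rpow_of_exponent_le hx ?_).trans le_add_self
          push_cast
          linarith
      _ = 1 + ∫⁻ ω, ‖X ω‖ₑ ^ (2 * Q) ∂μ := by
        rw [lintegral_add_left measurable_const]; simp
      _ ≤ ENNReal.ofReal (1 + D) := by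
        rw [ENNReal.ofReal_add zero_le_one hD, ENNReal.ofReal_one]
        gcongr
  exact (ENNReal.ofReal_le_ofReal_iff (by positivity)).1 h1

end Moments

/-! ### Estimation errors of the LASSO residuals. -/

section TightResiduals

variable {Ω : ℕ → Type*} [∀ T, MeasurableSpace (Ω T)] {P : ∀ T, Measure (Ω T)}

lemma TightEvents.of_tendsto {F : ∀ T, Set (Ω T)} (h : Tendsto (fun T => P T (F T)ᶜ) atTop (𝓝 0)) :
    TightEvents P fun _ T => F T := by
  intro ε hε
  refine ⟨1, one_pos, fun C _ => ?_⟩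
  have : (0 : ℝ≥0∞) < ENNReal.ofReal ε := by simpa using hε
  filter_upwards [h.eventually (gt_mem_nhds this)] with T hT using hT.le

variable {ι : ℕ → Type} [∀ T, Fintype (ι T)] [∀ T, DecidableEq (ι T)] {R : ∀ T, LinReg (Ω T) (ι T)}
  {s' s : ℕ → ℝ} {p : ℕ → ℕ} {βhat : ∀ T, Ω T → ι T → ℝ}

/-- The residual minus the true error is the approximation error minus the fitted difference. The
former is o_P(T^{-1/2}), hence at most of the order of √s L. -/
lemma tight_residual (hp : ∀ T, 2 ≤ p T) (hs1 : ∀ T, 1 ≤ s T) (hs : ∀ T, s' T ≤ s T)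
    (hl : TightEvents P (lassoEvent R s' (fun T => √(Real.log (p T) / T)) βhat))
    (he : IsLittleOP P (fun T ω => √(empNormSq T fun t => (R T).approxError t ω))
      (fun T => (T : ℝ) ^ (-(1 / 2) : ℝ))) :
    TightEvents P fun C T => {ω | empNormSq T
      (fun t => (R T).y t ω - (R T).x t ω ⬝ᵥ βhat T ω - (R T).u t ω)
        ≤ C * (s T * √(Real.log (p T) / T) ^ 2)} := by
  have h1 : TightEvents P fun (_ : ℝ) T => {ω | √(empNormSq T fun t => (R T).approxError t ω)
      ≤ (T : ℝ) ^ (-(1 / 2) : ℝ)} := by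
    refine TightEvents.of_tendsto ?_
    have h2 := he 1 one_pos
    refine h2.congr fun T => ?_
    congr 1
    ext ω
    simp [abs_of_nonneg (Real.sqrt_nonneg _)]
  set c₂ := (√(Real.log 2))⁻¹ with hc₂
  refine (hl.inter h1).mono_const fun C hC => ⟨2 * c₂ ^ 2 + 2 * (C + 4 * c₂) ^ 2, fun D hD => ?_⟩
  refine Eventually.of_forall fun T ω ⟨hω1, hω2⟩ => ?_
  have hc₂0 : 0 ≤ c₂ := by positivity
  set L := √(Real.log (p T) / T) with hL
  have hL0 : 0 ≤ L := Real.sqrt_nonneg _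
  have hsT := hs1 T
  have hs0 : 0 ≤ s T := by linarith
  have hsq : √(s T) ^ 2 = s T := Real.sq_sqrt hs0
  have hsq1 : 1 ≤ √(s T) := Real.one_le_sqrt.2 hsT
  have hss : √(s' T) ≤ √(s T) := Real.sqrt_le_sqrt (hs T)
  have he1 : √(empNormSq T fun t => (R T).approxError t ω) ≤ c₂ * (√(s T) * L) := by
    have h3 : (T : ℝ) ^ (-(1 / 2) : ℝ) = (√(T : ℝ))⁻¹ := by
      rw [Real.rpow_neg (by positivity), Real.sqrt_eq_rpow]
    have h4 : √(empNormSq T fun t => (R T).approxError t ω) ≤ (T : ℝ) ^ (-(1 / 2) : ℝ) := hω2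
    rw [h3] at h4
    refine h4.trans ((inv_sqrt_le_sqrt_log_div (hp T)).trans ?_)
    gcongr
    exact le_mul_of_one_le_left hL0 hsq1
  have hx1 : √(empNormSq T fun t => (R T).x t ω ⬝ᵥ (βhat T ω - (R T).β))
      ≤ (C + 4 * c₂) * (√(s T) * L) := by
    refine hω1.1.trans ?_
    have : C * (√(s' T) * L) ≤ C * (√(s T) * L) := by gcongr
    linarith
  have hsq' : ∀ z : ℤ → ℝ, ∀ A, √(empNormSq T z) ≤ A * (√(s T) * L) → empNormSq T z ≤ A ^ 2 * (s T * L ^ 2) := by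
    intro z A h
    have := pow_le_pow_left₀ (Real.sqrt_nonneg _) h 2
    rwa [Real.sq_sqrt (empNormSq_nonneg _ _), mul_pow, mul_pow, hsq] at this
  have hz : (fun t => (R T).y t ω - (R T).x t ω ⬝ᵥ βhat T ω - (R T).u t ω)
      = fun t => (R T).approxError t ω + -((R T).x t ω ⬝ᵥ (βhat T ω - (R T).β)) := by
    ext t
    rw [(R T).y_eq, dotProduct_sub]
    ring
  show empNormSq T (fun t => (R T).y t ω - (R T).x t ω ⬝ᵥ βhat T ω - (R T).u t ω) ≤ D * (s T * L ^ 2)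
  rw [hz]
  refine (empNormSq_add_le _ _ _).trans ?_
  rw [empNormSq_neg]
  have e1 := hsq' _ _ he1
  have e2 := hsq' _ _ hx1
  calc _ ≤ (2 * c₂ ^ 2 + 2 * (C + 4 * c₂) ^ 2) * (s T * L ^ 2) := by linarith
    _ ≤ _ := by gcongr

/-- Vanishing approximation error, as in the nodewise regressions, makes the ℓ₁ part of `lassoEvent`
available. -/
lemma tight_coef (hs0 : ∀ T, 0 ≤ s' T) (hs : ∀ T, s' T ≤ s T)
    (hl : TightEvents P (lassoEvent R s' (fun T => √(Real.log (p T) / T)) βhat))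
    (he : ∀ T t ω, (R T).approxError t ω = 0) :
    TightEvents P fun C T => {ω | empNormSq T (fun t => (R T).x t ω ⬝ᵥ (βhat T ω - (R T).β))
        ≤ C ^ 2 * (s T * √(Real.log (p T) / T) ^ 2) ∧
      ∑ j, |(βhat T ω - (R T).β) j| ≤ C * (s T * √(Real.log (p T) / T))} := by
  refine hl.mono_const fun C hC => ⟨C, fun D hD => Eventually.of_forall fun T ω hω => ?_⟩
  have hz : √(empNormSq T fun t => (R T).approxError t ω) = 0 := by simp [he, empNormSq]
  obtain ⟨h1, h2⟩ := hω
  rw [hz, mul_zero, add_zero] at h1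
  have hD0 : 0 ≤ D := hC.le.trans hD
  set L := √(Real.log (p T) / T) with hL
  have hL0 : 0 ≤ L := Real.sqrt_nonneg _
  refine ⟨?_, (h2 hz).trans ?_⟩
  · have := pow_le_pow_left₀ (Real.sqrt_nonneg _) h1 2
    rw [Real.sq_sqrt (empNormSq_nonneg _ _), mul_pow, mul_pow, Real.sq_sqrt (hs0 T)] at this
    refine this.trans ?_
    have := hs T
    have := hs0 T
    gcongr
  · have := hs T
    have := hs0 T
    gcongr

end TightResiduals

/-- Only the second entry of the maximum is kept; the remaining terms in the bracket are
nonnegative. -/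
lemma le_hacRate {κ ς s M : ℝ} {p T : ℕ} (hs : 0 ≤ s) (hM : 0 ≤ M) :
    M * (s * √(Real.log p / T)) + M ^ (-ς) + (T : ℝ) ^ (-(min ς 1)) ≤ hacRate κ ς s M p T := by
  rw [hacRate]
  gcongr
  rw [add_assoc]
  refine le_add_of_le_of_nonneg (le_max_right _ _) (by positivity)

lemma exists_abs_tuning_le {q r a C₀ : ℝ} {p : ℕ → ℕ} {lam : ℕ → ℝ} (hp : ∀ T, 2 ≤ p T)
    (hκ : 0 < kappa q r a) (hC₀ : 0 ≤ C₀)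
    (h6 : Tendsto (fun T : ℕ => (p T : ℝ) /
      √((T : ℝ) ^ (kappa q r a - 2) * Real.log (p T) ^ kappa q r a)) atTop (𝓝 0))
    (h : ∃ δ : ℝ, 0 < δ ∧ δ < 1 ∧ ∃ C₁ : ℝ, ∀ᶠ T in atTop,
      C₀ * tuningRate (kappa q r a) δ (p T) T ≤ lam T ∧
        lam T ≤ C₁ * tuningRate (kappa q r a) δ (p T) T) :
    ∃ c : ℝ, 0 ≤ c ∧ ∀ᶠ T in atTop, |lam T| ≤ c * √(Real.log (p T) / T) := by
  obtain ⟨δ, hδ, hδ1, C₁, h⟩ := h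
  refine ⟨|C₁| * (1 + √(1 + Real.log (8 / δ) / Real.log 2)), by positivity, ?_⟩
  filter_upwards [h, eventually_tuningRate_le hp hκ hδ hδ1 h6] with T h1 h2
  have h0 := tuningRate_nonneg (kappa q r a) δ (p T) T
  rw [abs_of_nonneg ((mul_nonneg hC₀ h0).trans h1.1), mul_assoc]
  calc lam T ≤ C₁ * tuningRate (kappa q r a) δ (p T) T := h1.2
    _ ≤ |C₁| * tuningRate (kappa q r a) δ (p T) T := by gcongr; exact le_abs_self _
    _ ≤ _ := by gcongr

/-! ### Comparison of the sparsities and transfer of the dimension condition. -/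

section Main

variable {Ω : ℕ → Type*} [∀ T, MeasurableSpace (Ω T)] {P : ∀ T, Measure (Ω T)}
  [∀ T, IsProbabilityMeasure (P T)] {p : ℕ → ℕ} {R : ∀ T, LinReg (Ω T) (Fin (p T))}
  {α : ℝ} {𝒢 : ∀ T, Finpartition (Finset.univ : Finset (Fin (p T)))}
  {g : ℕ} {G : ∀ T, Fin g ↪ Fin (p T)} {lam : ℕ → ℝ} {lamNode : Fin g → ℕ → ℝ}
  {βhat : ∀ T, Ω T → Fin (p T) → ℝ}
  {γhat : ∀ T, Ω T → ∀ i : Fin g, {k : Fin (p T) // k ≠ G T i} → ℝ}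
  {K : ℝ → ℝ} {ς : ℝ} {M : ℕ → ℝ} {Q q r a b c B C₀ : ℝ}

lemma summable_autocov (hr : 4 < r) (hq : 2 * r / (r - 2) < q)
    (hR : RegressionCond P R α 𝒢 p lam q r a b c B C₀) (hς : 0 < ς) {D₁ D₂ : ℝ} (hD₁ : 0 < D₁)
    (hV : ∀ T, AutocovCond (P T) (scoreProcess (R T) (P T) (G T)) ς D₁ D₂) (T : ℕ) :
    Summable (autocov (R T) (P T) (G T)) := by
  obtain ⟨γ, hγ, hS⟩ := hR.covariance
  exact summable_matrix_of_apply fun i l => ((hV T).summable_apply hς hD₁.le i l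
    fun k => autocov_apply hr hq (hR.data T) hγ (hS T) k i l).1

variable (hr : 4 < r) (hR : RegressionCond P R α 𝒢 p lam q r a b c B C₀)

include hr hR in
-- A row of Θ has one more non-zero entry than γ_j. For non-empty G this makes s at least 1 and at
-- least each individual sparsity; conversely 1 + x ≤ 2(x ∨ 1) shows that one of the regressions
-- attains s up to a factor 2.
lemma sparsity_bounds (T : ℕ) :
    (∀ i, max (effSparsity 1 ⊥ ((R T).nodeCoef (P T) (G T i))) 1
      ≤ sparsity (R T) (P T) α (𝒢 T) (G T)) ∧
    (0 < g → max (effSparsity α (𝒢 T) (R T).β) 1 ≤ sparsity (R T) (P T) α (𝒢 T) (G T) ∧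
      (sparsity (R T) (P T) α (𝒢 T) (G T) ≤ 2 * max (effSparsity α (𝒢 T) (R T).β) 1 ∨
        ∃ i, sparsity (R T) (P T) α (𝒢 T) (G T)
          ≤ 2 * max (effSparsity 1 ⊥ ((R T).nodeCoef (P T) (G T i))) 1)) := by
  obtain ⟨γ, hγ, hS⟩ := hR.covariance
  have hrow : ∀ i, ((R T).rowSparsity (P T) (G T i) : ℝ)
      = 1 + effSparsity 1 ⊥ ((R T).nodeCoef (P T) (G T i)) := fun i =>
    LinReg.rowSparsity_eq hr (hR.data T) hγ (hS T) (G T i)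
  have heff : ∀ i, 0 ≤ effSparsity 1 ⊥ ((R T).nodeCoef (P T) (G T i)) := fun i => sq_nonneg _
  have hle : ∀ i, ((R T).rowSparsity (P T) (G T i) : ℝ) ≤ sparsity (R T) (P T) α (𝒢 T) (G T) := by
    intro i
    refine le_max_of_le_right ?_
    exact_mod_cast Finset.le_sup (f := fun i => (R T).rowSparsity (P T) (G T i)) (Finset.mem_univ i)
  refine ⟨fun i => max_le ?_ ?_, fun hg => ⟨max_le (le_max_left _ _) ?_, ?_⟩⟩
  · linarith [hle i, hrow i]
  · linarith [hle i, hrow i, heff i]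
  · linarith [hle ⟨0, hg⟩, hrow ⟨0, hg⟩, heff ⟨0, hg⟩]
  · have hne : (Finset.univ : Finset (Fin g)).Nonempty := ⟨⟨0, hg⟩, Finset.mem_univ _⟩
    obtain ⟨i, -, hi⟩ := Finset.exists_mem_eq_sup _ hne fun i => (R T).rowSparsity (P T) (G T i)
    rw [sparsity, hi, hrow]
    have h0 := le_max_left (effSparsity α (𝒢 T) (R T).β) 1
    have h1 := le_max_left (effSparsity 1 ⊥ ((R T).nodeCoef (P T) (G T i))) 1
    have h2 := le_max_right (effSparsity 1 ⊥ ((R T).nodeCoef (P T) (G T i))) 1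
    have h3 : 0 ≤ effSparsity α (𝒢 T) (R T).β := sq_nonneg _
    rcases le_total (effSparsity α (𝒢 T) (R T).β)
      (1 + effSparsity 1 ⊥ ((R T).nodeCoef (P T) (G T i))) with h | h
    · refine Or.inr ⟨i, ?_⟩
      rw [max_eq_right h]
      linarith
    · left
      rw [max_eq_left h]
      linarith

variable (hN : ∀ i : Fin g, RegressionCond P (fun T => (R T).nodewise (P T) (G T i)) 1
        (fun _ => ⊥) p (lamNode i) q r a b c B C₀)

include hr hR hN in
-- The dimension condition is assumed for each of finitely many regressions, and s is at most twice
-- the sparsity of one of them, which may change with T.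
lemma eventually_sparsity_rpow_le (hb : (r - 2) / (r - 4) < b) (hg : 0 < g) :
    ∀ᶠ T : ℕ in atTop, sparsity (R T) (P T) α (𝒢 T) (G T) ^ muExponent r b * (p T : ℝ) ^ 2 *
      (T : ℝ) ^ (1 - muExponent r b) ≤ 2 ^ muExponent r b := by
  have hμ := two_lt_muExponent hr hb
  have h2 : ∀ᶠ T : ℕ in atTop, ∀ i, max (effSparsity 1 ⊥ ((R T).nodeCoef (P T) (G T i))) 1
      ^ muExponent r b * (p T : ℝ) ^ 2 * (T : ℝ) ^ (1 - muExponent r b) ≤ 1 :=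
    eventually_all.2 fun i => (hN i).dim_rate.eventually (eventually_le_nhds one_pos)
  filter_upwards [hR.dim_rate.eventually (eventually_le_nhds one_pos), h2] with T h1 h2
  obtain ⟨-, hs⟩ := sparsity_bounds (G := G) hr hR T
  obtain ⟨hs1, hs2⟩ := hs hg
  have hs0 : 0 ≤ sparsity (R T) (P T) α (𝒢 T) (G T) :=
    zero_le_one.trans ((le_max_right _ _).trans hs1)
  have key : ∀ m : ℝ, 0 ≤ m → sparsity (R T) (P T) α (𝒢 T) (G T) ≤ 2 * m →
      m ^ muExponent r b * (p T : ℝ) ^ 2 * (T : ℝ) ^ (1 - muExponent r b) ≤ 1 →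
      sparsity (R T) (P T) α (𝒢 T) (G T) ^ muExponent r b * (p T : ℝ) ^ 2 *
      (T : ℝ) ^ (1 - muExponent r b) ≤ 2 ^ muExponent r b := by
    intro m hm h3 h4
    calc _ ≤ (2 * m) ^ muExponent r b * (p T : ℝ) ^ 2 * (T : ℝ) ^ (1 - muExponent r b) := by
          gcongr
      _ = 2 ^ muExponent r b * (m ^ muExponent r b * (p T : ℝ) ^ 2 *
          (T : ℝ) ^ (1 - muExponent r b)) := by
        rw [Real.mul_rpow (by norm_num) hm]; ring
      _ ≤ _ := mul_le_of_le_one_right (by positivity) h4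
  rcases hs2 with h | ⟨i, h⟩
  · exact key _ (by positivity) h h1
  · exact key _ (by positivity) h (h2 i)

end Main

/-! ### The event on which the error analysis is deterministic. -/

section Main

variable {Ω : ℕ → Type*} [∀ T, MeasurableSpace (Ω T)] {P : ∀ T, Measure (Ω T)}
  [∀ T, IsProbabilityMeasure (P T)] {p : ℕ → ℕ} {R : ∀ T, LinReg (Ω T) (Fin (p T))}
  {α : ℝ} {𝒢 : ∀ T, Finpartition (Finset.univ : Finset (Fin (p T)))}
  {g : ℕ} {G : ∀ T, Fin g ↪ Fin (p T)} {lam : ℕ → ℝ} {lamNode : Fin g → ℕ → ℝ}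
  {βhat : ∀ T, Ω T → Fin (p T) → ℝ}
  {γhat : ∀ T, Ω T → ∀ i : Fin g, {k : Fin (p T) // k ≠ G T i} → ℝ}
  {K : ℝ → ℝ} {ς : ℝ} {M : ℕ → ℝ} {Q q r a b c B C₀ : ℝ}

/-- The events on which the LASSO estimators attain their rates, and on which maxima, second
moments and weighted sums of autocovariances of the errors are of their typical size. -/
def hacEvent (P : ∀ T, Measure (Ω T)) (R : ∀ T, LinReg (Ω T) (Fin (p T)))
    (G : ∀ T, Fin g ↪ Fin (p T)) (βhat : ∀ T, Ω T → Fin (p T) → ℝ)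
    (γhat : ∀ T, Ω T → ∀ i : Fin g, {k : Fin (p T) // k ≠ G T i} → ℝ) (K : ℝ → ℝ) (M s : ℕ → ℝ)
    (Q r D₂ C : ℝ) (T : ℕ) : Set (Ω T) :=
  {ω | empNormSq T (fun t => (R T).y t ω - (R T).x t ω ⬝ᵥ βhat T ω - (R T).u t ω)
        ≤ C * (s T * √(Real.log (p T) / T) ^ 2)} ∩
  (⋂ i, {ω | empNormSq T (fun t => (fun k : {k // k ≠ G T i} => (R T).x t ω k.1) ⬝ᵥ
          (γhat T ω i - (R T).nodeCoef (P T) (G T i)))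
        ≤ C ^ 2 * (s T * √(Real.log (p T) / T) ^ 2) ∧
      ∑ j, |(γhat T ω i - (R T).nodeCoef (P T) (G T i)) j| ≤ C * (s T * √(Real.log (p T) / T))}) ∩
  (⋂ i, {ω | |empNormSq T (fun t => (R T).nodeError (P T) (G T i) t ω)
      - (R T).nodeVar (P T) (G T i)| ≤ C * (√(T : ℝ))⁻¹}) ∩
  {ω | ∑ k ∈ Finset.Ioo (-(T : ℤ)) T, |K ((k : ℝ) / M T)| *
      lagMean T k.natAbs (momentSum (fun t => (R T).u t ω)
        (fun i t => (R T).nodeError (P T) (G T i) t ω)) ≤ C * M T} ∩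
  (⋂ i, ⋂ l, {ω | ∑ k ∈ Finset.Ioo (-(T : ℤ)) T, |K ((k : ℝ) / M T)| *
      |(if 0 ≤ k then lagMean T k.natAbs
            (fun t t' => scoreProcess (R T) (P T) (G T) t ω i * scoreProcess (R T) (P T) (G T) t' ω l)
          else lagMean T k.natAbs
            (fun t t' => scoreProcess (R T) (P T) (G T) t ω l * scoreProcess (R T) (P T) (G T) t' ω i))
        - (1 - |(k : ℝ)| / T) * ∫ ω', scoreProcess (R T) (P T) (G T) 0 ω' i *
            scoreProcess (R T) (P T) (G T) k ω' l ∂(P T)| ≤ C * (M T * √(D₂ / T))}) ∩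
  {ω | ∀ t : {t // t ∈ Finset.Icc (1 : ℤ) T}, |(R T).u t ω| ^ (2 * Q) ≤ C * T} ∩
  (⋂ i, {ω | ∀ t : {t // t ∈ Finset.Icc (1 : ℤ) T},
    |(R T).nodeError (P T) (G T i) t ω| ^ (2 * Q) ≤ C * T}) ∩
  {ω | ∀ m : Fin (p T) × {t // t ∈ Finset.Icc (1 : ℤ) T}, |(R T).x m.2 ω m.1| ^ r ≤ C * (p T * T)}

lemma tight_hacEvent {D D₂ S : ℝ} {s s' : ℕ → ℝ} {s'' : Fin g → ℕ → ℝ} (hp : ∀ T, 2 ≤ p T) (hr : 4 < r)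
    (hQ : 0 < Q) (hD : 0 ≤ D) (hD₂ : 0 < D₂) (hS : 0 ≤ S)
    (hR : RegressionCond P R α 𝒢 p lam q r a b c B C₀)
    (hN : ∀ i : Fin g, RegressionCond P (fun T => (R T).nodewise (P T) (G T i)) 1
        (fun _ => ⊥) p (lamNode i) q r a b c B C₀)
    (hs1 : ∀ T, 1 ≤ s T) (hs' : ∀ T, s' T ≤ s T) (hs''0 : ∀ i T, 0 ≤ s'' i T)
    (hs'' : ∀ i T, s'' i T ≤ s T)
    (hl : TightEvents P (lassoEvent R s' (fun T => √(Real.log (p T) / T)) βhat))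
    (hlN : ∀ i, TightEvents P (lassoEvent (fun T => (R T).nodewise (P T) (G T i)) (s'' i)
      (fun T => √(Real.log (p T) / T)) (fun T ω => γhat T ω i)))
    (hmom : ∀ T, MomentCond (R T) (P T) (G T) Q D)
    (hV : ∃ ς D₁, ∀ T, AutocovCond (P T) (scoreProcess (R T) (P T) (G T)) ς D₁ D₂)
    (hM : ∀ᶠ T in atTop, 1 ≤ M T)
    (hK : ∀ M : ℝ, 1 ≤ M → ∀ F : Finset ℤ, ∑ k ∈ F, |K ((k : ℝ) / M)| ≤ S * M) :
    TightEvents P (hacEvent P R G βhat γhat K M s Q r D₂) := by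
  obtain ⟨ς, D₁, hV⟩ := hV
  have hcardT : ∀ T : ℕ, (Fintype.card {t // t ∈ Finset.Icc (1 : ℤ) T} : ℝ) ≤ T := by
    intro T
    rw [Fintype.card_coe, Int.card_Icc, add_sub_cancel_right, Int.toNat_natCast]
  have hTpos : ∀ᶠ T : ℕ in atTop, (0 : ℝ) < T := by
    filter_upwards [eventually_ge_atTop 1] with T hT
    exact_mod_cast hT
  have hpT : ∀ᶠ T : ℕ in atTop, (0 : ℝ) < p T * T := by
    filter_upwards [hTpos] with T hT
    have : (0 : ℝ) < p T := by exact_mod_cast (by linarith [hp T] : 0 < p T)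
    positivity
  refine TightEvents.inter (TightEvents.inter (TightEvents.inter (TightEvents.inter
    (TightEvents.inter (TightEvents.inter (TightEvents.inter ?_ ?_) ?_) ?_) ?_) ?_) ?_) ?_
  · exact tight_residual hp hs1 hs' hl hR.approx_small
  · refine TightEvents.iInter fun i => ?_
    exact tight_coef (R := fun T => (R T).nodewise (P T) (G T i)) (βhat := fun T ω => γhat T ω i)
      (hs''0 i) (hs'' i) (hlN i) fun T t ω => sub_self _
  · refine TightEvents.iInter fun i => ?_
    obtain ⟨D', hD'⟩ := (hN i).long_run
    exact tight_empNormSq_sub hD' fun T t =>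
      LinReg.integral_nodeError_sq_eq_nodeVar hr (hR.data T) _ _
  · exact tight_momentSum hS hM hK hR.data hD hmom
  · exact TightEvents.iInter fun i => TightEvents.iInter fun l => tight_autocov hS hM hK hD₂ hV i l
  · exact TightEvents.forall_rpow_le (f := fun T (t : {t // t ∈ Finset.Icc (1 : ℤ) T}) => (R T).u t)
      hD (by positivity) hTpos hcardT (fun T t => (hR.data T).measurable_u _)
      fun T t => (hmom T).u_pow _
  · exact TightEvents.iInter fun i => TightEvents.forall_rpow_le
      (f := fun T (t : {t // t ∈ Finset.Icc (1 : ℤ) T}) => (R T).nodeError (P T) (G T i) t)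
      hD (by positivity) hTpos hcardT (fun T t => (hR.data T).measurable_nodeError _ _)
      fun T t => (hmom T).v_pow _ _
  · refine TightEvents.forall_rpow_le (D := max B 0 ^ r)
      (f := fun T (m : Fin (p T) × {t // t ∈ Finset.Icc (1 : ℤ) T}) ω => (R T).x m.2 ω m.1)
      (by positivity) (by linarith) hpT (fun T => ?_) (fun T m => (hR.data T).measurable_x_apply _ _)
      fun T m => ?_
    · rw [Fintype.card_prod, Fintype.card_fin]
      push_cast
      exact mul_le_mul_of_nonneg_left (hcardT T) (by positivity)
    · exact lintegral_rpow_le_of_eLpNorm_le (by linarith) (le_max_right _ _)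
        ((hR.data T).measurable_x_apply _ _)
        (((hR.data T).moment_x _ _).trans (ENNReal.ofReal_le_ofReal (le_max_left _ _)))

/-- The sup-norm of the fitted error on the maximal event. -/
lemma sq_dotProduct_le_min {κ : Type*} [Fintype κ] {T : ℕ} {x : ℤ → κ → ℝ} {d : κ → ℝ} {r C P s L : ℝ}
    (hr : 0 < r) (hC : 0 < C) (hP : 0 ≤ P) (hs : 0 ≤ s) (hL : 0 ≤ L)
    (hx : ∀ t ∈ Finset.Icc (1 : ℤ) T, ∀ k, |x t k| ^ r ≤ C * P)
    (hd : ∑ k, |d k| ≤ C * (s * L)) (hn : empNormSq T (fun t => x t ⬝ᵥ d) ≤ C ^ 2 * (s * L ^ 2))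
    {t : ℤ} (ht : t ∈ Finset.Icc (1 : ℤ) T) :
    (x t ⬝ᵥ d) ^ 2 ≤ (C ^ 2 + C ^ (2 / r) * C ^ 2) * min (T * (s * L ^ 2)) (P ^ (2 / r) * (s * L) ^ 2) := by
  -- A single square is at most T times the mean square; alternatively, below, Hölder's inequality
  -- with the largest regressor and the ℓ₁ norm of d.
  have h1 : (x t ⬝ᵥ d) ^ 2 ≤ C ^ 2 * (T * (s * L ^ 2)) := by
    refine (sq_le_mul_empNormSq (fun t => x t ⬝ᵥ d) ht).trans ?_
    calc _ ≤ (T : ℝ) * (C ^ 2 * (s * L ^ 2)) := by gcongr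
      _ = _ := by ring
  have h2 : (x t ⬝ᵥ d) ^ 2 ≤ C ^ (2 / r) * C ^ 2 * (P ^ (2 / r) * (s * L) ^ 2) := by
    have hm : ∀ k, |x t k| ≤ √((C * P) ^ (2 / r)) := fun k =>
      Real.le_sqrt_of_sq_le (sq_le_of_rpow_le (abs_nonneg _) hr (hx t ht k))
    have h3 := abs_dotProduct_le (d := d) hm
    have h4 : |x t ⬝ᵥ d| ≤ √((C * P) ^ (2 / r)) * (C * (s * L)) := h3.trans (by gcongr)
    rw [← sq_abs]
    refine (pow_le_pow_left₀ (abs_nonneg _) h4 2).trans (le_of_eq ?_)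
    rw [mul_pow, Real.sq_sqrt (by positivity), Real.mul_rpow hC.le hP]
    ring
  have h5 : 0 ≤ C ^ (2 / r) * C ^ 2 := by positivity
  rcases min_choice ((T : ℝ) * (s * L ^ 2)) (P ^ (2 / r) * (s * L) ^ 2) with h | h <;> rw [h]
  · refine h1.trans (mul_le_mul_of_nonneg_right (by linarith) (by positivity))
  · refine h2.trans (mul_le_mul_of_nonneg_right (by nlinarith) (by positivity))

/-- Consistency of the variance estimator of a nodewise regression. -/
lemma abs_nodeVar_sub_le {κ : Type*} [Fintype κ] {T : ℕ} {v b : ℤ → ℝ} {d γ : κ → ℝ}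
    {σ lam C D₃ c₂ c₃ E s L : ℝ} (hs : 1 ≤ s) (hL : 0 ≤ L) (hA : s * L ≤ 1) (hC : 0 < C)
    (hE : 0 ≤ E) (hc₂ : 0 ≤ c₂) (hc₃ : 0 ≤ c₃)
    (hv : |empNormSq T v - σ| ≤ C * (c₂ * (s * L))) (hσ : σ ≤ D₃) (hD₃ : 0 ≤ D₃)
    (hb : empNormSq T b ≤ C ^ 2 * (s * L ^ 2)) (hlam : |lam| ≤ c₃ * L)
    (hγ : ∑ k, |γ k| ≤ E) (hd : ∑ k, |(d - γ) k| ≤ C * (s * L)) :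
    |empNormSq T (fun t => v t + b t) + lam * ∑ k, |d k| - σ|
      ≤ (C * c₂ + 2 * (√(D₃ + C * c₂) * C) + C ^ 2 + c₃ * (E + C)) * (s * L) := by
  have hs0 : 0 ≤ s := by linarith
  have hsL : 0 ≤ s * L := by positivity
  have hLs : L ≤ s * L := le_mul_of_one_le_left hL hs
  have hX : s * L ^ 2 ≤ (s * L) ^ 2 := by
    rw [mul_pow]; gcongr; nlinarith
  have h1 : √(empNormSq T b) ≤ C * (s * L) := by
    refine Real.sqrt_le_iff.2 ⟨by positivity, hb.trans ?_⟩
    rw [mul_pow C]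
    gcongr
  have h2 : empNormSq T b ≤ C ^ 2 * (s * L) := by
    have h3 : s * L ^ 2 ≤ s * L := hX.trans (by nlinarith)
    exact hb.trans (mul_le_mul_of_nonneg_left h3 (by positivity))
  have h3 : √(empNormSq T v) ≤ √(D₃ + C * c₂) := by
    refine Real.sqrt_le_sqrt ?_
    have h4 := (abs_le.1 hv).2
    have : C * (c₂ * (s * L)) ≤ C * (c₂ * 1) := by gcongr
    linarith
  have h4 := abs_empNormSq_add_sub_le T v b σ
  have h5 : ∑ k, |d k| ≤ E + C := by
    calc ∑ k, |d k| ≤ ∑ k, (|γ k| + |(d - γ) k|) := by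
          refine Finset.sum_le_sum fun k _ => ?_
          have := abs_add_le (γ k) ((d - γ) k)
          rwa [Pi.sub_apply, add_sub_cancel] at this
      _ ≤ E + C * (s * L) := by rw [Finset.sum_add_distrib]; exact add_le_add hγ hd
      _ ≤ E + C := by nlinarith
  have h6 : |lam * (∑ k, |d k|)| ≤ c₃ * (E + C) * (s * L) := by
    have h7 : 0 ≤ ∑ k, |d k| := Finset.sum_nonneg fun _ _ => abs_nonneg _
    rw [abs_mul, abs_of_nonneg h7]
    calc |lam| * ∑ k, |d k| ≤ c₃ * (s * L) * (E + C) := by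
          have : |lam| ≤ c₃ * (s * L) := hlam.trans (by gcongr)
          gcongr
      _ = _ := by ring
  have h7 : √(empNormSq T v) * √(empNormSq T b) ≤ √(D₃ + C * c₂) * (C * (s * L)) := by gcongr
  calc _ ≤ |empNormSq T (fun t => v t + b t) - σ| + |lam * (∑ k, |d k|)| := by
        rw [add_sub_right_comm]; exact abs_add_le _ _
    _ ≤ C * (c₂ * (s * L)) + 2 * (√(D₃ + C * c₂) * (C * (s * L))) + C ^ 2 * (s * L)
        + c₃ * (E + C) * (s * L) := by linarith
    _ = _ := by ring

end Main

/-! ### Error of the estimator on the good event. -/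

section Main

variable {Ω : ℕ → Type*} [∀ T, MeasurableSpace (Ω T)] {P : ∀ T, Measure (Ω T)}
  [∀ T, IsProbabilityMeasure (P T)] {p : ℕ → ℕ} {R : ∀ T, LinReg (Ω T) (Fin (p T))}
  {g : ℕ} {G : ∀ T, Fin g ↪ Fin (p T)}
  {βhat : ∀ T, Ω T → Fin (p T) → ℝ}
  {γhat : ∀ T, Ω T → ∀ i : Fin g, {k : Fin (p T) // k ≠ G T i} → ℝ}
  {K : ℝ → ℝ} {M s : ℕ → ℝ} {Q r D₂ C : ℝ}

/-- The error of the HAC estimator on the event `hacEvent`. -/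
lemma abs_hacResiduals_sub_le {T : ℕ} {ω : Ω T} {lamNode : Fin g → ℝ}
    {κ γ S D₃ E c₂ c₃ c₄ c₅ bias : ℝ}
    (hω : ω ∈ hacEvent P R G βhat γhat K M s Q r D₂ C T)
    (hp : 2 ≤ p T) (hT : 1 ≤ T) (hM : 1 ≤ M T) (hs : 1 ≤ s T) (hC : 0 < C) (hr : 0 < r)
    (hκ : 0 < κ) (hκQ : κ ≤ Q) (hγ : 0 < γ) (hS : 0 ≤ S) (hD₂ : 0 ≤ D₂) (hD₃ : 0 ≤ D₃) (hE : 0 ≤ E)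
    (hc₂ : 0 ≤ c₂) (hc₃ : 0 ≤ c₃) (hc₄ : 0 ≤ c₄) (hc₅ : 0 ≤ c₅)
    (hσ : ∀ i, 2 * γ ≤ (R T).nodeVar (P T) (G T i) ∧ (R T).nodeVar (P T) (G T i) ≤ D₃)
    (hcoef : ∀ i, ∑ k, |(R T).nodeCoef (P T) (G T i) k| ≤ E)
    (hsqrt : (√(T : ℝ))⁻¹ ≤ c₂ * √(Real.log (p T) / T))
    (hlam : ∀ i, |lamNode i| ≤ c₃ * √(Real.log (p T) / T))
    (hκT : (T : ℝ) ^ (1 / κ) * √(Real.log (p T) / T) ≤ c₄)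
    (hmin : min (T * (s T * √(Real.log (p T) / T) ^ 2))
        (((p T : ℝ) * T) ^ (2 / r) * (s T * √(Real.log (p T) / T)) ^ 2)
        * (s T * √(Real.log (p T) / T) ^ 2) ≤ c₅ * (s T * √(Real.log (p T) / T)))
    (hA : s T * √(Real.log (p T) / T) ≤ 1)
    (hsmall : (C * c₂ + 2 * (√(D₃ + C * c₂) * C) + C ^ 2 + c₃ * (E + C)) *
      (s T * √(Real.log (p T) / T)) ≤ γ)
    (hKS : ∑ k ∈ Finset.Ioo (-(T : ℤ)) T, |K ((k : ℝ) / M T)| ≤ S * M T) (i l : Fin g)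
    (hbias : |∑ k ∈ Finset.Ioo (-(T : ℤ)) T, K ((k : ℝ) / M T) * ((1 - |(k : ℝ)| / T) *
        ∫ ω', scoreProcess (R T) (P T) (G T) 0 ω' i * scoreProcess (R T) (P T) (G T) k ω' l ∂(P T))
      - longRunVar (R T) (P T) (G T) i l| ≤ bias) :
    |hacResiduals K (M T) T (R T) (G T) lamNode (βhat T ω) (γhat T ω) ω i l
      - longRunVar (R T) (P T) (G T) i l|
      ≤ (γ⁻¹ ^ 2 * (((C + C ^ 2) * (2 + 12 * C ^ (1 / Q) * c₄
          + 12 * (C ^ 2 + C ^ (2 / r) * C ^ 2) * c₅)) * S + C)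
        + 2 * (C * c₂ + 2 * (√(D₃ + C * c₂) * C) + C ^ 2 + c₃ * (E + C)) * γ⁻¹ ^ 3 * C
        + C * √D₂ * c₂) * (M T * (s T * √(Real.log (p T) / T))) + bias := by
  obtain ⟨⟨⟨⟨⟨⟨⟨ha, hb⟩, hv⟩, hW⟩, hVd⟩, hu⟩, hvm⟩, hx⟩ := hω
  set L := √(Real.log (p T) / T) with hL
  have hL0 : 0 < L := sqrt_log_div_pos hp hT
  have hT0 : (0 : ℝ) < T := by exact_mod_cast hT
  have hT1 : (1 : ℝ) ≤ T := by exact_mod_cast hT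
  have hs0 : 0 < s T := by linarith
  have hQ : 0 < Q := by linarith
  have hM0 : 0 ≤ M T := by linarith
  set A := s T * L with hAd
  have hA0 : 0 < A := by positivity
  have hLA : L ≤ A := le_mul_of_one_le_left hL0.le hs
  set u : ℤ → ℝ := fun t => (R T).u t ω with hud
  set v : Fin g → ℤ → ℝ := fun i t => (R T).nodeError (P T) (G T i) t ω with hvd
  set e : ℤ → ℝ := fun t => (R T).y t ω - (R T).x t ω ⬝ᵥ βhat T ω - (R T).u t ω with he
  set f : Fin g → ℤ → ℝ := fun i t => -((fun k : {k // k ≠ G T i} => (R T).x t ω k.1) ⬝ᵥ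
          (γhat T ω i - (R T).nodeCoef (P T) (G T i))) with hf
  have hres : (fun t => (R T).y t ω - (R T).x t ω ⬝ᵥ βhat T ω) = fun t => u t + e t := by
    ext t; simp only [hud, he]; ring
  have hresv : ∀ i, (fun t => (R T).x t ω (G T i) -
      (fun k : {k // k ≠ G T i} => (R T).x t ω k.1) ⬝ᵥ γhat T ω i) = fun t => v i t + f i t := by
    intro i
    ext t
    simp only [hvd, hf, LinReg.nodeError, LinReg.nodewise, dotProduct_sub]
    ring
  simp only [Set.mem_iInter] at hb hv hVd hvm
  set N : ℝ := C ^ (1 / Q) * (T : ℝ) ^ (1 / κ) with hNd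
  have hN0 : 0 ≤ N := by positivity
  -- Moments of order 2Q with Q ≥ κ bound the largest squared error by a multiple of T^{1/Q} ≤
  -- T^{1/κ}.
  have hpow : ∀ z : ℝ, |z| ^ (2 * Q) ≤ C * T → z ^ 2 ≤ N := by
    intro z hz
    have h1 := sq_le_of_rpow_le (abs_nonneg z) (by positivity : 0 < 2 * Q) hz
    rw [sq_abs, Real.mul_rpow hC.le hT0.le, show 2 / (2 * Q) = 1 / Q by field_simp] at h1
    refine h1.trans (mul_le_mul_of_nonneg_left ?_ (by positivity))
    exact Real.rpow_le_rpow_of_exponent_le hT1 (one_div_le_one_div_of_le hκ hκQ)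
  have huN : ∀ t ∈ Finset.Icc (1 : ℤ) T, u t ^ 2 ≤ N := fun t ht => hpow _ (hu ⟨t, ht⟩)
  have hvN : ∀ i, ∀ t ∈ Finset.Icc (1 : ℤ) T, v i t ^ 2 ≤ N := fun i t ht => hpow _ (hvm i ⟨t, ht⟩)
  set mn := min (T * (s T * L ^ 2)) (((p T : ℝ) * T) ^ (2 / r) * A ^ 2) with hmn
  have hmn0 : 0 ≤ mn := le_min (by positivity) (by positivity)
  set β : ℝ := (C ^ 2 + C ^ (2 / r) * C ^ 2) * mn with hβd
  have hβ0 : 0 ≤ β := by positivity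
  have hfβ : ∀ i, ∀ t ∈ Finset.Icc (1 : ℤ) T, f i t ^ 2 ≤ β := by
    intro i t ht
    simp only [hf, neg_sq]
    exact sq_dotProduct_le_min (x := fun t (k : {k // k ≠ G T i}) => (R T).x t ω k.1) hr hC
      (by positivity) hs0.le hL0.le (fun t ht k => hx ⟨k.1, t, ht⟩) (hb i).2 (hb i).1 ht
  set X : ℝ := (C + C ^ 2) * (s T * L ^ 2) with hX
  have hX0 : 0 ≤ X := by positivity
  have heX : empNormSq T e ≤ X := by
    have ha' : empNormSq T e ≤ C * (s T * L ^ 2) := ha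
    refine ha'.trans (mul_le_mul_of_nonneg_right ?_ (by positivity))
    nlinarith
  have hfC : ∀ i, empNormSq T (f i) ≤ C ^ 2 * (s T * L ^ 2) := by
    intro i
    rw [hf, empNormSq_neg]
    exact (hb i).1
  have hfX : ∀ i, empNormSq T (f i) ≤ X := fun i =>
    (hfC i).trans (mul_le_mul_of_nonneg_right (by linarith) (by positivity))
  set d := (C * c₂ + 2 * (√(D₃ + C * c₂) * C) + C ^ 2 + c₃ * (E + C)) * A with hd
  have hσd : ∀ i, |nodeVarEst T (fun t => (R T).x t ω) (G T i) (lamNode i) (γhat T ω i)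
      - (R T).nodeVar (P T) (G T i)| ≤ d := by
    intro i
    rw [nodeVarEst, hresv]
    refine abs_nodeVar_sub_le hs hL0.le hA hC hE hc₂ hc₃ ?_ (hσ i).2 hD₃ (hfC i) (hlam i) (hcoef i)
      (hb i).2
    refine (hv i).trans (mul_le_mul_of_nonneg_left (hsqrt.trans ?_) hC.le)
    gcongr
  have hσγ : ∀ i, γ ≤ (R T).nodeVar (P T) (G T i) := fun i => by linarith [(hσ i).1]
  have hσγ' : ∀ i, γ ≤ nodeVarEst T (fun t => (R T).x t ω) (G T i) (lamNode i) (γhat T ω i) := by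
    intro i
    have := (abs_le.1 (hσd i)).1
    linarith [(hσ i).1]
  -- The Young parameter is η = A: then X/η is of order L ≤ A, and the moment term contributes
  -- η·O(M). The products N·X and β·X are O(A) by `hκT` and `hmin`.
  set cc := ((2 * A)⁻¹ + 3 * (N + β)) * (4 * X) with hcc
  have hcc0 : 0 ≤ cc := by positivity
  have hccA : cc ≤ ((C + C ^ 2) * (2 + 12 * C ^ (1 / Q) * c₄
      + 12 * (C ^ 2 + C ^ (2 / r) * C ^ 2) * c₅)) * A := by
    have e1 : (2 * A)⁻¹ * (4 * X) = (C + C ^ 2) * 2 * L := by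
      rw [hX, hAd]; field_simp; ring
    have e2 : N * X = (C + C ^ 2) * C ^ (1 / Q) * A * ((T : ℝ) ^ (1 / κ) * L) := by
      rw [hX, hAd, hNd]; ring
    have e3 : β * X = (C + C ^ 2) * (C ^ 2 + C ^ (2 / r) * C ^ 2) * (mn * (s T * L ^ 2)) := by
      rw [hX, hβd]; ring
    have i1 : (C + C ^ 2) * 2 * L ≤ (C + C ^ 2) * 2 * A := by gcongr
    have i2 : (C + C ^ 2) * C ^ (1 / Q) * A * ((T : ℝ) ^ (1 / κ) * L)
        ≤ (C + C ^ 2) * C ^ (1 / Q) * A * c₄ := by gcongr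
    have i3 : (C + C ^ 2) * (C ^ 2 + C ^ (2 / r) * C ^ 2) * (mn * (s T * L ^ 2))
        ≤ (C + C ^ 2) * (C ^ 2 + C ^ (2 / r) * C ^ 2) * (c₅ * A) := by gcongr
    calc cc = (2 * A)⁻¹ * (4 * X) + 12 * (N * X) + 12 * (β * X) := by rw [hcc]; ring
      _ ≤ (C + C ^ 2) * 2 * A + 12 * ((C + C ^ 2) * C ^ (1 / Q) * A * c₄)
          + 12 * ((C + C ^ 2) * (C ^ 2 + C ^ (2 / r) * C ^ 2) * (c₅ * A)) := by
        rw [e1, e2, e3]; linarith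
      _ = _ := by ring
  have step1 := abs_sum_kernel_perturb_le (Finset.Ioo (-(T : ℤ)) T) (fun k : ℤ => K ((k : ℝ) / M T))
    (A := fun k => signedLagMean T (fun t => u t + e t) (fun i t => v i t + f i t) k i l)
    (B := fun k => signedLagMean T u v k i l)
    (Y := fun k => lagMean T k.natAbs (momentSum u v)) hγ (hσγ' i) (hσγ' l) (hσγ i) (hσγ l)
    (hσd i) (hσd l) hcc0 hA0.le
    (fun k => abs_signedLagMean_perturb_le hA0 hN0 hβ0 huN hvN hfβ heX hfX k i l)
    (fun k => abs_signedLagMean_le T u v k i l) hKS hW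
  -- Fluctuation of the infeasible estimator built from the true scores; 1/√T is at most a multiple
  -- of L ≤ A.
  have step2 : |∑ k ∈ Finset.Ioo (-(T : ℤ)) T, K ((k : ℝ) / M T) *
        (((R T).nodeVar (P T) (G T i))⁻¹ * ((R T).nodeVar (P T) (G T l))⁻¹ * signedLagMean T u v k i l)
      - ∑ k ∈ Finset.Ioo (-(T : ℤ)) T, K ((k : ℝ) / M T) * ((1 - |(k : ℝ)| / T) *
        ∫ ω', scoreProcess (R T) (P T) (G T) 0 ω' i * scoreProcess (R T) (P T) (G T) k ω' l ∂(P T))|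
      ≤ C * √D₂ * c₂ * (M T * A) := by
    rw [← Finset.sum_sub_distrib]
    refine (Finset.abs_sum_le_sum_abs _ _).trans ?_
    refine le_trans (Finset.sum_le_sum fun k _ => le_of_eq ?_) ((hVd i l).trans ?_)
    · rw [← mul_sub, abs_mul, ← signedLagMean_scoreProcess]
    · rw [Real.sqrt_div hD₂, div_eq_mul_inv]
      calc C * (M T * (√D₂ * (√(T : ℝ))⁻¹)) ≤ C * (M T * (√D₂ * (c₂ * A))) := by
            have : (√(T : ℝ))⁻¹ ≤ c₂ * A := hsqrt.trans (by gcongr)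
            gcongr
        _ = _ := by ring
  have hresv' : (fun (i : Fin g) t => (R T).x t ω (G T i) -
      (fun k : {k // k ≠ G T i} => (R T).x t ω k.1) ⬝ᵥ γhat T ω i) = fun i t => v i t + f i t :=
    funext hresv
  rw [hacResiduals_apply, hres, hresv']
  calc _ ≤ γ⁻¹ ^ 2 * (cc * (S * M T) + A * (C * M T)) + 2 * d * γ⁻¹ ^ 3 * (C * M T)
        + C * √D₂ * c₂ * (M T * A) + bias := by
        have := abs_le.1 step1
        have := abs_le.1 step2
        have := abs_le.1 hbias
        rw [abs_le]
        constructor <;> linarith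
    _ ≤ γ⁻¹ ^ 2 * (((C + C ^ 2) * (2 + 12 * C ^ (1 / Q) * c₄
          + 12 * (C ^ 2 + C ^ (2 / r) * C ^ 2) * c₅)) * A * (S * M T) + A * (C * M T))
        + 2 * d * γ⁻¹ ^ 3 * (C * M T) + C * √D₂ * c₂ * (M T * A) + bias := by gcongr
    _ = _ := by rw [hd]; ring

end Main

/-! ### Assembly of the rate and the main theorem. -/

section Main

variable {Ω : ℕ → Type*} [∀ T, MeasurableSpace (Ω T)] {P : ∀ T, Measure (Ω T)}
  [∀ T, IsProbabilityMeasure (P T)] {p : ℕ → ℕ} {R : ∀ T, LinReg (Ω T) (Fin (p T))}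
  {α : ℝ} {𝒢 : ∀ T, Finpartition (Finset.univ : Finset (Fin (p T)))}
  {g : ℕ} {G : ∀ T, Fin g ↪ Fin (p T)} {lam : ℕ → ℝ} {lamNode : Fin g → ℕ → ℝ}
  {βhat : ∀ T, Ω T → Fin (p T) → ℝ}
  {γhat : ∀ T, Ω T → ∀ i : Fin g, {k : Fin (p T) // k ≠ G T i} → ℝ}
  {K : ℝ → ℝ} {ς : ℝ} {M : ℕ → ℝ} {Q q r a b c B C₀ : ℝ}

/-- The rate of convergence of the HAC estimator, given the rates of the LASSO estimators. -/
theorem isBigOP_hacResiduals_sub (hg : 0 < g) (hr : 4 < r) (hq : 2 * r / (r - 2) < q)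
    (ha : (prodExponent q r - 1) / (prodExponent q r - 2) < a) (hb : (r - 2) / (r - 4) < b)
    (hC₀ : 0 ≤ C₀) (hp : ∀ T, 2 ≤ p T)
    (hR : RegressionCond P R α 𝒢 p lam q r a b c B C₀)
    (hN : ∀ i : Fin g, RegressionCond P (fun T => (R T).nodewise (P T) (G T i)) 1
        (fun _ => ⊥) p (lamNode i) q r a b c B C₀)
    (hΘ : ∃ D : ℝ, ∀ T i, ∑ k, |(R T).precision (P T) (G T i) k| ≤ D)
    (hs2 : Tendsto (fun T : ℕ => sparsity (R T) (P T) α (𝒢 T) (G T) ^ 2 *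
        Real.log (p T) ^ 2 / T) atTop (𝓝 0))
    (hp6 : Tendsto (fun T : ℕ => (p T : ℝ) /
        √((T : ℝ) ^ (kappa q r a - 2) * Real.log (p T) ^ kappa q r a)) atTop (𝓝 0))
    (hQ : kappa q r a ≤ Q) (hmom : ∃ D : ℝ, ∀ T, MomentCond (R T) (P T) (G T) Q D)
    (hς : 0 < ς) (hK : KernelCond K ς)
    (hV : ∃ D₁ D₂ : ℝ, 0 < D₁ ∧ 0 < D₂ ∧ ∀ T,
        AutocovCond (P T) (scoreProcess (R T) (P T) (G T)) ς D₁ D₂)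
    (hM : Tendsto M atTop atTop)
    (hl : TightEvents P (lassoEvent R (fun T => max (effSparsity α (𝒢 T) (R T).β) 1)
      (fun T => √(Real.log (p T) / T)) βhat))
    (hlN : ∀ i, TightEvents P (lassoEvent (fun T => (R T).nodewise (P T) (G T i))
      (fun T => max (effSparsity 1 ⊥ ((R T).nodeCoef (P T) (G T i))) 1)
      (fun T => √(Real.log (p T) / T)) (fun T ω => γhat T ω i))) :
    IsBigOP P
        (fun T ω => ‖hacResiduals K (M T) T (R T) (G T) (fun i => lamNode i T)
          (βhat T ω) (γhat T ω) ω - longRunVar (R T) (P T) (G T)‖)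
        (fun T => hacRate (kappa q r a) ς
          (sparsity (R T) (P T) α (𝒢 T) (G T)) (M T) (p T) T) := by
  have hκ := two_lt_kappa hr hq ha
  have hμ := two_lt_muExponent hr hb
  have hμr := muExponent_lt hr hb
  set κ := kappa q r a
  set s : ℕ → ℝ := fun T => sparsity (R T) (P T) α (𝒢 T) (G T) with hs
  have hsb := fun T => sparsity_bounds (G := G) hr hR T
  have hs' : ∀ T, max (effSparsity α (𝒢 T) (R T).β) 1 ≤ s T := fun T => ((hsb T).2 hg).1
  have hs1 : ∀ T, 1 ≤ s T := fun T => (le_max_right _ _).trans (hs' T)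
  obtain ⟨D, hmom⟩ := hmom
  have hmom' : ∀ T, MomentCond (R T) (P T) (G T) Q (max D 0) := fun T => (hmom T).mono (le_max_left _ _)
  have hD0 : 0 ≤ max D 0 := le_max_right _ _
  obtain ⟨D₁, D₂, hD₁, hD₂, hV⟩ := hV
  obtain ⟨DΘ, hΘ⟩ := hΘ
  obtain ⟨S, hS, hKS⟩ := hK.exists_sum_abs_le
  obtain ⟨Ab, hAb, hbias⟩ := hK.exists_bias_le hς
  obtain ⟨γ, hγ, hcov⟩ := hR.covariance
  have hM1 : ∀ᶠ T in atTop, 1 ≤ M T := hM.eventually_ge_atTop 1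
  have htight := tight_hacEvent (G := G) (γhat := γhat) (K := K) hp hr (by linarith : 0 < Q) hD0 hD₂
    hS.le hR hN hs1 hs' (fun i T => zero_le_one.trans (le_max_right _ _)) (fun i T => (hsb T).1 i)
    hl hlN hmom' ⟨ς, D₁, hV⟩ hM1 hKS
  have hdim := eventually_sparsity_rpow_le hr hR hN hb hg
  have h2μ : (0 : ℝ) < 2 ^ muExponent r b := by positivity
  obtain ⟨c₄, hc₄, hκT⟩ := exists_rpow_mul_sqrt_log_div_le hp hs1 hμ h2μ hdim hκ
  obtain ⟨c₅, hc₅, hmin⟩ := exists_min_mul_le hp hs1 hr hμ hμr h2μ hdim hs2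
  have hlam : ∀ i, ∃ c : ℝ, 0 ≤ c ∧ ∀ᶠ T in atTop, |lamNode i T| ≤ c * √(Real.log (p T) / T) :=
    fun i => exists_abs_tuning_le hp (by linarith) hC₀ hp6 (hN i).tuning
  choose c₃ hc₃0 hc₃ using hlam
  have hc₃' : ∀ᶠ T in atTop, ∀ i, |lamNode i T| ≤ (∑ i, c₃ i) * √(Real.log (p T) / T) := by
    refine eventually_all.2 fun i => ?_
    filter_upwards [hc₃ i] with T hT
    refine hT.trans (mul_le_mul_of_nonneg_right ?_ (Real.sqrt_nonneg _))
    exact Finset.single_le_sum (fun i _ => hc₃0 i) (Finset.mem_univ i)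
  have hc₃s : 0 ≤ ∑ i, c₃ i := Finset.sum_nonneg fun i _ => hc₃0 i
  have hA := tendsto_mul_sqrt_log_div hp hs2
  set D₃ := 1 + max D 0 with hD₃
  -- The eigenvalue bound is halved so that the estimated variances, which are eventually within γ/2
  -- of the true ones, also stay above γ/2.
  have hσ : ∀ T i, 2 * (γ / 2) ≤ (R T).nodeVar (P T) (G T i) ∧ (R T).nodeVar (P T) (G T i) ≤ D₃ := by
    intro T i
    refine ⟨?_, integral_sq_le_one_add (by linarith) hD0 ((hmom' T).v_pow 0 i)⟩
    rw [mul_div_cancel₀ _ (by norm_num : (2 : ℝ) ≠ 0)]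
    exact LinReg.le_nodeVar hr (hR.data T) hγ (hcov T) _
  have hcoef : ∀ T i, ∑ k, |(R T).nodeCoef (P T) (G T i) k| ≤ D₃ * max DΘ 0 := by
    intro T i
    refine (LinReg.sum_abs_nodeCoef_le hr (hR.data T) hγ (hcov T) (G T i)).trans ?_
    refine mul_le_mul (hσ T i).2 ((hΘ T i).trans (le_max_left _ _))
      (Finset.sum_nonneg fun _ _ => abs_nonneg _) (by positivity)
  refine htight.isBigOP fun C hC => ?_
  set d := C * (√(Real.log 2))⁻¹ + 2 * (√(D₃ + C * (√(Real.log 2))⁻¹) * C) + C ^ 2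
    + (∑ i, c₃ i) * (D₃ * max DΘ 0 + C) with hd
  set C₁ := (γ / 2)⁻¹ ^ 2 * (((C + C ^ 2) * (2 + 12 * C ^ (1 / Q) * c₄
          + 12 * (C ^ 2 + C ^ (2 / r) * C ^ 2) * c₅)) * S + C)
        + 2 * d * (γ / 2)⁻¹ ^ 3 * C + C * √D₂ * (√(Real.log 2))⁻¹ with hC₁
  have hd0 : 0 < d := by positivity
  have hC₁0 : 0 < C₁ := by positivity
  refine ⟨g * (g * (C₁ + Ab * D₁)), by positivity, ?_⟩
  -- The constant d depends on C, which is fixed before T grows, so A → 0 eventually makes the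
  -- variance estimators accurate enough.
  have hsmall : ∀ᶠ T in atTop, s T * √(Real.log (p T) / T) ≤ min 1 (γ / 2 / d) :=
    hA.eventually (eventually_le_nhds (by positivity))
  filter_upwards [hM1, hκT, hmin, hc₃', hsmall, eventually_ge_atTop 1]
    with T hM1 hκT hmin hlam hsmall hT1 ω hω
  have hM0 : 0 < M T := by linarith
  set A := s T * √(Real.log (p T) / T) with hAd
  have hA0 : 0 ≤ A := mul_nonneg (zero_le_one.trans (hs1 T)) (Real.sqrt_nonneg _)
  have hrate := le_hacRate (κ := κ) (ς := ς) (p := p T) (T := T) (zero_le_one.trans (hs1 T)) hM0.le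
  set rate := hacRate κ ς (s T) (M T) (p T) T
  have hMς : 0 < M T ^ (-ς) := by positivity
  have hTς : 0 ≤ (T : ℝ) ^ (-(min ς 1)) := by positivity
  have hMA : 0 ≤ M T * A := by positivity
  have hsum := summable_autocov hr hq hR hς hD₁ hV T
  have hentry : ∀ i l, |(hacResiduals K (M T) T (R T) (G T) (fun i => lamNode i T)
      (βhat T ω) (γhat T ω) ω - longRunVar (R T) (P T) (G T)) i l| ≤ (C₁ + Ab * D₁) * rate := by
    intro i l
    have hΓ := fun k => autocov_apply (G := G T) hr hq (hR.data T) hγ (hcov T) k i l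
    obtain ⟨hc1, hc2, hc3⟩ := (hV T).summable_apply hς hD₁.le i l hΓ
    have hb' := hbias (M T) T (fun k => autocov (R T) (P T) (G T) k i l) D₁ hM0 hT1 hc1 hc2 hc3
    rw [← tsum_matrix_apply hsum] at hb'
    simp only [hΓ] at hb'
    have h := abs_hacResiduals_sub_le (lamNode := fun i => lamNode i T) hω (hp T) hT1 hM1 (hs1 T) hC
      (by linarith : 0 < r) (by linarith : 0 < κ) hQ (half_pos hγ) hS.le hD₂.le
      (by positivity : 0 ≤ D₃) (by positivity : 0 ≤ D₃ * max DΘ 0)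
      (by positivity : 0 ≤ (√(Real.log 2))⁻¹) hc₃s hc₄.le hc₅.le (hσ T) (hcoef T)
      (inv_sqrt_le_sqrt_log_div (hp T)) hlam hκT hmin (hsmall.trans (min_le_left _ _))
      (by
        have := hsmall.trans (min_le_right _ _)
        rw [le_div_iff₀ hd0] at this
        rw [← hd, mul_comm]
        exact this) (hKS _ hM1 _) i l hb'
    rw [Matrix.sub_apply]
    refine h.trans ?_
    calc C₁ * (M T * A) + Ab * (M T ^ (-ς) + (T : ℝ) ^ (-(min ς 1))) * D₁
        ≤ (C₁ + Ab * D₁) * (M T * A + M T ^ (-ς) + (T : ℝ) ^ (-(min ς 1))) := by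
          have h1 : 0 ≤ C₁ * (M T ^ (-ς) + (T : ℝ) ^ (-(min ς 1))) := by positivity
          have h2 : 0 ≤ Ab * D₁ * (M T * A) := by positivity
          linarith
      _ ≤ _ := by gcongr
  rw [abs_of_nonneg (norm_nonneg _)]
  refine (frobenius_norm_le_sum_abs _).trans ?_
  calc _ ≤ ∑ _i : Fin g, ∑ _l : Fin g, (C₁ + Ab * D₁) * rate :=
        Finset.sum_le_sum fun i _ => Finset.sum_le_sum fun l _ => hentry i l
    _ = _ := by
      simp only [Finset.sum_const, Finset.card_univ, Fintype.card_fin, nsmul_eq_mul]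
      ring

end Main

end HAC

theorem theorem2
    (q r a b c B : ℝ) (gmax : ℕ)
    (hr : 4 < r) (hq : 2 * r / (r - 2) < q)
    (ha : (HAC.prodExponent q r - 1) / (HAC.prodExponent q r - 2) < a)
    (hb : (r - 2) / (r - 4) < b) (hc : 0 < c) :
    -- the lower bound on the constant in the tuning parameters
    ∃ C₀ : ℝ, 0 < C₀ ∧
    -- a sequence of regressions, indexed by the sample size
    ∀ (Ω : ℕ → Type*) [∀ T, MeasurableSpace (Ω T)] (P : ∀ T, Measure (Ω T))
      [∀ T, IsProbabilityMeasure (P T)] (p : ℕ → ℕ) (R : ∀ T, HAC.LinReg (Ω T) (Fin (p T)))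
      (α : ℝ) (𝒢 : ∀ T, Finpartition (Finset.univ : Finset (Fin (p T))))
      (g : ℕ) (G : ∀ T, Fin g ↪ Fin (p T))
      -- tuning parameters and estimators
      (lam : ℕ → ℝ) (lamNode : Fin g → ℕ → ℝ)
      (βhat : ∀ T, Ω T → Fin (p T) → ℝ)
      (γhat : ∀ T, Ω T → ∀ i : Fin g, {k : Fin (p T) // k ≠ G T i} → ℝ)
      -- kernel and bandwidth
      (K : ℝ → ℝ) (ς : ℝ) (M : ℕ → ℝ) (Q : ℝ),
      (∀ T, 2 ≤ p T) → 0 ≤ α → α ≤ 1 → (∀ T, ∀ A ∈ (𝒢 T).parts, A.card ≤ gmax) →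
      -- the sg-LASSO and the nodewise LASSO
      (∀ᶠ T in atTop, ∀ᵐ ω ∂(P T), HAC.IsSGLasso T (fun t => (R T).y t ω)
        (fun t => (R T).x t ω) α (𝒢 T) (lam T) (βhat T ω)) →
      (∀ i : Fin g, ∀ᶠ T in atTop, ∀ᵐ ω ∂(P T),
        HAC.IsSGLasso T (fun t => ((R T).nodewise (P T) (G T i)).y t ω)
          (fun t => ((R T).nodewise (P T) (G T i)).x t ω) 1 ⊥ (lamNode i T) (γhat T ω i)) →
      -- conditions on the sg-LASSO regression and on each nodewise LASSO regression
      HAC.RegressionCond P R α 𝒢 p lam q r a b c B C₀ →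
      (∀ i : Fin g, HAC.RegressionCond P (fun T => (R T).nodewise (P T) (G T i)) 1
        (fun _ => ⊥) p (lamNode i) q r a b c B C₀) →
      -- bounded rows of the precision matrix, and the conditions on the dimension and the sparsity
      (∃ D : ℝ, ∀ T i, ∑ k, |(R T).precision (P T) (G T i) k| ≤ D) →
      Tendsto (fun T : ℕ => HAC.sparsity (R T) (P T) α (𝒢 T) (G T) ^ 2 *
        Real.log (p T) ^ 2 / T) atTop (𝓝 0) →
      Tendsto (fun T : ℕ => (p T : ℝ) /
        √((T : ℝ) ^ (HAC.kappa q r a - 2) * Real.log (p T) ^ HAC.kappa q r a)) atTop (𝓝 0) →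
      Tendsto (fun T : ℕ => HAC.sparsity (R T) (P T) α (𝒢 T) (G T) ^ HAC.kappa q r a *
        (p T : ℝ) * (T : ℝ) ^ (1 - 4 * HAC.kappa q r a / 5)) atTop (𝓝 0) →
      -- moments of the errors
      HAC.kappa q r a ≤ Q →
      (∃ D : ℝ, ∀ T, HAC.MomentCond (R T) (P T) (G T) Q D) →
      -- kernel, autocovariances and bandwidth
      0 < ς → HAC.KernelCond K ς →
      (∃ D₁ D₂ : ℝ, 0 < D₁ ∧ 0 < D₂ ∧ ∀ T,
        HAC.AutocovCond (P T) (HAC.scoreProcess (R T) (P T) (G T)) ς D₁ D₂) →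
      Tendsto M atTop atTop →
      -- conclusion
      (∀ T, Summable (HAC.autocov (R T) (P T) (G T))) ∧
      HAC.IsBigOP P
        (fun T ω => ‖HAC.hacResiduals K (M T) T (R T) (G T) (fun i => lamNode i T)
          (βhat T ω) (γhat T ω) ω - HAC.longRunVar (R T) (P T) (G T)‖)
        (fun T => HAC.hacRate (HAC.kappa q r a) ς
          (HAC.sparsity (R T) (P T) α (𝒢 T) (G T)) (M T) (p T) T) := by
  -- The maximum with 1 also covers the singleton groups of the nodewise regressions, so that a
  -- single C₀ serves all of them.
  obtain ⟨C₀, hC₀, hlasso⟩ := HAC.exists_lasso_rate (B := B) (le_max_right gmax 1) hr hq ha hb hc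
  refine ⟨C₀, hC₀, ?_⟩
  intro Ω _ P _ p R α 𝒢 g G lam lamNode βhat γhat K ς M Q hp hα0 hα1 h𝒢 hβ hγ hR hN hΘ hs2 hp6 _ hQ
    hmom hς hK hV hM
  obtain ⟨D₁, D₂, hD₁, hD₂, hV'⟩ := id hV
  refine ⟨HAC.summable_autocov hr hq hR hς hD₁ hV', ?_⟩
  -- For empty G the matrices are 0 × 0 and the error vanishes. This case is separate because s ≥ 1
  -- comes from the diagonal entry of a row of Θ.
  rcases Nat.eq_zero_or_pos g with rfl | hg
  · intro ε hε
    refine ⟨1, one_pos, ?_⟩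
    filter_upwards [hM.eventually_ge_atTop 0] with T hT
    have hs0 : 0 ≤ HAC.sparsity (R T) (P T) α (𝒢 T) (G T) := le_max_of_le_left (sq_nonneg _)
    have h1 := HAC.le_hacRate (κ := HAC.kappa q r a) (ς := ς) (p := p T) (T := T) hs0 hT
    have h2 : 0 ≤ HAC.hacRate (HAC.kappa q r a) ς (HAC.sparsity (R T) (P T) α (𝒢 T) (G T)) (M T)
        (p T) T := le_trans (by positivity) h1
    have h3 : {ω | 1 * HAC.hacRate (HAC.kappa q r a) ς (HAC.sparsity (R T) (P T) α (𝒢 T) (G T))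
        (M T) (p T) T < |‖HAC.hacResiduals K (M T) T (R T) (G T) (fun i => lamNode i T)
          (βhat T ω) (γhat T ω) ω - HAC.longRunVar (R T) (P T) (G T)‖|} = ∅ := by
      refine Set.eq_empty_of_forall_notMem fun ω hω => ?_
      have h4 : HAC.hacResiduals K (M T) T (R T) (G T) (fun i => lamNode i T)
          (βhat T ω) (γhat T ω) ω - HAC.longRunVar (R T) (P T) (G T) = 0 := Subsingleton.elim _ _
      have h5 : 1 * HAC.hacRate (HAC.kappa q r a) ς (HAC.sparsity (R T) (P T) α (𝒢 T) (G T))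
        (M T) (p T) T < |‖HAC.hacResiduals K (M T) T (R T) (G T) (fun i => lamNode i T)
          (βhat T ω) (γhat T ω) ω - HAC.longRunVar (R T) (P T) (G T)‖| := hω
      rw [h4, norm_zero, abs_zero] at h5
      linarith
    rw [h3, measure_empty]
    exact bot_le
  have hscale : ∀ m : ℕ → ℝ, (∀ T, 0 ≤ m T) →
      (∀ T, m T ≤ HAC.sparsity (R T) (P T) α (𝒢 T) (G T)) →
      Tendsto (fun T : ℕ => m T ^ 2 * Real.log (p T) ^ 2 / T) atTop (𝓝 0) := fun m hm0 hm =>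
    squeeze_zero (fun T => by positivity) (fun T => by
      have := hm0 T
      have := hm T
      gcongr) hs2
  have hsb := fun T => HAC.sparsity_bounds (G := G) hr hR T
  refine HAC.isBigOP_hacResiduals_sub hg hr hq ha hb hC₀.le hp hR hN hΘ hs2 hp6 hQ hmom hς hK hV hM
    ?_ fun i => ?_
  · exact hlasso Ω P _ p R α 𝒢 lam βhat hp (fun T => (Fintype.card_fin _).le) hα0 hα1
      (fun T A hA => (h𝒢 T A hA).trans (le_max_left _ _)) hβ hR
      (hscale _ (fun T => by positivity) fun T => ((hsb T).2 hg).1) hp6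
  · refine hlasso Ω P _ p (fun T => (R T).nodewise (P T) (G T i)) 1 (fun _ => ⊥) (lamNode i)
      (fun T ω => γhat T ω i) hp (fun T => ?_) zero_le_one le_rfl (fun T A hA => ?_) (hγ i) (hN i)
      (hscale _ (fun T => by positivity) fun T => (hsb T).1 i) hp6
    · exact (Fintype.card_subtype_le _).trans (Fintype.card_fin _).le
    · rw [Finpartition.mem_bot_iff] at hA
      obtain ⟨k, -, rfl⟩ := hA
      rw [Finset.card_singleton]
      exact le_max_right _ _
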